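/- Let $K$ be a field of characteristic zero. "Vector space" means $\mathbb Z/2$-graded vector space, "dg" means differential $\mathbb Z/2$-graded, $\Pi$ is parity reversion, operads are non-unital and may have operations of arity $0$, and maps between topological objects are continuous. The group $S_n$ acts on $\mathcal O(n)$ on the left; in $\operatorname{End}(W)$ this is $(\sigma f)(w_1,\dots,w_n)=\pm f(w_{\sigma(1)},\dots,w_{\sigma(n)})$ with the Koszul sign. For $f\in\mathcal O(n)$ and $y\in\mathcal O(0)$ write $f\circ y^{\otimes i}=(\cdots((f\circ_i y)\circ_{i-1}y)\cdots)\circ_1y$. $\mathrm{Sh}(p,q)\subset S_{p+q}$ is the set of permutations increasing on $\{1,\dots,p\}$ and on $\{p+1,\dots,p+q\}$. **The operads.** $L_\infty$ is the dg operad freely generated by odd $S_n$-invariant operations $m_n\in L_\infty(n)$, $n\ge1$, with $$d(m_n)=\sum_{k=1}^n\ \sum_{\sigma\in\mathrm{Sh}(n-k+1,k-1)}\sigma\,(m_k\circ_1m_{n-k+1}),$$ and $A_\infty$ is the (symmetric) dg operad freely generated by odd operations $m_n$, $n\ge1$, without symmetry, with $d(m_n)=\sum_{k=1}^n\sum_{i=1}^km_k\circ_im_{n-k+1}$.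 The topological dg operads $\mathscr L_\infty=L_\infty[[x]]=\varprojlim_r L_\infty[x]/(x)^r$ and $\mathscr A_\infty=A_\infty[[x]]$ are obtained by freely adjoining an even operation $x$ of arity $0$, completing at the ideal $(x)$, and setting $$d(x)=\sum_{n\ge1}\tfrac1{n!}\,m_n\circ x^{\otimes n}\quad\text{in }\mathscr L_\infty,\qquad d(x)=\sum_{n\ge1}m_n\circ x^{\otimes n}\quad\text{in }\mathscr A_\infty.$$ These operads are (anti)cyclic, the $m_n$ being invariant under $S_{n+1}$ (for $L_\infty$), respectively under cyclic permutations of the $n+1$ legs (for $A_\infty$). $\overline{\mathscr L}_\infty$ and $\overline{\mathscr A}_\infty$ denote their modular closures: the dg modular operads, completed at $(x)$, with the same generators (in genus $0$), relations and differential, in the version of modular operads in which reversing the direction of an edge gives a factor $-1$; no stability condition is imposed. **Algebras, MC elements, twisting.** A formal cdga $A$ is obtained by adjoining a unit to an inverse limit $A_+$ of a directed system of finite-dimensional nilpotent non-unital cdgas. For a dg vector space $V$, an $A$-linear $L_\infty$ (or $A_\infty$) structure $m$ on $V$ is a map of dg operads from $L_\infty$ (or $A_\infty$) to $A_+\otimes\operatorname{End}(\Pi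 V)$; its structure maps are the images $m_n$ of the generators. $\mathrm{MC}(V,A)$ is the set of even $\xi\in A_+\otimes\Pi V$ with $$d\xi=\sum_{n\ge1}\tfrac1{n!}m_n(\xi^{\otimes n})\quad(L_\infty),\qquad d\xi=\sum_{n\ge1}m_n(\xi^{\otimes n})\quad(A_\infty).$$ Regarding $m$ as a vector field (a derivation of the completed symmetric, resp. tensor, algebra of $(\Pi V)^*$ with coefficients in $A$) and $\xi$, $d\xi$ as constant vector fields, put $m^\xi=e^{\xi}me^{-\xi}-d\xi$, where $e^{\xi}me^{-\xi}=\sum_j\frac1{j!}(\operatorname{ad}\xi)^jm$. A continuous dg operad map $f$ from $\mathscr L_\infty$ (or $\mathscr A_\infty$) to $A_+\otimes\operatorname{End}(\Pi V)$ is said to determine the pair $(m,\xi)$ if it sends the generators $m_n$ to the structure maps $m_n$ and $x$ to $\xi$. If $V$ is finite-dimensional with an even symmetric nondegenerate scalar product compatible with the differential, giving an even symplectic form $\omega$ on $\Pi V$, the structure $m$ is cyclic if the forms $\omega(m_n(w_1,\dots,w_n),w_{n+1})$ are invariant under all (for $L_\infty$), resp. cyclic (for $A_\infty$), permutations of the $n+1$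 arguments; maps from $\overline{\mathscr L}_\infty$ or $\overline{\mathscr A}_\infty$ to the modular operad $A_+\otimes\operatorname{End}(\Pi V)$ determine pairs $(m,\xi)$ in the same way, multilinear maps $f$ being identified with forms $\omega(f(w_1,\dots,w_n),w_{n+1})$. **Theorem 4.5.** 1. There is a continuous automorphism $\mathrm{tw}$ of the dg operad $\mathscr L_\infty$ with $$\mathrm{tw}(x)=-x,\qquad \mathrm{tw}(m_n)=\sum_{i=0}^\infty\tfrac1{i!}\,m_{n+i}\circ x^{\otimes i}\quad(n\ge1),$$ such that for every formal cdga $A$, every dg vector space $V$ with an $A$-linear $L_\infty$ structure $m$ and every $\xi\in\mathrm{MC}(V,A)$ the following holds: $m^\xi$ is an $A$-linear $L_\infty$ structure on $V$, $-\xi$ is an MC element for it, there is a unique $\mathscr L_\infty$-algebra structure $f\colon\mathscr L_\infty\to A_+\otimes\operatorname{End}(\Pi V)$ determining $(m,\xi)$, and $f\circ\mathrm{tw}$ determines the pair $(m^\xi,-\xi)$. 2. There is a continuous automorphism $\mathrm{tw}$ of the dg modular operad $\overline{\mathscr L}_\infty$ given by the same formulas, such that for every formal cdga $A$, every cyclic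 $A$-linear $L_\infty$ structure $m$ on a finite-dimensional $V$ as above and every $\xi\in\mathrm{MC}(V,A)$: $m^\xi$ is again a cyclic $A$-linear $L_\infty$ structure, $-\xi$ is an MC element for it, there is a unique $F\colon\overline{\mathscr L}_\infty\to A_+\otimes\operatorname{End}(\Pi V)$ determining $(m,\xi)$, and $F\circ\mathrm{tw}$ determines $(m^\xi,-\xi)$. 3. There is a continuous automorphism $\mathrm{tw}$ of the dg operad $\mathscr A_\infty$ with $$\mathrm{tw}(x)=-x,\qquad \mathrm{tw}(m_n)=\sum_{i=0}^\infty\ \sum_{\sigma\in\mathrm{Sh}(i,n)}(\sigma^{-1}m_{i+n})\circ x^{\otimes i}\quad(n\ge1)$$ (the sum over all ways of inserting $i$ copies of $x$ into $m_{n+i}$, the remaining $n$ inputs staying in order), with the property in (1) for $A$-linear $A_\infty$ structures and $\mathscr A_\infty$ in place of $A$-linear $L_\infty$ structures and $\mathscr L_\infty$. 4. There is a continuous automorphism $\mathrm{tw}$ of the dg modular operad $\overline{\mathscr A}_\infty$ given by the formulas in (3), with the property in (2) for cyclic $A$-linear $A_\infty$ structures and $\overline{\mathscr A}_\infty$. 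-/

import Mathlib

/-!
# The operads governing Maurer-Cartan elements and their twisting

Conventions.  The ground field `K` has characteristic zero.  A super (i.e. `ℤ/2`-graded) vector
space is a vector space with an involution `par`: its even part is the `+1`-eigenspace and its odd
part the `-1`-eigenspace of `par`, so that `par v = (-1)^|v| v` for homogeneous `v`.
-/

universe u v w

noncomputable section

namespace MCTwist

/-! ## Dg vector spaces -/

/-- A dg (differential `ℤ/2`-graded) vector space: `par` is the parity involution and `d` an odd
operator of square zero. -/
class DGSpace (K : Type u) (V : Type v) [Field K] [AddCommGroup V] [Module K V] where
  par : V →ₗ[K] V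
  d : V →ₗ[K] V
  par_par : ∀ a, par (par a) = a
  d_d : ∀ a, d (d a) = 0
  d_par : ∀ a, d (par a) = - par (d a)

/-- The parity reversion `Π V`: same vector space and differential, opposite parity. -/
def PiRev (V : Type v) : Type v := V

instance (V : Type v) [AddCommGroup V] : AddCommGroup (PiRev V) := inferInstanceAs (AddCommGroup V)

instance (K : Type u) (V : Type v) [Field K] [AddCommGroup V] [Module K V] :
    Module K (PiRev V) := inferInstanceAs (Module K V)

instance (K : Type u) (V : Type v) [Field K] [AddCommGroup V] [Module K V]
    [h : FiniteDimensional K V] : FiniteDimensional K (PiRev V) := h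

instance (K : Type u) (V : Type v) [Field K] [AddCommGroup V] [Module K V] [DGSpace K V] :
    DGSpace K (PiRev V) where
  par := - (DGSpace.par : V →ₗ[K] V)
  d := (DGSpace.d : V →ₗ[K] V)
  par_par a := by
    have h := DGSpace.par_par (K := K) (V := V) a
    change -(DGSpace.par (K := K) (V := V) (-(DGSpace.par (K := K) (V := V) a))) = a
    rw [map_neg, neg_neg, h]
  d_d a := DGSpace.d_d (K := K) (V := V) a
  d_par a := by
    have h := DGSpace.d_par (K := K) (V := V) a
    change DGSpace.d (K := K) (V := V) (-(DGSpace.par (K := K) (V := V) a)) =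
      - (-(DGSpace.par (K := K) (V := V) (DGSpace.d (K := K) (V := V) a)))
    rw [map_neg, h]

/-- The projection of a super vector space onto its part of parity `q`
(`q = false` even, `q = true` odd), for a given parity involution `ε`. -/
def proj {K : Type u} {V : Type v} [Field K] [AddCommGroup V] [Module K V]
    (ε : V →ₗ[K] V) (q : Bool) : V →ₗ[K] V :=
  (2 : K)⁻¹ • (LinearMap.id + (if q then (-1 : K) else 1) • ε)

/-! ## Dg algebras over a coloured signature

Operads and modular operads are both given by a family of (topological) dg vector spaces with some
unary linear operations and some binary bilinear ones, all of them even, subject to axioms.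
`DGAlg` is the common type of such data; the axioms are listed in `OpLaw` and `ModLaw`. -/

/-- A coloured signature: colours, unary and binary operation symbols. -/
structure Sig where
  S : Type
  U : S → S → Type
  B : S → S → S → Type

/-- Topological super vector spaces `obj s` with an odd operator `d` and operations. -/
structure DGAlg (K : Type u) [Field K] (sg : Sig) where
  obj : sg.S → Type v
  [acg : ∀ s, AddCommGroup (obj s)]
  [mod : ∀ s, Module K (obj s)]
  [top : ∀ s, TopologicalSpace (obj s)]
  par : ∀ s, obj s →ₗ[K] obj s
  d : ∀ s, obj s →ₗ[K] obj s
  un : ∀ {s t}, sg.U s t → obj s →ₗ[K] obj t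
  bin : ∀ {r s t}, sg.B r s t → obj r →ₗ[K] obj s →ₗ[K] obj t

attribute [instance] DGAlg.acg DGAlg.mod DGAlg.top

section Generic

variable {K : Type u} [Field K] {sg : Sig}

/-- A morphism: continuous, linear, compatible with parity, differential and all operations. -/
structure Hom (P : DGAlg.{u, v} K sg) (Q : DGAlg.{u, w} K sg) where
  map : ∀ s, P.obj s →ₗ[K] Q.obj s
  cont : ∀ s, Continuous (map s)
  map_par : ∀ s a, map s (P.par s a) = Q.par s (map s a)
  map_d : ∀ s a, map s (P.d s a) = Q.d s (map s a)
  map_un : ∀ {s t} (o : sg.U s t) a, map t (P.un o a) = Q.un o (map s a)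
  map_bin : ∀ {r s t} (o : sg.B r s t) a b, map t (P.bin o a b) = Q.bin o (map r a) (map s b)

/-- Composition, first `f` and then `g`. -/
def Hom.trans {P : DGAlg.{u, v} K sg} {Q : DGAlg.{u, w} K sg} (f : Hom P P) (g : Hom P Q) :
    Hom P Q where
  map s := g.map s ∘ₗ f.map s
  cont s := (g.cont s).comp (f.cont s)
  map_par s a := by simp [f.map_par, g.map_par]
  map_d s a := by simp [f.map_d, g.map_d]
  map_un o a := by simp [f.map_un, g.map_un]
  map_bin o a b := by simp [f.map_bin, g.map_bin]

/-- `f` is an automorphism: it has an inverse which is again a (continuous) morphism. -/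
def Hom.IsAut {P : DGAlg.{u, v} K sg} (f : Hom P P) : Prop :=
  ∃ g : Hom P P, ∀ s a, g.map s (f.map s a) = a ∧ f.map s (g.map s a) = a

/-! ### Free dg algebras -/

/-- Monomials in generators `g` and their formal differentials: `leaf g false` stands for `g` and
`leaf g true` for `d g`. -/
inductive Mono (sg : Sig) (G : sg.S → Type) : sg.S → Type
  | leaf {s : sg.S} (g : G s) (b : Bool) : Mono sg G s
  | un {s t : sg.S} (o : sg.U s t) (x : Mono sg G s) : Mono sg G t
  | bin {r s t : sg.S} (o : sg.B r s t) (x : Mono sg G r) (y : Mono sg G s) : Mono sg G t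

variable {G : sg.S → Type}

/-- The parity of a monomial (`true` is odd), given the parities of the generators. -/
def Mono.odd (p : ∀ s, G s → Bool) : ∀ {s}, Mono sg G s → Bool
  | _, .leaf g b => xor (p _ g) b
  | _, .un _ x => Mono.odd p x
  | _, .bin _ x y => xor (Mono.odd p x) (Mono.odd p y)

/-- The number of leaves of a monomial, a generator `g` counted with multiplicity `wt g`. -/
def Mono.weight (wt : ∀ s, G s → ℕ) : ∀ {s}, Mono sg G s → ℕ
  | _, .leaf g _ => wt _ g
  | _, .un _ x => Mono.weight wt x
  | _, .bin _ x y => Mono.weight wt x + Mono.weight wt y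

/-- The sign `(-1)^q`. -/
def sgn (K : Type u) [Field K] (q : Bool) : K := if q then -1 else 1

/-- Unary operations on linear combinations of monomials. -/
def freeUn (K : Type u) [Field K] {s t : sg.S} (o : sg.U s t) :
    (Mono sg G s →₀ K) →ₗ[K] (Mono sg G t →₀ K) :=
  Finsupp.lmapDomain K K (Mono.un o)

/-- Binary operations on linear combinations of monomials. -/
def freeBin (K : Type u) [Field K] {r s t : sg.S} (o : sg.B r s t) :
    (Mono sg G r →₀ K) →ₗ[K] (Mono sg G s →₀ K) →ₗ[K] (Mono sg G t →₀ K) :=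
  Finsupp.linearCombination K (fun x => Finsupp.lmapDomain K K (Mono.bin o x))

/-- The differential of a monomial: the derivation with `g ↦ d g ↦ 0` on generators. -/
def Mono.diff (K : Type u) [Field K] (p : ∀ s, G s → Bool) :
    ∀ {s}, Mono sg G s → (Mono sg G s →₀ K)
  | _, .leaf g b => if b then 0 else Finsupp.single (.leaf g true) 1
  | _, .un o x => freeUn K o (Mono.diff K p x)
  | _, .bin o x y => freeBin K o (Mono.diff K p x) (Finsupp.single y 1) +
      sgn K (x.odd p) • freeBin K o (Finsupp.single x 1) (Mono.diff K p y)

/-- The free (discrete) dg algebra over the signature `sg`, no axioms imposed, on generators `G`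
of parities `p`. -/
def free (K : Type u) [Field K] (sg : Sig) (G : sg.S → Type) (p : ∀ s, G s → Bool) :
    DGAlg.{u, u} K sg where
  obj s := Mono sg G s →₀ K
  top _ := ⊥
  par s := Finsupp.linearCombination K (fun x => Finsupp.single x (sgn K (x.odd p)))
  d s := Finsupp.linearCombination K (fun x => Mono.diff K p x)
  un o := freeUn K o
  bin o := freeBin K o

/-- A generator, as an element of the free dg algebra. -/
def freeGen (K : Type u) [Field K] {sg : Sig} {G : sg.S → Type} (p : ∀ s, G s → Bool) {s : sg.S}
    (g : G s) : (free K sg G p).obj s :=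
  (Finsupp.single (Mono.leaf g false) (1 : K) : Mono sg G s →₀ K)

/-! ### Quotients by dg ideals -/

/-- Membership in the dg ideal generated by the elements satisfying `R`. -/
inductive InIdeal (P : DGAlg.{u, v} K sg) (R : ∀ s, P.obj s → Prop) : ∀ s, P.obj s → Prop
  | of {s} {a : P.obj s} : R s a → InIdeal P R s a
  | zero {s} : InIdeal P R s 0
  | add {s} {a b : P.obj s} : InIdeal P R s a → InIdeal P R s b → InIdeal P R s (a + b)
  | smul {s} {a : P.obj s} (c : K) : InIdeal P R s a → InIdeal P R s (c • a)
  | par {s} {a : P.obj s} : InIdeal P R s a → InIdeal P R s (P.par s a)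
  | d {s} {a : P.obj s} : InIdeal P R s a → InIdeal P R s (P.d s a)
  | un {s t} (o : sg.U s t) {a : P.obj s} : InIdeal P R s a → InIdeal P R t (P.un o a)
  | binl {r s t} (o : sg.B r s t) {a : P.obj r} (b : P.obj s) :
      InIdeal P R r a → InIdeal P R t (P.bin o a b)
  | binr {r s t} (o : sg.B r s t) (a : P.obj r) {b : P.obj s} :
      InIdeal P R s b → InIdeal P R t (P.bin o a b)

/-- The dg ideal generated by `R`. -/
def ideal (P : DGAlg.{u, v} K sg) (R : ∀ s, P.obj s → Prop) (s : sg.S) :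
    Submodule K (P.obj s) where
  carrier := {a | InIdeal P R s a}
  add_mem' := InIdeal.add
  zero_mem' := InIdeal.zero
  smul_mem' c _ h := InIdeal.smul c h

/-- The quotient by the dg ideal generated by `R`, with the discrete topology. -/
def quot (P : DGAlg.{u, v} K sg) (R : ∀ s, P.obj s → Prop) : DGAlg.{u, v} K sg where
  obj s := P.obj s ⧸ ideal P R s
  top _ := ⊥
  par s := (ideal P R s).mapQ (ideal P R s) (P.par s) (fun _ h => InIdeal.par h)
  d s := (ideal P R s).mapQ (ideal P R s) (P.d s) (fun _ h => InIdeal.d h)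
  un {s t} o := (ideal P R s).mapQ (ideal P R t) (P.un o) (fun _ h => InIdeal.un o h)
  bin {r s t} o := (ideal P R r).liftQ
    (LinearMap.flip ((ideal P R s).liftQ
      (LinearMap.flip ((P.bin o).compr₂ (ideal P R t).mkQ))
      (fun b hb => by
        rw [LinearMap.mem_ker]
        ext a
        exact (Submodule.Quotient.mk_eq_zero _).2 (InIdeal.binr o a hb))))
    (fun a ha => by
      rw [LinearMap.mem_ker]
      apply LinearMap.ext
      intro y
      obtain ⟨b, rfl⟩ := Submodule.Quotient.mk_surjective _ y
      exact (Submodule.Quotient.mk_eq_zero _).2 (InIdeal.binl o b ha))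

/-- The class of an element in the quotient. -/
def quotMk (P : DGAlg.{u, v} K sg) (R : ∀ s, P.obj s → Prop) {s : sg.S} (a : P.obj s) :
    (quot P R).obj s :=
  (ideal P R s).mkQ a

theorem ideal_mono {P : DGAlg.{u, v} K sg} {R R' : ∀ s, P.obj s → Prop}
    (h : ∀ s a, R s a → R' s a) {s : sg.S} : ideal P R s ≤ ideal P R' s := by
  intro a ha
  change InIdeal P R s a at ha
  change InIdeal P R' s a
  induction ha with
  | of h' => exact .of (h _ _ h')
  | zero => exact .zero
  | add _ _ h1 h2 => exact .add h1 h2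
  | smul c _ h1 => exact .smul c h1
  | par _ h1 => exact .par h1
  | d _ h1 => exact .d h1
  | un o _ h1 => exact .un o h1
  | binl o b _ h1 => exact .binl o b h1
  | binr o a _ h1 => exact .binr o a h1

/-- The projection between quotients by a smaller and by a larger ideal. -/
def quotMap (P : DGAlg.{u, v} K sg) {R R' : ∀ s, P.obj s → Prop}
    (h : ∀ s a, R s a → R' s a) : Hom (quot P R) (quot P R') where
  map s := (ideal P R s).mapQ (ideal P R' s) LinearMap.id (ideal_mono h)
  cont _ := continuous_bot
  map_par s a := by
    obtain ⟨a, rfl⟩ := Submodule.Quotient.mk_surjective _ a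
    rfl
  map_d s a := by
    obtain ⟨a, rfl⟩ := Submodule.Quotient.mk_surjective _ a
    rfl
  map_un o a := by
    obtain ⟨a, rfl⟩ := Submodule.Quotient.mk_surjective _ a
    rfl
  map_bin o a b := by
    obtain ⟨a, rfl⟩ := Submodule.Quotient.mk_surjective _ a
    obtain ⟨b, rfl⟩ := Submodule.Quotient.mk_surjective _ b
    rfl

/-! ### Inverse limits -/

/-- Compatible families in an inverse system. -/
def limSub {ι : Type w} [Preorder ι] (P : ι → DGAlg.{u, v} K sg)
    (tr : ∀ {i j : ι}, i ≤ j → Hom (P j) (P i)) (s : sg.S) :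
    Submodule K (∀ i, (P i).obj s) where
  carrier := {x | ∀ (i j : ι) (h : i ≤ j), (tr h).map s (x j) = x i}
  add_mem' ha hb i j h := by simp [ha i j h, hb i j h]
  zero_mem' i j h := by simp
  smul_mem' c a ha i j h := by simp [ha i j h]

/-- The inverse limit, with the inverse limit topology. -/
def lim {ι : Type w} [Preorder ι] (P : ι → DGAlg.{u, v} K sg)
    (tr : ∀ {i j : ι}, i ≤ j → Hom (P j) (P i)) : DGAlg.{u, max v w} K sg where
  obj s := limSub P tr s
  top s := instTopologicalSpaceSubtype
  par s := LinearMap.codRestrict _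
    (LinearMap.pi fun i => (P i).par s ∘ₗ LinearMap.proj i ∘ₗ (limSub P tr s).subtype)
    (fun a i j h => by
      have := a.2 i j h
      simp [(tr h).map_par, this])
  d s := LinearMap.codRestrict _
    (LinearMap.pi fun i => (P i).d s ∘ₗ LinearMap.proj i ∘ₗ (limSub P tr s).subtype)
    (fun a i j h => by
      have := a.2 i j h
      simp [(tr h).map_d, this])
  un {s t} o := LinearMap.codRestrict _
    (LinearMap.pi fun i => (P i).un o ∘ₗ LinearMap.proj i ∘ₗ (limSub P tr s).subtype)
    (fun a i j h => by
      have := a.2 i j h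
      simp [(tr h).map_un, this])
  bin {r s t} o := LinearMap.mk₂ K
    (fun a b => (⟨fun i => (P i).bin o (a.1 i) (b.1 i), fun i j h => by
      have h1 := a.2 i j h
      have h2 := b.2 i j h
      simp [(tr h).map_bin, h1, h2]⟩ : limSub P tr t))
    (fun a a' b => by ext i; simp)
    (fun c a b => by ext i; simp)
    (fun a b b' => by ext i; simp)
    (fun c a b => by ext i; simp)

end Generic

/-! ## Operads -/

/-- Operation symbols of a symmetric operad: relabelling of inputs (the action of the symmetric
groups) and the partial compositions `∘ᵢ : O(m) ⊗ O(n) → O(m + n - 1)`.  Inputs are numbered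
from `0`. -/
inductive OpU : ℕ → ℕ → Type
  | perm {m n : ℕ} (e : Fin m ≃ Fin n) : OpU m n

inductive OpB : ℕ → ℕ → ℕ → Type
  | comp {m n p : ℕ} (h : p + 1 = m + n) (i : Fin m) : OpB m n p

abbrev opSig : Sig := ⟨ℕ, OpU, OpB⟩

section Ops

variable {K : Type u} [Field K]

/-- The left action of permutations: `perm e a` has as its input number `e j` the input number `j`
of `a`. -/
def DGAlg.perm (P : DGAlg.{u, v} K opSig) {m n : ℕ} (e : Fin m ≃ Fin n) :
    P.obj m →ₗ[K] P.obj n :=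
  P.un (sg := opSig) (OpU.perm e)

/-- `a ∘ᵢ b`. -/
def DGAlg.comp (P : DGAlg.{u, v} K opSig) {m n p : ℕ} (h : p + 1 = m + n) (i : Fin m) :
    P.obj m →ₗ[K] P.obj n →ₗ[K] P.obj p :=
  P.bin (sg := opSig) (OpB.comp h i)

end Ops

/-- The position in `a ∘ᵢ b` of the input `j ≠ i` of `a`, where `b` has `n` inputs.  (The input `l`
of `b` gets the position `i + l`.) -/
def outer (n i j : ℕ) : ℕ := if j < i then j else j + n - 1

/-- The axioms of a (non-unital) symmetric operad: `OpLaw P n z` says that `z` is the difference of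
the two sides of one of the axioms.  They are the group action axioms, the equivariance of partial
compositions, and their sequential and parallel associativity. -/
inductive OpLaw {K : Type u} [Field K] (P : DGAlg.{u, v} K opSig) : ∀ n : ℕ, P.obj n → Prop
  | perm_refl {n} (a : P.obj n) : OpLaw P n (P.perm (Equiv.refl _) a - a)
  | perm_trans {l m n} (e : Fin l ≃ Fin m) (e' : Fin m ≃ Fin n) (a : P.obj l) :
      OpLaw P n (P.perm e' (P.perm e a) - P.perm (e.trans e') a)
  | equivariance {m n p m' n' p'} (h : p + 1 = m + n) (h' : p' + 1 = m' + n')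
      (e : Fin m ≃ Fin m') (e' : Fin n ≃ Fin n') (ρ : Fin p ≃ Fin p') (i : Fin m)
      (ho : ∀ (j : Fin m) (t : Fin p), j ≠ i → t.val = outer n i j →
        (ρ t).val = outer n' (e i) (e j))
      (hi : ∀ (l : Fin n) (t : Fin p), t.val = i + l → (ρ t).val = e i + e' l)
      (a : P.obj m) (b : P.obj n) :
      OpLaw P p' (P.perm ρ (P.comp h i a b) - P.comp h' (e i) (P.perm e a) (P.perm e' b))
  | seq {m n q r s p} (h₁ : r + 1 = m + n) (h₂ : p + 1 = r + q) (h₃ : s + 1 = n + q)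
      (h₄ : p + 1 = m + s) (i : Fin m) (j : Fin n) (ij : Fin r) (hij : ij.val = i + j)
      (a : P.obj m) (b : P.obj n) (c : P.obj q) :
      OpLaw P p (P.comp h₂ ij (P.comp h₁ i a b) c - P.comp h₄ i a (P.comp h₃ j b c))
  | par {m n q r s p} (h₁ : r + 1 = m + n) (h₂ : p + 1 = r + q) (h₃ : s + 1 = m + q)
      (h₄ : p + 1 = s + n) (i k : Fin m) (hik : i < k) (k' : Fin r) (hk : k'.val = k + n - 1)
      (i' : Fin s) (hi : i'.val = i) (β γ : Bool)
      (a : P.obj m) (b : P.obj n) (c : P.obj q)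
      (hb : P.par n b = sgn K β • b) (hc : P.par q c = sgn K γ • c) :
      OpLaw P p (P.comp h₂ k' (P.comp h₁ i a b) c -
        sgn K (β && γ) • P.comp h₄ i' (P.comp h₃ k a c) b)

/-! ## Modular operads -/

/-- Operation symbols of a modular operad `O((g, n))`.  An element of `O((g, n))` has genus `g` and
`n` legs numbered `0, …, n - 1`.  There are relabellings of the legs and the contraction of the
last two legs, the first of which is the tail and the second the tip of the new edge. -/
inductive ModU : ℕ × ℕ → ℕ × ℕ → Type
  | perm (g : ℕ) {m n : ℕ} (e : Fin m ≃ Fin n) : ModU (g, m) (g, n)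
  | contr {g r : ℕ} (h : r = g + 1) (n : ℕ) : ModU (g, n + 2) (r, n)

/-- The gluing `a ∘ᵢ b` of the leg `i` of `a` (the tail of the new edge) with the last leg of `b`
(its tip); the remaining legs of `b` take the place of the leg `i` of `a`. -/
inductive ModB : ℕ × ℕ → ℕ × ℕ → ℕ × ℕ → Type
  | comp {g h r m n p : ℕ} (hg : r = g + h) (hp : p + 1 = m + n) (i : Fin m) :
      ModB (g, m) (h, n + 1) (r, p)

abbrev modSig : Sig := ⟨ℕ × ℕ, ModU, ModB⟩

section ModOps

variable {K : Type u} [Field K]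

def DGAlg.mperm (M : DGAlg.{u, v} K modSig) (g : ℕ) {m n : ℕ} (e : Fin m ≃ Fin n) :
    M.obj (g, m) →ₗ[K] M.obj (g, n) :=
  M.un (sg := modSig) (ModU.perm g e)

def DGAlg.contr (M : DGAlg.{u, v} K modSig) {g r : ℕ} (h : r = g + 1) (n : ℕ) :
    M.obj (g, n + 2) →ₗ[K] M.obj (r, n) :=
  M.un (sg := modSig) (ModU.contr h n)

def DGAlg.mcomp (M : DGAlg.{u, v} K modSig) {g h r m n p : ℕ} (hg : r = g + h)
    (hp : p + 1 = m + n) (i : Fin m) :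
    M.obj (g, m) →ₗ[K] M.obj (h, n + 1) →ₗ[K] M.obj (r, p) :=
  M.bin (sg := modSig) (ModB.comp hg hp i)

end ModOps

/-- The axioms of a modular operad, in the version twisted by the cocycle of edge orientations (an
even sign-twist: reversing the direction of an edge multiplies by `-1`).  This is the version for
which a super vector space with an even antisymmetric form has an endomorphism modular operad.  In
genus zero and without `contr`, these are the axioms of an anticyclic operad: `∘ᵢ` are the partial
compositions of an operad if the last leg is regarded as the output, and `anti` is the anticyclic
relation.  There is no stability condition. -/
inductive ModLaw {K : Type u} [Field K] (M : DGAlg.{u, v} K modSig) :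
    ∀ s : ℕ × ℕ, M.obj s → Prop
  | perm_refl {g n} (a : M.obj (g, n)) : ModLaw M (g, n) (M.mperm g (Equiv.refl _) a - a)
  | perm_trans {g l m n} (e : Fin l ≃ Fin m) (e' : Fin m ≃ Fin n) (a : M.obj (g, l)) :
      ModLaw M (g, n) (M.mperm g e' (M.mperm g e a) - M.mperm g (e.trans e') a)
  | equivariance {g h r m n p m' n' p'} (hg : r = g + h) (hp : p + 1 = m + n)
      (hp' : p' + 1 = m' + n')
      (e : Fin m ≃ Fin m') (e' : Fin (n + 1) ≃ Fin (n' + 1)) (he' : e' (Fin.last n) = Fin.last n')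
      (ρ : Fin p ≃ Fin p') (i : Fin m)
      (ho : ∀ (j : Fin m) (t : Fin p), j ≠ i → t.val = outer n i j →
        (ρ t).val = outer n' (e i) (e j))
      (hi : ∀ (l : Fin n) (t : Fin p), t.val = i + l → (ρ t).val = e i + e' l.castSucc)
      (a : M.obj (g, m)) (b : M.obj (h, n + 1)) :
      ModLaw M (r, p') (M.mperm r ρ (M.mcomp hg hp i a b) -
        M.mcomp hg hp' (e i) (M.mperm g e a) (M.mperm h e' b))
  | seq {g h k gh hk ghk m n q r s p} (g₁ : gh = g + h) (g₂ : ghk = gh + k) (g₃ : hk = h + k)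
      (g₄ : ghk = g + hk)
      (h₁ : r + 1 = m + n) (h₂ : p + 1 = r + q) (h₃ : (s + 1) + 1 = (n + 1) + q)
      (h₄ : p + 1 = m + s) (i : Fin m) (j : Fin n) (ij : Fin r) (hij : ij.val = i + j)
      (a : M.obj (g, m)) (b : M.obj (h, n + 1)) (c : M.obj (k, q + 1)) :
      ModLaw M (ghk, p) (M.mcomp g₂ h₂ ij (M.mcomp g₁ h₁ i a b) c -
        M.mcomp g₄ h₄ i a (M.mcomp g₃ h₃ j.castSucc b c))
  | par {g h k gh gk ghk m n q r s p} (g₁ : gh = g + h) (g₂ : ghk = gh + k) (g₃ : gk = g + k)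
      (g₄ : ghk = gk + h)
      (h₁ : r + 1 = m + n) (h₂ : p + 1 = r + q) (h₃ : s + 1 = m + q)
      (h₄ : p + 1 = s + n) (i k₀ : Fin m) (hik : i < k₀) (k' : Fin r)
      (hk : k'.val = k₀ + n - 1) (i' : Fin s) (hi : i'.val = i) (β γ : Bool)
      (a : M.obj (g, m)) (b : M.obj (h, n + 1)) (c : M.obj (k, q + 1))
      (hb : M.par (h, n + 1) b = sgn K β • b) (hc : M.par (k, q + 1) c = sgn K γ • c) :
      ModLaw M (ghk, p) (M.mcomp g₂ h₂ k' (M.mcomp g₁ h₁ i a b) c -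
        sgn K (β && γ) • M.mcomp g₄ h₄ i' (M.mcomp g₃ h₃ k₀ a c) b)
  | anti {g h r m n p} (hg : r = g + h) (hg' : r = h + g) (hp : p + 1 = (m + 1) + n)
      (hp' : p + 1 = (n + 1) + m) (i : Fin (m + 1)) (e : Fin (m + 1) ≃ Fin (m + 1))
      (he : e i = Fin.last m) (ρ : Fin p ≃ Fin p)
      (hb : ∀ (l : Fin n) (t : Fin p), t.val = l → (ρ t).val = i + l)
      (ha : ∀ (j : Fin (m + 1)) (t : Fin p), j ≠ i → t.val = n + e j →
        (ρ t).val = outer n i j)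
      (α β : Bool) (a : M.obj (g, m + 1)) (b : M.obj (h, n + 1))
      (hpa : M.par (g, m + 1) a = sgn K α • a) (hpb : M.par (h, n + 1) b = sgn K β • b) :
      ModLaw M (r, p) (M.mcomp hg hp i a b +
        sgn K (α && β) • M.mperm r ρ (M.mcomp hg' hp' (Fin.last n) b (M.mperm g e a)))
  | contr_equivariance {g r m n} (h : r = g + 1) (e : Fin m ≃ Fin n)
      (e' : Fin (m + 2) ≃ Fin (n + 2)) (he : ∀ t : Fin m, (e' (t.castAdd 2)).val = e t)
      (he₀ : (e' (Fin.natAdd m 0)).val = n) (he₁ : (e' (Fin.natAdd m 1)).val = n + 1)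
      (a : M.obj (g, m + 2)) :
      ModLaw M (r, n) (M.mperm r e (M.contr h m a) - M.contr h n (M.mperm g e' a))
  | contr_anti {g r n} (h : r = g + 1) (a : M.obj (g, n + 2)) :
      ModLaw M (r, n) (M.contr h n (M.mperm g
        (Equiv.swap (Fin.natAdd n (0 : Fin 2)) (Fin.natAdd n (1 : Fin 2))) a) + M.contr h n a)
  | contr_contr {g r s n} (h : r = g + 1) (h' : s = r + 1) (a : M.obj (g, n + 4)) :
      ModLaw M (s, n) (M.contr h' n (M.contr h (n + 2) (M.mperm g
        (Equiv.swap (Fin.natAdd n (0 : Fin 4)) (Fin.natAdd n (2 : Fin 4)) *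
          Equiv.swap (Fin.natAdd n (1 : Fin 4)) (Fin.natAdd n (3 : Fin 4))) a)) -
        M.contr h' n (M.contr h (n + 2) a))
  | contr_comp {g h r s t m n p} (hr : r = g + 1) (hs : s = r + h) (ht : t = g + h)
      (hst : s = t + 1) (hp : p + 1 = m + n) (hp' : (p + 2) + 1 = (m + 2) + n) (i : Fin m)
      (a : M.obj (g, m + 2)) (b : M.obj (h, n + 1)) :
      ModLaw M (s, p) (M.mcomp hs hp i (M.contr hr m a) b -
        M.contr hst p (M.mcomp ht hp' (i.castAdd 2) a b))
  | comp_comp {g h r s m n} (hr : r = g + h) (hs : s = r + 1)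
      (hp : (m + n + 2) + 1 = (m + 2) + (n + 1)) (ρ : Fin (m + n + 2) ≃ Fin (m + n + 2))
      (h₁ : ∀ t : Fin (m + n + 2), t.val < m → (ρ t).val = t)
      (h₂ : ∀ t : Fin (m + n + 2), t.val = m → (ρ t).val = m + n)
      (h₃ : ∀ t : Fin (m + n + 2), m < t.val → t.val ≤ m + n → (ρ t).val = t - 1)
      (h₄ : ∀ t : Fin (m + n + 2), t.val = m + n + 1 → (ρ t).val = m + n + 1)
      (a : M.obj (g, m + 2)) (b : M.obj (h, n + 2)) :
      ModLaw M (s, m + n)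
        (M.contr hs (m + n) (M.mperm r ρ (M.mcomp hr hp (Fin.natAdd m 1) a b)) -
        M.contr hs (m + n) (M.mperm r
          (Equiv.swap (Fin.natAdd (m + n) (0 : Fin 2)) (Fin.natAdd (m + n) (1 : Fin 2)))
          (M.mcomp hr hp (Fin.natAdd m 0) a (M.mperm h
            (Equiv.swap (Fin.natAdd n (0 : Fin 2)) (Fin.natAdd n (1 : Fin 2))) b))))

/-- A bijection of the inputs, extended to a bijection of the legs that fixes the last leg. -/
def extendLast {m n : ℕ} (e : Fin m ≃ Fin n) : Fin (m + 1) ≃ Fin (n + 1) :=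
  (finSuccEquivLast.trans e.optionCongr).trans finSuccEquivLast.symm

/-- The operad underlying a modular operad: its genus zero part, the last leg being the output. -/
def opOf {K : Type u} [Field K] (M : DGAlg.{u, v} K modSig) : DGAlg.{u, v} K opSig where
  obj := fun n : ℕ => M.obj ((0, n + 1) : ℕ × ℕ)
  par := fun n : ℕ => M.par ((0, n + 1) : ℕ × ℕ)
  d := fun n : ℕ => M.d ((0, n + 1) : ℕ × ℕ)
  un := fun {_ _ : ℕ} (o : OpU _ _) => match o with
    | .perm e => M.mperm 0 (extendLast e)
  bin := fun {_ _ _ : ℕ} (o : OpB _ _ _) => match o with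
    | .comp h i => M.mcomp (rfl : 0 = 0 + 0) (by omega) i.castSucc

/-! ## The formulas, in an arbitrary operad -/

/-- The two cases: `L∞` (governed by symmetric operations) and `A∞`. -/
inductive Kind
  | lie
  | ass

section Formulas

variable {K : Type u} [Field K]

/-- `f ∘ (x ⊗ ⋯ ⊗ x)` with `i` factors `x`, that is `(⋯((f ∘_i x) ∘_{i-1} x)⋯) ∘_1 x`
with inputs counted from `1`. -/
def plug (P : DGAlg.{u, v} K opSig) (x : P.obj (0 : ℕ)) (n : ℕ) :
    ∀ i : ℕ, P.obj (n + i) → P.obj n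
  | 0, f => f
  | i + 1, f => plug P x n i
      (P.comp (m := n + (i + 1)) (n := 0) (p := n + i) (by omega) ⟨i, by omega⟩ f x)

/-- The `(p, N - p)`-shuffles: permutations increasing on the first `p` and on the last `N - p`
elements. -/
def shuffles (p N : ℕ) : Finset (Equiv.Perm (Fin N)) :=
  open Classical in
  Finset.univ.filter fun σ => ∀ a b : Fin N, a < b → (b.val < p ∨ p ≤ a.val) → σ a < σ b

/-- The cobar differential of `m_n`, in terms of the family `m` of operations. -/
def cobar (kind : Kind) (P : DGAlg.{u, v} K opSig) (m : ∀ n : ℕ, P.obj n) (n : ℕ) : P.obj n :=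
  match kind with
  | .lie => ∑ j : Fin n, ∑ σ ∈ shuffles (n - j) n,
      P.perm σ (P.comp (m := j.val + 1) (n := n - j) (p := n) (by omega) 0 (m (j + 1)) (m (n - j)))
  | .ass => ∑ j : Fin n, ∑ i : Fin (j.val + 1),
      P.comp (m := j.val + 1) (n := n - j) (p := n) (by omega) i (m (j + 1)) (m (n - j))

/-- The coefficient of `m_n(x, …, x)` in the Maurer-Cartan series: `1/n!` or `1`. -/
def coef (K : Type u) [Field K] (kind : Kind) (n : ℕ) : K :=
  match kind with
  | .lie => (n.factorial : K)⁻¹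
  | .ass => 1

/-- The term `m_n ∘ (x ⊗ ⋯ ⊗ x)` of the Maurer-Cartan series, with its coefficient. -/
def mcTerm (kind : Kind) (P : DGAlg.{u, v} K opSig) (m : ∀ n : ℕ, P.obj n)
    (x : P.obj (0 : ℕ)) (n : ℕ) : P.obj (0 : ℕ) :=
  coef K kind n • plug P x 0 n (m (0 + n))

/-- The `i`-th term of the series defining `tw(m_n)`.  In the associative case a permutation `σ` acts
on operations by `f ↦ f(z_{σ⁻¹(1)}, z_{σ⁻¹(2)}, …)`, which is the action of `σ⁻¹` in the
convention of `DGAlg.perm`; the sum runs over all ways of inserting `i` copies of `x` among the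
inputs of `m_{n+i}`, the other inputs staying in order. -/
def twTerm (kind : Kind) (P : DGAlg.{u, v} K opSig) (m : ∀ n : ℕ, P.obj n)
    (x : P.obj (0 : ℕ)) (n i : ℕ) : P.obj n :=
  match kind with
  | .lie => (i.factorial : K)⁻¹ • plug P x n i (m (n + i))
  | .ass => ∑ σ ∈ shuffles i (n + i), plug P x n i (P.perm σ.symm (m (n + i)))

end Formulas

/-! ## The operads `L∞`, `A∞` and their extensions by a Maurer-Cartan element -/

/-- Generators `m_1, m_2, …`. -/
inductive GenM : ℕ → Type
  | m (n : ℕ) : GenM (n + 1)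

/-- Generators `m_1, m_2, …` and `x`. -/
inductive GenX : ℕ → Type
  | m (n : ℕ) : GenX (n + 1)
  | x : GenX 0

/-- All `m_n` are odd. -/
def oddM : ∀ n : ℕ, GenM n → Bool := fun _ _ => true

/-- All `m_n` are odd, `x` is even. -/
def oddX : ∀ n : ℕ, GenX n → Bool
  | _, .m _ => true
  | _, .x => false

/-- Weights counting the occurrences of `x`. -/
def wtX : ∀ n : ℕ, GenX n → ℕ
  | _, .m _ => 0
  | _, .x => 1

section Operads

variable (K : Type u) [Field K]

/-- The relations for the operations `m_n` (with `m 0 = 0`): in the Lie case they are symmetric; the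
differential is the cobar differential. -/
inductive StrRel {K : Type u} [Field K] (kind : Kind) (P : DGAlg.{u, v} K opSig)
    (m : ∀ n : ℕ, P.obj n) : ∀ n : ℕ, P.obj n → Prop
  | symm (hk : kind = .lie) (n : ℕ) (σ : Equiv.Perm (Fin n)) :
      StrRel kind P m n (P.perm σ (m n) - m n)
  | diff (n : ℕ) : StrRel kind P m n (P.d n (m n) - cobar kind P m n)

def freeM : DGAlg.{u, u} K opSig := free K opSig GenM oddM

/-- The generator `m_n`, `n ≥ 1`, of the free algebra (and `0` for `n = 0`). -/
def genM : ∀ n : ℕ, (freeM K).obj n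
  | 0 => 0
  | n + 1 => freeGen K (sg := opSig) (G := GenM) oddM (GenM.m n)

/-- The dg operad `L∞` (`kind = lie`), free on symmetric odd operations `m_n`, or the
(symmetric version of the) dg operad `A∞` (`kind = ass`), free on odd operations `m_n`, with
the cobar differential; `n = 1, 2, …`. -/
def Inf (kind : Kind) : DGAlg.{u, u} K opSig :=
  quot (freeM K) fun n z => OpLaw (freeM K) n z ∨ StrRel kind (freeM K) (genM K) n z

/-- `m_n` in `L∞` or `A∞`. -/
def infM (kind : Kind) (n : ℕ) : (Inf K kind).obj n := quotMk _ _ (genM K n)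

def freeX : DGAlg.{u, u} K opSig := free K opSig GenX oddX

def genXM : ∀ n : ℕ, (freeX K).obj n
  | 0 => 0
  | n + 1 => freeGen K (sg := opSig) (G := GenX) oddX (GenX.m n)

def genXX : (freeX K).obj (0 : ℕ) := freeGen K (sg := opSig) (G := GenX) oddX GenX.x

/-- The relations for the dg operad `L∞[[x]]/(x)^k` or `A∞[[x]]/(x)^k`.  Modulo `(x)^k`, the series
`d x = ∑ m_n ∘ x^{⊗ n}` (with coefficients `1/n!` in the Lie case) may be cut off after the
term `n = N`, for any `N ≥ k`; and `(x)^k` is spanned by the monomials with at least `k`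
occurrences of `x`. -/
inductive CurlyRel (kind : Kind) (k : ℕ) : ∀ n : ℕ, (freeX K).obj n → Prop
  | law {n z} : OpLaw (freeX K) n z → CurlyRel kind k n z
  | str {n z} : StrRel kind (freeX K) (genXM K) n z → CurlyRel kind k n z
  | diff (N : ℕ) (h : k ≤ N) : CurlyRel kind k 0 ((freeX K).d (0 : ℕ) (genXX K) -
      ∑ n ∈ Finset.range N, mcTerm kind (freeX K) (genXM K) (genXX K) (n + 1))
  | adic {n : ℕ} (t : Mono opSig GenX n) (h : k ≤ Mono.weight wtX t) :
      CurlyRel kind k n (Finsupp.single t (1 : K) : Mono opSig GenX n →₀ K)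

variable {K} in
theorem CurlyRel.mono {kind : Kind} {k l : ℕ} (hkl : k ≤ l) (n : ℕ) (z : (freeX K).obj n)
    (h : CurlyRel K kind l n z) : CurlyRel K kind k n z := by
  cases h with
  | law h => exact .law h
  | str h => exact .str h
  | diff N h => exact .diff N (hkl.trans h)
  | adic t h => exact .adic t (hkl.trans h)

/-- The dg operad `L∞[[x]]/(x)^k` or `A∞[[x]]/(x)^k`. -/
def CurlyLevel (kind : Kind) (k : ℕ) : DGAlg.{u, u} K opSig :=
  quot (freeX K) (CurlyRel K kind k)

/-- The topological dg operad governing `L∞` or `A∞` algebras with a Maurer-Cartan element: the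
inverse limit of `L∞[[x]]/(x)^k` or `A∞[[x]]/(x)^k`, that is `L∞[[x]]` or `A∞[[x]]`. -/
def Curly (kind : Kind) : DGAlg.{u, u} K opSig :=
  lim (ι := ℕ) (CurlyLevel K kind) (fun h => quotMap (freeX K) (CurlyRel.mono h))

/-- The image in the completed operad of an operad polynomial in `m_1, m_2, …` and `x`. -/
def curlyMk (kind : Kind) {n : ℕ} (a : (freeX K).obj n) : (Curly K kind).obj n :=
  ⟨fun k => quotMk (freeX K) (CurlyRel K kind k) a, fun _ _ _ => rfl⟩

def curlyM (kind : Kind) (n : ℕ) : (Curly K kind).obj n := curlyMk K kind (genXM K n)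

def curlyX (kind : Kind) : (Curly K kind).obj (0 : ℕ) := curlyMk K kind (genXX K)

/-! ### Modular closures -/

/-- Generators of the modular closure: `m_n` in `O((0, n + 1))`, `n ≥ 1`, and `x` in
`O((0, 1))`. -/
inductive ModGen : ℕ × ℕ → Type
  | m (n : ℕ) : ModGen (0, n + 2)
  | x : ModGen (0, 1)

def oddMod : ∀ s : ℕ × ℕ, ModGen s → Bool
  | _, .m _ => true
  | _, .x => false

def wtMod : ∀ s : ℕ × ℕ, ModGen s → ℕ
  | _, .m _ => 0
  | _, .x => 1

/-- The permutations of the `n + 1` legs under which a cyclic operation `m_n` is invariant: all of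
them in the Lie case, the cyclic ones (generated by one rotation) in the associative case. -/
def LegSym (kind : Kind) (n : ℕ) (σ : Equiv.Perm (Fin (n + 1))) : Prop :=
  match kind with
  | .lie => True
  | .ass => σ = finRotate (n + 1)

/-- The relations for the operations `m_n` in a modular operad. -/
inductive ModStrRel {K : Type u} [Field K] (kind : Kind) (M : DGAlg.{u, v} K modSig)
    (m : ∀ n : ℕ, M.obj ((0, n + 1) : ℕ × ℕ)) : ∀ s : ℕ × ℕ, M.obj s → Prop
  | symm (n : ℕ) (σ : Equiv.Perm (Fin (n + 1))) (h : LegSym kind n σ) :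
      ModStrRel kind M m (0, n + 1) (M.mperm 0 σ (m n) - m n)
  | diff (n : ℕ) : ModStrRel kind M m (0, n + 1)
      (M.d ((0, n + 1) : ℕ × ℕ) (m n) -
        show M.obj ((0, n + 1) : ℕ × ℕ) from cobar kind (opOf M) m n)

def freeMod : DGAlg.{u, u} K modSig := free K modSig ModGen oddMod

def genModM : ∀ n : ℕ, (freeMod K).obj ((0, n + 1) : ℕ × ℕ)
  | 0 => 0
  | n + 1 => freeGen K (sg := modSig) (G := ModGen) oddMod (ModGen.m n)

def genModX : (freeMod K).obj ((0, 1) : ℕ × ℕ) :=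
  freeGen K (sg := modSig) (G := ModGen) oddMod ModGen.x

/-- The relations for the modular closure of `L∞[[x]]/(x)^k` or `A∞[[x]]/(x)^k`. -/
inductive CurlyModRel (kind : Kind) (k : ℕ) : ∀ s : ℕ × ℕ, (freeMod K).obj s → Prop
  | law {s z} : ModLaw (freeMod K) s z → CurlyModRel kind k s z
  | str {s z} : ModStrRel kind (freeMod K) (genModM K) s z → CurlyModRel kind k s z
  | diff (N : ℕ) (h : k ≤ N) : CurlyModRel kind k (0, 1)
      ((freeMod K).d ((0, 1) : ℕ × ℕ) (genModX K) -
      show (freeMod K).obj ((0, 1) : ℕ × ℕ) from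
        ∑ n ∈ Finset.range N, mcTerm kind (opOf (freeMod K)) (genModM K) (genModX K) (n + 1))
  | adic {s : ℕ × ℕ} (t : Mono modSig ModGen s) (h : k ≤ Mono.weight wtMod t) :
      CurlyModRel kind k s (Finsupp.single t (1 : K) : Mono modSig ModGen s →₀ K)

variable {K} in
theorem CurlyModRel.mono {kind : Kind} {k l : ℕ} (hkl : k ≤ l) (s : ℕ × ℕ)
    (z : (freeMod K).obj s) (h : CurlyModRel K kind l s z) : CurlyModRel K kind k s z := by
  cases h with
  | law h => exact .law h
  | str h => exact .str h
  | diff N h => exact .diff N (hkl.trans h)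
  | adic t h => exact .adic t (hkl.trans h)

/-- The modular closure of the cyclic operad `Curly K kind`.  The modular closure is left adjoint to
taking the genus zero part, so it has the same generators and relations as the cyclic operad, but
as a modular operad: it is spanned by graphs (ribbon graphs for `kind = ass`) with vertices `m_n`
and `x`, completed with respect to the number of occurrences of `x`. -/
def CurlyMod (kind : Kind) : DGAlg.{u, u} K modSig :=
  lim (ι := ℕ) (fun k => quot (freeMod K) (CurlyModRel K kind k))
    (fun h => quotMap (freeMod K) (CurlyModRel.mono h))

/-- The image in the completed modular operad of a polynomial in `m_1, m_2, …` and `x`. -/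
def curlyModMk (kind : Kind) {s : ℕ × ℕ} (a : (freeMod K).obj s) : (CurlyMod K kind).obj s :=
  ⟨fun k => quotMk (freeMod K) (CurlyModRel K kind k) a, fun _ _ _ => rfl⟩

def curlyModM (kind : Kind) (n : ℕ) : (CurlyMod K kind).obj ((0, n + 1) : ℕ × ℕ) :=
  curlyModMk K kind (genModM K n)

def curlyModX (kind : Kind) : (CurlyMod K kind).obj ((0, 1) : ℕ × ℕ) :=
  curlyModMk K kind (genModX K)

end Operads

/-! ## Endomorphism operads -/

section Multilinear

variable {K : Type u} [Field K] {W : Type w} [AddCommGroup W] [Module K W] [DGSpace K W]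
variable {U : Type v} [AddCommGroup U] [Module K U]

/-- Multilinear maps in `n` variables of `W`. -/
abbrev ML (K : Type u) [Field K] (W : Type w) [AddCommGroup W] [Module K W] (U : Type v)
    [AddCommGroup U] [Module K U] (n : ℕ) : Type (max w v) :=
  MultilinearMap K (fun _ : Fin n => W) U

/-- Parity of multilinear maps: `f ↦ εU ∘ f ∘ (par, …, par)`. -/
def mlPar (εU : U →ₗ[K] U) (n : ℕ) : ML K W U n →ₗ[K] ML K W U n where
  toFun f := εU.compMultilinearMap (f.compLinearMap fun _ => DGSpace.par)
  map_add' f g := by ext; simp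
  map_smul' c f := by ext; simp

/-- The differential
`(d f)(w_1, …, w_n) = d f(w_1, …, w_n) - (-1)^|f| ∑ (-1)^{|w_1| + ⋯ + |w_{i-1}|} f(…, d w_i, …)`. -/
def mlD (εU dU : U →ₗ[K] U) (n : ℕ) : ML K W U n →ₗ[K] ML K W U n where
  toFun f := dU.compMultilinearMap f - ∑ i : Fin n, (mlPar εU n f).compLinearMap fun j =>
    if j < i then DGSpace.par else if j = i then DGSpace.d else LinearMap.id
  map_add' f g := by ext; simp [Finset.sum_add_distrib]; abel
  map_smul' c f := by ext; simp [Finset.smul_sum, smul_sub]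

/-- The Koszul sign of permuting factors of parities `p`, the factor `j` being taken from
position `e j`. -/
def koszul (K : Type u) [Field K] {m n : ℕ} (e : Fin m ≃ Fin n) (p : Fin m → Bool) : K :=
  ∏ j, ∏ j', if j < j' ∧ e j' < e j ∧ p j = true ∧ p j' = true then -1 else 1

/-- The action of permutations: `(w_1, w_2, …) ↦ ± f(w_{e(1)}, w_{e(2)}, …)` with Koszul sign. -/
def mlPerm {m n : ℕ} (e : Fin m ≃ Fin n) : ML K W U m →ₗ[K] ML K W U n where
  toFun f := ∑ p : Fin m → Bool, koszul K e p •
    (f.compLinearMap fun j => proj DGSpace.par (p j)).domDomCongr e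
  map_add' f g := by ext; simp [Finset.sum_add_distrib]
  map_smul' c f := by ext; simp [Finset.smul_sum, smul_smul, mul_comm]

/-- The list of arguments of `f` in `f(φ w_1, …, φ w_i, g(w_{i+1}, …, w_{i+n}), w_{i+n+1}, …)`. -/
def args {m n p : ℕ} (h : p + 1 = m + n) (i : Fin m) (φ : W →ₗ[K] W) (g : ML K W W n)
    (w : Fin p → W) (j : Fin m) : W :=
  if hj : j < i then φ (w ⟨j, by have := j.2; have := i.2; have : j.val < i.val := hj; omega⟩)
  else if hj' : j = i then g fun l => w ⟨i + l, by have := i.2; have := l.2; omega⟩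
  else w ⟨j + n - 1, by
    have := j.2
    have : ¬ j.val < i.val := hj
    have : j.val ≠ i.val := fun h => hj' (Fin.ext h)
    omega⟩

theorem args_update {m n p : ℕ} (h : p + 1 = m + n) (i : Fin m) (φ : W →ₗ[K] W)
    (g : ML K W W n) (w : Fin p → W) (t : Fin p) :
    ∃ (j : Fin m) (ψ : W →ₗ[K] W), ∀ v,
      args h i φ g (Function.update w t v) = Function.update (args h i φ g w) j (ψ v) := by
  have hi := i.2
  have ht := t.2
  by_cases h1 : t.val < i.val
  · refine ⟨⟨t, by omega⟩, φ, fun v => ?_⟩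
    obtain ⟨j₀, hj₀, hj₀'⟩ : ∃ j₀ : Fin m, j₀.val = t.val ∧ (⟨t.val, by omega⟩ : Fin m) = j₀ :=
      ⟨⟨t.val, by omega⟩, rfl, rfl⟩
    rw [hj₀']
    funext j
    have hjj := j.2
    by_cases hne : j = j₀
    · rw [hne]
      have h3 : j₀ < i := by
        change j₀.val < i.val
        omega
      have h5 : ∀ hh, (⟨j₀.val, hh⟩ : Fin p) = t := fun _ => Fin.ext hj₀
      simp only [args, h3, h5, dite_true, Function.update_self]
    · have hj : j.val ≠ t.val := fun h => hne (Fin.ext (by omega))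
      rw [Function.update_of_ne hne]
      unfold args
      by_cases hji : j < i
      · have : (⟨j.val, by omega⟩ : Fin p) ≠ t := fun h => hj (by simp [← h])
        simp [hji, this]
      · have hji' : ¬ j.val < i.val := hji
        by_cases hje : j = i
        · have : ∀ l : Fin n, (⟨i.val + l.val, by have := l.2; omega⟩ : Fin p) ≠ t :=
            fun l h => by have := congrArg Fin.val h; simp at this; omega
          simp [hje, this]
        · have hje' : j.val ≠ i.val := fun h => hje (Fin.ext h)
          have : (⟨j.val + n - 1, by omega⟩ : Fin p) ≠ t :=
            fun h => by have := congrArg Fin.val h; simp at this; omega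
          simp [hji, hje, this]
  · by_cases h2 : t.val < i.val + n
    · refine ⟨i, g.toLinearMap (fun l => w ⟨i + l, by have := l.2; omega⟩) ⟨t - i, by omega⟩,
        fun v => ?_⟩
      funext j
      have hjj := j.2
      by_cases hj : j = i
      · subst hj
        simp only [args, lt_irrefl, dite_false, dite_true, Function.update_self,
          MultilinearMap.toLinearMap_apply]
        congr 1
        funext l
        by_cases hl : l = ⟨t - j, by omega⟩
        · have : (⟨j.val + l.val, by have := l.2; omega⟩ : Fin p) = t := by
            apply Fin.ext; subst hl; simp; omega
          rw [this, hl]; simp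
        · have : (⟨j.val + l.val, by have := l.2; omega⟩ : Fin p) ≠ t := fun h => hl (by
            have := congrArg Fin.val h; simp at this; apply Fin.ext; simp; omega)
          rw [Function.update_of_ne this, Function.update_of_ne hl]
      · rw [Function.update_of_ne hj]
        have hje' : j.val ≠ i.val := fun h => hj (Fin.ext h)
        unfold args
        by_cases hji : j < i
        · have hji' : j.val < i.val := hji
          have : (⟨j.val, by omega⟩ : Fin p) ≠ t := fun h => by
            have := congrArg Fin.val h; simp at this; omega
          simp [hji, this]
        · have hji' : ¬ j.val < i.val := hji
          have : (⟨j.val + n - 1, by omega⟩ : Fin p) ≠ t :=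
            fun h => by have := congrArg Fin.val h; simp at this; omega
          simp [hji, hj, this]
    · refine ⟨⟨t + 1 - n, by omega⟩, LinearMap.id, fun v => ?_⟩
      obtain ⟨j₀, hj₀, hj₀'⟩ : ∃ j₀ : Fin m, j₀.val = t.val + 1 - n ∧
          (⟨t + 1 - n, by omega⟩ : Fin m) = j₀ := ⟨⟨t + 1 - n, by omega⟩, rfl, rfl⟩
      rw [hj₀']
      funext j
      have hjj := j.2
      by_cases hj : j = j₀
      · rw [hj]
        have h3 : ¬ j₀ < i := fun h => by
          have h' : j₀.val < i.val := h
          omega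
        have h4 : j₀ ≠ i := fun h => by
          have := congrArg Fin.val h
          omega
        have h5 : ∀ hh, (⟨j₀.val + n - 1, hh⟩ : Fin p) = t := fun _ => Fin.ext (by simp; omega)
        simp only [args, h3, h4, h5, dite_false, Function.update_self, LinearMap.id_apply]
      · rw [Function.update_of_ne hj]
        have hjt : j.val ≠ t.val + 1 - n := fun h => hj (Fin.ext (by omega))
        unfold args
        by_cases hji : j < i
        · have hji' : j.val < i.val := hji
          have : (⟨j.val, by omega⟩ : Fin p) ≠ t := fun h => by
            have := congrArg Fin.val h; simp at this; omega
          simp [hji, this]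
        · have hji' : ¬ j.val < i.val := hji
          by_cases hje : j = i
          · have : ∀ l : Fin n, (⟨i.val + l.val, by have := l.2; omega⟩ : Fin p) ≠ t :=
              fun l h => by have := congrArg Fin.val h; simp at this; omega
            simp [hje, this]
          · have hje' : j.val ≠ i.val := fun h => hje (Fin.ext h)
            have : (⟨j.val + n - 1, by omega⟩ : Fin p) ≠ t :=
              fun h => by have := congrArg Fin.val h; simp at this; omega
            simp [hji, hje, this]

/-- `f(φ w_1, …, φ w_i, g(w_{i+1}, …, w_{i+n}), w_{i+n+1}, …)`, as a multilinear map. -/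
def compWith {m n p : ℕ} (h : p + 1 = m + n) (i : Fin m) (φ : W →ₗ[K] W) (f : ML K W U m)
    (g : ML K W W n) : ML K W U p :=
  MultilinearMap.mk' (fun w => f (args h i φ g w))
    (fun w t x y => by
      obtain ⟨j, ψ, hψ⟩ := args_update h i φ g w t
      simp [hψ])
    (fun w t c x => by
      obtain ⟨j, ψ, hψ⟩ := args_update h i φ g w t
      simp [hψ])

theorem args_eq_update {m n p : ℕ} (h : p + 1 = m + n) (i : Fin m) (φ : W →ₗ[K] W)
    (g : ML K W W n) (w : Fin p → W) :
    args h i φ g w = Function.update (args h i φ 0 w) i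
      (g fun l => w ⟨i + l, by have := i.2; have := l.2; omega⟩) := by
  funext j
  by_cases hj : j = i
  · subst hj
    simp [args]
  · rw [Function.update_of_ne hj]
    simp [args, hj]

/-- The composition `f ∘ᵢ g` in the endomorphism operad: the value at `(w_1, w_2, …)` is
`(-1)^{|g|(|w_1| + ⋯ + |w_i|)} f(w_1, …, w_i, g(w_{i+1}, …, w_{i+n}), …)`, inputs of
`f` being counted from `0`. -/
def mlComp {m n p : ℕ} (h : p + 1 = m + n) (i : Fin m) :
    ML K W U m →ₗ[K] ML K W W n →ₗ[K] ML K W U p :=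
  LinearMap.mk₂ K
    (fun f g => compWith h i LinearMap.id f (proj (mlPar DGSpace.par n) false g) +
      compWith h i DGSpace.par f (proj (mlPar DGSpace.par n) true g))
    (fun f f' g => by ext w; simp [compWith]; abel)
    (fun c f g => by ext w; simp [compWith])
    (fun f g g' => by
      ext w
      simp only [compWith, MultilinearMap.mk'_apply, add_apply, map_add]
      rw [args_eq_update, args_eq_update h i _ (_ + _), args_eq_update h i _ (proj _ false g),
        args_eq_update h i _ (proj _ false g'), args_eq_update h i _ (proj _ true g),
        args_eq_update h i _ (proj _ true g')]
      simp only [add_apply, MultilinearMap.map_update_add]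
      abel)
    (fun c f g => by
      ext w
      simp only [compWith, MultilinearMap.mk'_apply, add_apply,
        smul_apply, map_smul]
      rw [args_eq_update, args_eq_update h i _ (c • proj _ true g),
        args_eq_update h i _ (proj _ false g), args_eq_update h i _ (proj _ true g)]
      simp only [smul_apply, MultilinearMap.map_update_smul, smul_add])

end Multilinear

/-- The endomorphism dg operad `End(W) = {Hom(W^{⊗ n}, W)}` of a dg vector space, including
`n = 0`. -/
def EndOp (K : Type u) [Field K] (W : Type w) [AddCommGroup W] [Module K W] [DGSpace K W] :
    DGAlg.{u, w} K opSig where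
  obj := fun n : ℕ => ML K W W n
  top _ := ⊥
  par := fun n : ℕ => mlPar DGSpace.par n
  d := fun n : ℕ => mlD DGSpace.par DGSpace.d n
  un := fun {_ _ : ℕ} (o : OpU _ _) => match o with
    | .perm e => mlPerm e
  bin := fun {_ _ _ : ℕ} (o : OpB _ _ _) => match o with
    | .comp h i => mlComp h i

section Cyclic

variable {K : Type u} [Field K] {W : Type w} [AddCommGroup W] [Module K W] [DGSpace K W]

/-- The form `ω(f(w_1, …, w_n), w_{n+1})` associated with `f`. -/
def toForm (ω : LinearMap.BilinForm K W) (n : ℕ) : ML K W W n →ₗ[K] ML K W K (n + 1) where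
  toFun f := (ω.compMultilinearMap f).uncurryRight
  map_add' f g := by ext; simp
  map_smul' c f := by ext; simp

variable [FiniteDimensional K W]

/-- The inverse of `toForm`: the map `g` with `ω(g(w_1, …, w_n), w_{n+1}) = G(w_1, …, w_{n+1})`. -/
def ofForm (ω : LinearMap.BilinForm K W) (hω : ω.Nondegenerate) (n : ℕ) :
    ML K W K (n + 1) →ₗ[K] ML K W W n where
  toFun G := (ω.toDual hω).symm.toLinearMap.compMultilinearMap G.curryRight
  map_add' f g := by
    ext w
    have : (f + g).curryRight w = f.curryRight w + g.curryRight w := by ext; simp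
    simp [this]
  map_smul' c f := by
    ext w
    have : (c • f).curryRight w = c • f.curryRight w := by ext; simp
    simp [this]

/-- The supertrace of the endomorphism `v ↦ v'` of `W` determined by `ω(v', v'') = T(v, v'')`. -/
def formTrace (ω : LinearMap.BilinForm K W) (hω : ω.Nondegenerate) :
    (W →ₗ[K] W →ₗ[K] K) →ₗ[K] K where
  toFun T := LinearMap.trace K W ((ω.toDual hω).symm.toLinearMap ∘ₗ T ∘ₗ DGSpace.par)
  map_add' S T := by rw [LinearMap.add_comp, LinearMap.comp_add, map_add]
  map_smul' c T := by rw [LinearMap.smul_comp, LinearMap.comp_smul, map_smul]; rfl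

/-- The contraction of the last two arguments of a form by means of `ω`. -/
def mlContr (ω : LinearMap.BilinForm K W) (hω : ω.Nondegenerate) (n : ℕ) :
    ML K W K (n + 2) →ₗ[K] ML K W K n where
  toFun H := (formTrace ω hω).compMultilinearMap H.curryRight.curryRight
  map_add' f g := by
    ext w
    have : (f + g).curryRight.curryRight w =
      f.curryRight.curryRight w + g.curryRight.curryRight w := by ext; simp
    simp [this]
  map_smul' c f := by
    ext w
    have : (c • f).curryRight.curryRight w = c • f.curryRight.curryRight w := by ext; simp
    simp [this]

/-- The unary operations of the endomorphism modular operad. -/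
def endModUn (ω : LinearMap.BilinForm K W) (hω : ω.Nondegenerate) :
    ∀ {s t : ℕ × ℕ}, ModU s t → (ML K W K s.2 →ₗ[K] ML K W K t.2)
  | _, _, .perm _ e => mlPerm e
  | _, _, .contr _ n => mlContr ω hω n

/-- The gluing operations of the endomorphism modular operad: turn the second form into an operation
whose output is its last leg, and insert it into the first form. -/
def endModBin (ω : LinearMap.BilinForm K W) (hω : ω.Nondegenerate) :
    ∀ {r s t : ℕ × ℕ}, ModB r s t → (ML K W K r.2 →ₗ[K] ML K W K s.2 →ₗ[K] ML K W K t.2)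
  | _, _, _, .comp (n := n) _ hp i => (mlComp hp i).compl₂ (ofForm ω hω n)

/-- The endomorphism modular operad of a finite-dimensional dg vector space `W` with an even
antisymmetric nondegenerate form `ω`: its part of genus `g` with `n` legs is
`Hom(W^{⊗ n}, K)`, for all `g`.  Through `toForm`, its genus zero part is the endomorphism operad
of `W`, and edges are contracted by means of `ω`. -/
def EndMod (ω : LinearMap.BilinForm K W) (hω : ω.Nondegenerate) :
    DGAlg.{u, max u w} K modSig where
  obj := fun s : ℕ × ℕ => ML K W K s.2
  top _ := ⊥
  par := fun s : ℕ × ℕ => mlPar LinearMap.id s.2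
  d := fun s : ℕ × ℕ => mlD LinearMap.id 0 s.2
  un o := endModUn ω hω o
  bin o := endModBin ω hω o

end Cyclic

/-- A symmetric (in the super sense) even nondegenerate scalar product on a dg vector space. -/
structure ScalarProduct (K : Type u) (V : Type w) [Field K] [AddCommGroup V] [Module K V]
    [DGSpace K V] where
  form : LinearMap.BilinForm K V
  even : ∀ a b, form (DGSpace.par (K := K) a) (DGSpace.par (K := K) b) = form a b
  symm : ∀ (p q : Bool) (a b : V), DGSpace.par (K := K) a = sgn K p • a →
    DGSpace.par (K := K) b = sgn K q • b → form a b = sgn K (p && q) * form b a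
  d_form : ∀ a b, form (DGSpace.d (K := K) a) b +
    form (DGSpace.par (K := K) a) (DGSpace.d (K := K) b) = 0
  nondeg : form.Nondegenerate

section Symplectic

variable {K : Type u} {V : Type w} [Field K] [AddCommGroup V] [Module K V] [DGSpace K V]

/-- The even symplectic form `ω(Πa, Πb) = (-1)^|a| ⟨a, b⟩` on `Π V`. -/
def ScalarProduct.omega (B : ScalarProduct K V) : LinearMap.BilinForm K (PiRev V) :=
  (B.form ∘ₗ (DGSpace.par : V →ₗ[K] V) : V →ₗ[K] V →ₗ[K] K)

theorem ScalarProduct.omega_nondeg (B : ScalarProduct K V) : B.omega.Nondegenerate := by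
  constructor
  · intro a h
    have h' : DGSpace.par (K := K) (V := V) a = 0 := B.nondeg.1 _ h
    have := DGSpace.par_par (K := K) (V := V) a
    rw [h', map_zero] at this
    exact this.symm
  · intro b h
    refine B.nondeg.2 b fun a => ?_
    have := h (DGSpace.par (K := K) (V := V) a)
    change B.form (DGSpace.par (K := K) (DGSpace.par (K := K) (V := V) a)) b = 0 at this
    rwa [DGSpace.par_par] at this

end Symplectic

/-! ## Formal cdgas and coefficients -/

/-- The product `f 0 * f 1 * ⋯ * f r`. -/
def nprod {N : Type v} [Mul N] (f : ℕ → N) : ℕ → N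
  | 0 => f 0
  | r + 1 => nprod f r * f (r + 1)

/-- A finite-dimensional nilpotent non-unital (super-)commutative dg algebra. -/
class NilCDGA (K : Type u) (N : Type v) [Field K] [NonUnitalRing N] [Module K N] extends
    DGSpace K N where
  par_mul : ∀ a b : N, par (a * b) = par a * par b
  d_mul : ∀ a b : N, d (a * b) = d a * b + par a * d b
  comm : ∀ (p q : Bool) (a b : N), par a = sgn K p • a → par b = sgn K q • b →
    a * b = sgn K (p && q) • (b * a)
  finite : FiniteDimensional K N
  nilpotent : ∃ r, ∀ f : ℕ → N, nprod f r = 0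

/-- (The augmentation ideal `A₊` of) a formal cdga `A = K ⊕ A₊`: a directed inverse system of
finite-dimensional nilpotent non-unital cdgas, of which `A₊` is the limit. -/
structure FormalCDGA (K : Type u) [Field K] where
  ι : Type v
  [pre : Preorder ι]
  [dir : IsDirectedOrder ι]
  [ne : Nonempty ι]
  N : ι → Type v
  [ring : ∀ i, NonUnitalRing (N i)]
  [mod : ∀ i, Module K (N i)]
  [tower : ∀ i, IsScalarTower K (N i) (N i)]
  [scomm : ∀ i, SMulCommClass K (N i) (N i)]
  [cdga : ∀ i, NilCDGA K (N i)]
  map : ∀ {i j : ι}, i ≤ j → N j →ₗ[K] N i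
  map_mul : ∀ {i j : ι} (h : i ≤ j) (a b : N j), map h (a * b) = map h a * map h b
  map_par : ∀ {i j : ι} (h : i ≤ j) (a : N j),
    map h (DGSpace.par (K := K) a) = DGSpace.par (K := K) (map h a)
  map_d : ∀ {i j : ι} (h : i ≤ j) (a : N j),
    map h (DGSpace.d (K := K) a) = DGSpace.d (K := K) (map h a)
  map_refl : ∀ (i : ι) (a : N i), map (le_refl i) a = a
  map_trans : ∀ {i j k : ι} (h : i ≤ j) (h' : j ≤ k) (a : N k),
    map h (map h' a) = map (h.trans h') a

attribute [instance] FormalCDGA.pre FormalCDGA.dir FormalCDGA.ne FormalCDGA.ring FormalCDGA.mod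
  FormalCDGA.tower FormalCDGA.scomm FormalCDGA.cdga

section Coefficients

open TensorProduct

variable {K : Type u} [Field K] {sg : Sig}

/-- The tensor product `N ⊗ P`, with `d(a ⊗ f) = da ⊗ f + (-1)^|a| a ⊗ df` and
`(a ⊗ f) ∘ (b ⊗ g) = (-1)^{|f||b|} ab ⊗ (f ∘ g)`. -/
def tensor (N : Type v) [NonUnitalRing N] [Module K N] [IsScalarTower K N N]
    [SMulCommClass K N N] [NilCDGA K N] (P : DGAlg.{u, w} K sg) : DGAlg.{u, max v w} K sg where
  obj s := N ⊗[K] P.obj s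
  top _ := ⊥
  par s := TensorProduct.map DGSpace.par (P.par s)
  d s := TensorProduct.map DGSpace.d LinearMap.id + TensorProduct.map DGSpace.par (P.d s)
  un o := TensorProduct.map LinearMap.id (P.un o)
  bin {r _ _} o :=
    TensorProduct.map₂ ((LinearMap.mul K N).compl₂ (proj DGSpace.par false)) (P.bin o) +
    TensorProduct.map₂ ((LinearMap.mul K N).compl₂ (proj DGSpace.par true)) (P.bin o ∘ₗ P.par r)

/-- Change of coefficients. -/
def tensorMap {N N' : Type v} [NonUnitalRing N] [Module K N] [IsScalarTower K N N]
    [SMulCommClass K N N] [NilCDGA K N] [NonUnitalRing N'] [Module K N'] [IsScalarTower K N' N']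
    [SMulCommClass K N' N'] [NilCDGA K N'] (P : DGAlg.{u, w} K sg) (f : N →ₗ[K] N')
    (h_mul : ∀ a b, f (a * b) = f a * f b)
    (h_par : ∀ a, f (DGSpace.par (K := K) a) = DGSpace.par (K := K) (f a))
    (h_d : ∀ a, f (DGSpace.d (K := K) a) = DGSpace.d (K := K) (f a)) :
    Hom (tensor N P) (tensor N' P) where
  map s := TensorProduct.map f LinearMap.id
  cont _ := continuous_bot
  map_par s a := by
    change TensorProduct.map f LinearMap.id (TensorProduct.map DGSpace.par (P.par s) a) =
      TensorProduct.map DGSpace.par (P.par s) (TensorProduct.map f LinearMap.id a)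
    induction a using TensorProduct.induction_on with
    | zero => simp
    | tmul a b => simp [h_par]
    | add a b ha hb => simp only [map_add, ha, hb]
  map_d s a := by
    change TensorProduct.map f LinearMap.id
        (TensorProduct.map DGSpace.d (LinearMap.id : P.obj s →ₗ[K] P.obj s) a +
          TensorProduct.map DGSpace.par (P.d s) a) =
      TensorProduct.map DGSpace.d (LinearMap.id : P.obj s →ₗ[K] P.obj s)
        (TensorProduct.map f LinearMap.id a) +
      TensorProduct.map DGSpace.par (P.d s) (TensorProduct.map f LinearMap.id a)
    induction a using TensorProduct.induction_on with
    | zero => simp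
    | tmul a b => simp [h_par, h_d]
    | add a b ha hb =>
      simp only [map_add] at ha hb ⊢
      rw [add_add_add_comm, ha, hb]
      abel
  map_un {s t} o a := by
    change TensorProduct.map f LinearMap.id (TensorProduct.map LinearMap.id (P.un o) a) =
      TensorProduct.map LinearMap.id (P.un o) (TensorProduct.map f LinearMap.id a)
    induction a using TensorProduct.induction_on with
    | zero => simp
    | tmul a b => simp
    | add a b ha hb => simp only [map_add, ha, hb]
  map_bin {r s t} o a b := by
    have hp : ∀ (q : Bool) (c : N), f (proj (K := K) DGSpace.par q c) =
        proj (K := K) DGSpace.par q (f c) := by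
      intro q c
      cases q <;> simp [proj, h_par]
    have key : ∀ (Φ : N ⊗[K] P.obj r →ₗ[K] N ⊗[K] P.obj s →ₗ[K] N ⊗[K] P.obj t)
        (Φ' : N' ⊗[K] P.obj r →ₗ[K] N' ⊗[K] P.obj s →ₗ[K] N' ⊗[K] P.obj t)
        (_ : ∀ a b c e, TensorProduct.map f LinearMap.id (Φ (a ⊗ₜ c) (b ⊗ₜ e)) =
          Φ' (f a ⊗ₜ c) (f b ⊗ₜ e)) (a) (b),
        TensorProduct.map f LinearMap.id (Φ a b) =
          Φ' (TensorProduct.map f LinearMap.id a) (TensorProduct.map f LinearMap.id b) := by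
      intro Φ Φ' hΦ a b
      induction a using TensorProduct.induction_on with
      | zero => simp
      | add a a' ha ha' => simp only [map_add, LinearMap.add_apply, ha, ha']
      | tmul a c =>
        induction b using TensorProduct.induction_on with
        | zero => simp
        | add b b' hb hb' => simp only [map_add, hb, hb']
        | tmul b e => simp [hΦ]
    refine key _ _ (fun a b c e => ?_) a b
    simp [tensor, h_mul, hp]

/-- The topological dg (modular) operad `A₊ ⊗ P`: the inverse limit of the `N_i ⊗ P`. -/
def FormalCDGA.coeff (A : FormalCDGA.{u, v} K) (P : DGAlg.{u, w} K sg) :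
    DGAlg.{u, max v w} K sg :=
  lim (fun i : A.ι => tensor (A.N i) P)
    (fun h => tensorMap P (A.map h) (A.map_mul h) (A.map_par h) (A.map_d h))

theorem map_map_comm {M M' E E' : Type*} [AddCommGroup M] [AddCommGroup M'] [AddCommGroup E]
    [AddCommGroup E'] [Module K M] [Module K M'] [Module K E] [Module K E'] (f : M →ₗ[K] M')
    (g : E →ₗ[K] E') (z : M ⊗[K] E) :
    TensorProduct.map f LinearMap.id (TensorProduct.map LinearMap.id g z) =
      TensorProduct.map LinearMap.id g (TensorProduct.map f LinearMap.id z) := by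
  induction z using TensorProduct.induction_on with
  | zero => simp
  | tmul a b => simp
  | add a b ha hb => simp only [map_add, ha, hb]

/-- The map `A₊ ⊗ End(W)(n) → A₊ ⊗ Hom(W^{⊗ (n+1)}, K)` induced by `toForm`. -/
def FormalCDGA.toForm (A : FormalCDGA.{u, v} K) {W : Type w} [AddCommGroup W] [Module K W]
    [DGSpace K W] [FiniteDimensional K W] (ω : LinearMap.BilinForm K W) (hω : ω.Nondegenerate)
    (n : ℕ) (a : (A.coeff (EndOp K W)).obj n) :
    (A.coeff (EndMod ω hω)).obj ((0, n + 1) : ℕ × ℕ) :=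
  ⟨fun i => TensorProduct.map LinearMap.id (MCTwist.toForm ω n) (Subtype.val a i), fun i j h => by
    have h1 := Subtype.property a i j h
    dsimp only
    rw [← h1]
    change TensorProduct.map (A.map h) LinearMap.id
        (TensorProduct.map LinearMap.id (MCTwist.toForm ω n) (Subtype.val a j)) =
      TensorProduct.map LinearMap.id (MCTwist.toForm ω n)
        (TensorProduct.map (A.map h) LinearMap.id (Subtype.val a j))
    exact map_map_comm _ _ _⟩

end Coefficients

/-! ## Maurer-Cartan elements and twisting -/

section MC

variable {K : Type u} [Field K]

/-- The operations `m_1, m_2, …` of an algebra structure `φ : L∞ → P` or `φ : A∞ → P`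
(with `m_0 = 0`). -/
def ops {kind : Kind} {P : DGAlg.{u, v} K opSig} (φ : Hom (Inf K kind) P) (n : ℕ) : P.obj n :=
  φ.map n (infM K kind n)

/-- `ξ` is a Maurer-Cartan element: it is even and `d ξ = ∑_{n ≥ 1} m_n(ξ, …, ξ)`, with
coefficients `1/n!` in the Lie case. -/
def IsMC (kind : Kind) (P : DGAlg.{u, v} K opSig) (m : ∀ n : ℕ, P.obj n)
    (ξ : P.obj (0 : ℕ)) : Prop :=
  P.par (0 : ℕ) ξ = ξ ∧ HasSum (fun n : ℕ => mcTerm kind P m ξ (n + 1)) (P.d (0 : ℕ) ξ)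

/-- A formal vector field is given by its Taylor coefficients `X_n`, `n ≥ 0` (derivations of the
completed symmetric, respectively tensor, algebra of the dual space).  `adv ξ X` is the commutator
`[ξ, X]` with the constant even vector field `ξ`, i.e. the derivative of `X` in the direction of
`ξ`. -/
def adv (kind : Kind) (P : DGAlg.{u, v} K opSig) (ξ : P.obj (0 : ℕ)) (X : ∀ n : ℕ, P.obj n) :
    ∀ n : ℕ, P.obj n := fun n =>
  match kind with
  | .lie => P.comp (m := n + 1) (n := 0) (p := n) (by omega) 0 (X (n + 1)) ξ
  | .ass => ∑ i : Fin (n + 1), P.comp (m := n + 1) (n := 0) (p := n) (by omega) i (X (n + 1)) ξ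

/-- The constant vector field `z`. -/
def constField (P : DGAlg.{u, v} K opSig) (z : P.obj (0 : ℕ)) : ∀ n : ℕ, P.obj n
  | 0 => z
  | _ + 1 => 0

/-- `m'` is the twist `m^ξ = e^ξ m e^{-ξ} - d ξ` of the vector field `m`, where
`e^ξ m e^{-ξ} = ∑_j (ad ξ)^j m / j!` and `d ξ` is regarded as a constant vector field. -/
def IsTwist (kind : Kind) (P : DGAlg.{u, v} K opSig) (m : ∀ n : ℕ, P.obj n)
    (ξ : P.obj (0 : ℕ)) (m' : ∀ n : ℕ, P.obj n) : Prop :=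
  ∀ n : ℕ, HasSum (fun j : ℕ => (j.factorial : K)⁻¹ • ((adv kind P ξ)^[j] m) n)
    (m' n + constField P (P.d (0 : ℕ) ξ) n)

/-- The algebra structure `f` over the completed operad determines the pair consisting of the
`L∞` or `A∞` structure `φ` and the element `ξ`. -/
def Determines {kind : Kind} {P : DGAlg.{u, v} K opSig} (f : Hom (Curly K kind) P)
    (φ : Hom (Inf K kind) P) (ξ : P.obj (0 : ℕ)) : Prop :=
  (∀ n : ℕ, f.map n (curlyM K kind n) = ops φ n) ∧ f.map (0 : ℕ) (curlyX K kind) = ξ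

variable {V : Type w} [AddCommGroup V] [Module K V] [DGSpace K V] [FiniteDimensional K V]

/-- The structure `φ` is cyclic: the forms `ω(m_n(w_1, …, w_n), w_{n+1})` are invariant under all
permutations (Lie case) or cyclic permutations (associative case) of the arguments. -/
def IsCyclicStr {kind : Kind} (A : FormalCDGA.{u, v} K) (B : ScalarProduct K V)
    (φ : Hom (Inf K kind) (A.coeff (EndOp K (PiRev V)))) : Prop :=
  ∀ (n : ℕ) (σ : Equiv.Perm (Fin (n + 1))), LegSym kind n σ →
    (A.coeff (EndMod B.omega B.omega_nondeg)).mperm 0 σ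
      (A.toForm B.omega B.omega_nondeg n (ops φ n)) = A.toForm B.omega B.omega_nondeg n (ops φ n)

/-- The modular algebra structure `F` determines the cyclic structure `φ` and the element `ξ`. -/
def DeterminesMod {kind : Kind} {A : FormalCDGA.{u, v} K} {B : ScalarProduct K V}
    (F : Hom (CurlyMod K kind) (A.coeff (EndMod B.omega B.omega_nondeg)))
    (φ : Hom (Inf K kind) (A.coeff (EndOp K (PiRev V))))
    (ξ : (A.coeff (EndOp K (PiRev V))).obj (0 : ℕ)) : Prop :=
  (∀ n : ℕ, F.map ((0, n + 1) : ℕ × ℕ) (curlyModM K kind n) =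
    A.toForm B.omega B.omega_nondeg n (ops φ n)) ∧
  F.map ((0, 1) : ℕ × ℕ) (curlyModX K kind) = A.toForm B.omega B.omega_nondeg 0 ξ

end MC

end MCTwist

end

open MCTwist

universe w'

noncomputable section

namespace MCTwist

open TensorProduct

section Generic

variable {K : Type u} [Field K] {sg : Sig}

/-- The laws of a dg algebra over a signature: `par` is an involution, `d` is an odd operator of
square zero, all operations are even and `d` is a derivation with respect to them. -/
structure DGAlg.IsDG (P : DGAlg.{u, v} K sg) : Prop where
  par_par : ∀ s a, P.par s (P.par s a) = a
  d_d : ∀ s a, P.d s (P.d s a) = 0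
  d_par : ∀ s a, P.d s (P.par s a) = - P.par s (P.d s a)
  un_par : ∀ {s t} (o : sg.U s t) a, P.par t (P.un o a) = P.un o (P.par s a)
  un_d : ∀ {s t} (o : sg.U s t) a, P.d t (P.un o a) = P.un o (P.d s a)
  bin_par : ∀ {r s t} (o : sg.B r s t) a b, P.par t (P.bin o a b) = P.bin o (P.par r a) (P.par s b)
  bin_d : ∀ {r s t} (o : sg.B r s t) a b,
    P.d t (P.bin o a b) = P.bin o (P.d r a) b + P.bin o (P.par r a) (P.d s b)

/-- Composition of morphisms, first `f` and then `g`. -/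
def Hom.comp' {P Q R : DGAlg K sg} (f : Hom P Q) (g : Hom Q R) : Hom P R where
  map s := g.map s ∘ₗ f.map s
  cont s := (g.cont s).comp (f.cont s)
  map_par s a := by simp [f.map_par, g.map_par]
  map_d s a := by simp [f.map_d, g.map_d]
  map_un o a := by simp [f.map_un, g.map_un]
  map_bin o a b := by simp [f.map_bin, g.map_bin]

theorem Hom.ext_map {P : DGAlg.{u, v} K sg} {Q : DGAlg.{u, w} K sg} {f g : Hom P Q}
    (h : ∀ s a, f.map s a = g.map s a) : f = g := by
  have : f.map = g.map := funext fun s => LinearMap.ext (h s)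
  cases f; cases g; cases this; rfl

theorem sgn_mul_self (q : Bool) : sgn K q * sgn K q = 1 := by cases q <;> simp [sgn]

theorem sgn_xor (p q : Bool) : sgn K (xor p q) = sgn K p * sgn K q := by
  cases p <;> cases q <;> simp [sgn]

@[simp] theorem sgn_true : sgn K true = -1 := rfl
@[simp] theorem sgn_false : sgn K false = 1 := rfl

/-! ### The free dg algebra -/

variable {G : sg.S → Type} {p : ∀ s, G s → Bool}

/-- A monomial, as an element of the free dg algebra. -/
def freeMono (p : ∀ s, G s → Bool) {s : sg.S} (x : Mono sg G s) : (free K sg G p).obj s :=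
  (Finsupp.single x (1 : K) : Mono sg G s →₀ K)

theorem free_induction {s : sg.S} {motive : (free K sg G p).obj s → Prop} (zero : motive 0)
    (add : ∀ a b, motive a → motive b → motive (a + b))
    (smul : ∀ (c : K) a, motive a → motive (c • a))
    (mono : ∀ x : Mono sg G s, motive (freeMono p x)) (a : (free K sg G p).obj s) : motive a := by
  refine Finsupp.induction_linear (M := K) (motive := fun a => motive a) a zero
    (fun f g hf hg => add f g hf hg) (fun x c => ?_)
  have := smul c _ (mono x)
  have e : (c • freeMono p x : (free K sg G p).obj s) = (Finsupp.single x c : Mono sg G s →₀ K) := by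
    change c • (Finsupp.single x (1 : K) : Mono sg G s →₀ K) = _
    simp
  rwa [e] at this

theorem free_par_mono {s : sg.S} (x : Mono sg G s) :
    (free K sg G p).par s (freeMono p x) = sgn K (x.odd p) • freeMono p x := by
  change Finsupp.linearCombination K _ (Finsupp.single x (1 : K)) =
    sgn K (x.odd p) • (Finsupp.single x (1 : K) : Mono sg G s →₀ K)
  simp [Finsupp.linearCombination_single]

theorem free_d_mono {s : sg.S} (x : Mono sg G s) :
    (free K sg G p).d s (freeMono p x) = (x.diff K p : Mono sg G s →₀ K) := by
  have : Finsupp.linearCombination K (fun x : Mono sg G s => x.diff K p)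
      (Finsupp.single x (1 : K)) = x.diff K p := by
    simp [Finsupp.linearCombination_single]
  exact this

theorem free_un_mono {s t : sg.S} (o : sg.U s t) (x : Mono sg G s) :
    (free K sg G p).un o (freeMono p x) = freeMono p (.un o x) := by
  exact Finsupp.mapDomain_single

theorem free_bin_mono {r s t : sg.S} (o : sg.B r s t) (x : Mono sg G r) (y : Mono sg G s) :
    (free K sg G p).bin o (freeMono p x) (freeMono p y) = freeMono p (.bin o x y) := by
  have : freeBin K o (Finsupp.single x (1 : K)) (Finsupp.single y (1 : K)) =
      Finsupp.single (Mono.bin o x y) 1 := by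
    simp [freeBin, Finsupp.linearCombination_single, Finsupp.lmapDomain_apply]
  exact this

theorem free_d_bin_mono {r s t : sg.S} (o : sg.B r s t) (x : Mono sg G r) (y : Mono sg G s) :
    (free K sg G p).d t (freeMono p (.bin o x y)) =
      (free K sg G p).bin o ((free K sg G p).d r (freeMono p x)) (freeMono p y) +
      sgn K (x.odd p) • (free K sg G p).bin o (freeMono p x) ((free K sg G p).d s (freeMono p y)) := by
  rw [free_d_mono, free_d_mono, free_d_mono]
  rfl

theorem free_d_un_mono {s t : sg.S} (o : sg.U s t) (x : Mono sg G s) :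
    (free K sg G p).d t (freeMono p (.un o x)) =
      (free K sg G p).un o ((free K sg G p).d s (freeMono p x)) := by
  rw [free_d_mono, free_d_mono]
  rfl

/-- Bilinear identities in the free dg algebra hold if they hold on monomials. -/
theorem free_induction₂ {r s : sg.S} {V : Type*} [AddCommGroup V] [Module K V]
    (f g : (free K sg G p).obj r →ₗ[K] (free K sg G p).obj s →ₗ[K] V)
    (h : ∀ x y, f (freeMono p x) (freeMono p y) = g (freeMono p x) (freeMono p y)) (a b) :
    f a b = g a b := by
  induction a using free_induction with
  | zero => simp
  | add a a' h1 h2 => simp [h1, h2]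
  | smul c a h1 => simp [h1]
  | mono x =>
    induction b using free_induction with
    | zero => simp
    | add a a' h1 h2 => simp [h1, h2]
    | smul c a h1 => simp [h1]
    | mono y => exact h x y

theorem free_isDG (p : ∀ s, G s → Bool) : (free K sg G p).IsDG := by
  have un_par : ∀ {s t} (o : sg.U s t) a, (free K sg G p).par t ((free K sg G p).un o a) =
      (free K sg G p).un o ((free K sg G p).par s a) := by
    intro s t o a
    induction a using free_induction with
    | zero => simp
    | add a a' h1 h2 => simp [h1, h2]
    | smul c a h1 => simp [h1]
    | mono x => rw [free_un_mono, free_par_mono, free_par_mono, map_smul, free_un_mono]; rfl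
  have bin_par : ∀ {r s t} (o : sg.B r s t) a b,
      (free K sg G p).par t ((free K sg G p).bin o a b) =
        (free K sg G p).bin o ((free K sg G p).par r a) ((free K sg G p).par s b) := by
    intro r s t o a b
    refine free_induction₂ (((free K sg G p).bin o).compr₂ ((free K sg G p).par t))
      (((free K sg G p).bin o).compl₁₂ ((free K sg G p).par r) ((free K sg G p).par s)) ?_ a b
    intro x y
    simp only [LinearMap.compr₂_apply, LinearMap.compl₁₂_apply, free_bin_mono, free_par_mono,
      map_smul, LinearMap.smul_apply, smul_smul]
    congr 1
    rw [← sgn_xor, Bool.xor_comm]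
    rfl
  have un_d : ∀ {s t} (o : sg.U s t) a, (free K sg G p).d t ((free K sg G p).un o a) =
      (free K sg G p).un o ((free K sg G p).d s a) := by
    intro s t o a
    induction a using free_induction with
    | zero => simp
    | add a a' h1 h2 => simp [h1, h2]
    | smul c a h1 => simp [h1]
    | mono x => rw [free_un_mono, free_d_un_mono]
  have bin_d : ∀ {r s t} (o : sg.B r s t) a b,
      (free K sg G p).d t ((free K sg G p).bin o a b) =
        (free K sg G p).bin o ((free K sg G p).d r a) b +
        (free K sg G p).bin o ((free K sg G p).par r a) ((free K sg G p).d s b) := by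
    intro r s t o a b
    refine free_induction₂ (((free K sg G p).bin o).compr₂ ((free K sg G p).d t))
      (((free K sg G p).bin o).comp ((free K sg G p).d r) +
        ((free K sg G p).bin o).compl₁₂ ((free K sg G p).par r) ((free K sg G p).d s)) ?_ a b
    intro x y
    simp only [LinearMap.compr₂_apply, LinearMap.compl₁₂_apply, free_bin_mono, free_par_mono,
      map_smul, LinearMap.smul_apply, LinearMap.add_apply, LinearMap.comp_apply, free_d_bin_mono]
  have par_par : ∀ s a, (free K sg G p).par s ((free K sg G p).par s a) = a := by
    intro s a
    induction a using free_induction with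
    | zero => simp
    | add a a' h1 h2 => simp [h1, h2]
    | smul c a h1 => simp [h1]
    | mono x => rw [free_par_mono, map_smul, free_par_mono, smul_smul, sgn_mul_self, one_smul]
  have par_d_mono : ∀ {s} (x : Mono sg G s), (free K sg G p).par s ((free K sg G p).d s
      (freeMono p x)) = - sgn K (x.odd p) • (free K sg G p).d s (freeMono p x) := by
    intro s x
    induction x with
    | leaf g b =>
      cases b
      · have : (free K sg G p).d _ (freeMono p (.leaf g false)) = freeMono p (.leaf g true) := by
          rw [free_d_mono]; rfl
        rw [this, free_par_mono]
        simp only [Mono.odd, sgn_xor]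
        simp
      · have : (free K sg G p).d _ (freeMono p (.leaf g true)) = 0 := by
          rw [free_d_mono]; rfl
        rw [this]; simp
    | un o x ih => rw [free_d_un_mono, un_par, ih, map_smul]; rfl
    | bin o x y ihx ihy =>
      rw [free_d_bin_mono]
      simp only [map_add, map_smul, bin_par, ihx, ihy, free_par_mono, LinearMap.smul_apply,
        smul_add, Mono.odd, sgn_xor, LinearMap.neg_apply, neg_smul, map_neg]
      cases Mono.odd p x <;> cases Mono.odd p y <;> simp
  refine ⟨par_par, ?_, ?_, un_par, un_d, bin_par, bin_d⟩
  · intro s a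
    induction a using free_induction with
    | zero => simp
    | add a a' h1 h2 => simp [h1, h2]
    | smul c a h1 => simp [h1]
    | mono x =>
      induction x with
      | leaf g b =>
        have : (free K sg G p).d _ (freeMono p (.leaf g true)) = 0 := by
          rw [free_d_mono]; rfl
        cases b
        · have h : (free K sg G p).d _ (freeMono p (.leaf g false)) = freeMono p (.leaf g true) := by
            rw [free_d_mono]; rfl
          rw [h, this]
        · rw [this, map_zero]
      | un o x ih => rw [free_d_un_mono, un_d, ih, map_zero]
      | bin o x y ihx ihy =>
        rw [free_d_bin_mono]
        simp only [map_add, map_smul, bin_d, ihx, ihy, par_d_mono, free_par_mono]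
        simp
  · intro s a
    induction a using free_induction with
    | zero => simp
    | add a a' h1 h2 => simp only [map_add, h1, h2, neg_add]
    | smul c a h1 => simp [h1]
    | mono x => rw [par_d_mono, free_par_mono, map_smul]; simp

/-- The value of a monomial for given values of the generators. -/
def Mono.eval (Q : DGAlg.{u, v} K sg) (q : ∀ s, G s → Q.obj s) :
    ∀ {s : sg.S}, Mono sg G s → Q.obj s
  | _, .leaf g b => if b then Q.d _ (q _ g) else q _ g
  | _, .un o x => Q.un o (Mono.eval Q q x)
  | _, .bin o x y => Q.bin o (Mono.eval Q q x) (Mono.eval Q q y)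

/-- The linear extension of `Mono.eval`. -/
def freeLiftFun (p : ∀ s, G s → Bool) (Q : DGAlg.{u, v} K sg) (q : ∀ s, G s → Q.obj s) (s : sg.S) :
    (free K sg G p).obj s →ₗ[K] Q.obj s :=
  Finsupp.linearCombination K (fun x : Mono sg G s => x.eval Q q)

theorem freeLiftFun_mono (Q : DGAlg.{u, v} K sg) (q : ∀ s, G s → Q.obj s) {s : sg.S}
    (x : Mono sg G s) : freeLiftFun p Q q s (freeMono p x) = x.eval Q q := by
  change Finsupp.linearCombination K _ (Finsupp.single x (1 : K)) = _
  simp [Finsupp.linearCombination_single]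

/-- The morphism from the free dg algebra with given values on the generators. -/
def freeLift (p : ∀ s, G s → Bool) {Q : DGAlg.{u, v} K sg} (hQ : Q.IsDG) (q : ∀ s, G s → Q.obj s)
    (hq : ∀ s g, Q.par s (q s g) = sgn K (p s g) • q s g) : Hom (free K sg G p) Q where
  map := freeLiftFun p Q q
  cont _ := continuous_bot
  map_par s a := by
    induction a using free_induction with
    | zero => simp
    | add a a' h1 h2 => simp only [map_add, h1, h2]
    | smul c a h1 => simp [h1]
    | mono x =>
      rw [free_par_mono, map_smul, freeLiftFun_mono]
      induction x with
      | leaf g b =>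
        cases b
        · simp [Mono.eval, Mono.odd, hq]
        · have h := hQ.d_par _ (q _ g)
          rw [hq, map_smul] at h
          simp only [Mono.eval, Mono.odd, if_true, sgn_xor, sgn_true, mul_neg, mul_one, neg_smul, h,
            neg_neg]
      | un o x ih => simp only [Mono.eval, Mono.odd, hQ.un_par, ← ih, map_smul]
      | bin o x y ihx ihy =>
        simp only [Mono.eval, Mono.odd, hQ.bin_par, ← ihx, ← ihy, map_smul, sgn_xor,
          LinearMap.smul_apply, smul_smul, mul_comm]
  map_un o a := by
    induction a using free_induction with
    | zero => simp
    | add a a' h1 h2 => simp only [map_add, h1, h2]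
    | smul c a h1 => simp [h1]
    | mono x => rw [free_un_mono, freeLiftFun_mono, freeLiftFun_mono]; rfl
  map_bin {r s t} o a b := by
    refine free_induction₂ (((free K sg G p).bin o).compr₂ (freeLiftFun p Q q t))
      ((Q.bin o).compl₁₂ (freeLiftFun p Q q r) (freeLiftFun p Q q s)) ?_ a b
    intro x y
    simp only [LinearMap.compr₂_apply, LinearMap.compl₁₂_apply, free_bin_mono, freeLiftFun_mono]
    rfl
  map_d s a := by
    have hpar : ∀ {s} (x : Mono sg G s), Q.par s (x.eval Q q) = sgn K (x.odd p) • x.eval Q q := by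
      intro s x
      induction x with
      | leaf g b =>
        cases b
        · simp [Mono.eval, Mono.odd, hq]
        · have h := hQ.d_par _ (q _ g)
          rw [hq, map_smul] at h
          simp only [Mono.eval, Mono.odd, if_true, sgn_xor, sgn_true, mul_neg, mul_one, neg_smul, h,
            neg_neg]
      | un o x ih => simp only [Mono.eval, Mono.odd, hQ.un_par, ih, map_smul]
      | bin o x y ihx ihy =>
        simp only [Mono.eval, Mono.odd, hQ.bin_par, ihx, ihy, map_smul, sgn_xor,
          LinearMap.smul_apply, smul_smul, mul_comm]
    have hun : ∀ {s t} (o : sg.U s t) a, freeLiftFun p Q q t ((free K sg G p).un o a) =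
        Q.un o (freeLiftFun p Q q s a) := by
      intro s t o a
      induction a using free_induction with
      | zero => simp
      | add a a' h1 h2 => simp only [map_add, h1, h2]
      | smul c a h1 => simp [h1]
      | mono x => rw [free_un_mono, freeLiftFun_mono, freeLiftFun_mono]; rfl
    have hbin : ∀ {r s t} (o : sg.B r s t) a b, freeLiftFun p Q q t ((free K sg G p).bin o a b) =
        Q.bin o (freeLiftFun p Q q r a) (freeLiftFun p Q q s b) := by
      intro r s t o a b
      refine free_induction₂ (((free K sg G p).bin o).compr₂ (freeLiftFun p Q q t))
        ((Q.bin o).compl₁₂ (freeLiftFun p Q q r) (freeLiftFun p Q q s)) ?_ a b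
      intro x y
      simp only [LinearMap.compr₂_apply, LinearMap.compl₁₂_apply, free_bin_mono, freeLiftFun_mono]
      rfl
    induction a using free_induction with
    | zero => simp
    | add a a' h1 h2 => simp only [map_add, h1, h2]
    | smul c a h1 => simp [h1]
    | mono x =>
      rw [freeLiftFun_mono]
      induction x with
      | leaf g b =>
        cases b
        · have h : (free K sg G p).d _ (freeMono p (.leaf g false)) = freeMono p (.leaf g true) := by
            rw [free_d_mono]; rfl
          rw [h, freeLiftFun_mono]; simp [Mono.eval]
        · have h : (free K sg G p).d _ (freeMono p (.leaf g true)) = 0 := by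
            rw [free_d_mono]; rfl
          rw [h]; simp [Mono.eval, hQ.d_d]
      | un o x ih => rw [free_d_un_mono, hun, ih, ← hQ.un_d]; rfl
      | bin o x y ihx ihy =>
        rw [free_d_bin_mono, map_add, map_smul, hbin, hbin, ihx, ihy]
        simp only [Mono.eval, hQ.bin_d, hpar, freeLiftFun_mono, map_smul, LinearMap.smul_apply]

theorem freeLift_gen {Q : DGAlg.{u, v} K sg} (hQ : Q.IsDG) (q : ∀ s, G s → Q.obj s)
    (hq : ∀ s g, Q.par s (q s g) = sgn K (p s g) • q s g) {s : sg.S} (g : G s) :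
    (freeLift p hQ q hq).map s (freeGen K p g) = q s g := by
  change freeLiftFun p Q q s (freeMono p (.leaf g false)) = _
  rw [freeLiftFun_mono]
  simp [Mono.eval]

/-- A morphism from the free dg algebra is determined by its values on the generators. -/
theorem free_hom_ext {Q : DGAlg.{u, v} K sg} {f f' : Hom (free K sg G p) Q}
    (h : ∀ s (g : G s), f.map s (freeGen K p g) = f'.map s (freeGen K p g)) : f = f' := by
  refine Hom.ext_map fun s a => ?_
  induction a using free_induction with
  | zero => simp
  | add a a' h1 h2 => simp only [map_add, h1, h2]
  | smul c a h1 => simp [h1]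
  | mono x =>
    induction x with
    | leaf g b =>
      cases b
      · exact h _ g
      · have e : freeMono p (.leaf g true) = (free K sg G p).d _ (freeGen K p g) := by
          change _ = (free K sg G p).d _ (freeMono p (.leaf g false))
          rw [free_d_mono]; rfl
        rw [e, f.map_d, f'.map_d, h]
    | un o x ih => rw [← free_un_mono, f.map_un, f'.map_un, ih]
    | bin o x y ihx ihy => rw [← free_bin_mono, f.map_bin, f'.map_bin, ihx, ihy]

/-! ### Quotients -/

theorem quotMk_surjective (P : DGAlg.{u, v} K sg) (R : ∀ s, P.obj s → Prop) {s : sg.S}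
    (a : (quot P R).obj s) : ∃ b : P.obj s, quotMk P R b = a :=
  Submodule.Quotient.mk_surjective _ a

theorem quotMk_eq_zero {P : DGAlg.{u, v} K sg} {R : ∀ s, P.obj s → Prop} {s : sg.S}
    {a : P.obj s} (h : R s a) : quotMk P R a = 0 :=
  (Submodule.Quotient.mk_eq_zero _).2 (InIdeal.of h)

/-- The projection to the quotient. -/
def quotHom (P : DGAlg.{u, v} K sg) (hP : ∀ s, (P.top s) = ⊥) (R : ∀ s, P.obj s → Prop) :
    Hom P (quot P R) where
  map s := (ideal P R s).mkQ
  cont s := by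
    have := hP s
    rw [continuous_def]
    intro U _
    rw [this]
    trivial
  map_par _ _ := rfl
  map_d _ _ := rfl
  map_un _ _ := rfl
  map_bin _ _ _ := rfl

theorem quot_isDG {P : DGAlg.{u, v} K sg} (hP : P.IsDG) (R : ∀ s, P.obj s → Prop) :
    (quot P R).IsDG where
  par_par s a := by
    obtain ⟨a, rfl⟩ := quotMk_surjective P R a
    exact congrArg (quotMk P R) (hP.par_par s a)
  d_d s a := by
    obtain ⟨a, rfl⟩ := quotMk_surjective P R a
    exact (congrArg (quotMk P R) (hP.d_d s a)).trans (map_zero _)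
  d_par s a := by
    obtain ⟨a, rfl⟩ := quotMk_surjective P R a
    exact (congrArg (quotMk P R) (hP.d_par s a)).trans (map_neg _ _)
  un_par o a := by
    obtain ⟨a, rfl⟩ := quotMk_surjective P R a
    exact congrArg (quotMk P R) (hP.un_par o a)
  un_d o a := by
    obtain ⟨a, rfl⟩ := quotMk_surjective P R a
    exact congrArg (quotMk P R) (hP.un_d o a)
  bin_par o a b := by
    obtain ⟨a, rfl⟩ := quotMk_surjective P R a
    obtain ⟨b, rfl⟩ := quotMk_surjective P R b
    exact congrArg (quotMk P R) (hP.bin_par o a b)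
  bin_d o a b := by
    obtain ⟨a, rfl⟩ := quotMk_surjective P R a
    obtain ⟨b, rfl⟩ := quotMk_surjective P R b
    exact (congrArg (quotMk P R) (hP.bin_d o a b)).trans (map_add _ _ _)

theorem Hom.ideal_le_ker {P : DGAlg.{u, v} K sg} {Q : DGAlg.{u, w} K sg} {R : ∀ s, P.obj s → Prop}
    (f : Hom P Q) (hf : ∀ s a, R s a → f.map s a = 0) (s : sg.S) :
    ideal P R s ≤ LinearMap.ker (f.map s) := by
  intro a ha
  change InIdeal P R s a at ha
  rw [LinearMap.mem_ker]
  induction ha with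
  | of h => exact hf _ _ h
  | zero => simp
  | add _ _ h1 h2 => simp [h1, h2]
  | smul c _ h => simp [h]
  | par _ h => simp [f.map_par, h]
  | d _ h => simp [f.map_d, h]
  | un o _ h => simp [f.map_un, h]
  | binl o b _ h => simp [f.map_bin, h]
  | binr o a _ h => simp [f.map_bin, h]

/-- The morphism from a quotient induced by a morphism that kills the relations. -/
def quotLift {P : DGAlg.{u, v} K sg} {Q : DGAlg.{u, w} K sg} {R : ∀ s, P.obj s → Prop}
    (f : Hom P Q) (hf : ∀ s a, R s a → f.map s a = 0) : Hom (quot P R) Q where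
  map s := (ideal P R s).liftQ (f.map s) (f.ideal_le_ker hf s)
  cont _ := continuous_bot
  map_par s a := by
    obtain ⟨a, rfl⟩ := quotMk_surjective P R a
    exact f.map_par s a
  map_d s a := by
    obtain ⟨a, rfl⟩ := quotMk_surjective P R a
    exact f.map_d s a
  map_un o a := by
    obtain ⟨a, rfl⟩ := quotMk_surjective P R a
    exact f.map_un o a
  map_bin o a b := by
    obtain ⟨a, rfl⟩ := quotMk_surjective P R a
    obtain ⟨b, rfl⟩ := quotMk_surjective P R b
    exact f.map_bin o a b

theorem quotLift_mk {P : DGAlg.{u, v} K sg} {Q : DGAlg.{u, w} K sg} {R : ∀ s, P.obj s → Prop}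
    (f : Hom P Q) (hf : ∀ s a, R s a → f.map s a = 0) {s : sg.S} (a : P.obj s) :
    (quotLift f hf).map s (quotMk P R a) = f.map s a := rfl

/-! ### Inverse limits -/

section Lim

variable {ι : Type w} [Preorder ι] (P : ι → DGAlg.{u, v} K sg)
  (tr : ∀ {i j : ι}, i ≤ j → Hom (P j) (P i))

/-- The projections of an inverse limit. -/
def limProj (i : ι) : Hom (lim P tr) (P i) where
  map s := LinearMap.proj i ∘ₗ (limSub P tr s).subtype
  cont s := by
    have : Continuous fun x : (lim P tr).obj s => x.1 i :=
      (continuous_apply i).comp continuous_subtype_val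
    exact this
  map_par _ _ := rfl
  map_d _ _ := rfl
  map_un _ _ := rfl
  map_bin _ _ _ := rfl

theorem lim_ext {s : sg.S} {a b : (lim P tr).obj s}
    (h : ∀ i, (limProj P tr i).map s a = (limProj P tr i).map s b) : a = b :=
  Subtype.ext (funext h)

theorem tendsto_lim_iff {α : Type*} {l : Filter α} {s : sg.S} {f : α → (lim P tr).obj s}
    {a : (lim P tr).obj s} : Filter.Tendsto f l (nhds a) ↔
      ∀ i, Filter.Tendsto (fun n => (limProj P tr i).map s (f n)) l
        (nhds ((limProj P tr i).map s a)) := by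
  have h : Filter.Tendsto f l (nhds a) ↔
      Filter.Tendsto (fun n => Subtype.val (f n)) l (nhds (Subtype.val a)) :=
    tendsto_subtype_rng
  rw [h, tendsto_pi_nhds]
  rfl

theorem hasSum_lim_iff {α : Type*} {s : sg.S} {f : α → (lim P tr).obj s}
    {a : (lim P tr).obj s} : HasSum f a ↔
      ∀ i, HasSum (fun n => (limProj P tr i).map s (f n)) ((limProj P tr i).map s a) := by
  unfold HasSum
  rw [tendsto_lim_iff]
  simp only [map_sum]

/-- An inverse limit of discrete spaces is Hausdorff. -/
theorem lim_t2 (h : ∀ i s, (P i).top s = ⊥) (s : sg.S) : T2Space ((lim P tr).obj s) := by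
  have : ∀ i, T2Space ((P i).obj s) := fun i => by
    have : DiscreteTopology ((P i).obj s) := ⟨h i s⟩
    infer_instance
  exact inferInstanceAs (T2Space (limSub P tr s))

end Lim

theorem hasSum_discrete_iff {V : Type*} [AddCommGroup V] [TopologicalSpace V] [DiscreteTopology V]
    (f : ℕ → V) (N : ℕ) (hN : ∀ n, N ≤ n → f n = 0) (a : V) :
    HasSum f a ↔ a = ∑ n ∈ Finset.range N, f n := by
  have h : HasSum f (∑ n ∈ Finset.range N, f n) :=
    hasSum_sum_of_ne_finset_zero fun n hn => hN n (by simpa using hn)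
  constructor
  · exact fun h' => h'.unique h
  · rintro rfl; exact h

/-! ### Adic completions -/

section Adic

variable (F : DGAlg.{u, v} K sg) (R : ℕ → ∀ s, F.obj s → Prop)
  (hR : ∀ {k l : ℕ}, k ≤ l → ∀ s z, R l s z → R k s z)

/-- The inverse limit of a sequence of quotients. -/
def adicLim : DGAlg.{u, v} K sg :=
  lim (fun k => quot F (R k)) (fun h => quotMap F (fun s z => hR h s z))

/-- The morphism to the inverse limit of quotients. -/
def toAdic (hF : ∀ s, F.top s = ⊥) : Hom F (adicLim F R hR) where
  map s := LinearMap.codRestrict _ (LinearMap.pi fun k => (ideal F (R k) s).mkQ)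
    (fun _ _ _ _ => rfl)
  cont s := by
    rw [continuous_def]
    intro U _
    rw [hF s]
    trivial
  map_par _ _ := rfl
  map_d _ _ := rfl
  map_un _ _ := rfl
  map_bin _ _ _ := rfl

theorem adicLim_hom_ext (hF : ∀ s, F.top s = ⊥) {Q : DGAlg.{u, w} K sg}
    (hQ : ∀ s, T2Space (Q.obj s)) {f f' : Hom (adicLim F R hR) Q}
    (h : ∀ s a, f.map s ((toAdic F R hR hF).map s a) = f'.map s ((toAdic F R hR hF).map s a)) :
    f = f' := by
  refine Hom.ext_map fun s x => ?_
  have := hQ s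
  choose a ha using fun k => quotMk_surjective F (R k) ((limProj _ _ k).map s x)
  have key : Filter.Tendsto (fun k => (toAdic F R hR hF).map s (a k)) Filter.atTop (nhds x) := by
    refine (tendsto_lim_iff _ _).2 fun k => ?_
    refine Filter.Tendsto.congr' (f₁ := fun _ => (limProj _ _ k).map s x) ?_ tendsto_const_nhds
    filter_upwards [Filter.eventually_ge_atTop k] with l hl
    have h1 := x.2 k l hl
    have h2 : (quotMap F (fun s z => hR hl s z)).map s (quotMk F (R l) (a l)) =
      quotMk F (R k) (a l) := rfl
    rw [ha l] at h2
    exact h1.symm.trans h2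
  have h1 := ((f.cont s).tendsto x).comp key
  have h2 := ((f'.cont s).tendsto x).comp key
  refine tendsto_nhds_unique h1 (h2.congr fun k => ?_)
  exact (h s (a k)).symm

variable {ι : Type*} [Preorder ι] (Q : ι → DGAlg.{u, w} K sg)
  (tr : ∀ {i j : ι}, i ≤ j → Hom (Q j) (Q i))

/-- A morphism from the inverse limit of quotients to an inverse limit. -/
def adicLift (g : ∀ i, Hom F (Q i))
    (hg : ∀ i j (h : i ≤ j) s a, (tr h).map s ((g j).map s a) = (g i).map s a)
    (k : ι → ℕ) (hk : ∀ i s a, R (k i) s a → (g i).map s a = 0) :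
    Hom (adicLim F R hR) (lim Q tr) where
  map s := LinearMap.codRestrict _
    (LinearMap.pi fun i => (quotLift (g i) (hk i)).map s ∘ₗ (limProj _ _ (k i)).map s)
    (fun x i j h => by
      obtain ⟨a, ha⟩ := quotMk_surjective F (R (max (k i) (k j))) (x.1 (max (k i) (k j)))
      have hx : ∀ l, l ≤ max (k i) (k j) → x.1 l = quotMk F (R l) a := fun l hl => by
        rw [← x.2 l _ hl, ← ha]; rfl
      change (tr h).map s ((quotLift (g j) (hk j)).map s (x.1 (k j))) =
        (quotLift (g i) (hk i)).map s (x.1 (k i))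
      rw [hx _ (le_max_left _ _), hx _ (le_max_right _ _), quotLift_mk, quotLift_mk, hg])
  cont s := by
    refine Continuous.subtype_mk (continuous_pi fun i => ?_) _
    exact ((quotLift (g i) (hk i)).cont s).comp ((limProj _ _ (k i)).cont s)
  map_par s a := by
    refine lim_ext _ _ fun i => ?_
    exact (congrArg _ ((limProj _ _ (k i)).map_par s a)).trans ((quotLift (g i) (hk i)).map_par s _)
  map_d s a := by
    refine lim_ext _ _ fun i => ?_
    exact (congrArg _ ((limProj _ _ (k i)).map_d s a)).trans ((quotLift (g i) (hk i)).map_d s _)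
  map_un o a := by
    refine lim_ext _ _ fun i => ?_
    exact (congrArg _ ((limProj _ _ (k i)).map_un o a)).trans ((quotLift (g i) (hk i)).map_un o _)
  map_bin o a b := by
    refine lim_ext _ _ fun i => ?_
    exact (congrArg _ ((limProj _ _ (k i)).map_bin o a b)).trans
      ((quotLift (g i) (hk i)).map_bin o _ _)

end Adic

/-! ### Filtrations -/

/-- A multiplicative decreasing filtration. -/
structure Filt (Q : DGAlg.{u, v} K sg) where
  F : ℕ → ∀ s, Submodule K (Q.obj s)
  zero : ∀ s a, a ∈ F 0 s
  un : ∀ {s t} (o : sg.U s t) (i : ℕ) a, a ∈ F i s → Q.un o a ∈ F i t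
  bin : ∀ {r s t} (o : sg.B r s t) (i j : ℕ) a b, a ∈ F i r → b ∈ F j s →
    Q.bin o a b ∈ F (i + j) t

theorem Filt.eval_mem {Q : DGAlg.{u, v} K sg} (F : Filt Q) (wt : ∀ s, G s → ℕ)
    (q : ∀ s, G s → Q.obj s) (hq : ∀ s g, q s g ∈ F.F (wt s g) s)
    (hdq : ∀ s g, Q.d s (q s g) ∈ F.F (wt s g) s) {s : sg.S} (x : Mono sg G s) :
    x.eval Q q ∈ F.F (x.weight wt) s := by
  induction x with
  | leaf g b => cases b <;> simp [Mono.eval, Mono.weight, hq, hdq]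
  | un o x ih => exact F.un o _ _ ih
  | bin o x y ihx ihy => exact F.bin o _ _ _ _ ihx ihy

/-- The filtration of a quotient of a free dg algebra by the weight of monomials. -/
def weightFilt (p : ∀ s, G s → Bool) (wt : ∀ s, G s → ℕ) (R : ∀ s, (free K sg G p).obj s → Prop) :
    Filt (quot (free K sg G p) R) where
  F i s := Submodule.span K
    {a | ∃ x : Mono sg G s, i ≤ x.weight wt ∧ quotMk (free K sg G p) R (freeMono p x) = a}
  zero s a := by
    obtain ⟨a, rfl⟩ := quotMk_surjective _ R a
    induction a using free_induction with
    | zero => exact (congrArg (· ∈ _) (map_zero (ideal _ R s).mkQ)).mpr (Submodule.zero_mem _)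
    | add a a' h1 h2 =>
      exact (congrArg (· ∈ _) (map_add (ideal _ R s).mkQ a a')).mpr (Submodule.add_mem _ h1 h2)
    | smul c a h1 =>
      exact (congrArg (· ∈ _) (map_smul (ideal _ R s).mkQ c a)).mpr (Submodule.smul_mem _ c h1)
    | mono x => exact Submodule.subset_span ⟨x, Nat.zero_le _, rfl⟩
  un o i a ha := by
    induction ha using Submodule.span_induction with
    | mem a h =>
      obtain ⟨x, hx, rfl⟩ := h
      exact Submodule.subset_span ⟨.un o x, hx, congrArg (quotMk _ R) (free_un_mono o x).symm⟩
    | zero => simp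
    | add a b _ _ h1 h2 => rw [map_add]; exact Submodule.add_mem _ h1 h2
    | smul c a _ h1 => rw [map_smul]; exact Submodule.smul_mem _ c h1
  bin o i j a b ha hb := by
    induction ha using Submodule.span_induction with
    | mem a h =>
      obtain ⟨x, hx, rfl⟩ := h
      induction hb using Submodule.span_induction with
      | mem b h =>
        obtain ⟨y, hy, rfl⟩ := h
        exact Submodule.subset_span ⟨.bin o x y, Nat.add_le_add hx hy,
          congrArg (quotMk _ R) (free_bin_mono o x y).symm⟩
      | zero => simp
      | add a b _ _ h1 h2 => rw [map_add]; exact Submodule.add_mem _ h1 h2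
      | smul c a _ h1 => rw [map_smul]; exact Submodule.smul_mem _ c h1
    | zero => simp
    | add a b _ _ h1 h2 =>
      rw [map_add, LinearMap.add_apply]; exact Submodule.add_mem _ h1 h2
    | smul c a _ h1 => rw [map_smul, LinearMap.smul_apply]; exact Submodule.smul_mem _ c h1

theorem weightFilt_mono_mem {wt : ∀ s, G s → ℕ} {R : ∀ s, (free K sg G p).obj s → Prop} {s : sg.S}
    (x : Mono sg G s) :
    quotMk (free K sg G p) R (freeMono p x) ∈ (weightFilt p wt R).F (x.weight wt) s :=
  Submodule.subset_span ⟨x, le_rfl, rfl⟩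

theorem weightFilt_eq_bot {wt : ∀ s, G s → ℕ} {R : ∀ s, (free K sg G p).obj s → Prop} {k : ℕ}
    (hk : ∀ s (x : Mono sg G s), k ≤ x.weight wt → R s (freeMono p x)) (s : sg.S) :
    (weightFilt p wt R).F k s = ⊥ := by
  rw [eq_bot_iff]
  refine Submodule.span_le.2 ?_
  rintro _ ⟨x, hx, rfl⟩
  exact quotMk_eq_zero (hk s x hx)

end Generic

end MCTwist
end

noncomputable section

namespace MCTwist

open TensorProduct

section Parity

variable {K : Type u} [Field K] {V : Type v} [AddCommGroup V] [Module K V] (ε : V →ₗ[K] V)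

theorem proj_apply (q : Bool) (a : V) : proj ε q a = (2 : K)⁻¹ • (a + sgn K q • ε a) := by
  cases q <;> simp [proj]

theorem proj_false_add_true [CharZero K] (a : V) : proj ε false a + proj ε true a = a := by
  rw [proj_apply, proj_apply, ← smul_add]
  have : a + sgn K false • ε a + (a + sgn K true • ε a) = (2 : K) • a := by
    rw [two_smul]; simp; abel
  rw [this, smul_smul, inv_mul_cancel₀ (two_ne_zero), one_smul]

theorem proj_of_par [CharZero K] {q : Bool} {a : V} (h : ε a = sgn K q • a) : proj ε q a = a := by
  rw [proj_apply, h, smul_smul, sgn_mul_self, one_smul, ← two_smul K, smul_smul,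
    inv_mul_cancel₀ (two_ne_zero), one_smul]

theorem proj_of_par_ne {q r : Bool} {a : V} (h : ε a = sgn K r • a) (hqr : q ≠ r) :
    proj ε q a = 0 := by
  rw [proj_apply, h]
  cases q <;> cases r <;> simp_all

variable {ε}

theorem par_proj (hε : ∀ a, ε (ε a) = a) (q : Bool) (a : V) :
    ε (proj ε q a) = sgn K q • proj ε q a := by
  rw [proj_apply]
  simp only [map_smul, map_add, hε, smul_add, smul_smul]
  rw [add_comm]
  congr 2
  · rw [mul_comm]
  · rw [mul_left_comm, sgn_mul_self, mul_one]

theorem map_proj {V' : Type*} [AddCommGroup V'] [Module K V'] {ε' : V' →ₗ[K] V'}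
    (f : V →ₗ[K] V') (h : ∀ a, f (ε a) = ε' (f a)) (q : Bool) (a : V) :
    f (proj ε q a) = proj ε' q (f a) := by
  simp [proj_apply, h]

end Parity

section Laws

variable {K : Type u} [Field K]

/-- The axioms of a symmetric operad hold. -/
def LawfulOp (P : DGAlg.{u, v} K opSig) : Prop := ∀ n z, OpLaw P n z → z = 0

/-- The axioms of a modular operad hold. -/
def LawfulMod (M : DGAlg.{u, v} K modSig) : Prop := ∀ s z, ModLaw M s z → z = 0

theorem quot_par_lift [CharZero K] {sg : Sig} {P : DGAlg.{u, v} K sg} (hP : P.IsDG)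
    (R : ∀ s, P.obj s → Prop) {s : sg.S} {q : Bool} {a : (quot P R).obj s}
    (h : (quot P R).par s a = sgn K q • a) :
    ∃ b : P.obj s, P.par s b = sgn K q • b ∧ quotMk P R b = a := by
  obtain ⟨b, rfl⟩ := quotMk_surjective P R a
  refine ⟨proj (P.par s) q b, par_proj (hP.par_par s) q b, ?_⟩
  let f : P.obj s →ₗ[K] (quot P R).obj s := (ideal P R s).mkQ
  have : f (proj (P.par s) q b) = proj ((quot P R).par s) q (f b) :=
    map_proj f (fun _ => rfl) q b
  exact this.trans (proj_of_par _ h)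

theorem quot_lawfulOp [CharZero K] {P : DGAlg.{u, v} K opSig} (hP : P.IsDG)
    {R : ∀ s : ℕ, P.obj s → Prop} (hR : ∀ n z, OpLaw P n z → R n z) : LawfulOp (quot P R) := by
  intro n z h
  have key : ∀ {n : ℕ} {z : P.obj n}, OpLaw P n z → quotMk P R z = 0 :=
    fun h => quotMk_eq_zero (hR _ _ h)
  cases h with
  | perm_refl a =>
    obtain ⟨a, rfl⟩ := quotMk_surjective P R a
    exact key (.perm_refl a)
  | perm_trans e e' a =>
    obtain ⟨a, rfl⟩ := quotMk_surjective P R a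
    exact key (.perm_trans e e' a)
  | equivariance h h' e e' ρ i ho hi a b =>
    obtain ⟨a, rfl⟩ := quotMk_surjective P R a
    obtain ⟨b, rfl⟩ := quotMk_surjective P R b
    exact key (.equivariance h h' e e' ρ i ho hi a b)
  | seq h₁ h₂ h₃ h₄ i j ij hij a b c =>
    obtain ⟨a, rfl⟩ := quotMk_surjective P R a
    obtain ⟨b, rfl⟩ := quotMk_surjective P R b
    obtain ⟨c, rfl⟩ := quotMk_surjective P R c
    exact key (.seq h₁ h₂ h₃ h₄ i j ij hij a b c)
  | par h₁ h₂ h₃ h₄ i k hik k' hk i' hi β γ a b c hb hc =>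
    obtain ⟨a, rfl⟩ := quotMk_surjective P R a
    obtain ⟨b, hb', rfl⟩ := quot_par_lift hP R hb
    obtain ⟨c, hc', rfl⟩ := quot_par_lift hP R hc
    exact key (.par h₁ h₂ h₃ h₄ i k hik k' hk i' hi β γ a b c hb' hc')

theorem quot_lawfulMod [CharZero K] {P : DGAlg.{u, v} K modSig} (hP : P.IsDG)
    {R : ∀ s : ℕ × ℕ, P.obj s → Prop} (hR : ∀ n z, ModLaw P n z → R n z) :
    LawfulMod (quot P R) := by
  intro n z h
  have key : ∀ {n : ℕ × ℕ} {z : P.obj n}, ModLaw P n z → quotMk P R z = 0 :=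
    fun h => quotMk_eq_zero (hR _ _ h)
  cases h with
  | perm_refl a =>
    obtain ⟨a, rfl⟩ := quotMk_surjective P R a
    exact key (.perm_refl a)
  | perm_trans e e' a =>
    obtain ⟨a, rfl⟩ := quotMk_surjective P R a
    exact key (.perm_trans e e' a)
  | equivariance hg hp hp' e e' he' ρ i ho hi a b =>
    obtain ⟨a, rfl⟩ := quotMk_surjective P R a
    obtain ⟨b, rfl⟩ := quotMk_surjective P R b
    exact key (.equivariance hg hp hp' e e' he' ρ i ho hi a b)
  | seq g₁ g₂ g₃ g₄ h₁ h₂ h₃ h₄ i j ij hij a b c =>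
    obtain ⟨a, rfl⟩ := quotMk_surjective P R a
    obtain ⟨b, rfl⟩ := quotMk_surjective P R b
    obtain ⟨c, rfl⟩ := quotMk_surjective P R c
    exact key (.seq g₁ g₂ g₃ g₄ h₁ h₂ h₃ h₄ i j ij hij a b c)
  | par g₁ g₂ g₃ g₄ h₁ h₂ h₃ h₄ i k hik k' hk i' hi β γ a b c hb hc =>
    obtain ⟨a, rfl⟩ := quotMk_surjective P R a
    obtain ⟨b, hb', rfl⟩ := quot_par_lift hP R hb
    obtain ⟨c, hc', rfl⟩ := quot_par_lift hP R hc
    exact key (.par g₁ g₂ g₃ g₄ h₁ h₂ h₃ h₄ i k hik k' hk i' hi β γ a b c hb' hc')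
  | anti hg hg' hp hp' i e he ρ hb ha α β a b hpa hpb =>
    obtain ⟨a, hpa', rfl⟩ := quot_par_lift hP R hpa
    obtain ⟨b, hpb', rfl⟩ := quot_par_lift hP R hpb
    exact key (.anti hg hg' hp hp' i e he ρ hb ha α β a b hpa' hpb')
  | contr_equivariance h e e' he he₀ he₁ a =>
    obtain ⟨a, rfl⟩ := quotMk_surjective P R a
    exact key (.contr_equivariance h e e' he he₀ he₁ a)
  | contr_anti h a =>
    obtain ⟨a, rfl⟩ := quotMk_surjective P R a
    exact key (.contr_anti h a)
  | contr_contr h h' a =>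
    obtain ⟨a, rfl⟩ := quotMk_surjective P R a
    exact key (.contr_contr h h' a)
  | contr_comp hr hs ht hst hp hp' i a b =>
    obtain ⟨a, rfl⟩ := quotMk_surjective P R a
    obtain ⟨b, rfl⟩ := quotMk_surjective P R b
    exact key (.contr_comp hr hs ht hst hp hp' i a b)
  | comp_comp hr hs hp ρ h₁ h₂ h₃ h₄ a b =>
    obtain ⟨a, rfl⟩ := quotMk_surjective P R a
    obtain ⟨b, rfl⟩ := quotMk_surjective P R b
    exact key (.comp_comp hr hs hp ρ h₁ h₂ h₃ h₄ a b)

/-! ### The operad underlying a modular operad -/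

theorem extendLast_castSucc {m n : ℕ} (e : Fin m ≃ Fin n) (i : Fin m) :
    extendLast e i.castSucc = (e i).castSucc := by
  simp [extendLast]

theorem extendLast_last {m n : ℕ} (e : Fin m ≃ Fin n) :
    extendLast e (Fin.last m) = Fin.last n := by
  simp [extendLast]

theorem extendLast_refl (n : ℕ) : extendLast (Equiv.refl (Fin n)) = Equiv.refl _ := by
  ext i
  induction i using Fin.lastCases with
  | last => rw [extendLast_last]; rfl
  | cast i => rw [extendLast_castSucc]; rfl

theorem extendLast_trans {l m n : ℕ} (e : Fin l ≃ Fin m) (e' : Fin m ≃ Fin n) :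
    (extendLast e).trans (extendLast e') = extendLast (e.trans e') := by
  ext i
  induction i using Fin.lastCases with
  | last => simp only [Equiv.trans_apply, extendLast_last]
  | cast i => simp only [Equiv.trans_apply, extendLast_castSucc]

theorem opOf_isDG {M : DGAlg.{u, v} K modSig} (hM : M.IsDG) : (opOf M).IsDG where
  par_par s a := hM.par_par _ a
  d_d s a := hM.d_d _ a
  d_par s a := hM.d_par _ a
  un_par o a := by cases o; exact hM.un_par (sg := modSig) _ a
  un_d o a := by cases o; exact hM.un_d (sg := modSig) _ a
  bin_par o a b := by cases o; exact hM.bin_par (sg := modSig) _ a b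
  bin_d o a b := by cases o; exact hM.bin_d (sg := modSig) _ a b

theorem opOf_lawful {M : DGAlg.{u, v} K modSig} (hM : LawfulMod M) : LawfulOp (opOf M) := by
  intro n z h
  cases h with
  | perm_refl a =>
    have := hM _ _ (.perm_refl (g := 0) a)
    rw [← extendLast_refl] at this
    exact this
  | perm_trans e e' a =>
    have := hM _ _ (.perm_trans (g := 0) (extendLast e) (extendLast e') a)
    rw [extendLast_trans] at this
    exact this
  | @equivariance m n p m' n' p' h h' e e' ρ i ho hi a b =>
    have := hM _ _ (.equivariance (g := 0) (h := 0) (r := 0) rfl (p := p + 1) (m := m + 1)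
      (n := n) (by omega) (by omega) (extendLast e)
      (extendLast e') (extendLast_last e') (extendLast ρ) i.castSucc ?_ ?_ a b)
    · rw [extendLast_castSucc] at this
      exact this
    · intro j t hj ht
      have := t.2
      have := i.2
      have := (e i).2
      rw [extendLast_castSucc]
      induction j using Fin.lastCases with
      | last =>
        have ht' : t = Fin.last p := by
          apply Fin.ext
          simp only [outer, Fin.val_last, Fin.val_castSucc] at ht ⊢
          split_ifs at ht <;> omega
        rw [ht', extendLast_last, extendLast_last]
        simp only [outer, Fin.val_last, Fin.val_castSucc]
        split_ifs <;> omega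
      | cast j =>
        have hj' : j ≠ i := fun h => hj (by rw [h])
        have hjv : j.val ≠ i.val := fun h => hj' (Fin.ext h)
        have := j.2
        have htp : t.val < p := by
          simp only [outer, Fin.val_castSucc] at ht
          split_ifs at ht <;> omega
        have := ho j ⟨t, htp⟩ hj' (by simpa [outer] using ht)
        have ht' : t = (⟨t, htp⟩ : Fin p).castSucc := rfl
        rw [ht', extendLast_castSucc, extendLast_castSucc]
        exact this
    · intro l t ht
      have := l.2
      have := i.2
      have htp : t.val < p := by simp at ht; omega
      have := hi l ⟨t, htp⟩ ht
      have ht' : t = (⟨t, htp⟩ : Fin p).castSucc := rfl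
      rw [ht', extendLast_castSucc, extendLast_castSucc, extendLast_castSucc]
      exact this
  | seq h₁ h₂ h₃ h₄ i j ij hij a b c =>
    exact hM _ _ (.seq (g := 0) (h := 0) (k := 0) rfl rfl rfl rfl (by omega) (by omega) (by omega)
      (by omega) i.castSucc j ij.castSucc hij a b c)
  | par h₁ h₂ h₃ h₄ i k hik k' hk i' hi β γ a b c hb hc =>
    exact hM _ _ (.par (g := 0) (h := 0) (k := 0) rfl rfl rfl rfl (by omega) (by omega) (by omega)
      (by omega) i.castSucc k.castSucc hik k'.castSucc hk i'.castSucc hi β γ a b c hb hc)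

end Laws

/-! ### Tensor products -/

section Tensor

variable {K : Type u} [Field K] [CharZero K] {sg : Sig} {N : Type v} [NonUnitalRing N] [Module K N]
  [IsScalarTower K N N] [SMulCommClass K N N] [NilCDGA K N]

variable {P : DGAlg.{u, w} K sg}

/-- A pure tensor. -/
def tmk (P : DGAlg.{u, w} K sg) {s : sg.S} (a : N) (f : P.obj s) : (tensor N P).obj s := a ⊗ₜ[K] f

theorem tensor_par_tmk {s : sg.S} (a : N) (f : P.obj s) :
    (tensor N P).par s (tmk P a f) = tmk P (DGSpace.par (K := K) a) (P.par s f) := rfl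

theorem tensor_d_tmk {s : sg.S} (a : N) (f : P.obj s) :
    (tensor N P).d s (tmk P a f) = tmk P (DGSpace.d (K := K) a) f +
      tmk P (DGSpace.par (K := K) a) (P.d s f) := rfl

theorem tensor_un_tmk {s t : sg.S} (o : sg.U s t) (a : N) (f : P.obj s) :
    (tensor N P).un o (tmk P a f) = tmk P a (P.un o f) := rfl

theorem tmk_smul_left {s : sg.S} (c : K) (a : N) (f : P.obj s) :
    tmk P (c • a) f = c • tmk P a f := (TensorProduct.smul_tmul' c a f).symm

theorem tmk_smul_right {s : sg.S} (c : K) (a : N) (f : P.obj s) :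
    tmk P a (c • f) = c • tmk P a f := TensorProduct.tmul_smul c a f

theorem tmk_add_left {s : sg.S} (a a' : N) (f : P.obj s) :
    tmk P (a + a') f = tmk P a f + tmk P a' f := TensorProduct.add_tmul a a' f

theorem tmk_add_right {s : sg.S} (a : N) (f f' : P.obj s) :
    tmk P a (f + f') = tmk P a f + tmk P a f' := TensorProduct.tmul_add a f f'

theorem tmk_zero_right {s : sg.S} (a : N) : tmk P a (0 : P.obj s) = 0 := TensorProduct.tmul_zero _ a
theorem tmk_zero_left {s : sg.S} (f : P.obj s) : tmk P (0 : N) f = 0 := TensorProduct.zero_tmul _ f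

theorem tensor_bin_tmk {r s t : sg.S} (o : sg.B r s t) {a b : N} {f : P.obj r} {g : P.obj s}
    {q γ : Bool} (hb : DGSpace.par (K := K) b = sgn K q • b) (hf : P.par r f = sgn K γ • f) :
    (tensor N P).bin o (tmk P a f) (tmk P b g) = sgn K (γ && q) • tmk P (a * b) (P.bin o f g) := by
  have h : (tensor N P).bin o (tmk P a f) (tmk P b g) =
      tmk P (a * proj (K := K) DGSpace.par false b) (P.bin o f g) +
      tmk P (a * proj (K := K) DGSpace.par true b) (P.bin o (P.par r f) g) := by
    change (TensorProduct.map₂ ((LinearMap.mul K N).compl₂ (proj DGSpace.par false)) (P.bin o) +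
      TensorProduct.map₂ ((LinearMap.mul K N).compl₂ (proj DGSpace.par true))
        (P.bin o ∘ₗ P.par r)) (a ⊗ₜ[K] f) (b ⊗ₜ[K] g) = _
    rw [LinearMap.add_apply, LinearMap.add_apply, TensorProduct.map₂_apply_tmul,
      TensorProduct.map₂_apply_tmul]
    rfl
  rw [h]
  cases q
  · rw [proj_of_par _ hb, proj_of_par_ne _ hb (by simp), mul_zero, tmk_zero_left]; simp
  · rw [proj_of_par _ hb, proj_of_par_ne _ hb (by simp), mul_zero, tmk_zero_left, hf, map_smul,
      LinearMap.smul_apply, tmk_smul_right]; simp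

theorem tensor_induction (hP : P.IsDG) {s : sg.S} {motive : (tensor N P).obj s → Prop}
    (add : ∀ a b, motive a → motive b → motive (a + b))
    (tmul : ∀ (q r : Bool) (a : N) (f : P.obj s), DGSpace.par (K := K) a = sgn K q • a →
      P.par s f = sgn K r • f → motive (tmk P a f)) (z : (tensor N P).obj s) : motive z := by
  refine TensorProduct.induction_on (motive := fun z => motive z) z ?_ ?_ (fun x y => add x y)
  · have := tmul false false 0 0 (by simp) (by simp)
    rwa [tmk_zero_left] at this
  · intro a f
    change motive (tmk P a f)
    have ha : ∀ q, DGSpace.par (K := K) (proj (K := K) DGSpace.par q a) = _ :=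
      fun q => par_proj (DGSpace.par_par (K := K)) q a
    have hf := fun q => par_proj (hP.par_par s) q f
    rw [← proj_false_add_true (K := K) DGSpace.par a, ← proj_false_add_true (P.par s) f,
      tmk_add_left, tmk_add_right, tmk_add_right]
    exact add _ _ (add _ _ (tmul _ _ _ _ (ha _) (hf _)) (tmul _ _ _ _ (ha _) (hf _)))
      (add _ _ (tmul _ _ _ _ (ha _) (hf _)) (tmul _ _ _ _ (ha _) (hf _)))

theorem tensor_induction_par_aux (hP : P.IsDG) {s : sg.S} {motive : (tensor N P).obj s → Prop}
    (β : Bool) (add : ∀ a b, motive a → motive b → motive (a + b))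
    (tmul : ∀ (q r : Bool) (a : N) (f : P.obj s), DGSpace.par (K := K) a = sgn K q • a →
      P.par s f = sgn K r • f → xor q r = β → motive (tmk P a f)) (z : (tensor N P).obj s)
    (hz : (tensor N P).par s z = sgn K β • z) : motive z := by
  rw [← proj_of_par _ hz]
  clear hz
  induction z using tensor_induction hP with
  | add a b h1 h2 => rw [map_add]; exact add _ _ h1 h2
  | tmul q r a f ha hf =>
    have h : (tensor N P).par s (tmk P a f) = sgn K (xor q r) • tmk P a f := by
      rw [tensor_par_tmk, ha, hf, tmk_smul_left, tmk_smul_right, smul_smul, sgn_xor]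
    by_cases hb : xor q r = β
    · rw [← hb, proj_of_par _ h]
      exact tmul q r a f ha hf hb
    · rw [proj_of_par_ne _ h (Ne.symm hb)]
      have := tmul β false 0 0 (by simp) (by simp) (by simp)
      rwa [tmk_zero_left] at this

theorem tensor_induction_par (hP : P.IsDG) {s : sg.S} {β : Bool}
    {motive : ∀ z : (tensor N P).obj s, (tensor N P).par s z = sgn K β • z → Prop}
    (add : ∀ a b ha hb, motive a ha → motive b hb →
      motive (a + b) (by rw [map_add, ha, hb, smul_add]))
    (tmul : ∀ (q r : Bool) (a : N) (f : P.obj s) (ha : DGSpace.par (K := K) a = sgn K q • a)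
      (hf : P.par s f = sgn K r • f) (h : xor q r = β), motive (tmk P a f) (by
        rw [tensor_par_tmk, ha, hf, tmk_smul_left, tmk_smul_right, smul_smul, ← sgn_xor, h]))
    (z : (tensor N P).obj s) (hz : (tensor N P).par s z = sgn K β • z) : motive z hz := by
  have : ∃ hz, motive z hz := by
    refine tensor_induction_par_aux (motive := fun z => ∃ hz, motive z hz) hP β ?_ ?_ z hz
    · rintro a b ⟨ha, ha'⟩ ⟨hb, hb'⟩
      exact ⟨_, add a b ha hb ha' hb'⟩
    · exact fun q r a f ha hf h => ⟨_, tmul q r a f ha hf h⟩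
  exact this.2

theorem mul_par {a b : N} {q r : Bool} (ha : DGSpace.par (K := K) a = sgn K q • a)
    (hb : DGSpace.par (K := K) b = sgn K r • b) :
    DGSpace.par (K := K) (a * b) = sgn K (xor q r) • (a * b) := by
  rw [NilCDGA.par_mul, ha, hb, sgn_xor, smul_mul_smul_comm]

theorem DGAlg.IsDG.bin_par' (hP : P.IsDG) {r s t : sg.S} (o : sg.B r s t) {f : P.obj r}
    {g : P.obj s} {q γ : Bool} (hf : P.par r f = sgn K q • f) (hg : P.par s g = sgn K γ • g) :
    P.par t (P.bin o f g) = sgn K (xor q γ) • P.bin o f g := by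
  rw [hP.bin_par, hf, hg]
  simp [sgn_xor, smul_smul, mul_comm]

theorem DGAlg.IsDG.un_par' (hP : P.IsDG) {r s : sg.S} (o : sg.U r s) {f : P.obj r}
    {q : Bool} (hf : P.par r f = sgn K q • f) :
    P.par s (P.un o f) = sgn K q • P.un o f := by
  rw [hP.un_par, hf, map_smul]

theorem DGAlg.IsDG.d_par' (hP : P.IsDG) {r : sg.S} {f : P.obj r}
    {q : Bool} (hf : P.par r f = sgn K q • f) : P.par r (P.d r f) = sgn K (!q) • P.d r f := by
  have h := hP.d_par r f
  rw [hf, map_smul] at h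
  rw [← neg_eq_iff_eq_neg.2 h]
  cases q <;> simp

theorem tensor_isDG (hP : P.IsDG) : (tensor N P).IsDG where
  par_par s z := by
    induction z using tensor_induction hP with
    | add a b h1 h2 => simp only [map_add, h1, h2]
    | tmul q r a f ha hf => rw [tensor_par_tmk, tensor_par_tmk, DGSpace.par_par, hP.par_par]
  d_d s z := by
    induction z using tensor_induction hP with
    | add a b h1 h2 => simp only [map_add, h1, h2, add_zero]
    | tmul q r a f ha hf =>
      simp only [tensor_d_tmk, map_add, DGSpace.d_d, hP.d_d, tmk_zero_left, tmk_zero_right,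
        DGSpace.d_par, zero_add, add_zero]
      rw [← tmk_add_left]
      simp [tmk_zero_left]
  d_par s z := by
    induction z using tensor_induction hP with
    | add a b h1 h2 => simp only [map_add, h1, h2, neg_add]
    | tmul q r a f ha hf =>
      simp only [tensor_d_tmk, tensor_par_tmk, map_add, DGSpace.d_par, hP.d_par]
      simp only [← neg_one_smul K (DGSpace.par (K := K) (DGSpace.d (K := K) a)),
        ← neg_one_smul K (P.par s (P.d s f)), tmk_smul_left, tmk_smul_right]
      simp [add_comm]
  un_par o z := by
    induction z using tensor_induction hP with
    | add a b h1 h2 => simp only [map_add, h1, h2]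
    | tmul q r a f ha hf => simp only [tensor_par_tmk, tensor_un_tmk, hP.un_par]
  un_d o z := by
    induction z using tensor_induction hP with
    | add a b h1 h2 => simp only [map_add, h1, h2]
    | tmul q r a f ha hf => simp only [tensor_d_tmk, tensor_un_tmk, map_add, hP.un_d]
  bin_par o z z' := by
    induction z using tensor_induction hP with
    | add a b h1 h2 => simp only [map_add, LinearMap.add_apply, h1, h2]
    | tmul q r a f ha hf =>
      induction z' using tensor_induction hP with
      | add a b h1 h2 => simp only [map_add, h1, h2]
      | tmul q' r' b g hb hg =>
        simp only [tensor_par_tmk, tensor_bin_tmk o hb hf, ha, hb, hf, hg, tmk_smul_left,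
          tmk_smul_right, map_smul, mul_par ha hb, hP.bin_par' o hf hg, LinearMap.smul_apply,
          smul_smul, sgn_xor]
        congr 1
        ring
  bin_d o z z' := by
    induction z using tensor_induction hP with
    | add a b h1 h2 =>
      simp only [map_add, LinearMap.add_apply, h1, h2]
      abel
    | tmul q r a f ha hf =>
      induction z' using tensor_induction hP with
      | add a b h1 h2 =>
        simp only [map_add, h1, h2]
        abel
      | tmul q' r' b g hb hg =>
        have hdb : DGSpace.par (K := K) (DGSpace.d (K := K) b) =
            sgn K (!q') • DGSpace.d (K := K) b := by
          have h := DGSpace.d_par (K := K) b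
          rw [hb, map_smul] at h
          rw [← neg_eq_iff_eq_neg.2 h]
          cases q' <;> simp
        simp only [tensor_par_tmk, tensor_d_tmk, map_add, LinearMap.add_apply, ha, hf, hb,
          tmk_smul_left, tmk_smul_right, map_smul, LinearMap.smul_apply, tensor_bin_tmk o hb hf,
          tensor_bin_tmk o hdb hf, tensor_bin_tmk o hb (hP.d_par' hf), NilCDGA.d_mul,
          mul_par ha hb, hP.bin_d, tmk_add_left, tmk_add_right, smul_add, smul_smul,
          smul_mul_assoc, mul_smul_comm]
        rw [add_assoc, add_assoc]
        refine congrArg₂ _ rfl ?_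
        rw [add_left_comm]
        refine congrArg₂ _ ?_ (congrArg₂ _ ?_ ?_) <;> congr 1 <;> cases q <;> cases q' <;>
          cases r <;> simp

end Tensor

section TensorLaws

variable {K : Type u} [Field K] [CharZero K] {N : Type v} [NonUnitalRing N] [Module K N]
  [IsScalarTower K N N] [SMulCommClass K N N] [NilCDGA K N]

theorem tensor_lawfulOp {P : DGAlg.{u, w} K opSig} (hP : P.IsDG) (hl : LawfulOp P) :
    LawfulOp (tensor N P) := by
  intro n z h
  have un : ∀ {m n : ℕ} (e : Fin m ≃ Fin n) (a : N) (f : P.obj m),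
    (tensor N P).perm e (tmk P a f) = tmk P a (P.perm e f) := fun _ _ _ => rfl
  have bin : ∀ {m n p : ℕ} (h : p + 1 = m + n) (i : Fin m) {a b : N} {f : P.obj m} {g : P.obj n}
      {q γ : Bool} (_ : DGSpace.par (K := K) b = sgn K q • b) (_ : P.par m f = sgn K γ • f),
      (tensor N P).comp h i (tmk P a f) (tmk P b g) =
        sgn K (γ && q) • tmk P (a * b) (P.comp h i f g) :=
    fun h i _ _ _ _ _ _ hb hf => tensor_bin_tmk (sg := opSig) _ hb hf
  have pu : ∀ {m n : ℕ} (e : Fin m ≃ Fin n) {f : P.obj m} {q : Bool} (_ : P.par m f = sgn K q • f),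
    P.par n (P.perm e f) = sgn K q • P.perm e f := fun _ _ _ h => hP.un_par' (sg := opSig) _ h
  have pb : ∀ {m n p : ℕ} (h : p + 1 = m + n) (i : Fin m) {f : P.obj m} {g : P.obj n}
      {q γ : Bool} (_ : P.par m f = sgn K q • f) (_ : P.par n g = sgn K γ • g),
      P.par p (P.comp h i f g) = sgn K (xor q γ) • P.comp h i f g :=
    fun _ _ _ _ _ _ h h' => hP.bin_par' (sg := opSig) _ h h'
  cases h with
  | perm_refl a =>
    rw [sub_eq_zero]
    induction a using tensor_induction hP with
    | add a b h1 h2 => simp only [map_add, h1, h2]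
    | tmul q r a f ha hf => rw [un, sub_eq_zero.1 (hl _ _ (.perm_refl f))]
  | perm_trans e e' a =>
    rw [sub_eq_zero]
    induction a using tensor_induction hP with
    | add a b h1 h2 => simp only [map_add, h1, h2]
    | tmul q r a f ha hf => rw [un, un, un, sub_eq_zero.1 (hl _ _ (.perm_trans e e' f))]
  | equivariance h h' e e' ρ i ho hi a b =>
    rw [sub_eq_zero]
    induction a using tensor_induction hP with
    | add a b h1 h2 => simp only [map_add, LinearMap.add_apply, h1, h2]
    | tmul q r a f ha hf =>
      induction b using tensor_induction hP with
      | add a b h1 h2 => simp only [map_add, h1, h2]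
      | tmul q' r' b g hb hg =>
        rw [bin h i hb hf, un, un, bin h' (e i) hb (pu e hf), map_smul, un,
          sub_eq_zero.1 (hl _ _ (.equivariance h h' e e' ρ i ho hi f g))]
  | seq h₁ h₂ h₃ h₄ i j ij hij a b c =>
    rw [sub_eq_zero]
    induction a using tensor_induction hP with
    | add a b h1 h2 => simp only [map_add, LinearMap.add_apply, h1, h2]
    | tmul q r a f ha hf =>
      induction b using tensor_induction hP with
      | add a b h1 h2 => simp only [map_add, LinearMap.add_apply, h1, h2]
      | tmul q' r' b g hb hg =>
        induction c using tensor_induction hP with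
        | add a b h1 h2 => simp only [map_add, h1, h2]
        | tmul q'' r'' c k hc hk =>
          rw [bin h₁ i hb hf, map_smul, LinearMap.smul_apply, bin h₂ ij hc (pb h₁ i hf hg),
            bin h₃ j hc hg, map_smul, bin h₄ i (mul_par hb hc) hf,
            sub_eq_zero.1 (hl _ _ (.seq h₁ h₂ h₃ h₄ i j ij hij f g k)), smul_smul, smul_smul,
            mul_assoc]
          congr 1
          cases r <;> cases q' <;> cases q'' <;> cases r' <;> simp
  | par h₁ h₂ h₃ h₄ i k hik k' hk i' hi β γ a b c hb hc =>
    rw [sub_eq_zero]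
    induction a using tensor_induction hP with
    | add a b h1 h2 => simp only [map_add, LinearMap.add_apply, h1, h2, smul_add]
    | tmul q r a f ha hf =>
      induction b, hb using tensor_induction_par hP with
      | add a b _ _ h1 h2 => simp only [map_add, LinearMap.add_apply, h1, h2, smul_add]
      | tmul q' r' b g hb hg hβ =>
        induction c, hc using tensor_induction_par hP with
        | add a b _ _ h1 h2 => simp only [map_add, LinearMap.add_apply, h1, h2, smul_add]
        | tmul q'' r'' c k hc hk hγ =>
          rw [bin h₁ i hb hf, map_smul, LinearMap.smul_apply, bin h₂ _ hc (pb h₁ i hf hg),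
            bin h₃ _ hc hf, map_smul, LinearMap.smul_apply, bin h₄ _ hb (pb h₃ _ hf hk),
            sub_eq_zero.1 (hl _ _ (.par h₁ h₂ h₃ h₄ i _ hik k' (by assumption) i' hi _ _ f g k hg hk)),
            mul_assoc, NilCDGA.comm q' q'' b c hb hc, mul_smul_comm, tmk_smul_left, mul_assoc,
            tmk_smul_right]
          simp only [smul_smul]
          congr 1
          subst hβ hγ
          cases r <;> cases q' <;> cases q'' <;> cases r' <;> cases r'' <;> simp

theorem tensor_lawfulMod {P : DGAlg.{u, w} K modSig} (hP : P.IsDG) (hl : LawfulMod P) :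
    LawfulMod (tensor N P) := by
  intro n z h
  have un : ∀ {g m n : ℕ} (e : Fin m ≃ Fin n) (a : N) (f : P.obj (g, m)),
    (tensor N P).mperm g e (tmk P a f) = tmk P a (P.mperm g e f) := fun _ _ _ => rfl
  have contr : ∀ {g r n : ℕ} (h : r = g + 1) (a : N) (f : P.obj (g, n + 2)),
    (tensor N P).contr h n (tmk P a f) = tmk P a (P.contr h n f) := fun _ _ _ => rfl
  have bin : ∀ {k l r m n p : ℕ} (h : r = k + l) (h' : p + 1 = m + n) (i : Fin m) {a b : N}
      {f : P.obj (k, m)} {g : P.obj (l, n + 1)}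
      {q γ : Bool} (_ : DGSpace.par (K := K) b = sgn K q • b) (_ : P.par (k, m) f = sgn K γ • f),
      (tensor N P).mcomp h h' i (tmk P a f) (tmk P b g) =
        sgn K (γ && q) • tmk P (a * b) (P.mcomp h h' i f g) :=
    fun _ h i _ _ _ _ _ _ hb hf => tensor_bin_tmk (sg := modSig) _ hb hf
  have pu : ∀ {k m n : ℕ} (e : Fin m ≃ Fin n) {f : P.obj (k, m)} {q : Bool}
    (_ : P.par (k, m) f = sgn K q • f),
    P.par (k, n) (P.mperm k e f) = sgn K q • P.mperm k e f :=
    fun _ _ _ h => hP.un_par' (sg := modSig) _ h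
  have pc : ∀ {g r n : ℕ} (h : r = g + 1) {f : P.obj (g, n + 2)} {q : Bool}
    (_ : P.par (g, n + 2) f = sgn K q • f),
    P.par (r, n) (P.contr h n f) = sgn K q • P.contr h n f :=
    fun _ _ _ h => hP.un_par' (sg := modSig) _ h
  have pb : ∀ {k l r m n p : ℕ} (h : r = k + l) (h' : p + 1 = m + n) (i : Fin m)
      {f : P.obj (k, m)} {g : P.obj (l, n + 1)}
      {q γ : Bool} (_ : P.par (k, m) f = sgn K q • f) (_ : P.par (l, n + 1) g = sgn K γ • g),
      P.par (r, p) (P.mcomp h h' i f g) = sgn K (xor q γ) • P.mcomp h h' i f g :=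
    fun _ _ _ _ _ _ _ h h' => hP.bin_par' (sg := modSig) _ h h'
  cases h with
  | perm_refl a =>
    rw [sub_eq_zero]
    induction a using tensor_induction hP with
    | add a b h1 h2 => simp only [map_add, h1, h2]
    | tmul q r a f ha hf => rw [un, sub_eq_zero.1 (hl _ _ (.perm_refl f))]
  | perm_trans e e' a =>
    rw [sub_eq_zero]
    induction a using tensor_induction hP with
    | add a b h1 h2 => simp only [map_add, h1, h2]
    | tmul q r a f ha hf => rw [un, un, un, sub_eq_zero.1 (hl _ _ (.perm_trans e e' f))]
  | equivariance hg hp hp' e e' he' ρ i ho hi a b =>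
    rw [sub_eq_zero]
    induction a using tensor_induction hP with
    | add a b h1 h2 => simp only [map_add, LinearMap.add_apply, h1, h2]
    | tmul q r a f ha hf =>
      induction b using tensor_induction hP with
      | add a b h1 h2 => simp only [map_add, h1, h2]
      | tmul q' r' b g hb hg =>
        rw [bin _ hp i hb hf, un, un, bin _ hp' (e i) hb (pu e hf), map_smul, un,
          sub_eq_zero.1 (hl _ _ (.equivariance _ hp hp' e e' he' ρ i ho hi f g))]
  | seq g₁ g₂ g₃ g₄ h₁ h₂ h₃ h₄ i j ij hij a b c =>
    rw [sub_eq_zero]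
    induction a using tensor_induction hP with
    | add a b h1 h2 => simp only [map_add, LinearMap.add_apply, h1, h2]
    | tmul q r a f ha hf =>
      induction b using tensor_induction hP with
      | add a b h1 h2 => simp only [map_add, LinearMap.add_apply, h1, h2]
      | tmul q' r' b g hb hg =>
        induction c using tensor_induction hP with
        | add a b h1 h2 => simp only [map_add, h1, h2]
        | tmul q'' r'' c k hc hk =>
          rw [bin _ h₁ i hb hf, map_smul, LinearMap.smul_apply, bin _ h₂ ij hc (pb _ h₁ i hf hg),
            bin _ h₃ _ hc hg, map_smul, bin _ h₄ i (mul_par hb hc) hf,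
            sub_eq_zero.1 (hl _ _ (.seq _ _ g₃ g₄ h₁ h₂ h₃ h₄ i j ij hij f g k)), smul_smul,
            smul_smul, mul_assoc]
          congr 1
          cases r <;> cases q' <;> cases q'' <;> cases r' <;> simp
  | par g₁ g₂ g₃ g₄ h₁ h₂ h₃ h₄ i k hik k' hk i' hi β γ a b c hb hc =>
    rw [sub_eq_zero]
    induction a using tensor_induction hP with
    | add a b h1 h2 => simp only [map_add, LinearMap.add_apply, h1, h2, smul_add]
    | tmul q r a f ha hf =>
      induction b, hb using tensor_induction_par hP with
      | add a b _ _ h1 h2 => simp only [map_add, LinearMap.add_apply, h1, h2, smul_add]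
      | tmul q' r' b g hb hg hβ =>
        induction c, hc using tensor_induction_par hP with
        | add a b _ _ h1 h2 => simp only [map_add, LinearMap.add_apply, h1, h2, smul_add]
        | tmul q'' r'' c k hc hk hγ =>
          rw [bin _ h₁ i hb hf, map_smul, LinearMap.smul_apply, bin _ h₂ _ hc (pb _ h₁ i hf hg),
            bin _ h₃ _ hc hf, map_smul, LinearMap.smul_apply, bin _ h₄ _ hb (pb _ h₃ _ hf hk),
            sub_eq_zero.1 (hl _ _ (.par _ _ g₃ g₄ h₁ h₂ h₃ h₄ i _ hik k' (by assumption) i' hi _ _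
              f g k hg hk)),
            mul_assoc, NilCDGA.comm q' q'' b c hb hc, mul_smul_comm, tmk_smul_left, mul_assoc,
            tmk_smul_right]
          simp only [smul_smul]
          congr 1
          subst hβ hγ
          cases r <;> cases q' <;> cases q'' <;> cases r' <;> cases r'' <;> simp
  | anti hg hg' hp hp' i e he ρ hb ha α β a b hpa hpb =>
    induction a, hpa using tensor_induction_par hP with
    | add a a' _ _ h1 h2 =>
      simp only [map_add, LinearMap.add_apply, smul_add] at h1 h2 ⊢
      rw [add_add_add_comm, h1, h2, add_zero]
    | tmul q r a f ha' hf hα =>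
      induction b, hpb using tensor_induction_par hP with
      | add a a' _ _ h1 h2 =>
        simp only [map_add, LinearMap.add_apply, smul_add] at h1 h2 ⊢
        rw [add_add_add_comm, h1, h2, add_zero]
      | tmul q' r' b g hb' hg hβ =>
        rw [bin _ hp i hb' hf, un, bin _ hp' _ ha' hg, map_smul, un,
          eq_neg_of_add_eq_zero_left (hl _ _ (.anti _ hg' hp hp' i e he ρ hb ha r r' f g hf hg)),
          NilCDGA.comm q q' a b ha' hb']
        simp only [← neg_one_smul K (sgn K (r && r') • _), tmk_smul_left, tmk_smul_right, smul_smul]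
        rw [← add_smul]
        convert zero_smul K _ using 2
        subst hα hβ
        cases r <;> cases q <;> cases q' <;> cases r' <;> simp
  | contr_equivariance h e e' he he₀ he₁ a =>
    rw [sub_eq_zero]
    induction a using tensor_induction hP with
    | add a b h1 h2 => simp only [map_add, h1, h2]
    | tmul q r a f ha hf =>
      rw [un, contr, contr, un,
        sub_eq_zero.1 (hl _ _ (.contr_equivariance h e e' he he₀ he₁ f))]
  | contr_anti h a =>
    induction a using tensor_induction hP with
    | add a b h1 h2 =>
      simp only [map_add] at h1 h2 ⊢
      rw [add_add_add_comm, h1, h2, add_zero]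
    | tmul q r a f ha hf =>
      rw [un, contr, contr, ← tmk_add_right, hl _ _ (.contr_anti h f), tmk_zero_right]
  | contr_contr h h' a =>
    rw [sub_eq_zero]
    induction a using tensor_induction hP with
    | add a b h1 h2 => simp only [map_add, h1, h2]
    | tmul q r a f ha hf =>
      rw [un, contr, contr, contr, contr, sub_eq_zero.1 (hl _ _ (.contr_contr h h' f))]
  | contr_comp hr hs ht hst hp hp' i a b =>
    rw [sub_eq_zero]
    induction a using tensor_induction hP with
    | add a b h1 h2 => simp only [map_add, LinearMap.add_apply, h1, h2]
    | tmul q r a f ha hf =>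
      induction b using tensor_induction hP with
      | add a b h1 h2 => simp only [map_add, h1, h2]
      | tmul q' r' b g hb hg =>
        rw [contr, bin _ _ _ hb (pc hr hf), bin _ _ _ hb hf, map_smul, contr,
          sub_eq_zero.1 (hl _ _ (.contr_comp hr hs ht hst hp hp' i f g))]
  | comp_comp hr hs hp ρ h₁ h₂ h₃ h₄ a b =>
    rw [sub_eq_zero]
    induction a using tensor_induction hP with
    | add a b h1 h2 => simp only [map_add, LinearMap.add_apply, h1, h2]
    | tmul q r a f ha hf =>
      induction b using tensor_induction hP with
      | add a b h1 h2 => simp only [map_add, h1, h2]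
      | tmul q' r' b g hb hg =>
        rw [un (g := _) _ b g, bin _ _ _ hb hf, bin _ _ _ hb hf, map_smul, map_smul, un, contr,
          map_smul, map_smul, un, contr,
          sub_eq_zero.1 (hl _ _ (.comp_comp hr hs hp ρ h₁ h₂ h₃ h₄ f g))]

end TensorLaws

end MCTwist
end

noncomputable section

namespace MCTwist

/-! ## Combinatorics of positions -/

section Positions

theorem fin_strictMono_unique {n N : ℕ} {f g : Fin n → Fin N} (hf : StrictMono f)
    (hg : StrictMono g) (h : Set.range f = Set.range g) : f = g :=
  (hf.range_inj hg).1 h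

/-- The bijection between the inputs of `a ∘ᵢ b` and the inputs of `a` other than `i` together with
those of `b`. -/
def insFun {m n p : ℕ} (h : p + 1 = m + n) (i : Fin m) : {j : Fin m // j ≠ i} ⊕ Fin n → Fin p
  | .inl j => ⟨outer n i j.1, by
      have := j.1.2
      have := i.2
      have : j.1.val ≠ i.val := fun h => j.2 (Fin.ext h)
      unfold outer; split_ifs <;> omega⟩
  | .inr l => ⟨i + l, by have := i.2; have := l.2; omega⟩

theorem insFun_bijective {m n p : ℕ} (h : p + 1 = m + n) (i : Fin m) :
    Function.Bijective (insFun h i) := by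
  constructor
  · rintro (⟨j, hj⟩ | l) (⟨j', hj'⟩ | l') hjj <;>
      have hjj := congrArg Fin.val hjj <;> simp only [insFun, outer] at hjj
    · have h1 : j.val ≠ i.val := fun h => hj (Fin.ext h)
      have h2 : j'.val ≠ i.val := fun h => hj' (Fin.ext h)
      have : j = j' := by
        apply Fin.ext
        split_ifs at hjj <;> omega
      subst this; rfl
    · have h1 : j.val ≠ i.val := fun h => hj (Fin.ext h)
      have := l'.2
      split_ifs at hjj <;> omega
    · have h1 : j'.val ≠ i.val := fun h => hj' (Fin.ext h)
      have := l.2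
      split_ifs at hjj <;> omega
    · have : l = l' := Fin.ext (by omega)
      rw [this]
  · intro t
    have := t.2
    have := i.2
    by_cases h1 : t.val < i.val
    · refine ⟨.inl ⟨⟨t, by omega⟩, fun h => ?_⟩, ?_⟩
      · have := congrArg Fin.val h; simp at this; omega
      · apply Fin.ext; simp [insFun, outer, h1]
    · by_cases h2 : t.val < i.val + n
      · refine ⟨.inr ⟨t - i, by omega⟩, ?_⟩
        apply Fin.ext; simp [insFun]; omega
      · refine ⟨.inl ⟨⟨t + 1 - n, by omega⟩, fun h => ?_⟩, ?_⟩
        · have := congrArg Fin.val h; simp at this; omega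
        · apply Fin.ext; simp only [insFun, outer]; split_ifs <;> omega

def insEquiv {m n p : ℕ} (h : p + 1 = m + n) (i : Fin m) : {j : Fin m // j ≠ i} ⊕ Fin n ≃ Fin p :=
  Equiv.ofBijective _ (insFun_bijective h i)

theorem insEquiv_inl_val {m n p : ℕ} (h : p + 1 = m + n) (i : Fin m) (j : {j : Fin m // j ≠ i}) :
    (insEquiv h i (.inl j)).val = outer n i j.1 := rfl

theorem insEquiv_inr_val {m n p : ℕ} (h : p + 1 = m + n) (i : Fin m) (l : Fin n) :
    (insEquiv h i (.inr l)).val = i + l := rfl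

theorem outer_lt {m n p : ℕ} (h : p + 1 + 1 = m + n) (i s : Fin m) : outer n i s < p + 1 := by
  have := i.2
  have := s.2
  unfold outer; split_ifs <;> omega

theorem sum_insert {V : Type*} [AddCommMonoid V] {m n p : ℕ} (h : p + 1 + 1 = m + n) (i : Fin m)
    (F : Fin (p + 1) → V) : ∑ t, F t =
      (∑ s : Fin m, if s = i then 0 else F ⟨outer n i s, outer_lt h i s⟩) +
      ∑ l : Fin n, F ⟨i + l, by have := i.2; have := l.2; omega⟩ := by
  rw [← (insEquiv h i).sum_comp, Fintype.sum_sum_type]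
  congr 1
  have h1 := Finset.sum_subtype (p := fun s => s ≠ i) (F := inferInstance) (Finset.univ.filter (· ≠ i)) (by simp)
    (fun s : Fin m => F ⟨outer n i s, outer_lt h i s⟩)
  rw [Finset.sum_filter] at h1
  refine h1.symm.trans (Finset.sum_congr rfl fun s _ => ?_)
  by_cases hs : s = i <;> simp [hs]

/-- The bijection that sends `p` to `r` and is given by `σ` on the complement. -/
def insPerm {n : ℕ} (p r : Fin (n + 1)) (σ : Equiv.Perm (Fin n)) : Equiv.Perm (Fin (n + 1)) :=
  (finSuccEquiv' p).trans (σ.optionCongr.trans (finSuccEquiv' r).symm)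

@[simp] theorem insPerm_self {n : ℕ} (p r : Fin (n + 1)) (σ : Equiv.Perm (Fin n)) :
    insPerm p r σ p = r := by
  simp [insPerm]

@[simp] theorem insPerm_succAbove {n : ℕ} (p r : Fin (n + 1)) (σ : Equiv.Perm (Fin n)) (t : Fin n) :
    insPerm p r σ (p.succAbove t) = r.succAbove (σ t) := by
  simp [insPerm]

theorem insPerm_symm {n : ℕ} (p r : Fin (n + 1)) (σ : Equiv.Perm (Fin n)) :
    (insPerm p r σ).symm = insPerm r p σ.symm := by
  refine Equiv.ext fun t => (Equiv.symm_apply_eq _).2 ?_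
  induction t using Fin.succAboveCases r with
  | x => simp
  | p t => simp

theorem insPerm_bijective {n : ℕ} (r : Fin (n + 1)) : Function.Bijective
    fun q : Fin (n + 1) × Equiv.Perm (Fin n) => insPerm q.1 r q.2 := by
  rw [Fintype.bijective_iff_injective_and_card]
  constructor
  · rintro ⟨p, σ⟩ ⟨p', σ'⟩ h
    have hp : p = p' := by
      have h1 : insPerm p r σ p = insPerm p' r σ' p' := by simp
      simp only at h
      rw [h] at h1
      exact (insPerm p' r σ').injective h1
    subst hp
    congr
    ext t
    have := congrArg (fun e : Equiv.Perm (Fin (n + 1)) => e (p.succAbove t)) h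
    simp only [insPerm_succAbove] at this
    exact congrArg Fin.val (Fin.succAbove_right_injective this)
  · simp [Fintype.card_perm, Nat.factorial_succ]

theorem sum_perm_succ {V : Type*} [AddCommMonoid V] {n : ℕ} (r : Fin (n + 1))
    (F : Equiv.Perm (Fin (n + 1)) → V) : ∑ σ, F σ = ∑ p, ∑ σ, F (insPerm p r σ) := by
  rw [← Fintype.sum_prod_type' (f := fun p σ => F (insPerm p r σ))]
  exact ((insPerm_bijective r).sum_comp F).symm

theorem sum_perm_succ' {V : Type*} [AddCommMonoid V] {n : ℕ} (p : Fin (n + 1))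
    (F : Equiv.Perm (Fin (n + 1)) → V) : ∑ σ, F σ = ∑ r, ∑ σ, F (insPerm p r σ) := by
  rw [← Equiv.sum_comp (Equiv.inv (Equiv.Perm (Fin (n + 1)))), sum_perm_succ p]
  refine Finset.sum_congr rfl fun r _ => ?_
  rw [← Equiv.sum_comp (Equiv.inv (Equiv.Perm (Fin n)))]
  refine Finset.sum_congr rfl fun σ _ => congrArg F ?_
  exact insPerm_symm r p _

theorem mem_shuffles {p N : ℕ} {σ : Equiv.Perm (Fin N)} : σ ∈ shuffles p N ↔
    ∀ a b : Fin N, a < b → (b.val < p ∨ p ≤ a.val) → σ a < σ b := by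
  simp [shuffles]

theorem shuffles_eq_one {p N : ℕ} (h : p = 0 ∨ N ≤ p) : shuffles p N = {1} := by
  ext σ
  rw [mem_shuffles, Finset.mem_singleton]
  constructor
  · intro hσ
    have hm : StrictMono σ := fun a b hab => hσ a b hab (by have := b.2; omega)
    have := fin_strictMono_unique hm strictMono_id (by rw [σ.surjective.range_eq]; simp)
    ext t
    rw [this]; rfl
  · rintro rfl a b hab _
    exact hab

theorem insPerm_mem_shuffles {q n : ℕ} {p : Fin (n + 1)} {σ : Equiv.Perm (Fin n)} :
    insPerm p 0 σ ∈ shuffles q (n + 1) ↔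
      (p = 0 ∧ 0 < q ∧ σ ∈ shuffles (q - 1) n) ∨ (p.val = q ∧ σ ∈ shuffles q n) := by
  simp only [mem_shuffles]
  constructor
  · intro h
    have hlt : ∀ a b : Fin n, p.succAbove a < p.succAbove b →
        ((p.succAbove b).val < q ∨ q ≤ (p.succAbove a).val) → σ a < σ b := by
      intro a b hab hq
      have := h _ _ hab hq
      rw [insPerm_succAbove, insPerm_succAbove] at this
      exact (Fin.strictMono_succAbove 0).lt_iff_lt.1 this
    have hsucc : ∀ a : Fin n, (p.succAbove a).val = if a.val < p.val then a.val else a.val + 1 := by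
      intro a
      simp only [Fin.succAbove, Fin.lt_def, Fin.val_castSucc]
      split_ifs <;> rfl
    have hp := p.2
    by_cases hpq : p.val < q
    · left
      have hp0 : p = 0 := by
        by_contra hne
        have h0 : (0 : Fin (n + 1)) < p := Fin.pos_of_ne_zero hne
        have := h 0 p h0 (.inl hpq)
        rw [insPerm_self] at this
        exact absurd this (Fin.not_lt_zero _)
      refine ⟨hp0, by omega, fun a b hab hq => ?_⟩
      have hab' : a.val < b.val := hab
      refine hlt a b ((Fin.strictMono_succAbove p).lt_iff_lt.2 hab) ?_
      rw [hsucc, hsucc, hp0]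
      simp
      omega
    · right
      have hpq' : p.val = q := by
        by_contra hne
        have hq : q < p.val := by omega
        have := h ⟨q, by omega⟩ p hq (.inr le_rfl)
        rw [insPerm_self] at this
        exact absurd this (Fin.not_lt_zero _)
      refine ⟨hpq', fun a b hab hq => ?_⟩
      have hab' : a.val < b.val := hab
      refine hlt a b ((Fin.strictMono_succAbove p).lt_iff_lt.2 hab) ?_
      rw [hsucc, hsucc, hpq']
      split_ifs <;> omega
  · intro h a b hab hq
    have hab' : a.val < b.val := hab
    have hsucc : ∀ a : Fin n, (p.succAbove a).val = if a.val < p.val then a.val else a.val + 1 := by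
      intro a
      simp only [Fin.succAbove, Fin.lt_def, Fin.val_castSucc]
      split_ifs <;> rfl
    have hbp : b ≠ p := by
      rintro rfl
      rcases h with ⟨h1, h2, _⟩ | ⟨h1, _⟩
      · simp [h1] at hab'
      · omega
    obtain ⟨b, rfl⟩ := Fin.exists_succAbove_eq hbp
    rw [insPerm_succAbove]
    by_cases hap : a = p
    · subst hap
      rw [insPerm_self]
      rw [Fin.succAbove_zero]; exact Fin.succ_pos _
    · obtain ⟨a, rfl⟩ := Fin.exists_succAbove_eq hap
      rw [insPerm_succAbove]
      rw [(Fin.strictMono_succAbove (0 : Fin (n + 1))).lt_iff_lt]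
      have hab2 : a < b := (Fin.strictMono_succAbove p).lt_iff_lt.1 hab
      have hab3 : a.val < b.val := hab2
      rw [hsucc, hsucc] at hq
      rcases h with ⟨h1, h2, h3⟩ | ⟨h1, h3⟩
      · refine h3 a b hab2 ?_
        rw [h1] at hq
        simp at hq
        omega
      · refine h3 a b hab2 ?_
        split_ifs at hq <;> omega

theorem sum_shuffles_succ {V : Type*} [AddCommMonoid V] (q n : ℕ)
    (F : Equiv.Perm (Fin (n + 1)) → V) : ∑ σ ∈ shuffles q (n + 1), F σ =
      (if 0 < q then ∑ σ ∈ shuffles (q - 1) n, F (insPerm 0 0 σ) else 0) +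
      (if h : q ≤ n then ∑ σ ∈ shuffles q n, F (insPerm ⟨q, by omega⟩ 0 σ) else 0) := by
  classical
  have h1 : ∑ σ ∈ shuffles q (n + 1), F σ =
      ∑ σ, if σ ∈ shuffles q (n + 1) then F σ else 0 := by
    rw [← Finset.sum_filter]; simp
  have h2 : ∀ (p : Fin (n + 1)) (σ : Equiv.Perm (Fin n)),
      (if insPerm p 0 σ ∈ shuffles q (n + 1) then F (insPerm p 0 σ) else 0) =
      (if p = 0 ∧ 0 < q ∧ σ ∈ shuffles (q - 1) n then F (insPerm p 0 σ) else 0) +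
      (if p.val = q ∧ σ ∈ shuffles q n then F (insPerm p 0 σ) else 0) := by
    intro p σ
    rw [if_congr insPerm_mem_shuffles rfl rfl]
    by_cases hA : p = 0 ∧ 0 < q ∧ σ ∈ shuffles (q - 1) n
    · have hB : ¬ (p.val = q ∧ σ ∈ shuffles q n) := by
        rintro ⟨h, _⟩
        have := hA.2.1
        rw [hA.1] at h
        simp at h
        omega
      rw [if_neg hB, if_pos hA, if_pos (Or.inl hA), add_zero]
    · simp [hA]
  rw [h1, sum_perm_succ 0]
  simp only [h2, Finset.sum_add_distrib]
  congr 1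
  · rw [Finset.sum_eq_single 0 (fun p _ hp => by simp [hp]) (by simp)]
    split_ifs with hq
    · simp [hq, ← Finset.sum_filter]
    · simp [hq]
  · split_ifs with hq
    · rw [Finset.sum_eq_single ⟨q, by omega⟩ (fun p _ hp => ?_) (by simp)]
      · simp [← Finset.sum_filter]
      · have : p.val ≠ q := fun h => hp (Fin.ext h)
        simp [this]
    · refine Finset.sum_eq_zero fun p _ => ?_
      have : p.val ≠ q := by have := p.2; omega
      simp [this]

/-- The permutations of `Fin (n + i)` that are increasing on the last `n` elements are the products
of shuffles with permutations of the first `i` elements. -/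
theorem sum_increasing {V : Type*} [AddCommMonoid V] (n i : ℕ)
    (G : Equiv.Perm (Fin (n + i)) → V)
    (hG : ∀ σ τ : Equiv.Perm (Fin (n + i)), (∀ t : Fin (n + i), i ≤ t.val → τ t = t) →
      G (σ * τ) = G σ) :
    (∑ σ : Equiv.Perm (Fin (n + i)), open Classical in
      if ∀ a b, a < b → i ≤ a.val → σ a < σ b then G σ else 0) =
      i.factorial • ∑ σ ∈ shuffles i (n + i), G σ := by
  classical
  let ι : Fin i ↪ Fin (n + i) := Fin.castLEEmb (by omega)
  have hιv : ∀ s, (ι s).val = s.val := fun s => rfl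
  have hmem : ∀ t : Fin (n + i), t ∈ Set.range ι ↔ t.val < i := by
    intro t
    constructor
    · rintro ⟨s, rfl⟩; exact s.2
    · intro h; exact ⟨⟨t, h⟩, rfl⟩
  have hfix : ∀ (τ : Equiv.Perm (Fin i)) (t : Fin (n + i)), i ≤ t.val →
      τ.viaEmbedding ι t = t := fun τ t ht =>
    Equiv.Perm.viaEmbedding_apply_of_notMem _ _ _ (by rw [hmem]; omega)
  have hlow : ∀ (τ : Equiv.Perm (Fin i)) (s : Fin i), τ.viaEmbedding ι (ι s) = ι (τ s) :=
    fun τ s => Equiv.Perm.viaEmbedding_apply _ _ _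
  rw [← Finset.sum_filter]
  have h2 : i.factorial • ∑ σ ∈ shuffles i (n + i), G σ =
      ∑ q ∈ shuffles i (n + i) ×ˢ (Finset.univ : Finset (Equiv.Perm (Fin i))), G q.1 := by
    rw [Finset.sum_product, Finset.smul_sum]
    simp [Fintype.card_perm]
  rw [h2]
  symm
  refine Finset.sum_bij (fun q _ => q.1 * q.2.viaEmbedding ι) ?_ ?_ ?_ ?_
  · rintro ⟨σ, τ⟩ h
    simp only [Finset.mem_product, Finset.mem_univ, and_true, mem_shuffles] at h
    simp only [Finset.mem_filter, Finset.mem_univ, true_and]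
    intro a b hab ha
    have hab' : a.val < b.val := hab
    rw [Equiv.Perm.mul_apply, Equiv.Perm.mul_apply, hfix τ a ha, hfix τ b (by omega)]
    exact h a b hab (.inr ha)
  · rintro ⟨σ, τ⟩ h ⟨σ', τ'⟩ h' heq
    simp only [Finset.mem_product, Finset.mem_univ, and_true, mem_shuffles] at h h'
    have happ : ∀ t, σ (τ.viaEmbedding ι t) = σ' (τ'.viaEmbedding ι t) := fun t =>
      congrArg (fun e : Equiv.Perm (Fin (n + i)) => e t) heq
    have hm : ∀ (σ : Equiv.Perm (Fin (n + i))),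
        (∀ a b : Fin (n + i), a < b → (b.val < i ∨ i ≤ a.val) → σ a < σ b) →
        StrictMono (σ ∘ ι) := fun σ hσ a b hab => hσ _ _ hab (.inl b.2)
    have hr : ∀ (σ : Equiv.Perm (Fin (n + i))) (τ : Equiv.Perm (Fin i)),
        Set.range (fun s => σ (τ.viaEmbedding ι (ι s))) = Set.range (σ ∘ ι) := by
      intro σ τ
      have : (fun s => σ (τ.viaEmbedding ι (ι s))) = (σ ∘ ι) ∘ τ := by
        funext s; simp [hlow]
      rw [this, τ.surjective.range_comp]
    have hre : Set.range (σ ∘ ι) = Set.range (σ' ∘ ι) := by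
      rw [← hr σ τ, ← hr σ' τ']
      simp only [happ]
    have hσι := fin_strictMono_unique (hm σ h) (hm σ' h') hre
    have hσ : σ = σ' := by
      ext t
      by_cases ht : t.val < i
      · exact congrArg Fin.val (congrFun hσι ⟨t, ht⟩)
      · have := happ t
        rw [hfix τ t (by omega), hfix τ' t (by omega)] at this
        rw [this]
    subst hσ
    have hτ : τ = τ' := by
      ext s
      have := σ.injective (happ (ι s))
      rw [hlow, hlow] at this
      exact congrArg Fin.val (ι.injective this)
    rw [hτ]
  · intro ρ hρ
    simp only [Finset.mem_filter, Finset.mem_univ, true_and] at hρ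
    let τ := Tuple.sort (ρ ∘ ι)
    have hmono : StrictMono ((ρ ∘ ι) ∘ τ) :=
      (Tuple.monotone_sort (ρ ∘ ι)).strictMono_of_injective
        ((ρ.injective.comp ι.injective).comp τ.injective)
    refine ⟨⟨ρ * τ.viaEmbedding ι, τ⁻¹⟩, ?_, ?_⟩
    · simp only [Finset.mem_product, Finset.mem_univ, and_true, mem_shuffles]
      intro a b hab hq
      have hab' : a.val < b.val := hab
      rw [Equiv.Perm.mul_apply, Equiv.Perm.mul_apply]
      rcases hq with hq | hq
      · have := hmono (a := ⟨a, by omega⟩) (b := ⟨b, by omega⟩) hab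
        simp only [Function.comp_apply, ← hlow] at this
        exact this
      · rw [hfix τ a hq, hfix τ b (by omega)]
        exact hρ a b hab hq
    · ext t
      simp only [Equiv.Perm.mul_apply]
      by_cases ht : t.val < i
      · have : t = ι ⟨t, ht⟩ := rfl
        rw [this, hlow, hlow]
        simp
      · rw [hfix _ t (by omega), hfix _ t (by omega)]
  · rintro ⟨σ, τ⟩ _
    exact (hG σ _ (hfix τ)).symm

end Positions

end MCTwist
end

noncomputable section

namespace MCTwist

theorem sum_fin_split {V : Type*} [AddCommMonoid V] {n : ℕ} (i : Fin (n + 1))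
    (F : Fin (n + 1 + 1) → V) : ∑ j, F j =
      (∑ j : Fin (n + 1), if j ≤ i then F j.castSucc else 0) +
      ∑ j : Fin (n + 1), if i ≤ j then F j.succ else 0 := by
  have h : ∑ j, F j = (∑ j, if j ≤ i.castSucc then F j else 0) +
      ∑ j, if i.castSucc < j then F j else 0 := by
    rw [← Finset.sum_add_distrib]
    refine Finset.sum_congr rfl fun j _ => ?_
    by_cases hj : j ≤ i.castSucc
    · simp [hj, not_lt.2 hj]
    · simp [hj, not_le.1 hj]
  rw [h, Fin.sum_univ_castSucc (n := n + 1), Fin.sum_univ_succ (n := n + 1)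
    (f := fun j => if i.castSucc < j then F j else 0), if_neg (not_le.2 (Fin.castSucc_lt_last i)),
    if_neg (Fin.not_lt_zero _), add_zero, zero_add]
  congr 1
  refine Finset.sum_congr rfl fun j _ => ?_
  simp only [Fin.castSucc_lt_succ_iff]

section Insertion

variable {K : Type u} [Field K] {P : DGAlg.{u, v} K opSig}

/-- The insertion of an operation `y` without inputs into the input `i` of `f`. -/
def insOp (P : DGAlg.{u, v} K opSig) {n : ℕ} (i : Fin (n + 1)) :
    P.obj (n + 1 : ℕ) →ₗ[K] P.obj (0 : ℕ) →ₗ[K] P.obj n :=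
  P.comp (m := n + 1) (n := 0) (p := n) (by omega) i

theorem LawfulOp.perm_refl (hl : LawfulOp P) {n : ℕ} (a : P.obj n) :
    P.perm (Equiv.refl _) a = a := sub_eq_zero.1 (hl _ _ (.perm_refl a))

theorem LawfulOp.perm_one (hl : LawfulOp P) {n : ℕ} (a : P.obj n) :
    P.perm (1 : Equiv.Perm (Fin n)) a = a := hl.perm_refl a

theorem LawfulOp.perm_perm (hl : LawfulOp P) {l m n : ℕ} (e : Fin l ≃ Fin m) (e' : Fin m ≃ Fin n)
    (a : P.obj l) : P.perm e' (P.perm e a) = P.perm (e.trans e') a :=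
  sub_eq_zero.1 (hl _ _ (.perm_trans e e' a))

theorem LawfulOp.perm_ins (hl : LawfulOp P) {n : ℕ} (p r : Fin (n + 1)) (σ : Equiv.Perm (Fin n))
    (f : P.obj (n + 1 : ℕ)) (y : P.obj (0 : ℕ)) :
    insOp P r (P.perm (insPerm p r σ) f) y = P.perm σ (insOp P p f y) := by
  have h := sub_eq_zero.1 (hl _ _ (.equivariance (m := n + 1) (n := 0) (p := n) (m' := n + 1)
    (n' := 0) (p' := n) (by omega) (by omega) (insPerm p r σ) (Equiv.refl _) σ p ?_ ?_ f y))
  · rw [hl.perm_refl, insPerm_self] at h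
    exact h.symm
  · intro j t hj ht
    obtain ⟨s, rfl⟩ := Fin.exists_succAbove_eq hj
    have hsucc : ∀ (p : Fin (n + 1)) (a : Fin n),
        (p.succAbove a).val = if a.val < p.val then a.val else a.val + 1 := by
      intro p a
      simp only [Fin.succAbove, Fin.lt_def, Fin.val_castSucc]
      split_ifs <;> rfl
    have hst : t = s := by
      apply Fin.ext
      rw [ht, outer, hsucc]
      split_ifs <;> omega
    rw [insPerm_self, insPerm_succAbove, hst, outer, hsucc]
    split_ifs <;> omega
  · intro l; exact l.elim0

theorem LawfulOp.comp_ins_inner (hl : LawfulOp P) {m n p q : ℕ} (h₁ : p + 1 + 1 = m + (n + 1))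
    (h₂ : p + 1 = m + n) (i : Fin m) (j : Fin (n + 1)) (t : Fin (p + 1)) (ht : t.val = i + j)
    (a : P.obj m) (b : P.obj (n + 1 : ℕ)) (x : P.obj (0 : ℕ)) (_ : q = 0) :
    insOp P t (P.comp h₁ i a b) x = P.comp h₂ i a (insOp P j b x) :=
  sub_eq_zero.1 (hl _ _ (.seq (n := n + 1) (q := 0) (s := n) h₁ (by omega) (by omega) h₂ i j t ht
    a b x))

theorem DGAlg.IsDG.proj_add (hP : P.IsDG) [CharZero K] {n : ℕ} {V : Type*} [AddCommGroup V]
    [Module K V] {f g : P.obj n →ₗ[K] V}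
    (h : ∀ (β : Bool) b, P.par n b = sgn K β • b → f b = g b) (b : P.obj n) : f b = g b := by
  rw [← proj_false_add_true (P.par n) b, map_add, map_add,
    h _ _ (par_proj (hP.par_par n) _ b), h _ _ (par_proj (hP.par_par n) _ b)]

/-- Inserting an even element `x` commutes with the insertion of `b`: the case of a position after
that of `b`. -/
theorem LawfulOp.comp_ins_right (hl : LawfulOp P) (hP : P.IsDG) [CharZero K] {m n p : ℕ}
    (h₁ : p + 1 + 1 = m + 1 + n) (h₂ : p + 1 = m + n) (i k : Fin (m + 1)) (hik : i < k)
    (i' : Fin m) (hi : i'.val = i)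
    (t : Fin (p + 1)) (ht : t.val = k + n - 1) (a : P.obj (m + 1 : ℕ)) (b : P.obj n)
    {x : P.obj (0 : ℕ)} (hx : P.par (0 : ℕ) x = x) :
    insOp P t (P.comp h₁ i a b) x = P.comp h₂ i' (insOp P k a x) b := by
  refine hP.proj_add (f := (insOp P t).flip x ∘ₗ P.comp h₁ i a) (g := P.comp h₂ i' (insOp P k a x))
    (fun β b hb => ?_) b
  have := sub_eq_zero.1 (hl _ _ (.par (n := n) (q := 0) (s := m) h₁ (by omega) (by omega) h₂ i k hik
    t ht i' hi β false a b x hb (by simpa using hx)))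
  simp only [Bool.and_false, sgn_false, one_smul] at this
  exact this

/-- Inserting an even element `x` commutes with the insertion of `b`: the case of a position before
that of `b`. -/
theorem LawfulOp.comp_ins_left (hl : LawfulOp P) (hP : P.IsDG) [CharZero K] {m n p : ℕ}
    (h₁ : p + 1 + 1 = m + 1 + n) (h₂ : p + 1 = m + n) (i k : Fin (m + 1)) (hik : k < i)
    (i' : Fin m) (hi : i'.val + 1 = i)
    (t : Fin (p + 1)) (ht : t.val = k) (a : P.obj (m + 1 : ℕ)) (b : P.obj n)
    {x : P.obj (0 : ℕ)} (hx : P.par (0 : ℕ) x = x) :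
    insOp P t (P.comp h₁ i a b) x = P.comp h₂ i' (insOp P k a x) b := by
  refine hP.proj_add (f := (insOp P t).flip x ∘ₗ P.comp h₁ i a) (g := P.comp h₂ i' (insOp P k a x))
    (fun β b hb => ?_) b
  have := sub_eq_zero.1 (hl _ _ (.par (n := 0) (q := n) (s := p + 1) (r := m) (by omega) h₂ h₁
    (by omega) k i hik i' (by omega) t ht false β a x b (by simpa using hx) hb))
  simp only [Bool.false_and, sgn_false, one_smul] at this
  exact this.symm

theorem LawfulOp.ins_ins (hl : LawfulOp P) (hP : P.IsDG) [CharZero K] {n : ℕ} (i j : Fin (n + 1))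
    (hij : i ≤ j) (f : P.obj (n + 1 + 1 : ℕ)) (y : P.obj (0 : ℕ)) {x : P.obj (0 : ℕ)}
    (hx : P.par (0 : ℕ) x = x) :
    insOp P j (insOp P i.castSucc f x) y = insOp P i (insOp P j.succ f y) x := by
  have hij' : i.val ≤ j.val := hij
  exact (hl.comp_ins_left hP (m := n + 1) (n := 0) (p := n) (by omega) (by omega) j.succ
    i.castSucc (by rw [Fin.lt_def]; simp; omega) j (by simp) i (by simp) f y hx).symm

/-! ### Formal vector fields -/

/-- Formal vector fields, given by their Taylor coefficients. -/
abbrev Fam (P : DGAlg.{u, v} K opSig) := ∀ n : ℕ, P.obj n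

/-- The derivative of a vector field in the direction of a constant vector field, as a bilinear
map. -/
def advL (kind : Kind) (P : DGAlg.{u, v} K opSig) : P.obj (0 : ℕ) →ₗ[K] Fam P →ₗ[K] Fam P :=
  LinearMap.mk₂ K (fun y X => adv kind P y X)
    (fun y y' X => by
      funext n; cases kind
      · exact map_add _ _ _
      · simp only [adv, map_add, Finset.sum_add_distrib, Pi.add_apply])
    (fun c y X => by
      funext n; cases kind
      · exact map_smul _ _ _
      · simp only [adv, map_smul, Finset.smul_sum, Pi.smul_apply])
    (fun y X X' => by
      funext n; cases kind
      · simp only [adv, map_add, Pi.add_apply, LinearMap.add_apply]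
      · simp only [adv, map_add, Finset.sum_add_distrib, Pi.add_apply, LinearMap.add_apply])
    (fun c y X => by
      funext n; cases kind
      · simp only [adv, map_smul, Pi.smul_apply, LinearMap.smul_apply]
      · simp only [adv, map_smul, Finset.smul_sum, Pi.smul_apply, LinearMap.smul_apply])

theorem adv_lie (y : P.obj (0 : ℕ)) (X : Fam P) (n : ℕ) :
    advL .lie P y X n = insOp P 0 (X (n + 1)) y := rfl

theorem adv_ass (y : P.obj (0 : ℕ)) (X : Fam P) (n : ℕ) :
    advL .ass P y X n = ∑ i, insOp P i (X (n + 1)) y := rfl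

/-- A summand of the product `preLie`. -/
def preLieTerm (kind : Kind) (P : DGAlg.{u, v} K opSig) (X Y : Fam P) (j q n : ℕ) : P.obj n :=
  if h : j + q = n then
    match kind with
    | .lie => ∑ σ ∈ shuffles q n,
        P.perm σ (P.comp (m := j + 1) (n := q) (p := n) (by omega) 0 (X (j + 1)) (Y q))
    | .ass => ∑ i : Fin (j + 1),
        P.comp (m := j + 1) (n := q) (p := n) (by omega) i (X (j + 1)) (Y q)
  else 0

/-- The pre-Lie product of vector fields. -/
def preLieFun (kind : Kind) (P : DGAlg.{u, v} K opSig) (X Y : Fam P) : Fam P := fun n =>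
  ∑ jq ∈ Finset.HasAntidiagonal.antidiagonal n, preLieTerm kind P X Y jq.1 jq.2 n

theorem preLieTerm_add_left (kind : Kind) (X X' Y : Fam P) (j q n : ℕ) :
    preLieTerm kind P (X + X') Y j q n = preLieTerm kind P X Y j q n + preLieTerm kind P X' Y j q n := by
  unfold preLieTerm
  split_ifs
  · cases kind <;>
      simp only [Pi.add_apply, map_add, LinearMap.add_apply, Finset.sum_add_distrib]
  · simp

theorem preLieTerm_smul_left (kind : Kind) (c : K) (X Y : Fam P) (j q n : ℕ) :
    preLieTerm kind P (c • X) Y j q n = c • preLieTerm kind P X Y j q n := by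
  unfold preLieTerm
  split_ifs
  · cases kind <;>
      simp only [Pi.smul_apply, map_smul, LinearMap.smul_apply, Finset.smul_sum]
  · simp

theorem preLieTerm_add_right (kind : Kind) (X Y Y' : Fam P) (j q n : ℕ) :
    preLieTerm kind P X (Y + Y') j q n = preLieTerm kind P X Y j q n + preLieTerm kind P X Y' j q n := by
  unfold preLieTerm
  split_ifs
  · cases kind <;>
      simp only [Pi.add_apply, map_add, LinearMap.add_apply, Finset.sum_add_distrib]
  · simp

theorem preLieTerm_smul_right (kind : Kind) (c : K) (X Y : Fam P) (j q n : ℕ) :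
    preLieTerm kind P X (c • Y) j q n = c • preLieTerm kind P X Y j q n := by
  unfold preLieTerm
  split_ifs
  · cases kind <;>
      simp only [Pi.smul_apply, map_smul, LinearMap.smul_apply, Finset.smul_sum]
  · simp

/-- The pre-Lie product of vector fields, as a bilinear map. -/
def preLie (kind : Kind) (P : DGAlg.{u, v} K opSig) : Fam P →ₗ[K] Fam P →ₗ[K] Fam P :=
  LinearMap.mk₂ K (preLieFun kind P)
    (fun X X' Y => by
      funext n
      simp only [preLieFun, preLieTerm_add_left, Finset.sum_add_distrib, Pi.add_apply])
    (fun c X Y => by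
      funext n
      simp only [preLieFun, preLieTerm_smul_left, Finset.smul_sum, Pi.smul_apply])
    (fun X Y Y' => by
      funext n
      simp only [preLieFun, preLieTerm_add_right, Finset.sum_add_distrib, Pi.add_apply])
    (fun c X Y => by
      funext n
      simp only [preLieFun, preLieTerm_smul_right, Finset.smul_sum, Pi.smul_apply])

theorem preLie_apply (kind : Kind) (X Y : Fam P) (n : ℕ) :
    preLie kind P X Y n = ∑ jq ∈ Finset.HasAntidiagonal.antidiagonal n, preLieTerm kind P X Y jq.1 jq.2 n := rfl

theorem preLie_eq_cobar (kind : Kind) (m : Fam P) (h0 : m 0 = 0) (n : ℕ) :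
    preLie kind P m m n = cobar kind P m n := by
  rw [preLie_apply, Finset.Nat.sum_antidiagonal_eq_sum_range_succ_mk, Finset.sum_range_succ]
  have h1 : preLieTerm kind P m m n (n - n) n = 0 := by
    unfold preLieTerm
    rw [dif_pos (by omega)]
    have : m (n - n) = 0 := by rw [Nat.sub_self]; exact h0
    cases kind <;> simp [this]
  simp only [h1, add_zero]
  rw [Finset.sum_range]
  cases kind <;> refine Finset.sum_congr rfl fun j _ => ?_ <;>
    (have := j.2; unfold preLieTerm; rw [dif_pos (by omega)])

/-- A constant vector field. -/
theorem preLie_constField_left (kind : Kind) (z : P.obj (0 : ℕ)) (Y : Fam P) :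
    preLie kind P (constField P z) Y = 0 := by
  funext n
  rw [preLie_apply]
  refine Finset.sum_eq_zero fun jq _ => ?_
  unfold preLieTerm
  split_ifs
  · cases kind <;> simp [constField]
  · rfl

theorem adv_constField (kind : Kind) (y z : P.obj (0 : ℕ)) :
    advL kind P y (constField P z) = 0 := by
  funext n
  cases kind
  · simp [adv_lie, constField]
  · simp [adv_ass, constField]

theorem preLie_constField_right (hl : LawfulOp P) (kind : Kind) (z : P.obj (0 : ℕ)) (X : Fam P) :
    preLie kind P X (constField P z) = advL kind P z X := by
  funext n
  rw [preLie_apply, Finset.sum_eq_single (n, 0)]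
  · unfold preLieTerm
    rw [dif_pos (by simp)]
    cases kind
    · simp only
      rw [shuffles_eq_one (.inl rfl), Finset.sum_singleton, hl.perm_one]
      rfl
    · rfl
  · rintro ⟨j, q⟩ h1 h2
    have : q ≠ 0 := by
      rintro rfl
      simp at h1
      exact h2 (by rw [h1])
    obtain ⟨q, rfl⟩ := Nat.exists_eq_succ_of_ne_zero this
    unfold preLieTerm
    split_ifs
    · cases kind <;> simp [constField]
    · rfl
  · simp

/-- The admissible vector fields: in the Lie case, the Taylor coefficients have to be symmetric. -/
def admissible (kind : Kind) (P : DGAlg.{u, v} K opSig) : Submodule K (Fam P) where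
  carrier := {X | kind = .lie → ∀ n (σ : Equiv.Perm (Fin n)), P.perm σ (X n) = X n}
  add_mem' hX hY h n σ := by simp only [Pi.add_apply, map_add, hX h n σ, hY h n σ]
  zero_mem' h n σ := by simp
  smul_mem' c X hX h n σ := by simp only [Pi.smul_apply, map_smul, hX h n σ]

theorem ins_of_symm (hl : LawfulOp P) {n : ℕ} {f : P.obj (n + 1 : ℕ)}
    (hf : ∀ σ : Equiv.Perm (Fin (n + 1)), P.perm σ f = f) (i : Fin (n + 1)) (y : P.obj (0 : ℕ)) :
    insOp P i f y = insOp P 0 f y := by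
  have := hl.perm_ins 0 i 1 f y
  rwa [hf, hl.perm_one] at this

theorem adv_mem_admissible (hl : LawfulOp P) {kind : Kind} {X : Fam P}
    (hX : X ∈ admissible kind P) (y : P.obj (0 : ℕ)) : advL kind P y X ∈ admissible kind P := by
  rintro rfl n σ
  rw [adv_lie, ← hl.perm_ins 0 0 σ, hX rfl]

theorem constField_mem_admissible (hl : LawfulOp P) (kind : Kind) (z : P.obj (0 : ℕ)) :
    constField P z ∈ admissible kind P := by
  intro _ n σ
  cases n
  · have : σ = 1 := Subsingleton.elim _ _
    rw [this, hl.perm_one]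
  · simp [constField]

theorem adv_comm (hl : LawfulOp P) (hP : P.IsDG) [CharZero K] {kind : Kind} {X : Fam P}
    (hX : X ∈ admissible kind P) {x : P.obj (0 : ℕ)} (hx : P.par (0 : ℕ) x = x)
    (y : P.obj (0 : ℕ)) : advL kind P y (advL kind P x X) = advL kind P x (advL kind P y X) := by
  funext n
  cases kind
  · simp only [adv_lie]
    have h := hl.ins_ins hP 0 0 le_rfl (X (n + 1 + 1)) y hx
    rw [ins_of_symm hl (hX rfl (n + 1 + 1)) (Fin.succ 0) y] at h
    exact h
  · simp only [adv_ass, map_sum, LinearMap.sum_apply]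
    have hf : ∀ i j : Fin (n + 1), j ≤ i → insOp P i (insOp P j.castSucc (X (n + 1 + 1)) x) y =
        insOp P j (insOp P i.succ (X (n + 1 + 1)) y) x := fun i j hij =>
      hl.ins_ins hP j i hij _ y hx
    have hg : ∀ i j : Fin (n + 1), i ≤ j → insOp P i (insOp P j.succ (X (n + 1 + 1)) x) y =
        insOp P j (insOp P i.castSucc (X (n + 1 + 1)) y) x := fun i j hij => by
      have hij' : i.val ≤ j.val := hij
      exact (hl.comp_ins_right hP (m := n + 1) (n := 0) (p := n) (by omega) (by omega) i.castSucc
        j.succ (by rw [Fin.lt_def]; simp; omega) i (by simp) j (by simp) _ y hx).symm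
    have h1 : ∀ i, _ := fun i => sum_fin_split i
      (fun j => insOp P i (insOp P j (X (n + 1 + 1)) x) y)
    have h2 : ∀ i, _ := fun i => sum_fin_split i
      (fun j => insOp P i (insOp P j (X (n + 1 + 1)) y) x)
    rw [Finset.sum_congr rfl fun i _ => h1 i, Finset.sum_congr rfl fun i _ => h2 i,
      Finset.sum_add_distrib, Finset.sum_add_distrib, add_comm]
    congr 1
    · rw [Finset.sum_comm]
      refine Finset.sum_congr rfl fun j _ => Finset.sum_congr rfl fun i _ => ?_
      split_ifs with h
      · exact hg i j h
      · rfl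
    · rw [Finset.sum_comm]
      refine Finset.sum_congr rfl fun j _ => Finset.sum_congr rfl fun i _ => ?_
      split_ifs with h
      · exact hf i j h
      · rfl

/-! ### Insertion of a constant vector field is a derivation of the pre-Lie product -/

theorem ins_lie_term (hl : LawfulOp P) (hP : P.IsDG) [CharZero K] {X : Fam P}
    (hX : X ∈ admissible .lie P) (Y : Fam P) {x : P.obj (0 : ℕ)}
    (hx : P.par (0 : ℕ) x = x) (j q n : ℕ) (h : j + q = n + 1) :
    insOp P 0 (preLieTerm .lie P X Y j q (n + 1)) x =
      (match (generalizing := false) q with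
        | 0 => 0
        | q + 1 => preLieTerm .lie P X (advL .lie P x Y) j q n) +
      (match (generalizing := false) j with
        | 0 => 0
        | j + 1 => preLieTerm .lie P (advL .lie P x X) Y j q n) := by
  have h0 : preLieTerm .lie P X Y j q (n + 1) = ∑ σ ∈ shuffles q (n + 1),
      P.perm σ (P.comp (m := j + 1) (n := q) (p := n + 1) (by omega) 0 (X (j + 1)) (Y q)) := by
    unfold preLieTerm; rw [dif_pos h]
  rw [h0, map_sum, LinearMap.sum_apply, sum_shuffles_succ]
  simp only [hl.perm_ins]
  congr 1
  · cases q with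
    | zero => simp
    | succ q =>
      rw [if_pos (by omega)]
      dsimp only
      unfold preLieTerm
      rw [dif_pos (by omega)]
      refine Finset.sum_congr rfl fun σ _ => ?_
      rw [hl.comp_ins_inner (q := 0) _ (by omega : n + 1 = j + 1 + q) 0 0 0 (by simp) _ _ _ rfl]
      rfl
  · cases j with
    | zero => rw [dif_neg (by omega)]
    | succ j =>
      rw [dif_pos (by omega)]
      dsimp only
      unfold preLieTerm
      rw [dif_pos (by omega)]
      refine Finset.sum_congr rfl fun σ _ => ?_
      rw [hl.comp_ins_right hP (m := j + 1) (n := q) _ (by omega) 0 1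
        (by rw [Fin.lt_def]; simp) 0 (by simp) ⟨q, by omega⟩ (by simp) _ _ hx,
        ins_of_symm hl (hX rfl _)]
      rfl

theorem ins_ass_term (hl : LawfulOp P) (hP : P.IsDG) [CharZero K] (X : Fam P)
    (Y : Fam P) {x : P.obj (0 : ℕ)}
    (hx : P.par (0 : ℕ) x = x) (j q n : ℕ) (h : j + q = n + 1) :
    ∑ t, insOp P t (preLieTerm .ass P X Y j q (n + 1)) x =
      (match (generalizing := false) q with
        | 0 => 0
        | q + 1 => preLieTerm .ass P X (advL .ass P x Y) j q n) +
      (match (generalizing := false) j with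
        | 0 => 0
        | j + 1 => preLieTerm .ass P (advL .ass P x X) Y j q n) := by
  have h0 : preLieTerm .ass P X Y j q (n + 1) = ∑ i : Fin (j + 1),
      P.comp (m := j + 1) (n := q) (p := n + 1) (by omega) i (X (j + 1)) (Y q) := by
    unfold preLieTerm; rw [dif_pos h]
  rw [h0]
  simp only [map_sum, LinearMap.sum_apply]
  rw [Finset.sum_comm]
  have h1 : ∀ i : Fin (j + 1), _ := fun i => sum_insert (n := q) (m := j + 1) (p := n) (by omega) i
    (fun t => insOp P t (P.comp (m := j + 1) (n := q) (p := n + 1) (by omega) i (X (j + 1)) (Y q)) x)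
  simp only [h1, Finset.sum_add_distrib]
  rw [add_comm]
  congr 1
  · cases q with
    | zero => simp
    | succ q =>
      dsimp only
      unfold preLieTerm
      rw [dif_pos (by omega)]
      refine Finset.sum_congr rfl fun i _ => ?_
      rw [adv_ass, map_sum]
      refine Finset.sum_congr rfl fun l _ => ?_
      rw [hl.comp_ins_inner (q := 0) _ (by omega : n + 1 = j + 1 + q) i l _ (by simp) _ _ _ rfl]
  · cases j with
    | zero => simp
    | succ j =>
      dsimp only
      unfold preLieTerm
      rw [dif_pos (by omega), Finset.sum_comm]
      have h2 : ∀ i : Fin (j + 1), P.comp (m := j + 1) (n := q) (p := n) (by omega) i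
          (advL .ass P x X (j + 1)) (Y q) = ∑ s : Fin (j + 2),
            P.comp (m := j + 1) (n := q) (p := n) (by omega) i
              (insOp P s (X (j + 1 + 1)) x) (Y q) := by
        intro i
        rw [adv_ass, map_sum, LinearMap.sum_apply]
      simp only [h2]
      rw [Finset.sum_comm (s := (Finset.univ : Finset (Fin (j + 1))))]
      refine Finset.sum_congr rfl fun s _ => ?_
      rw [Fin.sum_univ_succAbove _ s, if_pos rfl, zero_add]
      refine Finset.sum_congr rfl fun i _ => ?_
      rw [if_neg (Fin.ne_succAbove s i)]
      by_cases his : i.val < s.val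
      · have hsa : s.succAbove i = i.castSucc := Fin.succAbove_of_castSucc_lt _ _ his
        exact hl.comp_ins_right hP (m := j + 1) (n := q) _ (by omega) _ s
          (by rw [hsa]; exact his) i (by rw [hsa]; rfl) _
          (by simp only [outer, hsa, Fin.val_castSucc]; rw [if_neg (by omega)]) _ _ hx
      · have hsa : s.succAbove i = i.succ :=
          Fin.succAbove_of_le_castSucc _ _ (by rw [Fin.le_def]; simp; omega)
        exact hl.comp_ins_left hP (m := j + 1) (n := q) _ (by omega) _ s
          (by rw [hsa, Fin.lt_def]; simp; omega) i (by rw [hsa]; rfl) _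
          (by simp only [outer, hsa, Fin.val_succ]; rw [if_pos (by omega)]) _ _ hx

theorem adv_preLie (hl : LawfulOp P) (hP : P.IsDG) [CharZero K] {kind : Kind} {X : Fam P}
    (hX : X ∈ admissible kind P) (Y : Fam P) {x : P.obj (0 : ℕ)} (hx : P.par (0 : ℕ) x = x) :
    advL kind P x (preLie kind P X Y) =
      preLie kind P (advL kind P x X) Y + preLie kind P X (advL kind P x Y) := by
  funext n
  have key : ∀ T : ℕ × ℕ → P.obj n, (∀ j q, j + q = n + 1 → T (j, q) =
      (match (generalizing := false) q with
        | 0 => 0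
        | q + 1 => preLieTerm kind P X (advL kind P x Y) j q n) +
      (match (generalizing := false) j with
        | 0 => 0
        | j + 1 => preLieTerm kind P (advL kind P x X) Y j q n)) →
      ∑ jq ∈ Finset.HasAntidiagonal.antidiagonal (n + 1), T jq =
      preLie kind P (advL kind P x X) Y n + preLie kind P X (advL kind P x Y) n := by
    intro T hT
    rw [Finset.sum_congr rfl (fun jq hjq => hT jq.1 jq.2
      (Finset.HasAntidiagonal.mem_antidiagonal.1 hjq)), Finset.sum_add_distrib, add_comm]
    congr 1
    · rw [Finset.Nat.sum_antidiagonal_succ]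
      simp [preLie_apply]
    · rw [Finset.Nat.sum_antidiagonal_succ']
      simp [preLie_apply]
  cases kind
  · rw [adv_lie, preLie_apply, map_sum, LinearMap.sum_apply, Pi.add_apply]
    exact key _ fun j q h => ins_lie_term hl hP hX Y hx j q n h
  · rw [adv_ass, preLie_apply, Pi.add_apply]
    simp only [map_sum, LinearMap.sum_apply]
    rw [Finset.sum_comm]
    exact key _ fun j q h => ins_ass_term hl hP X Y hx j q n h

end Insertion

end MCTwist
end

noncomputable section

namespace MCTwist

/-! ## Exponentials of nilpotent derivations -/

section Exp

variable {K : Type u} [Field K] [CharZero K] {V : Type v} [AddCommGroup V] [Module K V]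

/-- The divided power `D ^ j / j!`. -/
def divPow (D : Module.End K V) (j : ℕ) : Module.End K V := (j.factorial : K)⁻¹ • D ^ j

theorem divPow_zero (D : Module.End K V) : divPow D 0 = 1 := by simp [divPow]

theorem divPow_succ (D : Module.End K V) (j : ℕ) (a : V) :
    D (divPow D j a) = ((j : K) + 1) • divPow D (j + 1) a := by
  have h : ((j : K) + 1) ≠ 0 := by exact_mod_cast Nat.succ_ne_zero j
  simp only [divPow, LinearMap.smul_apply, map_smul, smul_smul, pow_succ', Module.End.mul_apply]
  congr 1
  rw [Nat.factorial_succ]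
  push_cast
  rw [mul_inv, mul_inv_cancel_left₀ h]

theorem divPow_mem {D : Module.End K V} {S : Submodule K V} (hD : ∀ a ∈ S, D a ∈ S) (j : ℕ) {a : V}
    (ha : a ∈ S) : divPow D j a ∈ S := by
  refine S.smul_mem _ ?_
  induction j with
  | zero => simpa using ha
  | succ j ih => rw [pow_succ']; exact hD _ ih

theorem divPow_eq_zero {D : Module.End K V} {k j : ℕ} (hD : D ^ k = 0) (hj : k ≤ j) :
    divPow D j = 0 := by
  rw [divPow, pow_eq_zero_of_le hj hD, smul_zero]

theorem divPow_bilin {D : Module.End K V} {S : Submodule K V} (hD : ∀ a ∈ S, D a ∈ S)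
    (s : V →ₗ[K] V →ₗ[K] V) (hs : ∀ a ∈ S, ∀ b, D (s a b) = s (D a) b + s a (D b)) (n : ℕ) {a : V}
    (ha : a ∈ S) (b : V) : divPow D n (s a b) =
      ∑ ij ∈ Finset.HasAntidiagonal.antidiagonal n, s (divPow D ij.1 a) (divPow D ij.2 b) := by
  induction n with
  | zero => simp [divPow_zero]
  | succ n ih =>
    have h : ((n : K) + 1) ≠ 0 := by exact_mod_cast Nat.succ_ne_zero n
    have h1 : ((n : K) + 1) • divPow D (n + 1) (s a b) = ((n : K) + 1) •
        ∑ ij ∈ Finset.HasAntidiagonal.antidiagonal (n + 1),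
          s (divPow D ij.1 a) (divPow D ij.2 b) := by
      rw [← divPow_succ, ih, map_sum]
      simp only [hs _ (divPow_mem hD _ ha), divPow_succ, map_smul, LinearMap.smul_apply]
      rw [Finset.sum_add_distrib]
      have h2 : ∑ ij ∈ Finset.HasAntidiagonal.antidiagonal n, ((ij.1 : K) + 1) •
          s (divPow D (ij.1 + 1) a) (divPow D ij.2 b) =
          ∑ ij ∈ Finset.HasAntidiagonal.antidiagonal (n + 1), (ij.1 : K) •
            s (divPow D ij.1 a) (divPow D ij.2 b) := by
        rw [Finset.Nat.sum_antidiagonal_succ]; simp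
      have h3 : ∑ ij ∈ Finset.HasAntidiagonal.antidiagonal n, ((ij.2 : K) + 1) •
          s (divPow D ij.1 a) (divPow D (ij.2 + 1) b) =
          ∑ ij ∈ Finset.HasAntidiagonal.antidiagonal (n + 1), (ij.2 : K) •
            s (divPow D ij.1 a) (divPow D ij.2 b) := by
        rw [Finset.Nat.sum_antidiagonal_succ']; simp
      rw [h2, h3, ← Finset.sum_add_distrib, Finset.smul_sum]
      refine Finset.sum_congr rfl fun ij hij => ?_
      rw [← add_smul]
      congr 1
      exact_mod_cast Finset.HasAntidiagonal.mem_antidiagonal.1 hij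
    exact smul_right_injective V h h1

/-- The partial sums of the exponential series. -/
def expSum (D : Module.End K V) (N : ℕ) : Module.End K V := ∑ j ∈ Finset.range N, divPow D j

theorem expSum_apply (D : Module.End K V) (N : ℕ) (a : V) :
    expSum D N a = ∑ j ∈ Finset.range N, divPow D j a := by
  simp [expSum, LinearMap.sum_apply]

theorem expSum_eq {D : Module.End K V} {k N : ℕ} (hD : D ^ k = 0) (hN : k ≤ N) :
    expSum D N = expSum D k := by
  refine (Finset.sum_subset (Finset.range_mono hN) fun j _ hj => ?_).symm
  exact divPow_eq_zero hD (by simpa using hj)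

theorem expSum_mem {D : Module.End K V} {S : Submodule K V} (hD : ∀ a ∈ S, D a ∈ S) (N : ℕ) {a : V}
    (ha : a ∈ S) : expSum D N a ∈ S := by
  rw [expSum_apply]
  exact S.sum_mem fun j _ => divPow_mem hD j ha

theorem expSum_bilin {D : Module.End K V} {k : ℕ} (hk : D ^ k = 0) {S : Submodule K V}
    (hD : ∀ a ∈ S, D a ∈ S)
    (s : V →ₗ[K] V →ₗ[K] V) (hs : ∀ a ∈ S, ∀ b, D (s a b) = s (D a) b + s a (D b)) {a : V}
    (ha : a ∈ S) (b : V) : expSum D k (s a b) = s (expSum D k a) (expSum D k b) := by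
  conv_lhs => rw [← expSum_eq hk (by omega : k ≤ 2 * k), expSum_apply]
  rw [expSum_apply, expSum_apply]
  simp only [divPow_bilin hD s hs _ ha, map_sum, LinearMap.sum_apply]
  rw [← Finset.sum_product' (f := fun i j => s (divPow D j a) (divPow D i b)),
    ← Finset.sum_fiberwise_of_maps_to (t := Finset.range (2 * k)) (g := fun ij : ℕ × ℕ => ij.1 + ij.2)]
  · refine Finset.sum_congr rfl fun n _ => ?_
    rw [← Finset.Nat.sum_antidiagonal_swap]
    symm
    refine Finset.sum_subset ?_ ?_
    · rintro ⟨i, j⟩ h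
      simp only [Finset.mem_filter] at h
      simpa using h.2
    · rintro ⟨i, j⟩ h h'
      simp only [Finset.HasAntidiagonal.mem_antidiagonal] at h
      simp only [Finset.mem_filter, Finset.mem_product, Finset.mem_range, h, and_true, not_and_or,
        not_lt] at h'
      rcases h' with h' | h'
      · simp [divPow_eq_zero hk h']
      · simp [divPow_eq_zero hk h']
  · rintro ⟨i, j⟩ h
    simp only [Finset.mem_product, Finset.mem_range] at h ⊢
    omega

theorem expSum_neg_expSum {D : Module.End K V} {k : ℕ} (hk : D ^ k = 0) (a : V) :
    expSum (-D) k (expSum D k a) = a := by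
  letI : Module ℚ (Module.End K V) := Module.compHom _ (algebraMap ℚ K)
  have h : ∀ (D : Module.End K V), D ^ k = 0 → IsNilpotent.exp D = expSum D k := by
    intro D hD
    rw [IsNilpotent.exp_eq_sum hD]
    refine Finset.sum_congr rfl fun j _ => ?_
    change (algebraMap ℚ K ((j.factorial : ℚ)⁻¹)) • D ^ j = (j.factorial : K)⁻¹ • D ^ j
    simp
  have hk' : (-D) ^ k = 0 := by rw [neg_pow, hk, mul_zero]
  have := IsNilpotent.exp_neg_mul_exp_self ⟨k, hk⟩
  rw [h D hk, h (-D) hk'] at this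
  exact congrArg (fun f : Module.End K V => f a) this

end Exp

section Plug

variable {K : Type u} [Field K] [CharZero K] {P : DGAlg.{u, v} K opSig}

/-- `plug` as a linear map. -/
def plugL (P : DGAlg.{u, v} K opSig) (x : P.obj (0 : ℕ)) (n : ℕ) :
    ∀ i : ℕ, P.obj (n + i : ℕ) →ₗ[K] P.obj n
  | 0 => LinearMap.id
  | i + 1 => plugL P x n i ∘ₗ (insOp P (⟨i, by omega⟩ : Fin (n + i + 1))).flip x

theorem plugL_apply (x : P.obj (0 : ℕ)) (n i : ℕ) (f : P.obj (n + i : ℕ)) :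
    plugL P x n i f = plug P x n i f := by
  induction i with
  | zero => rfl
  | succ i ih => exact ih _

theorem plugL_ins (hl : LawfulOp P) (hP : P.IsDG) {x : P.obj (0 : ℕ)}
    (hx : P.par (0 : ℕ) x = x) (n i p : ℕ) (hp : p ≤ i) (f : P.obj (n + i + 1 : ℕ)) :
    plugL P x n i (insOp P ⟨p, by omega⟩ f x) = plugL P x n i (insOp P ⟨i, by omega⟩ f x) := by
  induction i with
  | zero => have : p = 0 := by omega
            subst this; rfl
  | succ i ih =>
    by_cases hpi : p = i + 1
    · subst hpi; rfl
    · have h1 := hl.ins_ins hP (n := n + i) ⟨p, by omega⟩ ⟨i, by omega⟩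
        (by rw [Fin.le_def]; simp; omega) f x hx
      have h2 := ih (by omega) (insOp P (n := n + i + 1) ⟨i + 1, by omega⟩ f x)
      change plugL P x n i (insOp P (⟨i, by omega⟩ : Fin (n + i + 1))
        (insOp P (n := n + i + 1) (Fin.castSucc ⟨p, by omega⟩) f x) x) = _
      rw [h1]
      exact h2

theorem plugL_perm (hl : LawfulOp P) (hP : P.IsDG) {x : P.obj (0 : ℕ)}
    (hx : P.par (0 : ℕ) x = x) (n i : ℕ) (τ : Equiv.Perm (Fin (n + i)))
    (hτ : ∀ t : Fin (n + i), i ≤ t.val → τ t = t) (f : P.obj (n + i : ℕ)) :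
    plugL P x n i (P.perm τ f) = plugL P x n i f := by
  induction i with
  | zero =>
    have : τ = 1 := by ext t; rw [hτ t (by omega)]; rfl
    rw [this, hl.perm_one]
  | succ i ih =>
    let r : Fin (n + i + 1) := ⟨i, by omega⟩
    obtain ⟨p, σ, hσ⟩ : ∃ (p : Fin (n + i + 1)) (σ : Equiv.Perm (Fin (n + i))),
        τ = insPerm p r σ := by
      obtain ⟨⟨p, σ⟩, h⟩ := (insPerm_bijective r).2 τ
      exact ⟨p, σ, h.symm⟩
    have hp : p.val ≤ i := by
      by_contra h
      have h1 := hτ p (by omega)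
      rw [hσ, insPerm_self] at h1
      rw [← h1] at h
      exact h le_rfl
    change plugL P x n i (insOp P r (P.perm τ f) x) = plugL P x n i (insOp P r f x)
    rw [hσ, hl.perm_ins, ih σ]
    · exact plugL_ins hl hP hx n i p.val hp f
    · intro t ht
      have h1 : p.succAbove t = t.succ := Fin.succAbove_of_le_castSucc _ _ (by
        rw [Fin.le_def]; simp; omega)
      have h2 : r.succAbove t = t.succ := Fin.succAbove_of_le_castSucc _ _ (by
        rw [Fin.le_def]; simp [r]; omega)
      have h3 := hτ t.succ (by simp; omega)
      rw [hσ, ← h1, insPerm_succAbove, h1, ← h2] at h3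
      exact Fin.succAbove_right_injective h3

theorem pow_adv_lie (hl : LawfulOp P) (x : P.obj (0 : ℕ)) (n i : ℕ) {X : Fam P}
    (hX : X ∈ admissible .lie P) : ((advL .lie P x) ^ i) X n = plugL P x n i (X (n + i)) := by
  induction i generalizing X with
  | zero => rfl
  | succ i ih =>
    rw [pow_succ, Module.End.mul_apply, ih (adv_mem_admissible hl hX x), adv_lie,
      ← ins_of_symm hl (hX rfl _) ⟨i, by omega⟩]
    rfl

theorem pow_adv_ass_increasing (hl : LawfulOp P) (x : P.obj (0 : ℕ)) (n i : ℕ) (X : Fam P) :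
    ((advL .ass P x) ^ i) X n = ∑ σ : Equiv.Perm (Fin (n + i)), open Classical in
      if ∀ a b, a < b → i ≤ a.val → σ a < σ b then plugL P x n i (P.perm σ.symm (X (n + i)))
        else 0 := by
  classical
  induction i generalizing X with
  | zero =>
    rw [Finset.sum_eq_single 1]
    · refine Eq.trans ?_ (if_pos ?_).symm
      · exact (hl.perm_one _).symm
      · exact fun a b h _ => h
    · intro σ _ hσ
      rw [if_neg]
      intro h
      apply hσ
      have h1 : σ ∈ shuffles 0 (n + 0) := mem_shuffles.2 fun a b hab _ => h a b hab (Nat.zero_le _)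
      rw [shuffles_eq_one (.inl rfl)] at h1
      simpa using h1
    · simp
  | succ i ih =>
    let r : Fin (n + i + 1) := ⟨i, by omega⟩
    rw [pow_succ, Module.End.mul_apply, ih]
    refine Eq.trans ?_ (sum_perm_succ' (n := n + i) r _).symm
    rw [Finset.sum_comm]
    refine Finset.sum_congr rfl fun σ _ => ?_
    have hiff : ∀ p : Fin (n + i + 1), (∀ a b, a < b → i + 1 ≤ a.val →
        insPerm r p σ a < insPerm r p σ b) ↔ (∀ a b, a < b → i ≤ a.val → σ a < σ b) := by
      intro p
      have hr : ∀ t : Fin (n + i), i ≤ t.val → r.succAbove t = t.succ := fun t ht =>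
        Fin.succAbove_of_le_castSucc _ _ (by rw [Fin.le_def]; simp [r]; omega)
      constructor
      · intro h a b hab ha
        have hab' : a.val < b.val := hab
        have := h a.succ b.succ (by simpa using hab) (by simp; omega)
        rw [← hr a ha, ← hr b (by omega), insPerm_succAbove, insPerm_succAbove] at this
        exact (Fin.strictMono_succAbove p).lt_iff_lt.1 this
      · intro h a b hab ha
        have hab' : a.val < b.val := hab
        obtain ⟨a, rfl⟩ := Fin.exists_succ_eq.2 (fun h0 : a = 0 => by simp [h0] at ha)
        obtain ⟨b, rfl⟩ := Fin.exists_succ_eq.2 (fun h0 : b = 0 => by simp [h0] at hab')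
        simp only [Fin.val_succ] at ha hab'
        rw [← hr a (by omega), ← hr b (by omega), insPerm_succAbove, insPerm_succAbove]
        exact Fin.strictMono_succAbove p (h a b (by rw [Fin.lt_def]; omega) (by omega))
    by_cases hσ : ∀ a b, a < b → i ≤ a.val → σ a < σ b
    · rw [if_pos hσ, adv_ass, map_sum, map_sum]
      refine Finset.sum_congr rfl fun p _ => ?_
      refine Eq.trans ?_ (if_pos ((hiff p).2 hσ)).symm
      rw [insPerm_symm]
      exact congrArg (plugL P x n i) (hl.perm_ins p r σ.symm _ x).symm
    · rw [if_neg hσ]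
      exact (Finset.sum_eq_zero fun p _ => if_neg (fun h => hσ ((hiff p).1 h))).symm

theorem pow_adv_ass (hl : LawfulOp P) (hP : P.IsDG) {x : P.obj (0 : ℕ)}
    (hx : P.par (0 : ℕ) x = x) (n i : ℕ) (X : Fam P) :
    ((advL .ass P x) ^ i) X n = i.factorial •
      ∑ σ ∈ shuffles i (n + i), plugL P x n i (P.perm σ.symm (X (n + i))) := by
  rw [pow_adv_ass_increasing hl]
  refine sum_increasing n i (fun σ => plugL P x n i (P.perm σ.symm (X (n + i)))) ?_
  intro σ τ hτ
  have : (σ * τ).symm = σ.symm.trans τ.symm := rfl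
  rw [this, ← hl.perm_perm, plugL_perm hl hP hx]
  intro t ht
  rw [Equiv.symm_apply_eq, hτ t ht]

theorem twTerm_eq (hl : LawfulOp P) (hP : P.IsDG) {kind : Kind} {x : P.obj (0 : ℕ)}
    (hx : P.par (0 : ℕ) x = x) (n i : ℕ) {X : Fam P} (hX : X ∈ admissible kind P) :
    twTerm kind P X x n i = divPow (advL kind P x) i X n := by
  cases kind
  · simp only [twTerm, divPow, LinearMap.smul_apply, Pi.smul_apply]
    rw [pow_adv_lie hl x n i hX, plugL_apply]
  · simp only [twTerm, divPow, LinearMap.smul_apply, Pi.smul_apply]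
    rw [pow_adv_ass hl hP hx, ← Nat.cast_smul_eq_nsmul K, smul_smul, inv_mul_cancel₀ (by
      exact_mod_cast i.factorial_ne_zero), one_smul]
    simp only [plugL_apply]

theorem mcTerm_eq (hl : LawfulOp P) (hP : P.IsDG) {kind : Kind} {x : P.obj (0 : ℕ)}
    (hx : P.par (0 : ℕ) x = x) (n : ℕ) {X : Fam P} (hX : X ∈ admissible kind P) :
    mcTerm kind P X x n = divPow (advL kind P x) n X 0 := by
  rw [← twTerm_eq hl hP hx 0 n hX]
  cases kind
  · rfl
  · simp only [mcTerm, twTerm, coef, one_smul]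
    rw [shuffles_eq_one (.inr (by omega)), Finset.sum_singleton]
    have : (Equiv.symm (1 : Equiv.Perm (Fin (0 + n)))) = 1 := rfl
    rw [this, hl.perm_one]

end Plug

end MCTwist
end

noncomputable section

namespace MCTwist

/-! ## Twisting in an operad satisfying the axioms -/

section Twist

variable {K : Type u} [Field K] {P : DGAlg.{u, v} K opSig}

theorem end_neg_pow_eq_zero {V : Type*} [AddCommGroup V] [Module K V] {D : Module.End K V} {k : ℕ}
    (hD : D ^ k = 0) : (-D) ^ k = 0 := by
  rw [neg_pow, hD, mul_zero]

/-- The differential of the Taylor coefficients of a vector field. -/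
def dFam (P : DGAlg.{u, v} K opSig) : Fam P →ₗ[K] Fam P :=
  LinearMap.pi fun n : ℕ => P.d n ∘ₗ LinearMap.proj n

/-- The parity of the Taylor coefficients of a vector field. -/
def parFam (P : DGAlg.{u, v} K opSig) : Fam P →ₗ[K] Fam P :=
  LinearMap.pi fun n : ℕ => P.par n ∘ₗ LinearMap.proj n

theorem dFam_apply (X : Fam P) (n : ℕ) : dFam P X n = P.d n (X n) := rfl

theorem parFam_apply (X : Fam P) (n : ℕ) : parFam P X n = P.par n (X n) := rfl

theorem DGAlg.IsDG.d_ins (hP : P.IsDG) {n : ℕ} (i : Fin (n + 1)) (f : P.obj (n + 1 : ℕ))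
    (y : P.obj (0 : ℕ)) : P.d n (insOp P i f y) =
      insOp P i (P.d (n + 1 : ℕ) f) y + insOp P i (P.par (n + 1 : ℕ) f) (P.d (0 : ℕ) y) :=
  hP.bin_d (sg := opSig) _ f y

theorem DGAlg.IsDG.par_ins (hP : P.IsDG) {n : ℕ} (i : Fin (n + 1)) (f : P.obj (n + 1 : ℕ))
    (y : P.obj (0 : ℕ)) : P.par n (insOp P i f y) =
      insOp P i (P.par (n + 1 : ℕ) f) (P.par (0 : ℕ) y) :=
  hP.bin_par (sg := opSig) _ f y

theorem dFam_adv (hP : P.IsDG) (kind : Kind) (y : P.obj (0 : ℕ)) (X : Fam P) :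
    dFam P (advL kind P y X) =
      advL kind P y (dFam P X) + advL kind P (P.d (0 : ℕ) y) (parFam P X) := by
  funext n
  cases kind
  · exact hP.d_ins _ _ _
  · simp only [dFam_apply, adv_ass, map_sum, hP.d_ins, Finset.sum_add_distrib, Pi.add_apply]
    rfl

theorem parFam_adv (hP : P.IsDG) (kind : Kind) (y : P.obj (0 : ℕ)) (X : Fam P) :
    parFam P (advL kind P y X) = advL kind P (P.par (0 : ℕ) y) (parFam P X) := by
  funext n
  cases kind
  · exact hP.par_ins _ _ _
  · simp only [parFam_apply, adv_ass, map_sum, hP.par_ins]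

theorem parFam_divPow (hP : P.IsDG) (kind : Kind) {x : P.obj (0 : ℕ)}
    (hx : P.par (0 : ℕ) x = x) (j : ℕ) (X : Fam P) :
    parFam P (divPow (advL kind P x) j X) = divPow (advL kind P x) j (parFam P X) := by
  simp only [divPow, LinearMap.smul_apply, map_smul]
  congr 1
  induction j generalizing X with
  | zero => rfl
  | succ j ih => rw [pow_succ, Module.End.mul_apply, ih, parFam_adv hP, hx]; rfl

theorem dFam_divPow [CharZero K] (hP : P.IsDG) (hl : LawfulOp P) {kind : Kind} {x : P.obj (0 : ℕ)}
    (hx : P.par (0 : ℕ) x = x) {X : Fam P} (hX : X ∈ admissible kind P) (hpX : parFam P X = -X)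
    (j : ℕ) : dFam P (divPow (advL kind P x) (j + 1) X) =
      divPow (advL kind P x) (j + 1) (dFam P X) -
        advL kind P (P.d (0 : ℕ) x) (divPow (advL kind P x) j X) := by
  have hmem : ∀ j, divPow (advL kind P x) j X ∈ admissible kind P := fun j =>
    divPow_mem (fun a ha => adv_mem_admissible hl ha x) j hX
  have hpar : ∀ j, parFam P (divPow (advL kind P x) j X) = - divPow (advL kind P x) j X := by
    intro j
    rw [parFam_divPow hP kind hx, hpX, map_neg]
  induction j with
  | zero =>
    have h1 : ∀ Y, divPow (advL kind P x) (0 + 1) Y = advL kind P x Y := by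
      intro Y; simp [divPow]
    rw [h1, h1, dFam_adv hP, hpX, map_neg, divPow_zero, Module.End.one_apply, sub_eq_add_neg]
  | succ j ih =>
    have hj : ((j + 1 : ℕ) : K) + 1 ≠ 0 := by exact_mod_cast Nat.succ_ne_zero (j + 1)
    refine smul_right_injective (Fam P) hj ?_
    change (((j + 1 : ℕ) : K) + 1) • _ = (((j + 1 : ℕ) : K) + 1) • _
    rw [← map_smul, ← divPow_succ, dFam_adv hP, ih, hpar, map_sub, divPow_succ, map_neg,
      ← adv_comm hl hP (hmem j) hx, divPow_succ, map_smul, smul_sub]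
    push_cast
    rw [add_smul ((j : K) + 1) 1 (advL kind P (P.d (0 : ℕ) x) _), one_smul]
    abel

/-- The family `m` is a family of odd operations satisfying the relations of `L∞` or `A∞`, and `x`
is a solution of the Maurer-Cartan equation of nilpotency order `k`. -/
structure MCPair (kind : Kind) (P : DGAlg.{u, v} K opSig) (m : Fam P) (x : P.obj (0 : ℕ))
    (k : ℕ) : Prop where
  par_x : P.par (0 : ℕ) x = x
  par_m : parFam P m = -m
  m_zero : m 0 = 0
  symm : m ∈ admissible kind P
  d_m : ∀ n : ℕ, P.d n (m n) = cobar kind P m n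
  d_x : ∀ N, k ≤ N → P.d (0 : ℕ) x = ∑ n ∈ Finset.range N, mcTerm kind P m x (n + 1)
  nil : (advL kind P x) ^ k = 0

/-- The twist of `m` by `x`. -/
def twist (kind : Kind) (P : DGAlg.{u, v} K opSig) (m : Fam P) (x : P.obj (0 : ℕ)) (k : ℕ) :
    Fam P :=
  expSum (advL kind P x) k m - constField P (P.d (0 : ℕ) x)

theorem expSum_constField [CharZero K] (kind : Kind) (x z : P.obj (0 : ℕ)) (k : ℕ) :
    expSum (advL kind P x) (k + 1) (constField P z) = constField P z := by
  rw [expSum_apply, Finset.sum_range_succ', Finset.sum_eq_zero, divPow_zero, zero_add]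
  · rfl
  · intro j _
    rw [divPow, LinearMap.smul_apply, pow_succ, Module.End.mul_apply, adv_constField, map_zero,
      smul_zero]

theorem constField_neg (z : P.obj (0 : ℕ)) : constField P (-z) = - constField P z := by
  funext n; cases n <;> simp [constField]

theorem adv_pow_eq_zero (F : Filt P) {k : ℕ} (hF : ∀ n : ℕ, F.F k n = ⊥) (kind : Kind)
    {x : P.obj (0 : ℕ)} (hx : x ∈ F.F 1 (0 : ℕ)) : (advL kind P x) ^ k = 0 := by
  have h : ∀ (j : ℕ) (X : Fam P) (n : ℕ), ((advL kind P x) ^ j) X n ∈ F.F j n := by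
    intro j
    induction j with
    | zero => exact fun X n => F.zero _ _
    | succ j ih =>
      intro X n
      rw [pow_succ', Module.End.mul_apply]
      cases kind
      · exact F.bin (sg := opSig) (OpB.comp (by omega) 0) _ _ _ _ (ih X (n + 1)) hx
      · rw [adv_ass]
        exact Submodule.sum_mem _ fun i _ => F.bin (sg := opSig) (OpB.comp (by omega) i) _ _ _ _
          (ih X (n + 1)) hx
  ext X n
  have := h k X n
  rwa [hF, Submodule.mem_bot] at this

theorem adv_iterate (kind : Kind) (x : P.obj (0 : ℕ)) (j : ℕ) (X : Fam P) :
    (adv kind P x)^[j] X = ((advL kind P x) ^ j) X := by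
  rw [Module.End.pow_apply]; rfl

theorem adv_neg_pow_eq_zero {kind : Kind} {x : P.obj (0 : ℕ)} {k : ℕ}
    (h : (advL kind P x) ^ k = 0) : (advL kind P (-x)) ^ k = 0 := by
  rw [map_neg]
  exact end_neg_pow_eq_zero h

variable [CharZero K]

theorem sum_mcTerm (hP : P.IsDG) (hl : LawfulOp P) {kind : Kind} {x : P.obj (0 : ℕ)}
    (hx : P.par (0 : ℕ) x = x) {X : Fam P} (hX : X ∈ admissible kind P) (h0 : X 0 = 0) (N : ℕ) :
    ∑ n ∈ Finset.range N, mcTerm kind P X x (n + 1) = expSum (advL kind P x) (N + 1) X 0 := by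
  rw [expSum_apply, Finset.sum_range_succ', divPow_zero, Pi.add_apply, Finset.sum_apply,
    Module.End.one_apply, h0, add_zero]
  exact Finset.sum_congr rfl fun n _ => mcTerm_eq hl hP hx _ hX

namespace MCPair

variable {kind : Kind} {m : Fam P} {x : P.obj (0 : ℕ)} {k : ℕ}

theorem expSum_zero (h : MCPair kind P m x k) (hP : P.IsDG) (hl : LawfulOp P) :
    expSum (advL kind P x) k m 0 = P.d (0 : ℕ) x := by
  rw [h.d_x k le_rfl, sum_mcTerm hP hl h.par_x h.symm h.m_zero, ← expSum_eq h.nil (Nat.le_succ k)]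

theorem twist_zero (h : MCPair kind P m x k) (hP : P.IsDG) (hl : LawfulOp P) :
    twist kind P m x k 0 = 0 := by
  rw [twist, Pi.sub_apply, h.expSum_zero hP hl]
  exact sub_self _

theorem twist_mem (h : MCPair kind P m x k) (hl : LawfulOp P) :
    twist kind P m x k ∈ admissible kind P :=
  Submodule.sub_mem _ (expSum_mem (fun _ ha => adv_mem_admissible hl ha x) k h.symm)
    (constField_mem_admissible hl kind _)

theorem expSum_twist (h : MCPair kind P m x k) :
    expSum (advL kind P (-x)) k (twist kind P m x k) = m - constField P (P.d (0 : ℕ) x) := by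
  have h' := adv_neg_pow_eq_zero h.nil
  conv_lhs => rw [← expSum_eq h' (Nat.le_succ k), twist, map_sub, expSum_constField,
    expSum_eq h' (Nat.le_succ k), map_neg, expSum_neg_expSum h.nil]

theorem twist_twist (h : MCPair kind P m x k) :
    twist kind P (twist kind P m x k) (-x) k = m := by
  rw [twist, h.expSum_twist, map_neg, constField_neg]
  abel

theorem dFam_expSum (h : MCPair kind P m x k) (hP : P.IsDG) (hl : LawfulOp P) :
    dFam P (expSum (advL kind P x) k m) =
      preLie kind P (expSum (advL kind P x) k m) (expSum (advL kind P x) k m) -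
        advL kind P (P.d (0 : ℕ) x) (expSum (advL kind P x) k m) := by
  have hdm : dFam P m = preLie kind P m m := by
    funext n
    rw [dFam_apply, h.d_m, preLie_eq_cobar kind m h.m_zero]
  rw [← expSum_bilin h.nil (fun _ ha => adv_mem_admissible hl ha x) (preLie kind P)
    (fun a ha b => adv_preLie hl hP ha b h.par_x) h.symm, ← hdm]
  conv_lhs => rw [← expSum_eq h.nil (Nat.le_succ k)]
  conv_rhs => enter [1]; rw [← expSum_eq h.nil (Nat.le_succ k)]
  rw [expSum_apply, expSum_apply, expSum_apply, Finset.sum_range_succ', Finset.sum_range_succ',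
    map_add, map_sum, map_sum]
  simp only [dFam_divPow hP hl h.par_x h.symm h.par_m, Finset.sum_sub_distrib, divPow_zero,
    Module.End.one_apply]
  abel

theorem twist_pair (h : MCPair kind P m x k) (hP : P.IsDG) (hl : LawfulOp P) :
    MCPair kind P (twist kind P m x k) (-x) k where
  par_x := by rw [map_neg, h.par_x]
  par_m := by
    have h1 : parFam P (constField P (P.d (0 : ℕ) x)) = - constField P (P.d (0 : ℕ) x) := by
      funext n
      cases n
      · have := hP.d_par (0 : ℕ) x
        rw [h.par_x] at this
        exact (neg_eq_iff_eq_neg.2 this).symm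
      · simp [parFam_apply, constField]
    rw [twist, map_sub, h1, expSum_apply, map_sum]
    simp only [parFam_divPow hP kind h.par_x, h.par_m, map_neg, Finset.sum_neg_distrib]
    abel
  m_zero := h.twist_zero hP hl
  symm := h.twist_mem hl
  d_m n := by
    rw [← preLie_eq_cobar kind _ (h.twist_zero hP hl), ← dFam_apply]
    refine congrFun ?_ n
    have h1 : dFam P (constField P (P.d (0 : ℕ) x)) = 0 := by
      funext n
      cases n
      · exact hP.d_d _ _
      · simp [dFam_apply, constField]
    conv_lhs => rw [twist, map_sub, h1, sub_zero, h.dFam_expSum hP hl]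
    simp only [twist, map_sub, LinearMap.sub_apply, preLie_constField_left,
      preLie_constField_right hl, adv_constField, sub_zero]
  d_x N hN := by
    have h' := adv_neg_pow_eq_zero h.nil
    rw [sum_mcTerm hP hl (by rw [map_neg, h.par_x]) (h.twist_mem hl) (h.twist_zero hP hl),
      expSum_eq h' (by omega), h.expSum_twist, Pi.sub_apply, h.m_zero, map_neg, zero_sub]
    rfl
  nil := adv_neg_pow_eq_zero h.nil

theorem twist_eq_sum (h : MCPair kind P m x k) (hP : P.IsDG) (hl : LawfulOp P) {n : ℕ}
    (hn : 1 ≤ n) :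
    twist kind P m x k n = ∑ i ∈ Finset.range k, twTerm kind P m x n i := by
  obtain ⟨n, rfl⟩ : ∃ n', n = n' + 1 := ⟨n - 1, by omega⟩
  rw [twist, expSum_apply, Pi.sub_apply, Finset.sum_apply]
  refine (sub_zero _).trans ?_
  exact Finset.sum_congr rfl fun i _ => (twTerm_eq hl hP h.par_x _ i h.symm).symm

theorem twTerm_eq_zero (h : MCPair kind P m x k) (hP : P.IsDG) (hl : LawfulOp P) (n : ℕ) {i : ℕ}
    (hi : k ≤ i) : twTerm kind P m x n i = 0 := by
  rw [twTerm_eq hl hP h.par_x _ i h.symm, divPow_eq_zero h.nil hi]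
  rfl

theorem mcTerm_eq_zero (h : MCPair kind P m x k) (hP : P.IsDG) (hl : LawfulOp P) {i : ℕ}
    (hi : k ≤ i) : mcTerm kind P m x i = 0 := by
  rw [mcTerm_eq hl hP h.par_x i h.symm, divPow_eq_zero h.nil hi]
  rfl

end MCPair

end Twist

/-! ### Naturality -/

section Naturality

variable {K : Type u} [Field K] {P : DGAlg.{u, v} K opSig} {Q : DGAlg.{u, w} K opSig}

/-- The image of a vector field. -/
def Hom.mapFam (f : Hom P Q) : Fam P →ₗ[K] Fam Q :=
  LinearMap.pi fun n : ℕ => f.map n ∘ₗ LinearMap.proj n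

theorem Hom.mapFam_apply (f : Hom P Q) (X : Fam P) (n : ℕ) : f.mapFam X n = f.map n (X n) := rfl

theorem Hom.map_perm (f : Hom P Q) {m n : ℕ} (e : Fin m ≃ Fin n) (a : P.obj m) :
    f.map n (P.perm e a) = Q.perm e (f.map m a) := f.map_un (sg := opSig) _ a

theorem Hom.map_comp (f : Hom P Q) {m n p : ℕ} (h : p + 1 = m + n) (i : Fin m) (a : P.obj m)
    (b : P.obj n) : f.map p (P.comp h i a b) = Q.comp h i (f.map m a) (f.map n b) :=
  f.map_bin (sg := opSig) _ a b

theorem Hom.mapFam_adv (f : Hom P Q) (kind : Kind) (y : P.obj (0 : ℕ)) (X : Fam P) :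
    f.mapFam (advL kind P y X) = advL kind Q (f.map (0 : ℕ) y) (f.mapFam X) := by
  funext n
  cases kind
  · exact f.map_comp _ _ _ _
  · rw [Hom.mapFam_apply, adv_ass, map_sum]
    exact Finset.sum_congr rfl fun i _ => f.map_comp _ _ _ _

theorem Hom.mapFam_divPow (f : Hom P Q) (kind : Kind) (y : P.obj (0 : ℕ)) (j : ℕ) (X : Fam P) :
    f.mapFam (divPow (advL kind P y) j X) =
      divPow (advL kind Q (f.map (0 : ℕ) y)) j (f.mapFam X) := by
  simp only [divPow, LinearMap.smul_apply, map_smul]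
  congr 1
  induction j generalizing X with
  | zero => rfl
  | succ j ih => rw [pow_succ, Module.End.mul_apply, ih, f.mapFam_adv, pow_succ]; rfl

theorem Hom.mapFam_constField (f : Hom P Q) (z : P.obj (0 : ℕ)) :
    f.mapFam (constField P z) = constField Q (f.map (0 : ℕ) z) := by
  funext n; cases n
  · rfl
  · exact map_zero (f.map _)

theorem Hom.mapFam_twist [CharZero K] (f : Hom P Q) (kind : Kind) (m : Fam P) (x : P.obj (0 : ℕ)) (k : ℕ) :
    f.mapFam (twist kind P m x k) = twist kind Q (f.mapFam m) (f.map (0 : ℕ) x) k := by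
  simp only [twist, map_sub, expSum_apply, map_sum, f.mapFam_divPow, f.mapFam_constField, f.map_d]

theorem Hom.map_cobar (f : Hom P Q) (kind : Kind) (m : Fam P) (n : ℕ) :
    f.map n (cobar kind P m n) = cobar kind Q (f.mapFam m) n := by
  cases kind
  · simp only [cobar, map_sum, f.map_perm, f.map_comp, Hom.mapFam_apply]
  · simp only [cobar, map_sum, f.map_comp, Hom.mapFam_apply]

theorem Hom.map_plug (f : Hom P Q) (x : P.obj (0 : ℕ)) (n i : ℕ) (a : P.obj (n + i : ℕ)) :
    f.map n (plug P x n i a) = plug Q (f.map (0 : ℕ) x) n i (f.map (n + i : ℕ) a) := by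
  induction i with
  | zero => rfl
  | succ i ih => exact (ih _).trans (congrArg _ (f.map_comp _ _ _ _))

theorem Hom.map_mcTerm (f : Hom P Q) (kind : Kind) (m : Fam P) (x : P.obj (0 : ℕ)) (n : ℕ) :
    f.map (0 : ℕ) (mcTerm kind P m x n) = mcTerm kind Q (f.mapFam m) (f.map (0 : ℕ) x) n := by
  rw [mcTerm, map_smul, f.map_plug]; rfl

theorem Hom.map_twTerm (f : Hom P Q) (kind : Kind) (m : Fam P) (x : P.obj (0 : ℕ)) (n i : ℕ) :
    f.map n (twTerm kind P m x n i) = twTerm kind Q (f.mapFam m) (f.map (0 : ℕ) x) n i := by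
  cases kind
  · rw [twTerm, map_smul, f.map_plug]; rfl
  · rw [twTerm, map_sum]
    refine Finset.sum_congr rfl fun σ _ => ?_
    rw [f.map_plug, f.map_perm]; rfl

end Naturality

end MCTwist
end

noncomputable section

namespace MCTwist

/-! ## The twisting automorphism of the completed operad -/

section Laws

variable {K : Type u} [Field K]

theorem Hom.map_opLaw {P : DGAlg.{u, v} K opSig} {Q : DGAlg.{u, w} K opSig} (f : Hom P Q)
    (hQ : LawfulOp Q) {n : ℕ} {z : P.obj n} (h : OpLaw P n z) : f.map n z = 0 := by
  have hz : ∀ {n : ℕ} {z : Q.obj n}, OpLaw Q n z → z = 0 := fun h => hQ _ _ h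
  cases h with
  | perm_refl a =>
    rw [map_sub, f.map_perm]
    exact hz (.perm_refl _)
  | perm_trans e e' a =>
    rw [map_sub, f.map_perm, f.map_perm, f.map_perm]
    exact hz (.perm_trans _ _ _)
  | equivariance h h' e e' ρ i ho hi a b =>
    rw [map_sub, f.map_perm, f.map_comp, f.map_comp, f.map_perm, f.map_perm]
    exact hz (.equivariance h h' e e' ρ i ho hi _ _)
  | seq h₁ h₂ h₃ h₄ i j ij hij a b c =>
    rw [map_sub, f.map_comp, f.map_comp, f.map_comp, f.map_comp]
    exact hz (.seq h₁ h₂ h₃ h₄ i j ij hij _ _ _)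
  | par h₁ h₂ h₃ h₄ i k hik k' hk i' hi β γ a b c hb hc =>
    rw [map_sub, map_smul, f.map_comp, f.map_comp, f.map_comp, f.map_comp]
    refine hz (.par h₁ h₂ h₃ h₄ i k hik k' hk i' hi β γ _ _ _ ?_ ?_)
    · rw [← f.map_par, hb, map_smul]
    · rw [← f.map_par, hc, map_smul]

theorem Hom.map_mperm {P : DGAlg.{u, v} K modSig} {Q : DGAlg.{u, w} K modSig} (f : Hom P Q)
    (g : ℕ) {m n : ℕ} (e : Fin m ≃ Fin n) (a : P.obj ((g, m) : ℕ × ℕ)) :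
    f.map ((g, n) : ℕ × ℕ) (P.mperm g e a) = Q.mperm g e (f.map ((g, m) : ℕ × ℕ) a) :=
  f.map_un (sg := modSig) _ a

theorem Hom.map_contr {P : DGAlg.{u, v} K modSig} {Q : DGAlg.{u, w} K modSig} (f : Hom P Q)
    {g r : ℕ} (h : r = g + 1) (n : ℕ) (a : P.obj ((g, n + 2) : ℕ × ℕ)) :
    f.map ((r, n) : ℕ × ℕ) (P.contr h n a) = Q.contr h n (f.map ((g, n + 2) : ℕ × ℕ) a) :=
  f.map_un (sg := modSig) _ a

theorem Hom.map_mcomp {P : DGAlg.{u, v} K modSig} {Q : DGAlg.{u, w} K modSig} (f : Hom P Q)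
    {g h r m n p : ℕ} (hg : r = g + h) (hp : p + 1 = m + n) (i : Fin m)
    (a : P.obj ((g, m) : ℕ × ℕ)) (b : P.obj ((h, n + 1) : ℕ × ℕ)) :
    f.map ((r, p) : ℕ × ℕ) (P.mcomp hg hp i a b) =
      Q.mcomp hg hp i (f.map ((g, m) : ℕ × ℕ) a) (f.map ((h, n + 1) : ℕ × ℕ) b) :=
  f.map_bin (sg := modSig) _ a b

theorem Hom.map_modLaw {P : DGAlg.{u, v} K modSig} {Q : DGAlg.{u, w} K modSig} (f : Hom P Q)
    (hQ : LawfulMod Q) {s : ℕ × ℕ} {z : P.obj s} (h : ModLaw P s z) : f.map s z = 0 := by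
  have hz : ∀ {s : ℕ × ℕ} {z : Q.obj s}, ModLaw Q s z → z = 0 := fun h => hQ _ _ h
  cases h with
  | perm_refl a =>
    rw [map_sub, f.map_mperm]
    exact hz (.perm_refl _)
  | perm_trans e e' a =>
    rw [map_sub, f.map_mperm, f.map_mperm, f.map_mperm]
    exact hz (.perm_trans _ _ _)
  | equivariance hg hp hp' e e' he' ρ i ho hi a b =>
    rw [map_sub, f.map_mperm, f.map_mcomp, f.map_mcomp, f.map_mperm, f.map_mperm]
    exact hz (.equivariance hg hp hp' e e' he' ρ i ho hi _ _)
  | seq g₁ g₂ g₃ g₄ h₁ h₂ h₃ h₄ i j ij hij a b c =>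
    rw [map_sub, f.map_mcomp, f.map_mcomp, f.map_mcomp, f.map_mcomp]
    exact hz (.seq g₁ g₂ g₃ g₄ h₁ h₂ h₃ h₄ i j ij hij _ _ _)
  | par g₁ g₂ g₃ g₄ h₁ h₂ h₃ h₄ i k hik k' hk i' hi β γ a b c hb hc =>
    rw [map_sub, map_smul, f.map_mcomp, f.map_mcomp, f.map_mcomp, f.map_mcomp]
    refine hz (.par g₁ g₂ g₃ g₄ h₁ h₂ h₃ h₄ i k hik k' hk i' hi β γ _ _ _ ?_ ?_)
    · rw [← f.map_par, hb, map_smul]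
    · rw [← f.map_par, hc, map_smul]
  | anti hg hg' hp hp' i e he ρ hb ha α β a b hpa hpb =>
    rw [map_add, map_smul, f.map_mcomp, f.map_mperm, f.map_mcomp, f.map_mperm]
    refine hz (.anti hg hg' hp hp' i e he ρ hb ha α β _ _ ?_ ?_)
    · rw [← f.map_par, hpa, map_smul]
    · rw [← f.map_par, hpb, map_smul]
  | contr_equivariance h e e' he he₀ he₁ a =>
    rw [map_sub, f.map_mperm, f.map_contr, f.map_contr, f.map_mperm]
    exact hz (.contr_equivariance h e e' he he₀ he₁ _)
  | contr_anti h a =>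
    rw [map_add, f.map_contr, f.map_contr, f.map_mperm]
    exact hz (.contr_anti h _)
  | contr_contr h h' a =>
    rw [map_sub, f.map_contr, f.map_contr, f.map_contr, f.map_contr, f.map_mperm]
    exact hz (.contr_contr h h' _)
  | contr_comp hr hs ht hst hp hp' i a b =>
    rw [map_sub, f.map_mcomp, f.map_contr, f.map_contr, f.map_mcomp]
    exact hz (.contr_comp hr hs ht hst hp hp' i _ _)
  | comp_comp hr hs hp ρ h₁ h₂ h₃ h₄ a b =>
    rw [map_sub, f.map_contr, f.map_contr, f.map_mperm, f.map_mperm, f.map_mcomp, f.map_mcomp,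
      f.map_mperm]
    exact hz (.comp_comp hr hs hp ρ h₁ h₂ h₃ h₄ _ _)

/-- A morphism of modular operads, on the underlying operads. -/
def Hom.opOf {P : DGAlg.{u, v} K modSig} {Q : DGAlg.{u, w} K modSig} (f : Hom P Q) :
    Hom (opOf P) (opOf Q) where
  map n := f.map ((0, n + 1) : ℕ × ℕ)
  cont n := f.cont ((0, n + 1) : ℕ × ℕ)
  map_par n a := f.map_par ((0, n + 1) : ℕ × ℕ) a
  map_d n a := f.map_d ((0, n + 1) : ℕ × ℕ) a
  map_un o a := by cases o; exact f.map_mperm _ _ _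
  map_bin o a b := by cases o; exact f.map_mcomp _ _ _ _ _

/-- The filtration of the underlying operad. -/
def Filt.opOf {M : DGAlg.{u, v} K modSig} (F : Filt M) : Filt (opOf M) where
  F k n := F.F k ((0, n + 1) : ℕ × ℕ)
  zero n a := F.zero ((0, n + 1) : ℕ × ℕ) a
  un o i a h := by cases o; exact F.un (sg := modSig) _ i a h
  bin o i j a b ha hb := by cases o; exact F.bin (sg := modSig) _ i j a b ha hb

end Laws

section Pair

variable {K : Type u} [Field K] [CharZero K] {kind : Kind} {Q : DGAlg.{u, v} K opSig} {m : Fam Q}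
  {x : Q.obj (0 : ℕ)} {k : ℕ}

/-- The values of the generators given by a pair `(m, x)`. -/
def pairGen (m : Fam Q) (x : Q.obj (0 : ℕ)) : ∀ n : ℕ, GenX n → Q.obj n
  | _, .m n => m (n + 1)
  | _, .x => x

namespace MCPair

/-- The morphism from the free operad determined by a pair `(m, x)`. -/
def lift (h : MCPair kind Q m x k) (hQ : Q.IsDG) : Hom (freeX K) Q :=
  freeLift (sg := opSig) (G := GenX) oddX hQ (pairGen m x) (fun s g => by
    cases g with
    | m n =>
      have := congrFun h.par_m (n + 1)
      rw [parFam_apply] at this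
      simpa [pairGen, oddX] using this
    | x => simpa [pairGen, oddX] using h.par_x)

theorem lift_X (h : MCPair kind Q m x k) (hQ : Q.IsDG) : (h.lift hQ).map (0 : ℕ) (genXX K) = x :=
  freeLift_gen (sg := opSig) hQ _ _ GenX.x

theorem lift_M (h : MCPair kind Q m x k) (hQ : Q.IsDG) (n : ℕ) :
    (h.lift hQ).map n (genXM K n) = m n := by
  cases n with
  | zero => exact (map_zero _).trans h.m_zero.symm
  | succ n => exact freeLift_gen (sg := opSig) hQ _ _ (GenX.m n)

theorem lift_mapFam (h : MCPair kind Q m x k) (hQ : Q.IsDG) : (h.lift hQ).mapFam (genXM K) = m :=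
  funext (h.lift_M hQ)

theorem lift_rel (h : MCPair kind Q m x k) (hQ : Q.IsDG) (hl : LawfulOp Q) (F : Filt Q)
    (hF : ∀ n : ℕ, F.F k n = ⊥) (hx : x ∈ F.F 1 (0 : ℕ)) (hdx : Q.d (0 : ℕ) x ∈ F.F 1 (0 : ℕ))
    (hmono : ∀ i (s : ℕ), F.F (i + 1) s ≤ F.F i s)
    (n : ℕ) (a : (freeX K).obj n) (ha : CurlyRel K kind k n a) : (h.lift hQ).map n a = 0 := by
  cases ha with
  | law h' => exact (h.lift hQ).map_opLaw hl h'
  | str h' =>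
    cases h' with
    | symm hk n σ =>
      rw [map_sub, Hom.map_perm, h.lift_M, h.symm hk, sub_self]
    | diff n =>
      rw [map_sub, Hom.map_d, h.lift_M, h.d_m, Hom.map_cobar, h.lift_mapFam, sub_self]
  | diff N hN =>
    rw [map_sub, Hom.map_d, h.lift_X, h.d_x N hN, map_sum]
    simp only [Hom.map_mcTerm, h.lift_mapFam, h.lift_X, sub_self]
  | adic t ht =>
    have h1 : (h.lift hQ).map n (Finsupp.single t (1 : K) : Mono opSig GenX n →₀ K) =
        t.eval Q (pairGen m x) := freeLiftFun_mono (sg := opSig) Q _ t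
    rw [h1]
    have h2 := F.eval_mem (sg := opSig) wtX (pairGen m x) (fun s g => by
      cases g with
      | m n => exact F.zero _ _
      | x => exact hx) (fun s g => by
      cases g with
      | m n => exact F.zero _ _
      | x => exact hdx) t
    have hle : ∀ j, F.F (k + j) n ≤ F.F k n := by
      intro j
      induction j with
      | zero => exact le_rfl
      | succ j ih => exact (hmono _ _).trans ih
    have h3 := hle (t.weight wtX - k) (by rwa [Nat.add_sub_cancel' ht])
    rwa [hF, Submodule.mem_bot] at h3

end MCPair

end Pair

section Level

variable (K : Type u) [Field K] [CharZero K] (kind : Kind) (k : ℕ)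

theorem level_isDG : (CurlyLevel K kind k).IsDG := quot_isDG (free_isDG (sg := opSig) oddX) _

theorem level_lawful : LawfulOp (CurlyLevel K kind k) :=
  quot_lawfulOp (free_isDG (sg := opSig) oddX) (fun _ _ h => .law h)

/-- The projection from the free operad. -/
def levelHom : Hom (freeX K) (CurlyLevel K kind k) := quotHom (freeX K) (fun _ => rfl) _

def levelFilt : Filt (CurlyLevel K kind k) := weightFilt (sg := opSig) oddX wtX (CurlyRel K kind k)

theorem levelFilt_eq_bot (n : ℕ) : (levelFilt K kind k).F k n = ⊥ :=
  weightFilt_eq_bot (sg := opSig) (fun _ x hx => .adic x hx) n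

theorem levelFilt_mono (i s : ℕ) :
    (levelFilt K kind k).F (i + 1) s ≤ (levelFilt K kind k).F i s :=
  Submodule.span_mono fun _ ⟨x, hx, hx'⟩ => ⟨x, by omega, hx'⟩

theorem levelFilt_X : (levelHom K kind k).map (0 : ℕ) (genXX K) ∈
    (levelFilt K kind k).F 1 (0 : ℕ) :=
  weightFilt_mono_mem (sg := opSig) (p := oddX) (wt := wtX) (R := CurlyRel K kind k)
    (.leaf GenX.x false)

theorem levelFilt_dX : (CurlyLevel K kind k).d (0 : ℕ) ((levelHom K kind k).map (0 : ℕ) (genXX K)) ∈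
    (levelFilt K kind k).F 1 (0 : ℕ) := by
  have h : (freeX K).d (0 : ℕ) (genXX K) = freeMono (sg := opSig) oddX (.leaf GenX.x true) :=
    free_d_mono (sg := opSig) (p := oddX) (.leaf GenX.x false)
  rw [← Hom.map_d, h]
  exact weightFilt_mono_mem (sg := opSig) (p := oddX) (wt := wtX) (R := CurlyRel K kind k)
    (.leaf GenX.x true)

theorem level_pair : MCPair kind (CurlyLevel K kind k) ((levelHom K kind k).mapFam (genXM K))
    ((levelHom K kind k).map (0 : ℕ) (genXX K)) k where
  par_x := by
    rw [← Hom.map_par]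
    congr 1
    exact (free_par_mono (sg := opSig) (p := oddX) (.leaf GenX.x false)).trans (one_smul _ _)
  par_m := by
    funext n
    rw [parFam_apply, Pi.neg_apply, Hom.mapFam_apply, ← Hom.map_par, ← map_neg]
    congr 1
    cases n with
    | zero => exact (map_zero ((freeX K).par (0 : ℕ))).trans neg_zero.symm
    | succ n =>
      exact (free_par_mono (sg := opSig) (p := oddX) (.leaf (GenX.m n) false)).trans
        (neg_one_smul _ _)
  m_zero := map_zero ((levelHom K kind k).map (0 : ℕ))
  symm hk n σ := by
    have h := quotMk_eq_zero (P := freeX K) (R := CurlyRel K kind k) (.str (.symm hk n σ))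
    have h' : (levelHom K kind k).map n ((freeX K).perm σ (genXM K n) - genXM K n) = 0 := h
    rw [map_sub, Hom.map_perm, sub_eq_zero] at h'
    exact h'
  d_m n := by
    have h := quotMk_eq_zero (P := freeX K) (R := CurlyRel K kind k) (.str (.diff n))
    have h' : (levelHom K kind k).map n ((freeX K).d n (genXM K n) -
      cobar kind (freeX K) (genXM K) n) = 0 := h
    rw [map_sub, Hom.map_d, sub_eq_zero, Hom.map_cobar] at h'
    exact h'
  d_x N hN := by
    have h := quotMk_eq_zero (P := freeX K) (R := CurlyRel K kind k) (.diff N hN)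
    have h' : (levelHom K kind k).map (0 : ℕ) ((freeX K).d (0 : ℕ) (genXX K) -
      ∑ n ∈ Finset.range N, mcTerm kind (freeX K) (genXM K) (genXX K) (n + 1)) = 0 := h
    rw [map_sub, Hom.map_d, sub_eq_zero, map_sum] at h'
    simpa only [Hom.map_mcTerm] using h'
  nil := adv_pow_eq_zero (levelFilt K kind k)
    (levelFilt_eq_bot K kind k) kind
    (levelFilt_X K kind k)

end Level

end MCTwist
end

noncomputable section

namespace MCTwist

section Curly

variable {K : Type u} [Field K] [CharZero K] {kind : Kind}

theorem freeX_hom_ext {Q : DGAlg.{u, v} K opSig} {f f' : Hom (freeX K) Q}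
    (hM : ∀ n : ℕ, f.map n (genXM K n) = f'.map n (genXM K n))
    (hX : f.map (0 : ℕ) (genXX K) = f'.map (0 : ℕ) (genXX K)) : f = f' := by
  refine free_hom_ext (sg := opSig) (p := oddX) fun s g => ?_
  cases g with
  | m n => exact hM (n + 1)
  | x => exact hX

theorem MCPair.twist_order {P : DGAlg.{u, v} K opSig} {m : Fam P} {x : P.obj (0 : ℕ)} {k N : ℕ}
    (h : MCPair kind P m x k) (hN : k ≤ N) : twist kind P m x N = twist kind P m x k := by
  rw [twist, twist, expSum_eq h.nil hN]

variable (K kind)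

/-- The transition maps of the inverse system defining `Curly K kind`. -/
def levelTr {i j : ℕ} (h : i ≤ j) : Hom (CurlyLevel K kind j) (CurlyLevel K kind i) :=
  quotMap (freeX K) (CurlyRel.mono h)

/-- The morphism from the free operad with image the polynomials in the completed operad. -/
def curlyHom : Hom (freeX K) (Curly K kind) :=
  toAdic (freeX K) (CurlyRel K kind) CurlyRel.mono (fun _ => rfl)

/-- The projection of the completed operad to a quotient. -/
def curlyProj (k : ℕ) : Hom (Curly K kind) (CurlyLevel K kind k) :=
  limProj (CurlyLevel K kind) (fun h => levelTr K kind h) k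

variable {K kind} in
/-- A continuous morphism from the completed operad is determined by its values on generators. -/
theorem curly_hom_ext {Q : DGAlg.{u, v} K opSig} (hQ : ∀ n : ℕ, T2Space (Q.obj n))
    {f f' : Hom (Curly K kind) Q}
    (hM : ∀ n : ℕ, f.map n (curlyM K kind n) = f'.map n (curlyM K kind n))
    (hX : f.map (0 : ℕ) (curlyX K kind) = f'.map (0 : ℕ) (curlyX K kind)) : f = f' := by
  refine adicLim_hom_ext (freeX K) (CurlyRel K kind) CurlyRel.mono (fun _ => rfl) hQ fun s a => ?_
  have key : ∀ f : Hom (Curly K kind) Q, ∃ g : Hom (freeX K) Q,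
      ∀ (s : ℕ) a, g.map s a = f.map s ((curlyHom K kind).map s a) := fun f =>
    ⟨{ map := fun s => f.map s ∘ₗ (curlyHom K kind).map s
       cont := fun s => (f.cont s).comp ((curlyHom K kind).cont s)
       map_par := fun s a => by simp [Hom.map_par]
       map_d := fun s a => by simp [Hom.map_d]
       map_un := fun o a => by simp [Hom.map_un]
       map_bin := fun o a b => by simp [Hom.map_bin] }, fun _ _ => rfl⟩
  obtain ⟨g, hg⟩ := key f
  obtain ⟨g', hg'⟩ := key f'
  have : g = g' := freeX_hom_ext (fun n => by rw [hg, hg']; exact hM n) (by rw [hg, hg']; exact hX)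
  have h1 := hg s a
  rw [this, hg'] at h1
  exact h1.symm

/-- The twisted generators in a quotient of the completed operad. -/
theorem level_twist_pair (k : ℕ) :
    MCPair kind (CurlyLevel K kind k)
      (twist kind (CurlyLevel K kind k) ((levelHom K kind k).mapFam (genXM K))
        ((levelHom K kind k).map (0 : ℕ) (genXX K)) k)
      (-(levelHom K kind k).map (0 : ℕ) (genXX K)) k :=
  (level_pair K kind k).twist_pair (level_isDG K kind k) (level_lawful K kind k)

theorem twistLevel_rel (k n : ℕ) (a : (freeX K).obj n) (ha : CurlyRel K kind k n a) :
    ((level_twist_pair K kind k).lift (level_isDG K kind k)).map n a = 0 :=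
  (level_twist_pair K kind k).lift_rel (level_isDG K kind k) (level_lawful K kind k)
    (levelFilt K kind k) (levelFilt_eq_bot K kind k) (neg_mem (levelFilt_X K kind k))
    (by rw [map_neg]; exact neg_mem (levelFilt_dX K kind k)) (levelFilt_mono K kind k) n a ha

/-- The twisting endomorphism of a quotient of the completed operad. -/
def twistLevel (k : ℕ) : Hom (CurlyLevel K kind k) (CurlyLevel K kind k) :=
  quotLift ((level_twist_pair K kind k).lift (level_isDG K kind k)) (twistLevel_rel K kind k)

theorem twistLevel_M (k n : ℕ) :
    (twistLevel K kind k).map n ((levelHom K kind k).map n (genXM K n)) =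
      twist kind (CurlyLevel K kind k) ((levelHom K kind k).mapFam (genXM K))
        ((levelHom K kind k).map (0 : ℕ) (genXX K)) k n :=
  (level_twist_pair K kind k).lift_M (level_isDG K kind k) n

theorem twistLevel_X (k : ℕ) :
    (twistLevel K kind k).map (0 : ℕ) ((levelHom K kind k).map (0 : ℕ) (genXX K)) =
      -(levelHom K kind k).map (0 : ℕ) (genXX K) :=
  (level_twist_pair K kind k).lift_X (level_isDG K kind k)

theorem twistLevel_compat {i j : ℕ} (h : i ≤ j) (s : ℕ) (a : (freeX K).obj s) :
    (levelTr K kind h).map s (((level_twist_pair K kind j).lift (level_isDG K kind j)).map s a) =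
      ((level_twist_pair K kind i).lift (level_isDG K kind i)).map s a := by
  have : Hom.comp' ((level_twist_pair K kind j).lift (level_isDG K kind j)) (levelTr K kind h) =
      (level_twist_pair K kind i).lift (level_isDG K kind i) := by
    refine freeX_hom_ext (fun n => ?_) ?_
    · change (levelTr K kind h).map n (((level_twist_pair K kind j).lift _).map n (genXM K n)) = _
      rw [MCPair.lift_M, MCPair.lift_M, ← Hom.mapFam_apply, Hom.mapFam_twist,
        ← (level_pair K kind i).twist_order h]
      rfl
    · change (levelTr K kind h).map (0 : ℕ)
        (((level_twist_pair K kind j).lift _).map (0 : ℕ) (genXX K)) = _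
      rw [MCPair.lift_X, MCPair.lift_X, map_neg]
      rfl
  exact congrArg (fun f : Hom (freeX K) (CurlyLevel K kind i) => f.map s a) this

/-- The twisting endomorphism of the completed operad. -/
def curlyTw : Hom (Curly K kind) (Curly K kind) :=
  adicLift (freeX K) (CurlyRel K kind) CurlyRel.mono (CurlyLevel K kind)
    (fun h => levelTr K kind h)
    (fun k => (level_twist_pair K kind k).lift (level_isDG K kind k))
    (fun _ _ h s a => twistLevel_compat K kind h s a) id (fun k s a => twistLevel_rel K kind k s a)

theorem curlyTw_X : (curlyTw K kind).map (0 : ℕ) (curlyX K kind) = - curlyX K kind :=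
  lim_ext _ _ fun k => twistLevel_X K kind k

theorem curlyProj_tw_M (k n : ℕ) :
    (curlyProj K kind k).map n ((curlyTw K kind).map n (curlyM K kind n)) =
      twist kind (CurlyLevel K kind k) ((levelHom K kind k).mapFam (genXM K))
        ((levelHom K kind k).map (0 : ℕ) (genXX K)) k n :=
  twistLevel_M K kind k n

theorem twistLevel_twistLevel_M (k n : ℕ) :
    (twistLevel K kind k).map n ((twistLevel K kind k).map n ((levelHom K kind k).map n (genXM K n)))
      = (levelHom K kind k).map n (genXM K n) := by
  rw [twistLevel_M, ← Hom.mapFam_apply, Hom.mapFam_twist, twistLevel_X]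
  have : (twistLevel K kind k).mapFam ((levelHom K kind k).mapFam (genXM K)) =
    twist kind (CurlyLevel K kind k) ((levelHom K kind k).mapFam (genXM K))
        ((levelHom K kind k).map (0 : ℕ) (genXX K)) k := funext (twistLevel_M K kind k)
  rw [this, (level_pair K kind k).twist_twist]
  rfl

theorem curly_t2 (n : ℕ) : T2Space ((Curly K kind).obj n) :=
  lim_t2 (sg := opSig) (CurlyLevel K kind) (fun h => levelTr K kind h) (fun _ _ => rfl) n

theorem curlyTw_curlyTw (s : ℕ) (a : (Curly K kind).obj s) :
    (curlyTw K kind).map s ((curlyTw K kind).map s a) = a := by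
  let idHom : Hom (Curly K kind) (Curly K kind) :=
    { map := fun _ => LinearMap.id
      cont := fun _ => continuous_id
      map_par := fun _ _ => rfl
      map_d := fun _ _ => rfl
      map_un := fun _ _ => rfl
      map_bin := fun _ _ _ => rfl }
  have : (curlyTw K kind).trans (curlyTw K kind) = idHom := by
    refine curly_hom_ext (curly_t2 K kind) (fun n => ?_) ?_
    · exact lim_ext _ _ fun k => twistLevel_twistLevel_M K kind k n
    · change (curlyTw K kind).map (0 : ℕ) ((curlyTw K kind).map (0 : ℕ) (curlyX K kind)) =
        curlyX K kind
      rw [curlyTw_X, map_neg, curlyTw_X, neg_neg]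
  exact congrArg (fun f : Hom (Curly K kind) (Curly K kind) => f.map s a) this

theorem curlyTw_isAut : (curlyTw K kind).IsAut :=
  ⟨curlyTw K kind, fun s a => ⟨curlyTw_curlyTw K kind s a, curlyTw_curlyTw K kind s a⟩⟩

theorem curlyTw_hasSum {n : ℕ} (hn : 1 ≤ n) :
    HasSum (fun i : ℕ => twTerm kind (Curly K kind) (curlyM K kind) (curlyX K kind) n i)
      ((curlyTw K kind).map n (curlyM K kind n)) := by
  refine (hasSum_lim_iff (CurlyLevel K kind) (fun h => levelTr K kind h)).2 fun k => ?_
  have hd : DiscreteTopology ((CurlyLevel K kind k).obj n) := ⟨rfl⟩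
  have h := level_pair K kind k
  have hterm : ∀ i, (curlyProj K kind k).map n
      (twTerm kind (Curly K kind) (curlyM K kind) (curlyX K kind) n i) =
      twTerm kind (CurlyLevel K kind k) ((levelHom K kind k).mapFam (genXM K))
        ((levelHom K kind k).map (0 : ℕ) (genXX K)) n i := fun i =>
    (curlyProj K kind k).map_twTerm kind _ _ n i
  refine (hasSum_discrete_iff _ k (fun i hi => (hterm i).trans
    (h.twTerm_eq_zero (level_isDG K kind k) (level_lawful K kind k) n hi)) _).2 ?_
  refine (twistLevel_M K kind k n).trans ?_
  rw [h.twist_eq_sum (level_isDG K kind k) (level_lawful K kind k) hn]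
  exact Finset.sum_congr rfl fun i _ => (hterm i).symm

end Curly

end MCTwist
end

noncomputable section

namespace MCTwist

/-! ## The nilpotent filtration -/

section NilFilt

variable {K : Type u} [Field K] {N : Type v} [NonUnitalRing N] [Module K N]
  [IsScalarTower K N N] [SMulCommClass K N N] [NilCDGA K N]

theorem nprod_congr {f g : ℕ → N} {r : ℕ} (h : ∀ i, i ≤ r → f i = g i) : nprod f r = nprod g r := by
  induction r with
  | zero => exact h 0 le_rfl
  | succ r ih => rw [nprod, nprod, ih fun i hi => h i (by omega), h _ le_rfl]

theorem nprod_mul (f g : ℕ → N) (r t : ℕ) : nprod f r * nprod g t =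
    nprod (fun i => if i ≤ r then f i else g (i - r - 1)) (r + t + 1) := by
  induction t with
  | zero =>
    rw [add_zero, nprod]
    congr 1
    · exact nprod_congr fun i hi => by simp [hi]
    · simp [nprod]
  | succ t ih =>
    rw [nprod, ← mul_assoc, ih, ← add_assoc, nprod]
    congr 1
    have : ¬ (r + t + 1 + 1 ≤ r) := by omega
    simp only [this, if_false]
    congr 1
    omega

variable (K N) in
/-- The span of the products of at least `w` factors. -/
def nilPow (w : ℕ) : Submodule K N := Submodule.span K {a | ∃ f r, w ≤ r + 1 ∧ nprod f r = a}

theorem mem_nilPow_one (a : N) : a ∈ nilPow K N 1 :=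
  Submodule.subset_span ⟨fun _ => a, 0, le_rfl, rfl⟩

theorem nilPow_mono (w : ℕ) : nilPow K N (w + 1) ≤ nilPow K N w :=
  Submodule.span_mono fun _ ⟨f, r, h, h'⟩ => ⟨f, r, by omega, h'⟩

theorem mul_mem_nilPow {i j : ℕ} {a b : N} (ha : a ∈ nilPow K N i) (hb : b ∈ nilPow K N j) :
    a * b ∈ nilPow K N (i + j) := by
  refine Submodule.span_induction₂ (p := fun a b _ _ => a * b ∈ nilPow K N (i + j)) ?_ ?_ ?_ ?_ ?_
    ?_ ?_ ha hb
  · rintro _ _ ⟨f, r, hr, rfl⟩ ⟨g, t, ht, rfl⟩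
    exact Submodule.subset_span ⟨_, r + t + 1, by omega, (nprod_mul f g r t).symm⟩
  · intros; simp
  · intros; simp
  · intro x y z _ _ _ h1 h2; rw [add_mul]; exact add_mem h1 h2
  · intro x y z _ _ _ h1 h2; rw [mul_add]; exact add_mem h1 h2
  · intro c x y _ _ h; rw [smul_mul_assoc]; exact Submodule.smul_mem _ _ h
  · intro c x y _ _ h; rw [mul_smul_comm]; exact Submodule.smul_mem _ _ h

theorem par_mem_nilPow {i : ℕ} {a : N} (ha : a ∈ nilPow K N i) :
    DGSpace.par (K := K) a ∈ nilPow K N i := by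
  refine (Submodule.span_le (p := (nilPow K N i).comap (DGSpace.par (K := K))).2 ?_) ha
  rintro _ ⟨f, r, hr, rfl⟩
  refine Submodule.subset_span ⟨fun i => DGSpace.par (K := K) (f i), r, hr, ?_⟩
  clear hr
  induction r with
  | zero => rfl
  | succ r ih => rw [nprod, nprod, ih, NilCDGA.par_mul]

theorem nilPow_eq_bot (K : Type u) [Field K] (N : Type v) [NonUnitalRing N] [Module K N]
    [NilCDGA K N] : ∃ k, nilPow K N k = ⊥ := by
  obtain ⟨r, hr⟩ := NilCDGA.nilpotent (K := K) (N := N)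
  refine ⟨r + 1, eq_bot_iff.2 (Submodule.span_le.2 ?_)⟩
  rintro _ ⟨f, t, ht, rfl⟩
  obtain ⟨s, rfl⟩ := Nat.exists_eq_add_of_le (show r ≤ t by omega)
  clear ht
  change nprod f (r + s) = 0
  induction s with
  | zero => exact hr f
  | succ s ih => rw [← add_assoc, nprod, ih, zero_mul]

variable {sg : Sig} (P : DGAlg.{u, w} K sg)

variable (N) in
/-- The filtration of a tensor product with a nilpotent algebra. -/
def nilFilt : Filt (tensor N P) where
  F k s := Submodule.span K {z | ∃ a ∈ nilPow K N k, ∃ f : P.obj s, tmk P a f = z}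
  zero s z := by
    refine TensorProduct.induction_on (motive := fun z => z ∈ Submodule.span K
      {z | ∃ a ∈ nilPow K N 0, ∃ f : P.obj s, tmk P a f = z}) z (Submodule.zero_mem _)
      (fun a f => Submodule.subset_span ⟨a, nilPow_mono 0 (mem_nilPow_one a), f, rfl⟩)
      (fun _ _ => Submodule.add_mem _)
  un {s t} o i z hz := by
    have h : Submodule.span K {z | ∃ a ∈ nilPow K N i, ∃ f : P.obj s, tmk P a f = z} ≤
        Submodule.comap ((tensor N P).un o)
          (Submodule.span K {z | ∃ a ∈ nilPow K N i, ∃ f : P.obj t, tmk P a f = z}) := ?_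
    · exact h hz
    refine Submodule.span_le.2 ?_
    rintro _ ⟨a, ha, f, rfl⟩
    exact Submodule.subset_span ⟨a, ha, _, rfl⟩
  bin {r s t} o i j y z hy hz := by
    refine Submodule.span_induction₂ (p := fun y z _ _ => (tensor N P).bin o y z ∈
      Submodule.span K {z | ∃ a ∈ nilPow K N (i + j), ∃ f : P.obj t, tmk P a f = z}) ?_ ?_ ?_ ?_ ?_
      ?_ ?_ hy hz
    · rintro _ _ ⟨a, ha, f, rfl⟩ ⟨b, hb, g, rfl⟩
      have hproj : ∀ q, proj (K := K) DGSpace.par q b ∈ nilPow K N j := fun q => by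
        rw [proj_apply]
        exact Submodule.smul_mem _ _ (add_mem hb (Submodule.smul_mem _ _ (par_mem_nilPow hb)))
      have h : (tensor N P).bin o (tmk P a f) (tmk P b g) =
          tmk P (a * proj (K := K) DGSpace.par false b) (P.bin o f g) +
          tmk P (a * proj (K := K) DGSpace.par true b) (P.bin o (P.par r f) g) := by
        change (TensorProduct.map₂ ((LinearMap.mul K N).compl₂ (proj DGSpace.par false)) (P.bin o) +
          TensorProduct.map₂ ((LinearMap.mul K N).compl₂ (proj DGSpace.par true))
            (P.bin o ∘ₗ P.par r)) (a ⊗ₜ[K] f) (b ⊗ₜ[K] g) = _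
        simp only [LinearMap.add_apply, TensorProduct.map₂_apply_tmul]
        rfl
      rw [h]
      exact add_mem (Submodule.subset_span ⟨_, mul_mem_nilPow ha (hproj _), _, rfl⟩)
        (Submodule.subset_span ⟨_, mul_mem_nilPow ha (hproj _), _, rfl⟩)
    · intro y _; rw [map_zero, LinearMap.zero_apply]; exact Submodule.zero_mem _
    · intro y _; rw [map_zero]; exact Submodule.zero_mem _
    · intro x y z _ _ _ h1 h2; rw [map_add, LinearMap.add_apply]; exact add_mem h1 h2
    · intro x y z _ _ _ h1 h2; rw [map_add]; exact add_mem h1 h2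
    · intro c x y _ _ h; rw [map_smul, LinearMap.smul_apply]; exact Submodule.smul_mem _ _ h
    · intro c x y _ _ h; rw [map_smul]; exact Submodule.smul_mem _ _ h

theorem mem_nilFilt_one {s : sg.S} (z : (tensor N P).obj s) : z ∈ (nilFilt N P).F 1 s := by
  refine TensorProduct.induction_on (motive := fun z => z ∈ Submodule.span K
    {z | ∃ a ∈ nilPow K N 1, ∃ f : P.obj s, tmk P a f = z}) z (Submodule.zero_mem _)
    (fun a f => Submodule.subset_span ⟨a, mem_nilPow_one a, f, rfl⟩)
    (fun _ _ => Submodule.add_mem _)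

theorem nilFilt_mono (i : ℕ) (s : sg.S) : (nilFilt N P).F (i + 1) s ≤ (nilFilt N P).F i s :=
  Submodule.span_mono fun _ ⟨a, ha, h⟩ => ⟨a, nilPow_mono i ha, h⟩

theorem nilFilt_eq_bot {k : ℕ} (h : nilPow K N k = ⊥) (s : sg.S) : (nilFilt N P).F k s = ⊥ := by
  refine eq_bot_iff.2 (Submodule.span_le.2 ?_)
  rintro _ ⟨a, ha, f, rfl⟩
  rw [h, Submodule.mem_bot] at ha
  rw [ha]
  exact TensorProduct.zero_tmul _ f

end NilFilt

end MCTwist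
end

noncomputable section

namespace MCTwist

/-! ## Algebras over the completed operad -/

section Algebras

variable {K : Type u} [Field K] [CharZero K] {kind : Kind}

theorem coeff_t2 {sg : Sig} (A : FormalCDGA.{u, v} K) (P : DGAlg.{u, w} K sg) (s : sg.S) :
    T2Space ((A.coeff P).obj s) :=
  lim_t2 _ _ (fun _ _ => rfl) s

/-- The projection of `A₊ ⊗ P` to `N ⊗ P`, for one of the nilpotent algebras `N` with limit
`A₊`. -/
def coeffProj {sg : Sig} (A : FormalCDGA.{u, v} K) (P : DGAlg.{u, w} K sg) (i : A.ι) :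
    Hom (A.coeff P) (tensor (A.N i) P) :=
  limProj (fun i : A.ι => tensor (A.N i) P)
    (fun h => tensorMap P (A.map h) (A.map_mul h) (A.map_par h) (A.map_d h)) i

variable {P : DGAlg.{u, w} K opSig} {A : FormalCDGA.{u, v} K}

variable (K kind) in
theorem genM_hom_rel {Q : DGAlg.{u, w} K opSig} (hl : LawfulOp Q) (f : Hom (freeM K) Q)
    (hs : f.mapFam (genM K) ∈ admissible kind Q)
    (hd : ∀ n : ℕ, Q.d n (f.map n (genM K n)) = cobar kind Q (f.mapFam (genM K)) n)
    (n : ℕ) (a : (freeM K).obj n)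
    (ha : OpLaw (freeM K) n a ∨ StrRel kind (freeM K) (genM K) n a) : f.map n a = 0 := by
  rcases ha with ha | ha
  · exact f.map_opLaw hl ha
  · cases ha with
    | symm hk n σ =>
      rw [map_sub, f.map_perm]
      exact sub_eq_zero.2 (hs hk n σ)
    | diff n => rw [map_sub, f.map_d, hd, f.map_cobar, sub_self]

variable (K) in
/-- The inclusion of the free operads. -/
def freeIncl : Hom (freeM K) (freeX K) :=
  freeLift (sg := opSig) (G := GenM) oddM (free_isDG (sg := opSig) oddX)
    (fun n _ => match n with
      | 0 => 0
      | n + 1 => genXM K (n + 1)) (fun s g => by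
      cases g with
      | m n => exact free_par_mono (sg := opSig) (p := oddX) (.leaf (GenX.m n) false))

theorem freeIncl_M (n : ℕ) : (freeIncl K).map n (genM K n) = genXM K n := by
  cases n with
  | zero => exact map_zero ((freeIncl K).map (0 : ℕ))
  | succ n => exact freeLift_gen (sg := opSig) (free_isDG (sg := opSig) oddX) _ _ (GenM.m n)

variable (K kind) in
/-- The morphism from `L∞` or `A∞` to its extension by a Maurer-Cartan element. -/
def infCurly : Hom (Inf K kind) (Curly K kind) :=
  quotLift (Hom.comp' (freeIncl K) (curlyHom K kind)) (fun n a ha => lim_ext _ _ fun k => by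
    have hM : (Hom.comp' (freeIncl K) (levelHom K kind k)).mapFam (genM K) =
        (levelHom K kind k).mapFam (genXM K) :=
      funext fun n => congrArg ((levelHom K kind k).map n) (freeIncl_M n)
    refine genM_hom_rel K kind (level_lawful K kind k)
      (Hom.comp' (freeIncl K) (levelHom K kind k)) ?_ (fun n => ?_) n a ha
    · rw [hM]; exact (level_pair K kind k).symm
    · rw [← Hom.mapFam_apply, hM]; exact (level_pair K kind k).d_m n)

theorem infCurly_M (n : ℕ) : (infCurly K kind).map n (infM K kind n) = curlyM K kind n :=
  congrArg ((curlyHom K kind).map n) (freeIncl_M n)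

variable (K kind) in
theorem ops_zero (φ : Hom (Inf K kind) P) : ops φ 0 = 0 :=
  (congrArg (φ.map (0 : ℕ)) (map_zero (ideal (freeM K) _ (0 : ℕ)).mkQ)).trans
    (map_zero (φ.map (0 : ℕ)))

variable (K kind) in
/-- The projection from the free operad to `L∞` or `A∞`. -/
def infHom : Hom (freeM K) (Inf K kind) := quotHom (freeM K) (fun _ => rfl) _

theorem ops_par (φ : Hom (Inf K kind) P) : parFam P (ops φ) = - ops φ := by
  funext n
  change P.par n (φ.map n ((infHom K kind).map n (genM K n))) =
    - φ.map n ((infHom K kind).map n (genM K n))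
  rw [← φ.map_par, ← Hom.map_par, ← map_neg, ← map_neg]
  congr 2
  cases n with
  | zero => exact (map_zero ((freeM K).par (0 : ℕ))).trans neg_zero.symm
  | succ n =>
    exact (free_par_mono (sg := opSig) (p := oddM) (.leaf (GenM.m n) false)).trans
      (neg_one_smul _ _)

theorem inf_symm : (infHom K kind).mapFam (genM K) ∈ admissible kind (Inf K kind) := by
  intro hk n σ
  have h : (infHom K kind).map n ((freeM K).perm σ (genM K n) - genM K n) = 0 :=
    quotMk_eq_zero (P := freeM K) (Or.inr (.symm hk n σ))
  rw [map_sub, Hom.map_perm, sub_eq_zero] at h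
  exact h

theorem inf_d (n : ℕ) : (Inf K kind).d n ((infHom K kind).map n (genM K n)) =
    cobar kind (Inf K kind) ((infHom K kind).mapFam (genM K)) n := by
  have h : (infHom K kind).map n ((freeM K).d n (genM K n) - cobar kind (freeM K) (genM K) n) = 0 :=
    quotMk_eq_zero (P := freeM K) (Or.inr (.diff n))
  rw [map_sub, Hom.map_d, sub_eq_zero, Hom.map_cobar] at h
  exact h

theorem Hom.mapFam_admissible {Q : DGAlg.{u, v} K opSig} (f : Hom Q P) {X : Fam Q}
    (hX : X ∈ admissible kind Q) : f.mapFam X ∈ admissible kind P := by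
  intro hk n σ
  rw [Hom.mapFam_apply, ← f.map_perm, hX hk]

theorem ops_symm (φ : Hom (Inf K kind) P) : ops φ ∈ admissible kind P :=
  φ.mapFam_admissible inf_symm

theorem ops_d (φ : Hom (Inf K kind) P) (n : ℕ) : P.d n (ops φ n) = cobar kind P (ops φ) n := by
  change P.d n (φ.map n ((infHom K kind).map n (genM K n))) = _
  rw [← φ.map_d, inf_d, φ.map_cobar]
  rfl

/-- The nilpotency order of one of the nilpotent algebras with limit `A₊`. -/
def nilOrder (A : FormalCDGA.{u, v} K) (i : A.ι) : ℕ := (nilPow_eq_bot K (A.N i)).choose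

theorem nilOrder_spec (A : FormalCDGA.{u, v} K) (i : A.ι) :
    nilPow K (A.N i) (nilOrder A i) = ⊥ := (nilPow_eq_bot K (A.N i)).choose_spec

theorem adv_nilOrder (A : FormalCDGA.{u, v} K) (i : A.ι) (x : (tensor (A.N i) P).obj (0 : ℕ)) :
    (advL kind (tensor (A.N i) P) x) ^ nilOrder A i = 0 :=
  adv_pow_eq_zero (nilFilt (A.N i) P) (fun n => nilFilt_eq_bot P (nilOrder_spec A i) n) kind
    (mem_nilFilt_one P x)

/-- A family of odd operations in `A₊ ⊗ P` with a Maurer-Cartan element gives such a pair in each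
`N ⊗ P`. -/
theorem coeff_pair (hP : P.IsDG) (hl : LawfulOp P) {m : Fam (A.coeff P)}
    {ξ : (A.coeff P).obj (0 : ℕ)} (hpar : parFam (A.coeff P) m = -m) (h0 : m 0 = 0)
    (hs : m ∈ admissible kind (A.coeff P)) (hd : ∀ n : ℕ, (A.coeff P).d n (m n) = cobar kind _ m n)
    (hξ : IsMC kind (A.coeff P) m ξ) (i : A.ι) :
    MCPair kind (tensor (A.N i) P) ((coeffProj A P i).mapFam m)
      ((coeffProj A P i).map (0 : ℕ) ξ) (nilOrder A i) where
  par_x := by rw [← Hom.map_par, hξ.1]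
  par_m := by
    funext n
    have := congrFun hpar n
    rw [parFam_apply] at this ⊢
    rw [Hom.mapFam_apply, ← Hom.map_par, this, Pi.neg_apply, map_neg]
    rfl
  m_zero := (congrArg _ h0).trans (map_zero ((coeffProj A P i).map (0 : ℕ)))
  symm := (coeffProj A P i).mapFam_admissible hs
  d_m n := by rw [Hom.mapFam_apply, ← Hom.map_d, hd, Hom.map_cobar]
  d_x N hN := by
    have hd : DiscreteTopology ((tensor (A.N i) P).obj (0 : ℕ)) := ⟨rfl⟩
    have h := (hasSum_lim_iff (fun i : A.ι => tensor (A.N i) P)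
      (fun h => tensorMap P (A.map h) (A.map_mul h) (A.map_par h) (A.map_d h))).1 hξ.2 i
    have hterm : ∀ n, (coeffProj A P i).map (0 : ℕ) (mcTerm kind (A.coeff P) m ξ (n + 1)) =
        mcTerm kind (tensor (A.N i) P) ((coeffProj A P i).mapFam m)
          ((coeffProj A P i).map (0 : ℕ) ξ) (n + 1) := fun n => Hom.map_mcTerm _ _ _ _ _
    rw [← Hom.map_d]
    refine ((hasSum_discrete_iff _ N (fun n hn => (hterm n).trans ?_) _).1 h).trans
      (Finset.sum_congr rfl fun n _ => hterm n)
    rw [mcTerm_eq (tensor_lawfulOp hP hl) (tensor_isDG hP) (by rw [← Hom.map_par, hξ.1])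
      (n + 1) ((coeffProj A P i).mapFam_admissible hs),
      divPow_eq_zero (adv_nilOrder A i _) (by omega)]
    rfl
  nil := adv_nilOrder A i _

theorem coeffProj_compat {i j : A.ι} (h : i ≤ j) {s : ℕ} (a : (A.coeff P).obj s) :
    (tensorMap P (A.map h) (A.map_mul h) (A.map_par h) (A.map_d h)).map s
      ((coeffProj A P j).map s a) = (coeffProj A P i).map s a :=
  Subtype.property a i j h

theorem lift_compat (hP : P.IsDG) {m : Fam (A.coeff P)} {ξ : (A.coeff P).obj (0 : ℕ)}
    (hp : ∀ i : A.ι, MCPair kind (tensor (A.N i) P) ((coeffProj A P i).mapFam m)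
      ((coeffProj A P i).map (0 : ℕ) ξ) (nilOrder A i)) (i j : A.ι) (h : i ≤ j) (s : ℕ)
    (a : (freeX K).obj s) :
    (tensorMap P (A.map h) (A.map_mul h) (A.map_par h) (A.map_d h)).map s
      (((hp j).lift (tensor_isDG hP)).map s a) = ((hp i).lift (tensor_isDG hP)).map s a := by
  let f : Hom (freeX K) (tensor (A.N i) P) :=
    { map := fun s => (tensorMap P (A.map h) (A.map_mul h) (A.map_par h) (A.map_d h)).map s ∘ₗ
        ((hp j).lift (tensor_isDG hP)).map s
      cont := fun s => continuous_bot
      map_par := fun s a => by simp [Hom.map_par]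
      map_d := fun s a => by simp [Hom.map_d]
      map_un := fun o a => by simp [Hom.map_un]
      map_bin := fun o a b => by simp [Hom.map_bin] }
  have hf : f = (hp i).lift (tensor_isDG hP) := by
    refine freeX_hom_ext (fun n => ?_) ?_
    · change (tensorMap P (A.map h) (A.map_mul h) (A.map_par h) (A.map_d h)).map n (((hp j).lift _).map n (genXM K n)) = _
      rw [MCPair.lift_M, MCPair.lift_M]
      exact coeffProj_compat h (m n)
    · change (tensorMap P (A.map h) (A.map_mul h) (A.map_par h) (A.map_d h)).map (0 : ℕ) (((hp j).lift _).map (0 : ℕ) (genXX K)) = _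
      rw [MCPair.lift_X, MCPair.lift_X]
      exact coeffProj_compat h ξ
  exact congrArg (fun f : Hom (freeX K) (tensor (A.N i) P) => f.map s a) hf

theorem coeff_lift_rel (hP : P.IsDG) (hl : LawfulOp P) {m : Fam (A.coeff P)}
    {ξ : (A.coeff P).obj (0 : ℕ)}
    (hp : ∀ i : A.ι, MCPair kind (tensor (A.N i) P) ((coeffProj A P i).mapFam m)
      ((coeffProj A P i).map (0 : ℕ) ξ) (nilOrder A i)) (i : A.ι) (n : ℕ) (a : (freeX K).obj n)
    (ha : CurlyRel K kind (nilOrder A i) n a) : ((hp i).lift (tensor_isDG hP)).map n a = 0 :=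
  (hp i).lift_rel (tensor_isDG hP) (tensor_lawfulOp hP hl) (nilFilt (A.N i) P)
    (fun n => nilFilt_eq_bot P (nilOrder_spec A i) n) (mem_nilFilt_one P _) (mem_nilFilt_one P _)
    (nilFilt_mono P) n a ha

/-- The morphism from a quotient of the completed operad given by a pair. -/
def coeffLevel (hP : P.IsDG) (hl : LawfulOp P) {m : Fam (A.coeff P)} {ξ : (A.coeff P).obj (0 : ℕ)}
    (hp : ∀ i : A.ι, MCPair kind (tensor (A.N i) P) ((coeffProj A P i).mapFam m)
      ((coeffProj A P i).map (0 : ℕ) ξ) (nilOrder A i))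
    (i : A.ι) : Hom (CurlyLevel K kind (nilOrder A i)) (tensor (A.N i) P) :=
  quotLift ((hp i).lift (tensor_isDG hP)) (coeff_lift_rel hP hl hp i)

/-- The algebra over the completed operad given by an `L∞` or `A∞` algebra with a Maurer-Cartan
element. -/
def coeffLift (hP : P.IsDG) (hl : LawfulOp P) {m : Fam (A.coeff P)} {ξ : (A.coeff P).obj (0 : ℕ)}
    (hp : ∀ i : A.ι, MCPair kind (tensor (A.N i) P) ((coeffProj A P i).mapFam m)
      ((coeffProj A P i).map (0 : ℕ) ξ) (nilOrder A i)) : Hom (Curly K kind) (A.coeff P) :=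
  adicLift (freeX K) (CurlyRel K kind) CurlyRel.mono (fun i : A.ι => tensor (A.N i) P)
    (fun h => tensorMap P (A.map h) (A.map_mul h) (A.map_par h) (A.map_d h))
    (fun i => (hp i).lift (tensor_isDG hP)) (fun i j h s a => lift_compat hP hp i j h s a)
    (nilOrder A) (fun i s a ha => coeff_lift_rel hP hl hp i s a ha)

section Lift

variable {m : Fam (A.coeff P)} {ξ : (A.coeff P).obj (0 : ℕ)}

theorem coeffLift_M (hP : P.IsDG) (hl : LawfulOp P)
    (hp : ∀ i : A.ι, MCPair kind (tensor (A.N i) P) ((coeffProj A P i).mapFam m)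
      ((coeffProj A P i).map (0 : ℕ) ξ) (nilOrder A i)) (n : ℕ) : (coeffLift hP hl hp).map n (curlyM K kind n) = m n :=
  lim_ext _ _ fun i => (hp i).lift_M (tensor_isDG hP) n

theorem coeffLift_X (hP : P.IsDG) (hl : LawfulOp P)
    (hp : ∀ i : A.ι, MCPair kind (tensor (A.N i) P) ((coeffProj A P i).mapFam m)
      ((coeffProj A P i).map (0 : ℕ) ξ) (nilOrder A i)) : (coeffLift hP hl hp).map (0 : ℕ) (curlyX K kind) = ξ :=
  lim_ext _ _ fun i => (hp i).lift_X (tensor_isDG hP)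

theorem coeffLift_tw (hP : P.IsDG) (hl : LawfulOp P)
    (hp : ∀ i : A.ι, MCPair kind (tensor (A.N i) P) ((coeffProj A P i).mapFam m)
      ((coeffProj A P i).map (0 : ℕ) ξ) (nilOrder A i)) (n : ℕ) (i : A.ι) : (coeffProj A P i).map n
    ((coeffLift hP hl hp).map n ((curlyTw K kind).map n (curlyM K kind n))) =
      twist kind (tensor (A.N i) P) ((coeffProj A P i).mapFam m)
      ((coeffProj A P i).map (0 : ℕ) ξ) (nilOrder A i) n := by
  have hq : ∀ a : (Curly K kind).obj n, (coeffProj A P i).map n ((coeffLift hP hl hp).map n a) =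
      (coeffLevel hP hl hp i).map n
        ((curlyProj K kind (nilOrder A i)).map n a) := fun _ => rfl
  rw [hq, curlyProj_tw_M, ← Hom.mapFam_apply, Hom.mapFam_twist]
  have h1 : (coeffLevel hP hl hp i).mapFam
      ((levelHom K kind (nilOrder A i)).mapFam (genXM K)) = (coeffProj A P i).mapFam m :=
    (hp i).lift_mapFam (tensor_isDG hP)
  have h2 : (coeffLevel hP hl hp i).map (0 : ℕ)
      ((levelHom K kind (nilOrder A i)).map (0 : ℕ) (genXX K)) =
        (coeffProj A P i).map (0 : ℕ) ξ := (hp i).lift_X (tensor_isDG hP)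
  rw [h1, h2]

theorem isTwist_of_proj (hp : ∀ i : A.ι, MCPair kind (tensor (A.N i) P) ((coeffProj A P i).mapFam m)
      ((coeffProj A P i).map (0 : ℕ) ξ) (nilOrder A i))
    {m' : Fam (A.coeff P)} (hm' : ∀ (i : A.ι) (n : ℕ),
    (coeffProj A P i).map n (m' n) = twist kind (tensor (A.N i) P) ((coeffProj A P i).mapFam m)
      ((coeffProj A P i).map (0 : ℕ) ξ) (nilOrder A i) n) : IsTwist kind (A.coeff P) m ξ m' := by
  intro n
  refine (hasSum_lim_iff (fun i : A.ι => tensor (A.N i) P)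
      (fun h => tensorMap P (A.map h) (A.map_mul h) (A.map_par h) (A.map_d h))).2 fun i => ?_
  have hd : DiscreteTopology ((tensor (A.N i) P).obj n) := ⟨rfl⟩
  have hterm : ∀ j, (coeffProj A P i).map n ((j.factorial : K)⁻¹ • ((adv kind (A.coeff P) ξ)^[j] m) n)
      = divPow (advL kind (tensor (A.N i) P) ((coeffProj A P i).map (0 : ℕ) ξ)) j
        ((coeffProj A P i).mapFam m) n := fun j => by
    rw [← Hom.mapFam_divPow, adv_iterate]
    rfl
  refine (hasSum_discrete_iff _ (nilOrder A i) (fun j hj => (hterm j).trans ?_) _).2 ?_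
  · rw [divPow_eq_zero (hp i).nil hj]; rfl
  · refine Eq.trans ?_ (Finset.sum_congr rfl fun j _ => (hterm j).symm)
    have h1 : (coeffProj A P i).map n (m' n + constField (A.coeff P) ((A.coeff P).d (0 : ℕ) ξ) n) =
        expSum (advL kind (tensor (A.N i) P) ((coeffProj A P i).map (0 : ℕ) ξ)) (nilOrder A i)
        ((coeffProj A P i).mapFam m) n := by
      rw [map_add, hm', ← Hom.mapFam_apply _ (constField _ _), Hom.mapFam_constField, Hom.map_d,
        twist, Pi.sub_apply, sub_add_cancel]
    refine h1.trans ?_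
    rw [expSum_apply, Finset.sum_apply]

theorem isMC_of_proj (hp : ∀ i : A.ι, MCPair kind (tensor (A.N i) P) ((coeffProj A P i).mapFam m)
      ((coeffProj A P i).map (0 : ℕ) ξ) (nilOrder A i))
    (hP : P.IsDG) (hl : LawfulOp P) {m' : Fam (A.coeff P)}
    (hm' : ∀ (i : A.ι) (n : ℕ),
    (coeffProj A P i).map n (m' n) = twist kind (tensor (A.N i) P) ((coeffProj A P i).mapFam m)
      ((coeffProj A P i).map (0 : ℕ) ξ) (nilOrder A i) n) : IsMC kind (A.coeff P) m' (-ξ) := by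
  constructor
  · refine lim_ext _ _ fun i => ?_
    have h := ((hp i).twist_pair (tensor_isDG hP) (tensor_lawfulOp hP hl)).par_x
    rw [← map_neg, ← Hom.map_par] at h
    exact h
  refine (hasSum_lim_iff (fun i : A.ι => tensor (A.N i) P)
      (fun h => tensorMap P (A.map h) (A.map_mul h) (A.map_par h) (A.map_d h))).2 fun i => ?_
  have hd : DiscreteTopology ((tensor (A.N i) P).obj (0 : ℕ)) := ⟨rfl⟩
  have h := (hp i).twist_pair (tensor_isDG hP) (tensor_lawfulOp hP hl)
  have hterm : ∀ n, (coeffProj A P i).map (0 : ℕ) (mcTerm kind (A.coeff P) m' (-ξ) n) =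
      mcTerm kind (tensor (A.N i) P) (twist kind (tensor (A.N i) P) ((coeffProj A P i).mapFam m)
      ((coeffProj A P i).map (0 : ℕ) ξ) (nilOrder A i))
          (-(coeffProj A P i).map (0 : ℕ) ξ) n := fun n => by
    rw [Hom.map_mcTerm, map_neg]
    congr 1
    exact funext (hm' i)
  refine (hasSum_discrete_iff _ (nilOrder A i) (fun n hn => (hterm (n + 1)).trans ?_) _).2 ?_
  · exact h.mcTerm_eq_zero (tensor_isDG hP) (tensor_lawfulOp hP hl) (by omega)
  · refine Eq.trans ?_ (Finset.sum_congr rfl fun j _ => (hterm (j + 1)).symm)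
    rw [← h.d_x _ le_rfl, ← map_neg, ← Hom.map_d]
    rfl

end Lift

variable (K kind) in
/-- The twisted structure. -/
theorem exists_twisted_structure (hP : P.IsDG) (hl : LawfulOp P)
    (φ : Hom (Inf K kind) (A.coeff P)) (ξ : (A.coeff P).obj (0 : ℕ))
    (hξ : IsMC kind (A.coeff P) (ops φ) ξ) :
    ∃ φ' : Hom (Inf K kind) (A.coeff P), ∀ (i : A.ι) (n : ℕ),
      (coeffProj A P i).map n (ops φ' n) =
        twist kind (tensor (A.N i) P) ((coeffProj A P i).mapFam (ops φ))
          ((coeffProj A P i).map (0 : ℕ) ξ) (nilOrder A i) n := by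
  have hp := coeff_pair (A := A) hP hl (ops_par φ) (ops_zero K kind φ) (ops_symm φ) (ops_d φ) hξ
  let f := coeffLift hP hl hp
  let φ' : Hom (Inf K kind) (A.coeff P) :=
    { map := fun s => ((curlyTw K kind).trans f).map s ∘ₗ (infCurly K kind).map s
      cont := fun s => continuous_bot
      map_par := fun s a => by simp [Hom.map_par]
      map_d := fun s a => by simp [Hom.map_d]
      map_un := fun o a => by simp [Hom.map_un]
      map_bin := fun o a b => by simp [Hom.map_bin] }
  refine ⟨φ', fun i n => ?_⟩
  have hφ' : ops φ' n = f.map n ((curlyTw K kind).map n (curlyM K kind n)) :=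
    congrArg (((curlyTw K kind).trans f).map n) (infCurly_M n)
  rw [hφ']
  exact coeffLift_tw hP hl hp n i

variable (K kind) in
/-- The twisting automorphism of the operad of `L∞` or `A∞` algebras with a Maurer-Cartan
element describes the twisting of algebras. -/
theorem exists_twisted_algebra (hP : P.IsDG) (hl : LawfulOp P)
    (φ : Hom (Inf K kind) (A.coeff P)) (ξ : (A.coeff P).obj (0 : ℕ))
    (hξ : IsMC kind (A.coeff P) (ops φ) ξ) :
    ∃ (f : Hom (Curly K kind) (A.coeff P)) (φ' : Hom (Inf K kind) (A.coeff P)),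
      Determines f φ ξ ∧ (∀ f', Determines f' φ ξ → f' = f) ∧
      IsTwist kind (A.coeff P) (ops φ) ξ (ops φ') ∧ IsMC kind (A.coeff P) (ops φ') (-ξ) ∧
      Determines ((curlyTw K kind).trans f) φ' (-ξ) := by
  have hp := coeff_pair (A := A) hP hl (ops_par φ) (ops_zero K kind φ) (ops_symm φ) (ops_d φ) hξ
  obtain ⟨φ', hproj⟩ := exists_twisted_structure K kind hP hl φ ξ hξ
  refine ⟨coeffLift hP hl hp, φ', ⟨fun n => coeffLift_M hP hl hp n, coeffLift_X hP hl hp⟩,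
    ?_, isTwist_of_proj hp hproj, isMC_of_proj hp hP hl hproj, fun n => ?_, ?_⟩
  · rintro f' ⟨h1, h2⟩
    refine curly_hom_ext (coeff_t2 A P) (fun n => ?_) ?_
    · rw [h1, coeffLift_M]
    · rw [h2, coeffLift_X]
  · exact lim_ext _ _ fun i => (coeffLift_tw hP hl hp n i).trans (hproj i n).symm
  · change (coeffLift hP hl hp).map (0 : ℕ) ((curlyTw K kind).map (0 : ℕ) (curlyX K kind)) = -ξ
    rw [curlyTw_X, map_neg, coeffLift_X]

end Algebras

end MCTwist
end

noncomputable section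

namespace MCTwist

/-! ## Invariance of the twist under permutations of the legs -/

section LegSymm

variable {K : Type u} [Field K] {M : DGAlg.{u, v} K modSig}

/-- The vector fields that are invariant under the permutations `LegSym`. -/
def legSymm (kind : Kind) (M : DGAlg.{u, v} K modSig) : Submodule K (Fam (opOf M)) where
  carrier := {X | ∀ (n : ℕ) (σ : Equiv.Perm (Fin (n + 1))), LegSym kind n σ →
    M.mperm 0 σ (X n) = X n}
  add_mem' {X Y} hX hY n σ h := by
    exact (map_add (M.mperm 0 σ) (X n) (Y n)).trans (congrArg₂ (· + ·) (hX n σ h) (hY n σ h))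
  zero_mem' n σ _ := map_zero (M.mperm 0 σ)
  smul_mem' c X hX n σ h := by
    exact (map_smul (M.mperm 0 σ) c (X n)).trans (congrArg (c • ·) (hX n σ h))

/-- The insertion of an operation with one leg at any leg. -/
def insLeg (M : DGAlg.{u, v} K modSig) {n : ℕ} (i : Fin (n + 2)) :
    M.obj ((0, n + 2) : ℕ × ℕ) →ₗ[K] M.obj ((0, 1) : ℕ × ℕ) →ₗ[K] M.obj ((0, n + 1) : ℕ × ℕ) :=
  M.mcomp (g := 0) (h := 0) (r := 0) (m := n + 2) (n := 0) (p := n + 1) rfl (by omega) i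

theorem LawfulMod.mperm_one (hl : LawfulMod M) {g n : ℕ} (a : M.obj ((g, n) : ℕ × ℕ)) :
    M.mperm g (1 : Equiv.Perm (Fin n)) a = a := sub_eq_zero.1 (hl _ _ (.perm_refl a))

theorem LawfulMod.mperm_insLeg (hl : LawfulMod M) {n : ℕ} (p r : Fin (n + 2))
    (σ : Equiv.Perm (Fin (n + 1))) (f : M.obj ((0, n + 2) : ℕ × ℕ))
    (y : M.obj ((0, 1) : ℕ × ℕ)) :
    insLeg M r (M.mperm 0 (insPerm p r σ) f) y = M.mperm 0 σ (insLeg M p f y) := by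
  have h := sub_eq_zero.1 (hl _ _ (.equivariance (g := 0) (h := 0) (r := 0) (m := n + 2) (n := 0)
    (p := n + 1) (m' := n + 2) (n' := 0) (p' := n + 1) rfl (by omega) (by omega) (insPerm p r σ)
    (Equiv.refl _) rfl σ p ?_ ?_ f y))
  · have h1 := sub_eq_zero.1 (hl _ _ (.perm_refl (g := 0) (n := 0 + 1) y))
    rw [h1, insPerm_self] at h
    exact h.symm
  · intro j t hj ht
    obtain ⟨s, rfl⟩ := Fin.exists_succAbove_eq hj
    have hs : t = s := by
      apply Fin.ext
      rw [ht]
      unfold outer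
      by_cases h : s.val < p.val
      · rw [Fin.succAbove_of_castSucc_lt _ _ h]
        simp [h]
      · rw [Fin.succAbove_of_le_castSucc _ _ (by rw [Fin.le_def]; simp; omega)]
        simp only [Fin.val_succ]
        rw [if_neg (by omega)]
        omega
    subst hs
    rw [insPerm_succAbove, insPerm_self]
    unfold outer
    by_cases h : (σ t).val < r.val
    · rw [Fin.succAbove_of_castSucc_lt _ _ h]
      simp [h]
    · rw [Fin.succAbove_of_le_castSucc _ _ (by rw [Fin.le_def]; simp; omega)]
      simp only [Fin.val_succ]
      rw [if_neg (by omega)]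
      omega
  · intro l; exact l.elim0

theorem finRotate_val_of_lt {n : ℕ} (s : Fin (n + 1)) (h : s.val < n) :
    (finRotate (n + 1) s).val = s.val + 1 := by
  have h1 : s = ⟨s.val, h.trans_le n.le_succ⟩ := rfl
  rw [h1, finRotate_of_lt h]

theorem insPerm_finRotate {n : ℕ} (p : Fin (n + 1)) :
    insPerm p.castSucc p.succ (finRotate (n + 1)) = finRotate (n + 2) := by
  refine Equiv.ext fun t => Fin.ext ?_
  by_cases h : t = p.castSucc
  · subst h
    rw [insPerm_self, finRotate_val_of_lt _ (by have := p.2; simp; omega)]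
    simp
  · obtain ⟨s, rfl⟩ := Fin.exists_succAbove_eq h
    rw [insPerm_succAbove]
    have hp := p.2
    have hs := s.2
    by_cases hsp : s.val < p.val
    · have h1 := finRotate_val_of_lt s (by omega)
      rw [Fin.succAbove_of_castSucc_lt p.castSucc s hsp, finRotate_val_of_lt _ (by simp; omega),
        Fin.succAbove_of_castSucc_lt, Fin.val_castSucc, h1, Fin.val_castSucc]
      rw [Fin.lt_def, Fin.val_castSucc, h1]; simp; omega
    · rw [Fin.succAbove_of_le_castSucc p.castSucc s (by rw [Fin.le_def]; simp; omega)]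
      by_cases hsn : s.val < n
      · have h1 := finRotate_val_of_lt s hsn
        rw [finRotate_val_of_lt s.succ (by simp; omega), Fin.succAbove_of_le_castSucc,
          Fin.val_succ, h1, Fin.val_succ]
        rw [Fin.le_def, Fin.val_castSucc, h1]; simp; omega
      · have : s = Fin.last n := Fin.ext (by simp; omega)
        subst this
        rw [finRotate_last, Fin.succ_last, finRotate_last, Fin.succAbove_of_castSucc_lt]
        · rfl
        · rw [Fin.lt_def]; simp

theorem insPerm_last_zero (n : ℕ) : insPerm (Fin.last (n + 1)) 0 1 = finRotate (n + 2) := by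
  refine Equiv.ext fun t => ?_
  induction t using Fin.lastCases with
  | last => rw [insPerm_self, finRotate_last]
  | cast s =>
    have h : (Fin.last (n + 1)).succAbove s = s.castSucc := by simp
    rw [← h, insPerm_succAbove, h]
    apply Fin.ext
    rw [finRotate_val_of_lt _ (by have := s.2; simp; omega)]
    simp

theorem LawfulMod.mperm_sum_insLeg (hl : LawfulMod M) {n : ℕ} {f : M.obj ((0, n + 2) : ℕ × ℕ)}
    (hf : M.mperm 0 (finRotate (n + 2)) f = f) (y : M.obj ((0, 1) : ℕ × ℕ)) :
    M.mperm 0 (finRotate (n + 1)) (∑ p : Fin (n + 1), insLeg M p.castSucc f y) =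
      ∑ p : Fin (n + 1), insLeg M p.castSucc f y := by
  have h1 : ∀ p : Fin (n + 1), M.mperm 0 (finRotate (n + 1)) (insLeg M p.castSucc f y) =
      insLeg M p.succ f y := fun p => by
    rw [← hl.mperm_insLeg p.castSucc p.succ, insPerm_finRotate, hf]
  have h2 : insLeg M (Fin.last (n + 1)) f y = insLeg M 0 f y := by
    have := hl.mperm_insLeg (Fin.last (n + 1)) 0 1 f y
    rw [insPerm_last_zero, hf, hl.mperm_one] at this
    exact this.symm
  rw [map_sum]
  simp only [h1]
  have h3 := Fin.sum_univ_castSucc (fun p : Fin (n + 2) => insLeg M p f y)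
  rw [Fin.sum_univ_succ, h2, add_comm (insLeg M 0 f y)] at h3
  exact add_right_cancel h3

theorem adv_mem_legSymm (hl : LawfulMod M) {kind : Kind} (y : M.obj ((0, 1) : ℕ × ℕ))
    {X : Fam (opOf M)} (hX : X ∈ legSymm kind M) :
    advL kind (opOf M) y X ∈ legSymm kind M := by
  intro n σ h
  cases kind
  · refine (hl.mperm_insLeg 0 0 σ (X (n + 1)) y).symm.trans ?_
    exact congrArg (fun f => insLeg M 0 f y) (hX (n + 1) (insPerm 0 0 σ) trivial)
  · have hσ : σ = finRotate (n + 1) := h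
    rw [hσ]
    exact hl.mperm_sum_insLeg (hX (n + 1) (finRotate (n + 2)) rfl) y

theorem constField_mem_legSymm (hl : LawfulMod M) (kind : Kind) (z : M.obj ((0, 1) : ℕ × ℕ)) :
    constField (opOf M) z ∈ legSymm kind M := by
  intro n σ _
  cases n with
  | zero =>
    have : σ = 1 := Subsingleton.elim (α := Equiv.Perm (Fin 1)) _ _
    rw [this]
    exact hl.mperm_one _
  | succ n => exact map_zero (M.mperm 0 σ)

theorem twist_mem_legSymm [CharZero K] (hl : LawfulMod M) {kind : Kind} {m : Fam (opOf M)}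
    (hm : m ∈ legSymm kind M) (x : M.obj ((0, 1) : ℕ × ℕ)) (k : ℕ) :
    twist kind (opOf M) m x k ∈ legSymm kind M :=
  Submodule.sub_mem _ (expSum_mem (fun _ ha => adv_mem_legSymm hl x ha) k hm)
    (constField_mem_legSymm hl kind _)

theorem legSymm_le_admissible (kind : Kind) : legSymm kind M ≤ admissible kind (opOf M) := by
  rintro X hX rfl n σ
  exact hX n (extendLast σ) trivial

end LegSymm

/-! ## The twisting automorphism of the modular closure -/

section ModPair

variable {K : Type u} [Field K] [CharZero K] {kind : Kind} {M : DGAlg.{u, v} K modSig}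
  {m : Fam (opOf M)} {x : (opOf M).obj (0 : ℕ)} {k : ℕ}

/-- The values of the generators of the modular closure given by a pair `(m, x)`. -/
def modPairGen (m : Fam (opOf M)) (x : M.obj ((0, 1) : ℕ × ℕ)) : ∀ s : ℕ × ℕ, ModGen s → M.obj s
  | _, .m n => m (n + 1)
  | _, .x => x

namespace MCPair

/-- The morphism from the free modular operad determined by a pair `(m, x)`. -/
def modLift (h : MCPair kind (opOf M) m x k) (hM : M.IsDG) : Hom (freeMod K) M :=
  freeLift (sg := modSig) (G := ModGen) oddMod hM (modPairGen m x) (fun s g => by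
    cases g with
    | m n =>
      have := congrFun h.par_m (n + 1)
      exact Eq.trans this (neg_one_smul K (m (n + 1))).symm
    | x => exact Eq.trans h.par_x (one_smul K x).symm)

theorem modLift_X (h : MCPair kind (opOf M) m x k) (hM : M.IsDG) :
    (h.modLift hM).map ((0, 1) : ℕ × ℕ) (genModX K) = x :=
  freeLift_gen (sg := modSig) hM _ _ ModGen.x

theorem modLift_M (h : MCPair kind (opOf M) m x k) (hM : M.IsDG) (n : ℕ) :
    (h.modLift hM).map ((0, n + 1) : ℕ × ℕ) (genModM K n) = m n := by
  cases n with
  | zero => exact (map_zero ((h.modLift hM).map ((0, 1) : ℕ × ℕ))).trans h.m_zero.symm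
  | succ n => exact freeLift_gen (sg := modSig) hM _ _ (ModGen.m n)

theorem modLift_mapFam (h : MCPair kind (opOf M) m x k) (hM : M.IsDG) :
    (h.modLift hM).opOf.mapFam (genModM K) = m :=
  funext (h.modLift_M hM)

theorem modLift_rel (h : MCPair kind (opOf M) m x k) (hM : M.IsDG) (hl : LawfulMod M) (F : Filt M)
    (hF : ∀ s : ℕ × ℕ, F.F k s = ⊥) (hx : x ∈ F.F 1 ((0, 1) : ℕ × ℕ))
    (hdx : M.d ((0, 1) : ℕ × ℕ) x ∈ F.F 1 ((0, 1) : ℕ × ℕ))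
    (hmono : ∀ i (s : ℕ × ℕ), F.F (i + 1) s ≤ F.F i s) (hm : m ∈ legSymm kind M)
    (s : ℕ × ℕ) (a : (freeMod K).obj s) (ha : CurlyModRel K kind k s a) :
    (h.modLift hM).map s a = 0 := by
  cases ha with
  | law h' => exact (h.modLift hM).map_modLaw hl h'
  | str h' =>
    cases h' with
    | symm n σ hσ =>
      rw [map_sub, Hom.map_mperm, h.modLift_M]
      exact sub_eq_zero.2 (hm n σ hσ)
    | diff n =>
      rw [map_sub, Hom.map_d, h.modLift_M]
      refine sub_eq_zero.2 ((h.d_m n).trans ?_)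
      refine Eq.symm (((h.modLift hM).opOf.map_cobar kind (genModM K) n).trans ?_)
      rw [h.modLift_mapFam]
  | diff N hN =>
    rw [map_sub, Hom.map_d, h.modLift_X]
    refine sub_eq_zero.2 ((h.d_x N hN).trans (Eq.symm ?_))
    refine (map_sum ((h.modLift hM).opOf.map (0 : ℕ)) _ _).trans ?_
    refine Finset.sum_congr rfl fun n _ => ?_
    refine ((h.modLift hM).opOf.map_mcTerm kind (genModM K) (genModX K) (n + 1)).trans ?_
    rw [h.modLift_mapFam]
    exact congrArg (fun x => mcTerm kind (opOf M) m x (n + 1)) (h.modLift_X hM)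
  | adic t ht =>
    have h1 : (h.modLift hM).map s (Finsupp.single t (1 : K) : Mono modSig ModGen s →₀ K) =
        t.eval M (modPairGen m x) := freeLiftFun_mono (sg := modSig) M _ t
    rw [h1]
    have h2 := F.eval_mem (sg := modSig) wtMod (modPairGen m x) (fun s g => by
      cases g with
      | m n => exact F.zero _ _
      | x => exact hx) (fun s g => by
      cases g with
      | m n => exact F.zero _ _
      | x => exact hdx) t
    have hle : ∀ j, F.F (k + j) s ≤ F.F k s := by
      intro j
      induction j with
      | zero => exact le_rfl
      | succ j ih => exact (hmono _ _).trans ih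
    have h3 := hle (t.weight wtMod - k) (by rwa [Nat.add_sub_cancel' ht])
    rwa [hF, Submodule.mem_bot] at h3

end MCPair

theorem freeMod_hom_ext {Q : DGAlg.{u, v} K modSig} {f f' : Hom (freeMod K) Q}
    (hM : ∀ n : ℕ, f.map ((0, n + 1) : ℕ × ℕ) (genModM K n) =
      f'.map ((0, n + 1) : ℕ × ℕ) (genModM K n))
    (hX : f.map ((0, 1) : ℕ × ℕ) (genModX K) = f'.map ((0, 1) : ℕ × ℕ) (genModX K)) : f = f' := by
  refine free_hom_ext (sg := modSig) (p := oddMod) fun s g => ?_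
  cases g with
  | m n => exact hM (n + 1)
  | x => exact hX

end ModPair

section ModLevel

variable (K : Type u) [Field K] [CharZero K] (kind : Kind) (k : ℕ)

/-- The modular closure modulo the ideal `(x) ^ k`. -/
def ModLevel : DGAlg.{u, u} K modSig := quot (freeMod K) (CurlyModRel K kind k)

theorem modLevel_isDG : (ModLevel K kind k).IsDG := quot_isDG (free_isDG (sg := modSig) oddMod) _

theorem modLevel_lawful : LawfulMod (ModLevel K kind k) :=
  quot_lawfulMod (free_isDG (sg := modSig) oddMod) (fun _ _ h => .law h)

/-- The projection from the free modular operad. -/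
def modLevelHom : Hom (freeMod K) (ModLevel K kind k) := quotHom (freeMod K) (fun _ => rfl) _

/-- The generators `m_n`. -/
def genModFam : Fam (opOf (freeMod K)) := genModM K

/-- The classes of the generators `m_n`. -/
def modLevelM : Fam (opOf (ModLevel K kind k)) :=
  (modLevelHom K kind k).opOf.mapFam (genModFam K)

/-- The class of the generator `x`. -/
def modLevelX : (opOf (ModLevel K kind k)).obj (0 : ℕ) :=
  (modLevelHom K kind k).opOf.map (0 : ℕ) (genModX K)

def modLevelFilt : Filt (ModLevel K kind k) :=
  weightFilt (sg := modSig) oddMod wtMod (CurlyModRel K kind k)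

theorem modLevelFilt_eq_bot (s : ℕ × ℕ) : (modLevelFilt K kind k).F k s = ⊥ :=
  weightFilt_eq_bot (sg := modSig) (fun _ x hx => .adic x hx) s

theorem modLevelFilt_mono (i : ℕ) (s : ℕ × ℕ) :
    (modLevelFilt K kind k).F (i + 1) s ≤ (modLevelFilt K kind k).F i s :=
  Submodule.span_mono fun _ ⟨x, hx, hx'⟩ => ⟨x, by omega, hx'⟩

theorem modLevelFilt_X : modLevelX K kind k ∈
    (modLevelFilt K kind k).F 1 ((0, 1) : ℕ × ℕ) :=
  weightFilt_mono_mem (sg := modSig) (p := oddMod) (wt := wtMod) (R := CurlyModRel K kind k)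
    (.leaf ModGen.x false)

theorem modLevelFilt_dX : (ModLevel K kind k).d ((0, 1) : ℕ × ℕ)
    (modLevelX K kind k) ∈
    (modLevelFilt K kind k).F 1 ((0, 1) : ℕ × ℕ) := by
  have h : (freeMod K).d ((0, 1) : ℕ × ℕ) (genModX K) =
      freeMono (sg := modSig) oddMod (.leaf ModGen.x true) :=
    free_d_mono (sg := modSig) (p := oddMod) (.leaf ModGen.x false)
  refine Eq.mpr (congrArg (· ∈ (modLevelFilt K kind k).F 1 ((0, 1) : ℕ × ℕ))
    (((modLevelHom K kind k).map_d _ (genModX K)).symm.trans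
      (congrArg ((modLevelHom K kind k).map ((0, 1) : ℕ × ℕ)) h))) ?_
  exact weightFilt_mono_mem (sg := modSig) (p := oddMod) (wt := wtMod) (R := CurlyModRel K kind k)
    (.leaf ModGen.x true)

theorem modLevel_legSymm :
    modLevelM K kind k ∈ legSymm kind (ModLevel K kind k) := by
  intro n σ hσ
  have h : (modLevelHom K kind k).map ((0, n + 1) : ℕ × ℕ)
      ((freeMod K).mperm 0 σ (genModM K n) - genModM K n) = 0 :=
    quotMk_eq_zero (P := freeMod K) (R := CurlyModRel K kind k) (.str (.symm n σ hσ))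
  rw [map_sub, Hom.map_mperm, sub_eq_zero] at h
  exact h

theorem modLevel_pair : MCPair kind (opOf (ModLevel K kind k))
    (modLevelM K kind k)
    (modLevelX K kind k) k where
  par_x := by
    refine ((modLevelHom K kind k).map_par ((0, 1) : ℕ × ℕ) (genModX K)).symm.trans ?_
    congr 1
    exact (free_par_mono (sg := modSig) (p := oddMod) (.leaf ModGen.x false)).trans (one_smul _ _)
  par_m := by
    funext n
    have h : (freeMod K).par ((0, n + 1) : ℕ × ℕ) (genModM K n) = (-1 : K) • genModM K n := by
      cases n with
      | zero => exact (map_zero ((freeMod K).par ((0, 1) : ℕ × ℕ))).trans (smul_zero (-1 : K)).symm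
      | succ n => exact free_par_mono (sg := modSig) (p := oddMod) (.leaf (ModGen.m n) false)
    have h1 := ((modLevelHom K kind k).map_par ((0, n + 1) : ℕ × ℕ) (genModM K n)).symm
    rw [h, map_smul] at h1
    exact h1.trans (neg_one_smul K (modLevelM K kind k n))
  m_zero := map_zero ((modLevelHom K kind k).map ((0, 1) : ℕ × ℕ))
  symm := legSymm_le_admissible kind (modLevel_legSymm K kind k)
  d_m n := by
    have h : (modLevelHom K kind k).opOf.map n ((opOf (freeMod K)).d n (genModFam K n) -
      cobar kind (opOf (freeMod K)) (genModFam K) n) = 0 :=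
      quotMk_eq_zero (P := freeMod K) (R := CurlyModRel K kind k) (.str (.diff n))
    rw [map_sub, Hom.map_d, sub_eq_zero, Hom.map_cobar] at h
    exact h
  d_x N hN := by
    have h : (modLevelHom K kind k).opOf.map (0 : ℕ) ((opOf (freeMod K)).d (0 : ℕ) (genModX K) -
      ∑ n ∈ Finset.range N, mcTerm kind (opOf (freeMod K)) (genModFam K) (genModX K) (n + 1)) = 0 :=
      quotMk_eq_zero (P := freeMod K) (R := CurlyModRel K kind k) (.diff N hN)
    have h1 := (map_sub ((modLevelHom K kind k).opOf.map (0 : ℕ)) _ _).symm.trans h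
    refine ((modLevelHom K kind k).opOf.map_d (0 : ℕ) _).symm.trans ((sub_eq_zero.1 h1).trans ?_)
    refine (map_sum ((modLevelHom K kind k).opOf.map (0 : ℕ)) _ _).trans ?_
    refine Finset.sum_congr rfl fun n _ => ?_
    exact Hom.map_mcTerm _ _ _ _ _
  nil := adv_pow_eq_zero (modLevelFilt K kind k).opOf
    (fun n => modLevelFilt_eq_bot K kind k _) kind (modLevelFilt_X K kind k)

end ModLevel

section CurlyMod

variable (K : Type u) [Field K] [CharZero K] (kind : Kind)

/-- The transition maps of the inverse system defining `CurlyMod K kind`. -/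
def modLevelTr {i j : ℕ} (h : i ≤ j) : Hom (ModLevel K kind j) (ModLevel K kind i) :=
  quotMap (freeMod K) (CurlyModRel.mono h)

/-- The morphism from the free modular operad with image the polynomials in the completion. -/
def curlyModHom : Hom (freeMod K) (CurlyMod K kind) :=
  toAdic (freeMod K) (CurlyModRel K kind) CurlyModRel.mono (fun _ => rfl)

/-- The projection of the completed modular closure to a quotient. -/
def curlyModProj (k : ℕ) : Hom (CurlyMod K kind) (ModLevel K kind k) :=
  limProj (ModLevel K kind) (fun h => modLevelTr K kind h) k

variable {K kind} in
theorem curlyMod_hom_ext {Q : DGAlg.{u, v} K modSig} (hQ : ∀ s : ℕ × ℕ, T2Space (Q.obj s))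
    {f f' : Hom (CurlyMod K kind) Q}
    (hM : ∀ n : ℕ, f.map ((0, n + 1) : ℕ × ℕ) (curlyModM K kind n) =
      f'.map ((0, n + 1) : ℕ × ℕ) (curlyModM K kind n))
    (hX : f.map ((0, 1) : ℕ × ℕ) (curlyModX K kind) =
      f'.map ((0, 1) : ℕ × ℕ) (curlyModX K kind)) : f = f' := by
  refine adicLim_hom_ext (freeMod K) (CurlyModRel K kind) CurlyModRel.mono (fun _ => rfl) hQ
    fun s a => ?_
  have key : ∀ f : Hom (CurlyMod K kind) Q, ∃ g : Hom (freeMod K) Q,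
      ∀ (s : ℕ × ℕ) a, g.map s a = f.map s ((curlyModHom K kind).map s a) := fun f =>
    ⟨{ map := fun s => f.map s ∘ₗ (curlyModHom K kind).map s
       cont := fun s => (f.cont s).comp ((curlyModHom K kind).cont s)
       map_par := fun s a => by simp [Hom.map_par]
       map_d := fun s a => by simp [Hom.map_d]
       map_un := fun o a => by simp [Hom.map_un]
       map_bin := fun o a b => by simp [Hom.map_bin] }, fun _ _ => rfl⟩
  obtain ⟨g, hg⟩ := key f
  obtain ⟨g', hg'⟩ := key f'
  have : g = g' := freeMod_hom_ext (fun n => by rw [hg, hg']; exact hM n)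
    (by rw [hg, hg']; exact hX)
  have h1 := hg s a
  rw [this, hg'] at h1
  exact h1.symm

/-- The twisted generators in a quotient of the completed modular closure. -/
theorem modLevel_twist_pair (k : ℕ) :
    MCPair kind (opOf (ModLevel K kind k))
      (twist kind (opOf (ModLevel K kind k)) (modLevelM K kind k)
        (modLevelX K kind k) k)
      (-modLevelX K kind k) k :=
  (modLevel_pair K kind k).twist_pair (opOf_isDG (modLevel_isDG K kind k))
    (opOf_lawful (modLevel_lawful K kind k))

theorem modTwistLevel_rel (k : ℕ) (s : ℕ × ℕ) (a : (freeMod K).obj s)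
    (ha : CurlyModRel K kind k s a) :
    ((modLevel_twist_pair K kind k).modLift (modLevel_isDG K kind k)).map s a = 0 :=
  (modLevel_twist_pair K kind k).modLift_rel (modLevel_isDG K kind k) (modLevel_lawful K kind k)
    (modLevelFilt K kind k) (modLevelFilt_eq_bot K kind k) (neg_mem (modLevelFilt_X K kind k))
    (Eq.mpr (congrArg (· ∈ (modLevelFilt K kind k).F 1 ((0, 1) : ℕ × ℕ))
      (map_neg ((ModLevel K kind k).d ((0, 1) : ℕ × ℕ)) _)) (neg_mem (modLevelFilt_dX K kind k)))
    (modLevelFilt_mono K kind k)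
    (twist_mem_legSymm (modLevel_lawful K kind k) (modLevel_legSymm K kind k) _ k) s a ha

/-- The twisting endomorphism of a quotient of the completed modular closure. -/
def modTwistLevel (k : ℕ) : Hom (ModLevel K kind k) (ModLevel K kind k) :=
  quotLift ((modLevel_twist_pair K kind k).modLift (modLevel_isDG K kind k))
    (modTwistLevel_rel K kind k)

theorem modTwistLevel_M (k : ℕ) :
    (modTwistLevel K kind k).opOf.mapFam (modLevelM K kind k) =
      twist kind (opOf (ModLevel K kind k)) (modLevelM K kind k)
        (modLevelX K kind k) k :=
  funext ((modLevel_twist_pair K kind k).modLift_M (modLevel_isDG K kind k))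

theorem modTwistLevel_X (k : ℕ) :
    (modTwistLevel K kind k).map ((0, 1) : ℕ × ℕ)
      (modLevelX K kind k) =
      -modLevelX K kind k :=
  (modLevel_twist_pair K kind k).modLift_X (modLevel_isDG K kind k)

theorem modTwistLevel_compat {i j : ℕ} (h : i ≤ j) (s : ℕ × ℕ) (a : (freeMod K).obj s) :
    (modLevelTr K kind h).map s
      (((modLevel_twist_pair K kind j).modLift (modLevel_isDG K kind j)).map s a) =
      ((modLevel_twist_pair K kind i).modLift (modLevel_isDG K kind i)).map s a := by
  have : Hom.comp' ((modLevel_twist_pair K kind j).modLift (modLevel_isDG K kind j))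
      (modLevelTr K kind h) =
      (modLevel_twist_pair K kind i).modLift (modLevel_isDG K kind i) := by
    refine freeMod_hom_ext (fun n => ?_) ?_
    · refine (congrArg ((modLevelTr K kind h).map ((0, n + 1) : ℕ × ℕ))
        ((modLevel_twist_pair K kind j).modLift_M (modLevel_isDG K kind j) n)).trans
        (Eq.trans ?_ ((modLevel_twist_pair K kind i).modLift_M (modLevel_isDG K kind i) n).symm)
      refine (congrFun ((modLevelTr K kind h).opOf.mapFam_twist kind _ _ _) n).trans ?_
      exact congrFun ((modLevel_pair K kind i).twist_order h) n
    · refine (congrArg ((modLevelTr K kind h).map ((0, 1) : ℕ × ℕ))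
        ((modLevel_twist_pair K kind j).modLift_X (modLevel_isDG K kind j))).trans
        (Eq.trans ?_ ((modLevel_twist_pair K kind i).modLift_X (modLevel_isDG K kind i)).symm)
      exact map_neg ((modLevelTr K kind h).map ((0, 1) : ℕ × ℕ)) _
  exact congrArg (fun f : Hom (freeMod K) (ModLevel K kind i) => f.map s a) this

/-- The twisting endomorphism of the completed modular closure. -/
def curlyModTw : Hom (CurlyMod K kind) (CurlyMod K kind) :=
  adicLift (freeMod K) (CurlyModRel K kind) CurlyModRel.mono (ModLevel K kind)
    (fun h => modLevelTr K kind h)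
    (fun k => (modLevel_twist_pair K kind k).modLift (modLevel_isDG K kind k))
    (fun _ _ h s a => modTwistLevel_compat K kind h s a) id
    (fun k s a => modTwistLevel_rel K kind k s a)

theorem curlyModTw_X :
    (curlyModTw K kind).map ((0, 1) : ℕ × ℕ) (curlyModX K kind) = - curlyModX K kind :=
  lim_ext (sg := modSig) (ModLevel K kind) (fun h => modLevelTr K kind h)
    fun k => modTwistLevel_X K kind k

theorem curlyModProj_tw_M (k n : ℕ) :
    (curlyModProj K kind k).map ((0, n + 1) : ℕ × ℕ)
      ((curlyModTw K kind).map ((0, n + 1) : ℕ × ℕ) (curlyModM K kind n)) =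
      twist kind (opOf (ModLevel K kind k)) (modLevelM K kind k)
        (modLevelX K kind k) k n :=
  congrFun (modTwistLevel_M K kind k) n

theorem modTwistLevel_modTwistLevel_M (k : ℕ) :
    (modTwistLevel K kind k).opOf.mapFam ((modTwistLevel K kind k).opOf.mapFam
      (modLevelM K kind k)) =
      modLevelM K kind k := by
  rw [modTwistLevel_M, Hom.mapFam_twist, modTwistLevel_M]
  have h : (modTwistLevel K kind k).opOf.map (0 : ℕ)
      (modLevelX K kind k) =
      -modLevelX K kind k := modTwistLevel_X K kind k
  exact (congrArg (fun x => twist kind _ _ x k) h).trans (modLevel_pair K kind k).twist_twist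

theorem curlyMod_t2 (s : ℕ × ℕ) : T2Space ((CurlyMod K kind).obj s) :=
  lim_t2 (sg := modSig) (ModLevel K kind) (fun h => modLevelTr K kind h) (fun _ _ => rfl) s

theorem curlyModTw_curlyModTw (s : ℕ × ℕ) (a : (CurlyMod K kind).obj s) :
    (curlyModTw K kind).map s ((curlyModTw K kind).map s a) = a := by
  let idHom : Hom (CurlyMod K kind) (CurlyMod K kind) :=
    { map := fun _ => LinearMap.id
      cont := fun _ => continuous_id
      map_par := fun _ _ => rfl
      map_d := fun _ _ => rfl
      map_un := fun _ _ => rfl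
      map_bin := fun _ _ _ => rfl }
  have : (curlyModTw K kind).trans (curlyModTw K kind) = idHom := by
    refine curlyMod_hom_ext (curlyMod_t2 K kind) (fun n => ?_) ?_
    · exact lim_ext (sg := modSig) (ModLevel K kind) (fun h => modLevelTr K kind h) fun k =>
        congrFun (modTwistLevel_modTwistLevel_M K kind k) n
    · change (curlyModTw K kind).map ((0, 1) : ℕ × ℕ)
        ((curlyModTw K kind).map ((0, 1) : ℕ × ℕ) (curlyModX K kind)) = curlyModX K kind
      rw [curlyModTw_X, map_neg, curlyModTw_X, neg_neg]
  exact congrArg (fun f : Hom (CurlyMod K kind) (CurlyMod K kind) => f.map s a) this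

theorem curlyModTw_isAut : (curlyModTw K kind).IsAut :=
  ⟨curlyModTw K kind, fun s a => ⟨curlyModTw_curlyModTw K kind s a,
    curlyModTw_curlyModTw K kind s a⟩⟩

theorem curlyModTw_hasSum {n : ℕ} (hn : 1 ≤ n) :
    HasSum (fun i : ℕ =>
        twTerm kind (opOf (CurlyMod K kind)) (curlyModM K kind) (curlyModX K kind) n i)
      ((curlyModTw K kind).map ((0, n + 1) : ℕ × ℕ) (curlyModM K kind n)) := by
  refine (hasSum_lim_iff (sg := modSig) (ModLevel K kind) (fun h => modLevelTr K kind h)).2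
    fun k => ?_
  have hd : DiscreteTopology ((ModLevel K kind k).obj ((0, n + 1) : ℕ × ℕ)) := ⟨rfl⟩
  have h := modLevel_pair K kind k
  have hterm : ∀ i, (curlyModProj K kind k).map ((0, n + 1) : ℕ × ℕ)
      (twTerm kind (opOf (CurlyMod K kind)) (curlyModM K kind) (curlyModX K kind) n i) =
      twTerm kind (opOf (ModLevel K kind k)) (modLevelM K kind k)
        (modLevelX K kind k) n i := fun i =>
    (curlyModProj K kind k).opOf.map_twTerm kind _ _ n i
  refine (hasSum_discrete_iff _ k (fun i hi => (hterm i).trans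
    (h.twTerm_eq_zero (opOf_isDG (modLevel_isDG K kind k))
      (opOf_lawful (modLevel_lawful K kind k)) n hi)) _).2 ?_
  refine (curlyModProj_tw_M K kind k n).trans ?_
  rw [h.twist_eq_sum (opOf_isDG (modLevel_isDG K kind k))
    (opOf_lawful (modLevel_lawful K kind k)) hn]
  exact Finset.sum_congr rfl fun i _ => (hterm i).symm

end CurlyMod

end MCTwist
end

noncomputable section

namespace MCTwist

/-! ## Algebras over the completed modular closure -/

section TensorHom

open TensorProduct

variable {K : Type u} [Field K] {P : DGAlg.{u, w} K opSig} {M : DGAlg.{u, w'} K modSig}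
  (N : Type v) [NonUnitalRing N] [Module K N] [IsScalarTower K N N] [SMulCommClass K N N]
  [NilCDGA K N]

variable {N} in
theorem tensor_linear_ext {X Y : Type*} [AddCommGroup X] [Module K X] [AddCommGroup Y] [Module K Y]
    (f g : N ⊗[K] X →ₗ[K] Y) (h : ∀ x y, f (x ⊗ₜ y) = g (x ⊗ₜ y)) (a : N ⊗[K] X) : f a = g a :=
  LinearMap.congr_fun (TensorProduct.ext' h) a

variable {N} in
theorem tensor_bilinear_ext {X Y Z : Type*} [AddCommGroup X] [Module K X] [AddCommGroup Y]
    [Module K Y] [AddCommGroup Z] [Module K Z]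
    (f g : N ⊗[K] X →ₗ[K] N ⊗[K] Y →ₗ[K] Z)
    (h : ∀ x y x' y', f (x ⊗ₜ y) (x' ⊗ₜ y') = g (x ⊗ₜ y) (x' ⊗ₜ y')) (a : N ⊗[K] X)
    (b : N ⊗[K] Y) : f a b = g a b :=
  LinearMap.congr_fun (tensor_linear_ext f g
    (fun x y => LinearMap.ext (tensor_linear_ext _ _ (h x y))) a) b

theorem tensor_bin_apply {sg : Sig} (Q : DGAlg.{u, w} K sg) {r s t : sg.S} (o : sg.B r s t)
    (x y : N) (f : Q.obj r) (g : Q.obj s) :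
    (tensor N Q).bin o (x ⊗ₜ[K] f) (y ⊗ₜ[K] g) =
      (x * proj (K := K) DGSpace.par false y) ⊗ₜ[K] Q.bin o f g +
      (x * proj (K := K) DGSpace.par true y) ⊗ₜ[K] Q.bin o (Q.par r f) g := by
  change (TensorProduct.map₂ ((LinearMap.mul K N).compl₂ (proj DGSpace.par false)) (Q.bin o) +
    TensorProduct.map₂ ((LinearMap.mul K N).compl₂ (proj DGSpace.par true))
      (Q.bin o ∘ₗ Q.par r)) (x ⊗ₜ[K] f) (y ⊗ₜ[K] g) = _
  simp only [LinearMap.add_apply, TensorProduct.map₂_apply_tmul]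
  rfl

/-- Extension of coefficients of a morphism to the operad underlying a modular operad. -/
def tensorHom (τ : Hom P (opOf M)) : Hom (tensor N P) (opOf (tensor N M)) where
  map n := TensorProduct.map LinearMap.id (τ.map n)
  cont n := continuous_bot
  map_par n a := by
    let T : ∀ n : ℕ, N ⊗[K] P.obj n →ₗ[K] N ⊗[K] M.obj ((0, n + 1) : ℕ × ℕ) := fun n =>
      TensorProduct.map LinearMap.id (τ.map n)
    let p : N ⊗[K] P.obj n →ₗ[K] N ⊗[K] P.obj n := (tensor N P).par n
    let q : N ⊗[K] M.obj ((0, n + 1) : ℕ × ℕ) →ₗ[K] N ⊗[K] M.obj ((0, n + 1) : ℕ × ℕ) :=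
      (tensor N M).par ((0, n + 1) : ℕ × ℕ)
    exact tensor_linear_ext (T n ∘ₗ p) (q ∘ₗ T n)
      (fun x y => congrArg (DGSpace.par (K := K) x ⊗ₜ[K] ·) (τ.map_par n y)) a
  map_d n a := by
    let T : ∀ n : ℕ, N ⊗[K] P.obj n →ₗ[K] N ⊗[K] M.obj ((0, n + 1) : ℕ × ℕ) := fun n =>
      TensorProduct.map LinearMap.id (τ.map n)
    let p : N ⊗[K] P.obj n →ₗ[K] N ⊗[K] P.obj n := (tensor N P).d n
    let q : N ⊗[K] M.obj ((0, n + 1) : ℕ × ℕ) →ₗ[K] N ⊗[K] M.obj ((0, n + 1) : ℕ × ℕ) :=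
      (tensor N M).d ((0, n + 1) : ℕ × ℕ)
    refine tensor_linear_ext (T n ∘ₗ p) (q ∘ₗ T n) (fun x y => ?_) a
    refine (map_add (T n) ((DGSpace.d (K := K) x) ⊗ₜ[K] y)
      ((DGSpace.par (K := K) x) ⊗ₜ[K] P.d n y)).trans ?_
    exact congrArg (fun z => (DGSpace.d (K := K) x ⊗ₜ[K] τ.map n y :
      N ⊗[K] M.obj ((0, n + 1) : ℕ × ℕ)) + DGSpace.par (K := K) x ⊗ₜ[K] z) (τ.map_d n y)
  map_un {m n} o a := by
    cases o with
    | perm e =>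
      let T : ∀ n : ℕ, N ⊗[K] P.obj n →ₗ[K] N ⊗[K] M.obj ((0, n + 1) : ℕ × ℕ) := fun n =>
        TensorProduct.map LinearMap.id (τ.map n)
      let p : N ⊗[K] P.obj m →ₗ[K] N ⊗[K] P.obj n := (tensor N P).perm e
      let q : N ⊗[K] M.obj ((0, m + 1) : ℕ × ℕ) →ₗ[K] N ⊗[K] M.obj ((0, n + 1) : ℕ × ℕ) :=
        (tensor N M).mperm 0 (extendLast e)
      exact tensor_linear_ext (T n ∘ₗ p) (q ∘ₗ T m)
        (fun x y => congrArg (x ⊗ₜ[K] ·) (τ.map_perm e y)) a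
  map_bin {l m n} o a b := by
    cases o with
    | comp h i =>
      let T : ∀ n : ℕ, N ⊗[K] P.obj n →ₗ[K] N ⊗[K] M.obj ((0, n + 1) : ℕ × ℕ) := fun n =>
        TensorProduct.map LinearMap.id (τ.map n)
      let p : N ⊗[K] P.obj l →ₗ[K] N ⊗[K] P.obj m →ₗ[K] N ⊗[K] P.obj n :=
        (tensor N P).comp h i
      let q : N ⊗[K] M.obj ((0, l + 1) : ℕ × ℕ) →ₗ[K] N ⊗[K] M.obj ((0, m + 1) : ℕ × ℕ) →ₗ[K]
          N ⊗[K] M.obj ((0, n + 1) : ℕ × ℕ) :=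
        (tensor N M).mcomp (rfl : 0 = 0 + 0) (by omega) i.castSucc
      refine tensor_bilinear_ext (p.compr₂ (T n)) (q.compl₁₂ (T l) (T m)) (fun x f y g => ?_) a b
      refine (congrArg (T n) (tensor_bin_apply N P (OpB.comp h i) x y f g)).trans ?_
      refine (map_add (T n) _ _).trans ?_
      refine Eq.trans ?_ (tensor_bin_apply N M (sg := modSig) (ModB.comp (rfl : 0 = 0 + 0)
        (by omega) i.castSucc) x y (τ.map l f) (τ.map m g)).symm
      refine congrArg₂ (· + ·) (congrArg (_ ⊗ₜ[K] ·) (τ.map_comp h i f g))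
        (congrArg (_ ⊗ₜ[K] ·) ((τ.map_comp h i _ g).trans ?_))
      rw [τ.map_par]
      rfl

end TensorHom

section ModAlgebras

variable {K : Type u} [Field K] [CharZero K] {kind : Kind} {P : DGAlg.{u, w} K opSig}
  {M : DGAlg.{u, w'} K modSig} {A : FormalCDGA.{u, v} K}

theorem MCPair.map {Q : DGAlg.{u, w} K opSig} {R : DGAlg.{u, w'} K opSig} {m : Fam Q}
    {x : Q.obj (0 : ℕ)} {k : ℕ} (h : MCPair kind Q m x k) (f : Hom Q R)
    (hnil : (advL kind R (f.map (0 : ℕ) x)) ^ k = 0) :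
    MCPair kind R (f.mapFam m) (f.map (0 : ℕ) x) k where
  par_x := by rw [← f.map_par, h.par_x]
  par_m := by
    funext n
    have := congrFun h.par_m n
    rw [parFam_apply] at this ⊢
    rw [f.mapFam_apply, ← f.map_par, this, Pi.neg_apply, map_neg]
    rfl
  m_zero := (congrArg _ h.m_zero).trans (map_zero (f.map (0 : ℕ)))
  symm := f.mapFam_admissible h.symm
  d_m n := by rw [f.mapFam_apply, ← f.map_d, h.d_m, f.map_cobar]
  d_x N hN := by
    rw [← f.map_d, h.d_x N hN, map_sum]
    exact Finset.sum_congr rfl fun n _ => f.map_mcTerm _ _ _ _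
  nil := hnil

/-- The nilpotency of the derivative in the direction of an element of `N ⊗ M`. -/
theorem mod_adv_nilOrder (A : FormalCDGA.{u, v} K) (i : A.ι)
    (x : (opOf (tensor (A.N i) M)).obj (0 : ℕ)) :
    (advL kind (opOf (tensor (A.N i) M)) x) ^ nilOrder A i = 0 :=
  adv_pow_eq_zero (nilFilt (A.N i) M).opOf (fun n => nilFilt_eq_bot M (nilOrder_spec A i) _) kind
    (mem_nilFilt_one M x)

section ModLift

variable (hM : M.IsDG) (hl : LawfulMod M) {m : ∀ i : A.ι, Fam (opOf (tensor (A.N i) M))}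
  {x : ∀ i : A.ι, (opOf (tensor (A.N i) M)).obj (0 : ℕ)}
  (hp : ∀ i, MCPair kind (opOf (tensor (A.N i) M)) (m i) (x i) (nilOrder A i))
  (hsym : ∀ i, m i ∈ legSymm kind (tensor (A.N i) M))
  (hmt : ∀ (i j : A.ι) (h : i ≤ j), (tensorMap M (A.map h) (A.map_mul h) (A.map_par h)
    (A.map_d h)).opOf.mapFam (m j) = m i)
  (hxt : ∀ (i j : A.ι) (h : i ≤ j), (tensorMap M (A.map h) (A.map_mul h) (A.map_par h)
    (A.map_d h)).opOf.map (0 : ℕ) (x j) = x i)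

theorem coeff_modLift_rel (hM : M.IsDG) (hl : LawfulMod M)
    {m : ∀ i : A.ι, Fam (opOf (tensor (A.N i) M))}
    {x : ∀ i : A.ι, (opOf (tensor (A.N i) M)).obj (0 : ℕ)}
    (hp : ∀ i, MCPair kind (opOf (tensor (A.N i) M)) (m i) (x i) (nilOrder A i))
    (hsym : ∀ i, m i ∈ legSymm kind (tensor (A.N i) M)) (i : A.ι) (s : ℕ × ℕ)
    (a : (freeMod K).obj s) (ha : CurlyModRel K kind (nilOrder A i) s a) :
    ((hp i).modLift (tensor_isDG hM)).map s a = 0 :=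
  (hp i).modLift_rel (tensor_isDG hM) (tensor_lawfulMod hM hl) (nilFilt (A.N i) M)
    (fun s => nilFilt_eq_bot M (nilOrder_spec A i) s) (mem_nilFilt_one M _) (mem_nilFilt_one M _)
    (nilFilt_mono M) (hsym i) s a ha

theorem coeff_modLift_compat (hM : M.IsDG) {m : ∀ i : A.ι, Fam (opOf (tensor (A.N i) M))}
    {x : ∀ i : A.ι, (opOf (tensor (A.N i) M)).obj (0 : ℕ)}
    (hp : ∀ i, MCPair kind (opOf (tensor (A.N i) M)) (m i) (x i) (nilOrder A i))
    (hmt : ∀ (i j : A.ι) (h : i ≤ j), (tensorMap M (A.map h) (A.map_mul h) (A.map_par h)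
      (A.map_d h)).opOf.mapFam (m j) = m i)
    (hxt : ∀ (i j : A.ι) (h : i ≤ j), (tensorMap M (A.map h) (A.map_mul h) (A.map_par h)
      (A.map_d h)).opOf.map (0 : ℕ) (x j) = x i)
    (i j : A.ι) (h : i ≤ j) (s : ℕ × ℕ) (a : (freeMod K).obj s) :
    (tensorMap M (A.map h) (A.map_mul h) (A.map_par h) (A.map_d h)).map s
      (((hp j).modLift (tensor_isDG hM)).map s a) = ((hp i).modLift (tensor_isDG hM)).map s a := by
  let f : Hom (freeMod K) (tensor (A.N i) M) :=
    { map := fun s => (tensorMap M (A.map h) (A.map_mul h) (A.map_par h) (A.map_d h)).map s ∘ₗ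
        ((hp j).modLift (tensor_isDG hM)).map s
      cont := fun s => continuous_bot
      map_par := fun s a => by simp [Hom.map_par]
      map_d := fun s a => by simp [Hom.map_d]
      map_un := fun o a => by simp [Hom.map_un]
      map_bin := fun o a b => by simp [Hom.map_bin] }
  have hf : f = (hp i).modLift (tensor_isDG hM) := by
    refine freeMod_hom_ext (fun n => ?_) ?_
    · refine (congrArg ((tensorMap M (A.map h) (A.map_mul h) (A.map_par h) (A.map_d h)).map
        ((0, n + 1) : ℕ × ℕ)) ((hp j).modLift_M (tensor_isDG hM) n)).trans
        (Eq.trans ?_ ((hp i).modLift_M (tensor_isDG hM) n).symm)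
      exact congrFun (hmt i j h) n
    · refine (congrArg ((tensorMap M (A.map h) (A.map_mul h) (A.map_par h) (A.map_d h)).map
        ((0, 1) : ℕ × ℕ)) ((hp j).modLift_X (tensor_isDG hM))).trans
        (Eq.trans (hxt i j h) ((hp i).modLift_X (tensor_isDG hM)).symm)
  exact congrArg (fun f : Hom (freeMod K) (tensor (A.N i) M) => f.map s a) hf

/-- The morphism from a quotient of the completed modular closure given by a pair. -/
def coeffModLevel (i : A.ι) : Hom (ModLevel K kind (nilOrder A i)) (tensor (A.N i) M) :=
  quotLift ((hp i).modLift (tensor_isDG hM)) (coeff_modLift_rel hM hl hp hsym i)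

/-- The algebra over the completed modular closure given by a compatible family of pairs. -/
def coeffModLift : Hom (CurlyMod K kind) (A.coeff M) :=
  adicLift (freeMod K) (CurlyModRel K kind) CurlyModRel.mono (fun i : A.ι => tensor (A.N i) M)
    (fun h => tensorMap M (A.map h) (A.map_mul h) (A.map_par h) (A.map_d h))
    (fun i => (hp i).modLift (tensor_isDG hM))
    (fun i j h s a => coeff_modLift_compat hM hp hmt hxt i j h s a)
    (nilOrder A) (fun i s a ha => coeff_modLift_rel hM hl hp hsym i s a ha)

theorem coeffModLift_M (n : ℕ) (i : A.ι) : (coeffProj A M i).map ((0, n + 1) : ℕ × ℕ)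
    ((coeffModLift hM hl hp hsym hmt hxt).map ((0, n + 1) : ℕ × ℕ) (curlyModM K kind n)) = m i n :=
  (hp i).modLift_M (tensor_isDG hM) n

theorem coeffModLift_X (i : A.ι) : (coeffProj A M i).map ((0, 1) : ℕ × ℕ)
    ((coeffModLift hM hl hp hsym hmt hxt).map ((0, 1) : ℕ × ℕ) (curlyModX K kind)) = x i :=
  (hp i).modLift_X (tensor_isDG hM)

theorem coeffModLift_tw (n : ℕ) (i : A.ι) : (coeffProj A M i).map ((0, n + 1) : ℕ × ℕ)
    ((coeffModLift hM hl hp hsym hmt hxt).map ((0, n + 1) : ℕ × ℕ)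
      ((curlyModTw K kind).map ((0, n + 1) : ℕ × ℕ) (curlyModM K kind n))) =
      twist kind (opOf (tensor (A.N i) M)) (m i) (x i) (nilOrder A i) n := by
  refine Eq.trans (b := (coeffModLevel hM hl hp hsym i).map ((0, n + 1) : ℕ × ℕ)
    ((curlyModProj K kind (nilOrder A i)).map ((0, n + 1) : ℕ × ℕ)
      ((curlyModTw K kind).map ((0, n + 1) : ℕ × ℕ) (curlyModM K kind n)))) rfl ?_
  rw [curlyModProj_tw_M]
  refine (congrFun ((coeffModLevel hM hl hp hsym i).opOf.mapFam_twist kind _ _ _) n).trans ?_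
  have h1 : (coeffModLevel hM hl hp hsym i).opOf.mapFam (modLevelM K kind (nilOrder A i)) = m i :=
    funext ((hp i).modLift_M (tensor_isDG hM))
  have h2 : (coeffModLevel hM hl hp hsym i).opOf.map (0 : ℕ) (modLevelX K kind (nilOrder A i)) =
    x i := (hp i).modLift_X (tensor_isDG hM)
  rw [h1, h2]

end ModLift

variable (K kind) in
/-- The twisting automorphism of the completed modular closure describes the twisting of algebras
with a morphism to the operad underlying a modular operad. -/
theorem exists_twisted_modular_algebra (hP : P.IsDG) (hl : LawfulOp P) (hM : M.IsDG)
    (hlM : LawfulMod M) (τ : Hom P (opOf M)) (toF : ∀ n : ℕ, (A.coeff P).obj n →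
      (A.coeff M).obj ((0, n + 1) : ℕ × ℕ))
    (htoF : ∀ (n : ℕ) (a : (A.coeff P).obj n) (i : A.ι),
      (coeffProj A M i).map ((0, n + 1) : ℕ × ℕ) (toF n a) =
        (tensorHom (A.N i) τ).map n ((coeffProj A P i).map n a))
    (φ : Hom (Inf K kind) (A.coeff P)) (ξ : (A.coeff P).obj (0 : ℕ))
    (hcyc : ∀ (n : ℕ) (σ : Equiv.Perm (Fin (n + 1))), LegSym kind n σ →
      (A.coeff M).mperm 0 σ (toF n (ops φ n)) = toF n (ops φ n))
    (hξ : IsMC kind (A.coeff P) (ops φ) ξ) :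
    ∃ (F : Hom (CurlyMod K kind) (A.coeff M)) (φ' : Hom (Inf K kind) (A.coeff P)),
      ((∀ n : ℕ, F.map ((0, n + 1) : ℕ × ℕ) (curlyModM K kind n) = toF n (ops φ n)) ∧
        F.map ((0, 1) : ℕ × ℕ) (curlyModX K kind) = toF 0 ξ) ∧
      (∀ F' : Hom (CurlyMod K kind) (A.coeff M),
        ((∀ n : ℕ, F'.map ((0, n + 1) : ℕ × ℕ) (curlyModM K kind n) = toF n (ops φ n)) ∧
        F'.map ((0, 1) : ℕ × ℕ) (curlyModX K kind) = toF 0 ξ) → F' = F) ∧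
      IsTwist kind (A.coeff P) (ops φ) ξ (ops φ') ∧
      (∀ (n : ℕ) (σ : Equiv.Perm (Fin (n + 1))), LegSym kind n σ →
        (A.coeff M).mperm 0 σ (toF n (ops φ' n)) = toF n (ops φ' n)) ∧
      IsMC kind (A.coeff P) (ops φ') (-ξ) ∧
      ((∀ n : ℕ, ((curlyModTw K kind).trans F).map ((0, n + 1) : ℕ × ℕ) (curlyModM K kind n) =
          toF n (ops φ' n)) ∧
        ((curlyModTw K kind).trans F).map ((0, 1) : ℕ × ℕ) (curlyModX K kind) = toF 0 (-ξ)) := by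
  have hp := coeff_pair (A := A) hP hl (ops_par φ) (ops_zero K kind φ) (ops_symm φ) (ops_d φ) hξ
  obtain ⟨φ', hproj⟩ := exists_twisted_structure K kind hP hl φ ξ hξ
  let m : ∀ i : A.ι, Fam (opOf (tensor (A.N i) M)) := fun i =>
    (tensorHom (A.N i) τ).mapFam ((coeffProj A P i).mapFam (ops φ))
  let x : ∀ i : A.ι, (opOf (tensor (A.N i) M)).obj (0 : ℕ) := fun i =>
    (tensorHom (A.N i) τ).map (0 : ℕ) ((coeffProj A P i).map (0 : ℕ) ξ)
  have hpm : ∀ i, MCPair kind (opOf (tensor (A.N i) M)) (m i) (x i) (nilOrder A i) := fun i =>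
    (hp i).map (tensorHom (A.N i) τ) (mod_adv_nilOrder A i _)
  have hm : ∀ i n, (coeffProj A M i).map ((0, n + 1) : ℕ × ℕ) (toF n (ops φ n)) = m i n :=
    fun i n => htoF n _ i
  have hx : ∀ i, (coeffProj A M i).map ((0, 1) : ℕ × ℕ) (toF 0 ξ) = x i := fun i => htoF 0 _ i
  have hsym : ∀ i, m i ∈ legSymm kind (tensor (A.N i) M) := fun i n σ hσ => by
    have h := congrArg ((coeffProj A M i).map ((0, n + 1) : ℕ × ℕ)) (hcyc n σ hσ)
    rw [Hom.map_mperm, hm] at h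
    exact h
  have hmt : ∀ (i j : A.ι) (h : i ≤ j), (tensorMap M (A.map h) (A.map_mul h) (A.map_par h)
      (A.map_d h)).opOf.mapFam (m j) = m i := fun i j h => by
    funext n
    rw [← hm i n]
    refine (congrArg ((tensorMap M (A.map h) (A.map_mul h) (A.map_par h) (A.map_d h)).map
      ((0, n + 1) : ℕ × ℕ)) (hm j n)).symm.trans ?_
    exact Subtype.property (toF n (ops φ n)) i j h
  have hxt : ∀ (i j : A.ι) (h : i ≤ j), (tensorMap M (A.map h) (A.map_mul h) (A.map_par h)
      (A.map_d h)).opOf.map (0 : ℕ) (x j) = x i := fun i j h => by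
    rw [← hx i]
    refine (congrArg ((tensorMap M (A.map h) (A.map_mul h) (A.map_par h) (A.map_d h)).map
      ((0, 1) : ℕ × ℕ)) (hx j)).symm.trans ?_
    exact Subtype.property (toF 0 ξ) i j h
  have hm' : ∀ i n, (coeffProj A M i).map ((0, n + 1) : ℕ × ℕ) (toF n (ops φ' n)) =
      twist kind (opOf (tensor (A.N i) M)) (m i) (x i) (nilOrder A i) n := fun i n => by
    rw [htoF, hproj, ← Hom.mapFam_apply, Hom.mapFam_twist]
  have hext : ∀ (s : ℕ × ℕ) (a b : (A.coeff M).obj s),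
      (∀ i, (coeffProj A M i).map s a = (coeffProj A M i).map s b) → a = b := fun s a b h =>
    lim_ext (sg := modSig) (fun i : A.ι => tensor (A.N i) M)
      (fun h => tensorMap M (A.map h) (A.map_mul h) (A.map_par h) (A.map_d h)) h
  have hFM : ∀ n : ℕ, (coeffModLift hM hlM hpm hsym hmt hxt).map ((0, n + 1) : ℕ × ℕ)
      (curlyModM K kind n) = toF n (ops φ n) := fun n =>
    hext _ _ _ fun i => (coeffModLift_M hM hlM hpm hsym hmt hxt n i).trans (hm i n).symm
  have hFX : (coeffModLift hM hlM hpm hsym hmt hxt).map ((0, 1) : ℕ × ℕ)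
      (curlyModX K kind) = toF 0 ξ :=
    hext _ _ _ fun i => (coeffModLift_X hM hlM hpm hsym hmt hxt i).trans (hx i).symm
  refine ⟨coeffModLift hM hlM hpm hsym hmt hxt, φ', ⟨hFM, hFX⟩, ?_,
    isTwist_of_proj hp hproj, fun n σ hσ => ?_, isMC_of_proj hp hP hl hproj, fun n => ?_, ?_⟩
  · rintro F' ⟨h1, h2⟩
    exact curlyMod_hom_ext (coeff_t2 A M) (fun n => (h1 n).trans (hFM n).symm) (h2.trans hFX.symm)
  · refine hext _ _ _ fun i => ?_
    rw [Hom.map_mperm, hm']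
    exact twist_mem_legSymm (tensor_lawfulMod hM hlM) (hsym i) _ _ n σ hσ
  · exact hext _ _ _ fun i => (coeffModLift_tw hM hlM hpm hsym hmt hxt n i).trans (hm' i n).symm
  · refine (congrArg ((coeffModLift hM hlM hpm hsym hmt hxt).map ((0, 1) : ℕ × ℕ))
      (curlyModTw_X K kind)).trans ?_
    rw [map_neg, hFX]
    refine hext _ _ _ fun i => ?_
    rw [htoF, map_neg, htoF, map_neg, map_neg]
    rfl

end ModAlgebras

end MCTwist
end

noncomputable section

namespace MCTwist

/-! ### Koszul signs -/

section Koszul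

variable {K : Type u} [Field K]

theorem prod_prod_symmetrize {ι : Type*} [Fintype ι] {f : ι → ℕ} (A : ι → ι → K) :
    ∏ j, ∏ j', A j j' = ∏ j, ∏ j', if f j < f j' then A j j' * A j' j
      else if f j' < f j then 1 else A j j' := by
  have h1 : ∏ j, ∏ j', (if f j' < f j then A j j' else 1) =
      ∏ j, ∏ j', if f j < f j' then A j' j else 1 := Finset.prod_comm
  have h2 : ∀ j j', A j j' = (if f j < f j' then A j j' else 1) *
      ((if f j' < f j then A j j' else 1) *
        if f j < f j' then 1 else if f j' < f j then 1 else A j j') := by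
    intro j j'
    rcases lt_trichotomy (f j) (f j') with h | h | h
    · simp [h, h.not_gt]
    · simp [h]
    · simp [h, h.not_gt]
  calc ∏ j, ∏ j', A j j' = ∏ j, ∏ j', ((if f j < f j' then A j j' else 1) *
      ((if f j' < f j then A j j' else 1) *
        if f j < f j' then 1 else if f j' < f j then 1 else A j j')) :=
        Finset.prod_congr rfl fun j _ => Finset.prod_congr rfl fun j' _ => h2 j j'
    _ = _ := by
      simp only [Finset.prod_mul_distrib]
      rw [h1]
      simp only [← Finset.prod_mul_distrib]
      refine Finset.prod_congr rfl fun j _ => Finset.prod_congr rfl fun j' _ => ?_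
      by_cases h : f j < f j' <;> simp [h]

theorem prod_prod_eq_of_symm {ι : Type*} [Fintype ι] {f : ι → ℕ} (hf : Function.Injective f)
    {A B : ι → ι → K} (hd : ∀ j, A j j = B j j)
    (h : ∀ j j', j ≠ j' → A j j' * A j' j = B j j' * B j' j) :
    ∏ j, ∏ j', A j j' = ∏ j, ∏ j', B j j' := by
  rw [prod_prod_symmetrize (f := f) A, prod_prod_symmetrize (f := f) B]
  refine Finset.prod_congr rfl fun j _ => Finset.prod_congr rfl fun j' _ => ?_
  by_cases hj : j = j'
  · subst hj
    simp [hd]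
  · rcases lt_trichotomy (f j) (f j') with h' | h' | h'
    · simp [h', h j j' hj]
    · exact absurd (hf h') hj
    · simp [h', h'.not_gt]

/-- The Koszul sign of rearranging factors of parities `p`, indexed by `ι`, from the order given
by `f` to the order given by `g`. -/
def ksign (K : Type u) [Field K] {ι : Type*} [Fintype ι] (f g : ι → ℕ) (p : ι → Bool) : K :=
  ∏ j, ∏ j', sgn K ((decide (f j < f j') && decide (g j' < g j)) && (p j && p j'))

theorem koszul_eq_ksign {m n : ℕ} (e : Fin m ≃ Fin n) (p : Fin m → Bool) :
    koszul K e p = ksign K (fun j => j.val) (fun j => (e j).val) p := by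
  unfold koszul ksign
  refine Finset.prod_congr rfl fun j _ => Finset.prod_congr rfl fun j' _ => ?_
  by_cases h1 : j < j' <;> by_cases h2 : e j' < e j <;> cases p j <;> cases p j' <;>
    simp [h1, h2, sgn]

theorem ksign_equiv {ι κ : Type*} [Fintype ι] [Fintype κ] (s : κ ≃ ι) (f g : ι → ℕ)
    (p : ι → Bool) : ksign K f g p = ksign K (f ∘ s) (g ∘ s) (p ∘ s) := by
  unfold ksign
  rw [← s.prod_comp]
  refine Finset.prod_congr rfl fun j _ => ?_
  rw [← s.prod_comp]
  rfl

theorem ksign_eq_one {ι : Type*} [Fintype ι] {f g : ι → ℕ} (p : ι → Bool)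
    (h : ∀ j j', p j = true → p j' = true → f j < f j' → ¬ g j' < g j) : ksign K f g p = 1 := by
  unfold ksign
  refine Finset.prod_eq_one fun j _ => Finset.prod_eq_one fun j' _ => ?_
  have h := h j j'
  by_cases hf : f j < f j' <;> by_cases hg : g j' < g j <;> cases hp : p j <;>
    cases hp' : p j' <;> simp [hf, hg] <;> exact absurd hg (h hp hp' hf)

theorem ksign_congr {ι : Type*} [Fintype ι] {f g f' g' : ι → ℕ} (p : ι → Bool)
    (hf : ∀ j j', f j < f j' ↔ f' j < f' j') (hg : ∀ j j', g j < g j' ↔ g' j < g' j') :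
    ksign K f g p = ksign K f' g' p := by
  simp only [ksign, hf, hg]

theorem ksign_mul {ι : Type*} [Fintype ι] {f g h : ι → ℕ} (hf : Function.Injective f)
    (hg : Function.Injective g) (hh : Function.Injective h) (p : ι → Bool) :
    ksign K f g p * ksign K g h p = ksign K f h p := by
  unfold ksign
  simp only [← Finset.prod_mul_distrib]
  refine prod_prod_eq_of_symm hf (fun j => by simp) fun j j' hj => ?_
  have h1 : f j ≠ f j' := fun h => hj (hf h)
  have h2 : g j ≠ g j' := fun h => hj (hg h)
  have h3 : h j ≠ h j' := fun h => hj (hh h)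
  rcases lt_or_gt_of_ne h1 with h1 | h1 <;> rcases lt_or_gt_of_ne h2 with h2 | h2 <;>
    rcases lt_or_gt_of_ne h3 with h3 | h3 <;> cases p j <;> cases p j' <;>
    simp [h1, h2, h3, h1.not_gt, h2.not_gt, h3.not_gt]

/-- The sign of moving two factors of parities `p` and `q` past each other or not. -/
def crossing (K : Type u) [Field K] (a b a' b' : ℕ) (p q : Bool) : K :=
  sgn K (xor (decide (a < b)) (decide (a' < b')) && (p && q))

theorem ksign_sum {ι κ : Type*} [Fintype ι] [Fintype κ] {f g : ι ⊕ κ → ℕ}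
    (hf : Function.Injective f) (hg : Function.Injective g) (p : ι ⊕ κ → Bool) :
    ksign K f g p = ksign K (f ∘ Sum.inl) (g ∘ Sum.inl) (p ∘ Sum.inl) *
      ksign K (f ∘ Sum.inr) (g ∘ Sum.inr) (p ∘ Sum.inr) *
      ∏ i, ∏ k, crossing K (f (.inl i)) (f (.inr k)) (g (.inl i)) (g (.inr k))
        (p (.inl i)) (p (.inr k)) := by
  unfold ksign
  simp only [Fintype.prod_sum_type, Finset.prod_mul_distrib, Function.comp_apply]
  have key : ∀ a b c d e : K, b * c = e → a * b * (c * d) = a * d * e := by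
    rintro a b c d e rfl
    ring
  apply key
  rw [Finset.prod_comm (s := (Finset.univ : Finset κ)), ← Finset.prod_mul_distrib]
  refine Finset.prod_congr rfl fun i _ => ?_
  rw [← Finset.prod_mul_distrib]
  refine Finset.prod_congr rfl fun k _ => ?_
  have h1 : f (.inl i) ≠ f (.inr k) := fun h => by cases hf h
  have h2 : g (.inl i) ≠ g (.inr k) := fun h => by cases hg h
  rcases lt_or_gt_of_ne h1 with h1 | h1 <;> rcases lt_or_gt_of_ne h2 with h2 | h2 <;>
    simp [crossing, h1, h2, h1.not_gt, h2.not_gt]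
  rw [Bool.and_comm]

instance : Std.Commutative xor := ⟨Bool.xor_comm⟩

instance : Std.Associative xor := ⟨Bool.xor_assoc⟩

/-- The parity of a product of factors of parities `p`. -/
def parityOf {ι : Type*} [Fintype ι] (p : ι → Bool) : Bool := Finset.univ.fold xor false p

theorem sgn_and_parityOf {ι : Type*} [Fintype ι] (q : Bool) (p : ι → Bool) :
    sgn K (q && parityOf p) = ∏ i, sgn K (q && p i) := by
  classical
  have : ∀ s : Finset ι, sgn K (q && s.fold xor false p) = ∏ i ∈ s, sgn K (q && p i) := by
    intro s
    induction s using Finset.induction_on with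
    | empty => simp
    | insert a s ha ih =>
      rw [Finset.fold_insert ha, Finset.prod_insert ha, ← ih, ← sgn_xor, ← Bool.and_xor_distrib_left]
  exact this _

theorem sgn_parityOf {ι : Type*} [Fintype ι] (p : ι → Bool) :
    sgn K (parityOf p) = ∏ i, sgn K (p i) := by
  simpa using sgn_and_parityOf (K := K) true p

end Koszul

/-! ### Multilinear maps on homogeneous arguments -/

section Homogeneous

variable {K : Type u} [Field K] {W : Type w} [AddCommGroup W] [Module K W] [DGSpace K W]
variable {U : Type v} [AddCommGroup U] [Module K U]

/-- The entries of `w` are homogeneous of parities `p`. -/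
def IsHom (K : Type u) [Field K] {W : Type w} [AddCommGroup W] [Module K W] [DGSpace K W]
    {ι : Type*} (p : ι → Bool) (w : ι → W) : Prop :=
  ∀ j, DGSpace.par (K := K) (w j) = sgn K (p j) • w j

theorem IsHom.comp {ι κ : Type*} {p : ι → Bool} {w : ι → W} (h : IsHom K p w) (s : κ → ι) :
    IsHom K (p ∘ s) (w ∘ s) := fun j => h (s j)

theorem ml_ext_hom [CharZero K] {n : ℕ} {f g : ML K W U n}
    (h : ∀ p w, IsHom K p w → f w = g w) : f = g := by
  ext w
  have hw : w = fun j => ∑ q : Bool, proj (K := K) DGSpace.par q (w j) := by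
    funext j
    rw [Fintype.sum_bool, add_comm, proj_false_add_true]
  rw [hw, MultilinearMap.map_sum, MultilinearMap.map_sum]
  refine Finset.sum_congr rfl fun p _ => h p _ fun j => ?_
  exact par_proj (DGSpace.par_par (K := K) (V := W)) (p j) (w j)

theorem mlPerm_apply_hom [CharZero K] {m n : ℕ} (e : Fin m ≃ Fin n) (f : ML K W U m)
    {p : Fin n → Bool} {w : Fin n → W} (hw : IsHom K p w) :
    mlPerm e f w = koszul K e (p ∘ e) • f (w ∘ e) := by
  have h1 : mlPerm e f w = ∑ q : Fin m → Bool, koszul K e q •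
      f (fun j => proj (K := K) DGSpace.par (q j) (w (e j))) := by
    simp [mlPerm]
  rw [h1, Finset.sum_eq_single (p ∘ e)]
  · congr 2
    funext j
    exact proj_of_par _ (hw (e j))
  · intro q _ hq
    obtain ⟨j, hj⟩ := Function.ne_iff.1 hq
    rw [f.map_coord_zero j (proj_of_par_ne _ (hw (e j)) hj), smul_zero]
  · intro h
    exact absurd (Finset.mem_univ _) h

theorem mlPar_apply (εU : U →ₗ[K] U) {n : ℕ} (f : ML K W U n) (w : Fin n → W) :
    mlPar εU n f w = εU (f fun j => DGSpace.par (K := K) (w j)) := rfl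

theorem koszul_refl {n : ℕ} (p : Fin n → Bool) : koszul K (Equiv.refl _) p = 1 := by
  rw [koszul_eq_ksign]
  exact ksign_eq_one _ fun j j' _ _ h => h.not_gt

theorem val_injective {m n : ℕ} (e : Fin m ≃ Fin n) :
    Function.Injective fun j => (e j).val := Fin.val_injective.comp e.injective

theorem koszul_trans {l m n : ℕ} (e : Fin l ≃ Fin m) (e' : Fin m ≃ Fin n) (p : Fin m → Bool) :
    koszul K (e.trans e') (p ∘ e) = koszul K e (p ∘ e) * koszul K e' p := by
  rw [koszul_eq_ksign, koszul_eq_ksign, koszul_eq_ksign, ksign_equiv e (fun j => j.val)]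
  exact (ksign_mul Fin.val_injective (val_injective e) (val_injective (e.trans e')) _).symm

theorem mlPerm_refl [CharZero K] {n : ℕ} (f : ML K W U n) : mlPerm (Equiv.refl _) f = f :=
  ml_ext_hom fun p w hw => by
    rw [mlPerm_apply_hom _ _ hw, koszul_refl, one_smul]
    rfl

theorem mlPerm_trans [CharZero K] {l m n : ℕ} (e : Fin l ≃ Fin m) (e' : Fin m ≃ Fin n)
    (f : ML K W U l) : mlPerm e' (mlPerm e f) = mlPerm (e.trans e') f :=
  ml_ext_hom fun p w hw => by
    rw [mlPerm_apply_hom _ _ hw, mlPerm_apply_hom _ _ (hw.comp e'), mlPerm_apply_hom _ _ hw,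
      smul_smul, mul_comm, ← koszul_trans]
    rfl

theorem mlPar_mlPar {εU : U →ₗ[K] U} (hε : ∀ a, εU (εU a) = a) {n : ℕ} (f : ML K W U n) :
    mlPar εU n (mlPar εU n f) = f := by
  ext w
  simp [mlPar_apply, hε, DGSpace.par_par]

theorem mlPar_mlPerm [CharZero K] (εU : U →ₗ[K] U) {m n : ℕ} (e : Fin m ≃ Fin n)
    (f : ML K W U m) : mlPar εU n (mlPerm e f) = mlPerm e (mlPar εU m f) :=
  ml_ext_hom fun p w hw => by
    have h : IsHom K p fun j => DGSpace.par (K := K) (w j) := fun j => by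
      dsimp only
      rw [hw j, map_smul, hw j]
    rw [mlPar_apply, mlPerm_apply_hom _ _ h, mlPerm_apply_hom _ _ hw, map_smul]
    rfl

/-- The operator `φ^γ`, where `φ` is the parity involution. -/
def parIf (K : Type u) (W : Type w) [Field K] [AddCommGroup W] [Module K W] [DGSpace K W]
    (γ : Bool) : W →ₗ[K] W := if γ then DGSpace.par else LinearMap.id

theorem parIf_hom (γ q : Bool) {a : W} (h : DGSpace.par (K := K) a = sgn K q • a) :
    parIf K W γ a = sgn K (γ && q) • a := by
  cases γ <;> simp [parIf, h]

theorem parIf_parIf (γ δ : Bool) (a : W) :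
    parIf K W γ (parIf K W δ a) = parIf K W (xor γ δ) a := by
  cases γ <;> cases δ <;> simp [parIf, DGSpace.par_par]

theorem parIf_par (γ : Bool) (a : W) :
    parIf K W γ (DGSpace.par (K := K) a) = DGSpace.par (K := K) (parIf K W γ a) := by
  cases γ <;> simp [parIf]

theorem ml_par_apply [CharZero K] {εU : U →ₗ[K] U} (hε : ∀ a, εU (εU a) = a) {n : ℕ}
    {f : ML K W U n} {γ : Bool} (hf : mlPar εU n f = sgn K γ • f) (w : Fin n → W) :
    (f fun j => DGSpace.par (K := K) (w j)) = sgn K γ • εU (f w) := by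
  have h := congrArg εU (congrArg (fun F : ML K W U n => F w) hf)
  simpa [mlPar_apply, hε] using h

theorem ml_parIf_apply [CharZero K] {n : ℕ}
    {f : ML K W W n} {γ δ : Bool} (hf : mlPar DGSpace.par n f = sgn K γ • f) (w : Fin n → W) :
    (f fun j => parIf K W δ (w j)) = sgn K (γ && δ) • parIf K W δ (f w) := by
  cases δ
  · simp [parIf]
  · simpa [parIf] using ml_par_apply DGSpace.par_par hf w

theorem ml_apply_hom [CharZero K] {n : ℕ} {f : ML K W W n} {γ : Bool}
    (hf : mlPar DGSpace.par n f = sgn K γ • f) {p : Fin n → Bool} {w : Fin n → W}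
    (hw : IsHom K p w) : DGSpace.par (K := K) (f w) = sgn K (xor γ (parityOf p)) • f w := by
  have h1 := ml_par_apply DGSpace.par_par hf w
  have h2 : (f fun j => DGSpace.par (K := K) (w j)) = (∏ j, sgn K (p j)) • f w := by
    rw [← MultilinearMap.map_smul_univ]
    congr 1
    funext j
    exact hw j
  rw [h2, ← sgn_parityOf] at h1
  rw [sgn_xor, mul_smul, h1, smul_smul, sgn_mul_self, one_smul]

end Homogeneous

end MCTwist

end

noncomputable section

namespace MCTwist

/-! ### Composition of multilinear maps -/

section MLComp

variable {K : Type u} [Field K] {W : Type w} [AddCommGroup W] [Module K W] [DGSpace K W]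
variable {U : Type v} [AddCommGroup U] [Module K U]

section Args

variable {m n p : ℕ} (h : p + 1 = m + n) {i : Fin m} (φ : W →ₗ[K] W) (g : ML K W W n)
  (w : Fin p → W)

theorem args_of_lt {j : Fin m} (hj : j.val < i.val) (t : Fin p) (ht : t.val = j.val) :
    args h i φ g w j = φ (w t) := by
  have hj' : j < i := hj
  have : t = ⟨j.val, ht ▸ t.2⟩ := Fin.ext ht
  rw [this]
  simp [args, hj']

theorem args_self (s : Fin n → Fin p) (hs : ∀ l, (s l).val = i + l) :
    args h i φ g w i = g fun l => w (s l) := by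
  simp only [args, lt_irrefl, dite_false, dite_true]
  congr 1
  funext l
  congr 1
  exact Fin.ext (hs l).symm

theorem args_of_gt {j : Fin m} (hj : i.val < j.val) (t : Fin p) (ht : t.val + 1 = j + n) :
    args h i φ g w j = w t := by
  have h1 : ¬ j < i := fun h' => absurd h' (Nat.lt_asymm hj)
  have h2 : j ≠ i := fun h' => by simp [h'] at hj
  have : t = ⟨j.val + n - 1, by omega⟩ := Fin.ext (by simp; omega)
  rw [this]
  simp [args, h1, h2]

end Args

theorem ml_hom_induction [CharZero K] {n : ℕ} {P : ML K W W n → Prop}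
    (hadd : ∀ f g, P f → P g → P (f + g))
    (hom : ∀ γ f, mlPar DGSpace.par n f = sgn K γ • f → P f) (f : ML K W W n) : P f := by
  rw [← proj_false_add_true (mlPar DGSpace.par n) f]
  exact hadd _ _ (hom _ _ (par_proj (mlPar_mlPar DGSpace.par_par) _ _))
    (hom _ _ (par_proj (mlPar_mlPar DGSpace.par_par) _ _))

theorem mlComp_eq_compWith [CharZero K] {m n p : ℕ} (h : p + 1 = m + n) (i : Fin m)
    (f : ML K W U m) {g : ML K W W n} {γ : Bool} (hg : mlPar DGSpace.par n g = sgn K γ • g) :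
    mlComp h i f g = compWith h i (parIf K W γ) f g := by
  have h0 : ∀ φ, compWith h i φ f (0 : ML K W W n) = 0 := fun φ => by
    ext w
    exact f.map_coord_zero i (args_self h φ 0 w (fun l => ⟨i + l, by omega⟩) fun _ => rfl)
  change compWith h i LinearMap.id f (proj (mlPar DGSpace.par n) false g) +
      compWith h i DGSpace.par f (proj (mlPar DGSpace.par n) true g) = _
  cases γ
  · rw [proj_of_par _ hg, proj_of_par_ne _ hg (by simp), h0, add_zero]
    rfl
  · rw [proj_of_par _ hg, proj_of_par_ne _ hg (by simp), h0, zero_add]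
    rfl

theorem mlComp_apply_hom [CharZero K] {m n p : ℕ} (h : p + 1 = m + n) (i : Fin m)
    (f : ML K W U m) {g : ML K W W n} {γ : Bool} (hg : mlPar DGSpace.par n g = sgn K γ • g)
    (w : Fin p → W) : mlComp h i f g w = f (args h i (parIf K W γ) g w) := by
  rw [mlComp_eq_compWith h i f hg]
  rfl

theorem mlPar_mlComp [CharZero K] (εU : U →ₗ[K] U) {m n p : ℕ} (h : p + 1 = m + n) (i : Fin m)
    (f : ML K W U m) (g : ML K W W n) :
    mlPar εU p (mlComp h i f g) = mlComp h i (mlPar εU m f) (mlPar DGSpace.par n g) := by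
  induction g using ml_hom_induction with
  | hadd g g' hg hg' => simp only [map_add, hg, hg']
  | hom γ g hg =>
    have hg' : mlPar DGSpace.par n (mlPar DGSpace.par n g) =
      sgn K γ • mlPar DGSpace.par n g := by rw [hg, map_smul, hg]
    ext w
    rw [mlPar_apply, mlComp_apply_hom h i f hg, mlComp_apply_hom h i _ hg', mlPar_apply]
    congr 2
    funext j
    have := i.2
    have := j.2
    rcases lt_trichotomy j.val i.val with hj | hj | hj
    · rw [args_of_lt h _ _ _ hj ⟨j, by omega⟩ rfl, args_of_lt h _ _ _ hj ⟨j, by omega⟩ rfl,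
        parIf_par]
    · obtain rfl : j = i := Fin.ext hj
      rw [args_self h _ _ _ (fun l => ⟨j + l, by omega⟩) fun _ => rfl,
        args_self h _ _ _ (fun l => ⟨j + l, by omega⟩) fun _ => rfl, mlPar_apply, DGSpace.par_par]
    · rw [args_of_gt h _ _ _ hj ⟨j + n - 1, by omega⟩ (by simp; omega),
        args_of_gt h _ _ _ hj ⟨j + n - 1, by omega⟩ (by simp; omega)]

theorem mlComp_hom [CharZero K] {εU : U →ₗ[K] U} {m n p : ℕ} (h : p + 1 = m + n) (i : Fin m)
    {f : ML K W U m} {g : ML K W W n} {β γ : Bool} (hf : mlPar εU m f = sgn K β • f)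
    (hg : mlPar DGSpace.par n g = sgn K γ • g) :
    mlPar εU p (mlComp h i f g) = sgn K (xor β γ) • mlComp h i f g := by
  rw [mlPar_mlComp, hf, hg, map_smul, map_smul, LinearMap.smul_apply, smul_smul, sgn_xor, mul_comm]

theorem mlComp_mlComp_seq [CharZero K] {m n q r s p : ℕ} (h₁ : r + 1 = m + n) (h₂ : p + 1 = r + q)
    (h₃ : s + 1 = n + q) (h₄ : p + 1 = m + s) (i : Fin m) (j : Fin n) (ij : Fin r)
    (hij : ij.val = i + j) (a : ML K W U m) (b : ML K W W n) (c : ML K W W q) :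
    mlComp h₂ ij (mlComp h₁ i a b) c = mlComp h₄ i a (mlComp h₃ j b c) := by
  induction b using ml_hom_induction with
  | hadd g g' hg hg' => simp only [map_add, LinearMap.add_apply, hg, hg']
  | hom β b hb =>
  induction c using ml_hom_induction with
  | hadd g g' hg hg' => simp only [map_add, hg, hg']
  | hom γ c hc =>
  ext w
  rw [mlComp_apply_hom h₂ ij _ hc, mlComp_apply_hom h₁ i _ hb,
    mlComp_apply_hom h₄ i a (mlComp_hom h₃ j hb hc)]
  congr 1
  funext k
  have := i.2
  have := j.2
  have := k.2
  have := ij.2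
  rcases lt_trichotomy k.val i.val with hk | hk | hk
  · rw [args_of_lt h₁ _ _ _ hk ⟨k, by omega⟩ rfl, args_of_lt h₄ _ _ _ hk ⟨k, by omega⟩ rfl,
      args_of_lt h₂ _ _ _ (by simp; omega) ⟨k, by omega⟩ rfl, parIf_parIf]
  · obtain rfl : k = i := Fin.ext hk
    rw [args_self h₁ _ _ _ (fun l => ⟨k + l, by omega⟩) fun _ => rfl,
      args_self h₄ _ _ _ (fun l => ⟨k + l, by omega⟩) fun _ => rfl,
      mlComp_apply_hom h₃ j b hc]
    congr 1
    funext l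
    have := l.2
    rcases lt_trichotomy l.val j.val with hl | hl | hl
    · rw [args_of_lt h₂ _ _ _ (by simp; omega) ⟨k + l, by omega⟩ rfl,
        args_of_lt h₃ _ _ _ hl ⟨l, by omega⟩ rfl]
    · obtain rfl : l = j := Fin.ext hl
      have : (⟨k + l, by omega⟩ : Fin r) = ij := Fin.ext (by simp [hij])
      rw [this, args_self h₂ _ _ _ (fun t => ⟨ij + t, by omega⟩) fun _ => rfl,
        args_self h₃ _ _ _ (fun t => ⟨l + t, by omega⟩) fun _ => rfl]
      congr 1
      funext t
      congr 1
      apply Fin.ext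
      simp [hij, add_assoc]
    · rw [args_of_gt h₂ _ _ _ (by simp; omega) ⟨k + (l + q - 1), by omega⟩ (by simp; omega),
        args_of_gt h₃ _ _ _ hl ⟨l + q - 1, by omega⟩ (by simp; omega)]
  · rw [args_of_gt h₁ _ _ _ hk ⟨k + n - 1, by omega⟩ (by simp; omega),
      args_of_gt h₄ _ _ _ hk ⟨k + s - 1, by omega⟩ (by simp; omega),
      args_of_gt h₂ _ _ _ (by simp; omega) ⟨k + s - 1, by omega⟩ (by simp; omega)]

theorem mlComp_mlComp_par [CharZero K] {m n q r s p : ℕ} (h₁ : r + 1 = m + n) (h₂ : p + 1 = r + q)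
    (h₃ : s + 1 = m + q) (h₄ : p + 1 = s + n) (i k : Fin m) (hik : i < k) (k' : Fin r)
    (hk : k'.val = k + n - 1) (i' : Fin s) (hi : i'.val = i) {β γ : Bool}
    (a : ML K W U m) {b : ML K W W n} {c : ML K W W q}
    (hb : mlPar DGSpace.par n b = sgn K β • b) (hc : mlPar DGSpace.par q c = sgn K γ • c) :
    mlComp h₂ k' (mlComp h₁ i a b) c = sgn K (β && γ) • mlComp h₄ i' (mlComp h₃ k a c) b := by
  ext w
  rw [smul_apply, mlComp_apply_hom h₂ _ _ hc, mlComp_apply_hom h₁ i _ hb,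
    mlComp_apply_hom h₄ i' _ hb, mlComp_apply_hom h₃ k _ hc]
  have hik : i.val < k.val := hik
  have hi2 := i.2
  have hk2 := k.2
  have hk2' := k'.2
  have : args h₁ i (parIf K W β) b (args h₂ k' (parIf K W γ) c w) =
      Function.update (args h₃ k (parIf K W γ) c (args h₄ i' (parIf K W β) b w)) i
        (sgn K (β && γ) • args h₃ k (parIf K W γ) c (args h₄ i' (parIf K W β) b w) i) := by
    funext j
    have := j.2
    by_cases hji : j = i
    · subst hji
      rw [Function.update_self, args_self h₁ _ _ _ (fun l => ⟨j + l, by omega⟩) fun _ => rfl,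
        args_of_lt h₃ _ _ _ hik i' hi,
        args_self h₄ _ _ _ (fun l => ⟨i' + l, by omega⟩) fun _ => rfl,
        ← ml_parIf_apply hb]
      congr 1
      funext l
      have := l.2
      rw [args_of_lt h₂ _ _ _ (by simp; omega) ⟨i' + l, by omega⟩ (by simp [hi])]
    · rw [Function.update_of_ne hji]
      have hjv : j.val ≠ i.val := fun h => hji (Fin.ext h)
      rcases lt_or_gt_of_ne hjv with hj | hj
      · rw [args_of_lt h₁ _ _ _ hj ⟨j, by omega⟩ rfl,
          args_of_lt h₂ _ _ _ (by simp; omega) ⟨j, by omega⟩ rfl,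
          args_of_lt h₃ _ _ _ (by omega) ⟨j, by omega⟩ rfl,
          args_of_lt h₄ _ _ _ (by simp; omega) ⟨j, by omega⟩ rfl, parIf_parIf, parIf_parIf,
          Bool.xor_comm]
      · rw [args_of_gt h₁ _ _ _ hj ⟨j + n - 1, by omega⟩ (by simp; omega)]
        rcases lt_trichotomy j.val k.val with hjk | hjk | hjk
        · rw [args_of_lt h₂ _ _ _ (by simp; omega) ⟨j + n - 1, by omega⟩ rfl,
            args_of_lt h₃ _ _ _ hjk ⟨j, by omega⟩ rfl,
            args_of_gt h₄ _ _ _ (by simp; omega) ⟨j + n - 1, by omega⟩ (by simp; omega)]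
        · obtain rfl : j = k := Fin.ext hjk
          have : (⟨j + n - 1, by omega⟩ : Fin r) = k' := Fin.ext (by simp [hk])
          rw [this, args_self h₂ _ _ _ (fun t => ⟨k' + t, by omega⟩) fun _ => rfl,
            args_self h₃ _ _ _ (fun t => ⟨j + t, by omega⟩) fun _ => rfl]
          congr 1
          funext t
          have := t.2
          rw [args_of_gt h₄ _ _ _ (by simp; omega) ⟨k' + t, by omega⟩ (by simp; omega)]
        · rw [args_of_gt h₂ _ _ _ (by simp; omega) ⟨j + n - 1 + q - 1, by omega⟩ (by simp; omega),
            args_of_gt h₃ _ _ _ hjk ⟨j + q - 1, by omega⟩ (by simp; omega),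
            args_of_gt h₄ _ _ _ (by simp; omega) ⟨j + n - 1 + q - 1, by omega⟩ (by simp; omega)]
  rw [this, MultilinearMap.map_update_smul, Function.update_eq_self]

end MLComp

end MCTwist

end

noncomputable section

namespace MCTwist

/-! ### Equivariance of the composition of multilinear maps -/

section MLEquivariance

variable {K : Type u} [Field K] {W : Type w} [AddCommGroup W] [Module K W] [DGSpace K W]
variable {U : Type v} [AddCommGroup U] [Module K U]

theorem koszul_insert {m n p m' n' p' : ℕ} (h : p + 1 = m + n) (h' : p' + 1 = m' + n')
    (e : Fin m ≃ Fin m') (e' : Fin n ≃ Fin n') (ρ : Fin p ≃ Fin p') (i : Fin m)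
    (ho : ∀ (j : Fin m) (t : Fin p), j ≠ i → t.val = outer n i j →
      (ρ t).val = outer n' (e i) (e j))
    (hi : ∀ (l : Fin n) (t : Fin p), t.val = i + l → (ρ t).val = e i + e' l)
    (γ : Bool) (q : Fin p → Bool) (Q : Fin m → Bool)
    (hQ : ∀ j : {j // j ≠ i}, Q j.1 = q (insEquiv h i (.inl j)))
    (hQi : Q i = xor γ (parityOf (q ∘ insEquiv h i ∘ Sum.inr))) :
    koszul K ρ q * ∏ j : {j // j ≠ i}, sgn K (γ && (Q j.1 && decide (j.1 < i))) =
      koszul K e Q * (koszul K e' (q ∘ insEquiv h i ∘ Sum.inr) *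
        ∏ j : {j // j ≠ i}, sgn K (γ && (Q j.1 && decide (e j.1 < e i)))) := by
  have hne : ∀ j : {j // j ≠ i}, j.1.val ≠ i.val := fun j h => j.2 (Fin.ext h)
  have hne' : ∀ j : {j // j ≠ i}, (e j.1).val ≠ (e i).val :=
    fun j h => j.2 (e.injective (Fin.ext h))
  have ho' : ∀ j : {j // j ≠ i}, (ρ (insEquiv h i (.inl j))).val = outer n' (e i) (e j.1) :=
    fun j => ho j.1 _ j.2 rfl
  have hi' : ∀ l : Fin n, (ρ (insEquiv h i (.inr l))).val = e i + e' l := fun l => hi l _ rfl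
  have h1 : m + 1 = m + 1 := rfl
  have hl : ∀ j : {j // j ≠ i}, insEquiv h1 i (.inl j) = j.1 := fun j => Fin.ext (by
    rw [insEquiv_inl_val, outer]; split_ifs <;> omega)
  have hr : ∀ l : Fin 1, insEquiv h1 i (.inr l) = i := fun l => Fin.ext (by
    rw [insEquiv_inr_val]; omega)
  rw [koszul_eq_ksign, koszul_eq_ksign, koszul_eq_ksign, ksign_equiv (insEquiv h i),
    ksign_sum (Fin.val_injective.comp (Equiv.injective _))
      ((val_injective ρ).comp (Equiv.injective _)),
    ksign_equiv (insEquiv h1 i) (fun j => j.val),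
    ksign_sum (Fin.val_injective.comp (Equiv.injective _))
      ((val_injective e).comp (Equiv.injective _))]
  have e1 : ksign K ((((fun j : Fin p => j.val) ∘ insEquiv h i)) ∘ Sum.inl)
      (((fun j => (ρ j).val) ∘ insEquiv h i) ∘ Sum.inl) ((q ∘ insEquiv h i) ∘ Sum.inl) =
      ksign K (((fun j : Fin m => j.val) ∘ insEquiv h1 i) ∘ Sum.inl)
      (((fun j => (e j).val) ∘ insEquiv h1 i) ∘ Sum.inl) ((Q ∘ insEquiv h1 i) ∘ Sum.inl) := by
    have : (Q ∘ insEquiv h1 i) ∘ Sum.inl = (q ∘ insEquiv h i) ∘ Sum.inl := by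
      funext j
      simp only [Function.comp_apply, hl, hQ]
    rw [this]
    refine ksign_congr _ (fun j j' => ?_) fun j j' => ?_
    · have := hne j
      have := hne j'
      simp only [Function.comp_apply, hl, insEquiv_inl_val, outer]
      split_ifs <;> omega
    · have := hne' j
      have := hne' j'
      simp only [Function.comp_apply, hl, ho', outer]
      split_ifs <;> omega
  have e2 : ksign K ((((fun j : Fin p => j.val) ∘ insEquiv h i)) ∘ Sum.inr)
      (((fun j => (ρ j).val) ∘ insEquiv h i) ∘ Sum.inr) ((q ∘ insEquiv h i) ∘ Sum.inr) =
      ksign K (fun j : Fin n => j.val) (fun j => (e' j).val) (q ∘ insEquiv h i ∘ Sum.inr) := by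
    refine ksign_congr _ (fun j j' => ?_) fun j j' => ?_
    · simp only [Function.comp_apply, insEquiv_inr_val]
      omega
    · simp only [Function.comp_apply, hi']
      omega
  have e3 : ksign K ((((fun j : Fin m => j.val) ∘ insEquiv h1 i)) ∘ Sum.inr)
      (((fun j => (e j).val) ∘ insEquiv h1 i) ∘ Sum.inr) ((Q ∘ insEquiv h1 i) ∘ Sum.inr) = 1 :=
    ksign_eq_one _ fun j j' _ _ hj => by rw [Subsingleton.elim j j'] at hj; omega
  have key : ∀ a b c d e f : K, c * d = e * f → a * b * c * d = a * 1 * e * (b * f) := by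
    intro a b c d e f h
    linear_combination a * b * h
  rw [e1, e2, e3]
  apply key
  simp only [← Finset.prod_mul_distrib]
  refine Finset.prod_congr rfl fun j _ => ?_
  have hj := hne j
  have hj' := hne' j
  have c1 : ∀ l : Fin n, crossing K (((fun j : Fin p => j.val) ∘ insEquiv h i) (.inl j))
      (((fun j : Fin p => j.val) ∘ insEquiv h i) (.inr l))
      (((fun j => (ρ j).val) ∘ insEquiv h i) (.inl j))
      (((fun j => (ρ j).val) ∘ insEquiv h i) (.inr l)) ((q ∘ insEquiv h i) (.inl j))
      ((q ∘ insEquiv h i) (.inr l)) =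
      sgn K ((xor (decide (j.1 < i)) (decide (e j.1 < e i)) && Q j.1) &&
        (q ∘ insEquiv h i ∘ Sum.inr) l) := by
    intro l
    have a1 : (insEquiv h i (.inl j)).val < (insEquiv h i (.inr l)).val ↔ j.1 < i := by
      rw [insEquiv_inl_val, insEquiv_inr_val, outer, Fin.lt_def]
      split_ifs <;> omega
    have a2 : (ρ (insEquiv h i (.inl j))).val < (ρ (insEquiv h i (.inr l))).val ↔
        e j.1 < e i := by
      have := (e' l).2
      rw [ho', hi', outer, Fin.lt_def]
      split_ifs <;> omega
    simp only [crossing, Function.comp_apply, a1, a2, hQ, Bool.and_assoc]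
  have c2 : ∏ l : Fin 1, crossing K (((fun j : Fin m => j.val) ∘ insEquiv h1 i) (.inl j))
      (((fun j : Fin m => j.val) ∘ insEquiv h1 i) (.inr l))
      (((fun j => (e j).val) ∘ insEquiv h1 i) (.inl j))
      (((fun j => (e j).val) ∘ insEquiv h1 i) (.inr l)) ((Q ∘ insEquiv h1 i) (.inl j))
      ((Q ∘ insEquiv h1 i) (.inr l)) =
      sgn K ((xor (decide (j.1 < i)) (decide (e j.1 < e i)) && Q j.1) && γ) *
      sgn K ((xor (decide (j.1 < i)) (decide (e j.1 < e i)) && Q j.1) &&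
        parityOf (q ∘ insEquiv h i ∘ Sum.inr)) := by
    rw [← sgn_xor, ← Bool.and_xor_distrib_left, ← hQi]
    simp only [Finset.univ_unique, Finset.prod_singleton, crossing, Function.comp_apply, hl, hr,
      Bool.and_assoc, Fin.lt_def]
  have c3 : sgn K (γ && (Q j.1 && decide (j.1 < i))) =
      sgn K ((xor (decide (j.1 < i)) (decide (e j.1 < e i)) && Q j.1) && γ) *
        sgn K (γ && (Q j.1 && decide (e j.1 < e i))) := by
    cases γ <;> cases Q j.1 <;> cases decide (j.1 < i) <;> cases decide (e j.1 < e i) <;> simp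
  rw [Finset.prod_congr rfl fun l _ => c1 l, c2, ← sgn_and_parityOf, c3]
  ring

theorem mlPerm_mlComp [CharZero K] {m n p m' n' p' : ℕ} (h : p + 1 = m + n)
    (h' : p' + 1 = m' + n') (e : Fin m ≃ Fin m') (e' : Fin n ≃ Fin n') (ρ : Fin p ≃ Fin p')
    (i : Fin m) (ho : ∀ (j : Fin m) (t : Fin p), j ≠ i → t.val = outer n i j →
      (ρ t).val = outer n' (e i) (e j))
    (hi : ∀ (l : Fin n) (t : Fin p), t.val = i + l → (ρ t).val = e i + e' l)
    (a : ML K W U m) (b : ML K W W n) :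
    mlPerm ρ (mlComp h i a b) = mlComp h' (e i) (mlPerm e a) (mlPerm e' b) := by
  induction b using ml_hom_induction with
  | hadd g g' hg hg' => simp only [map_add, hg, hg']
  | hom γ b hb =>
  have hb' : mlPar DGSpace.par n' (mlPerm e' b) = sgn K γ • mlPerm e' b := by
    rw [mlPar_mlPerm, hb, map_smul]
  refine ml_ext_hom fun p w hw => ?_
  let q := p ∘ ρ
  let qi := q ∘ insEquiv h i ∘ Sum.inr
  let Q : Fin m → Bool := fun j => if hj : j = i then xor γ (parityOf qi) else
    q (insEquiv h i (.inl ⟨j, hj⟩))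
  have hQ : ∀ j : {j // j ≠ i}, Q j.1 = q (insEquiv h i (.inl j)) := fun j => by simp [Q, j.2]
  have hQi : Q i = xor γ (parityOf qi) := by simp [Q]
  let wi : Fin n → W := w ∘ ρ ∘ insEquiv h i ∘ Sum.inr
  have hwi : IsHom K qi wi := hw.comp _
  let x : Fin m → W := fun j => if hj : j = i then b wi else w (ρ (insEquiv h i (.inl ⟨j, hj⟩)))
  have hx : ∀ j : {j // j ≠ i}, x j.1 = w (ρ (insEquiv h i (.inl j))) := fun j => by simp [x, j.2]
  have hxi : x i = b wi := by simp [x]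
  have hxQ : IsHom K Q x := by
    intro j
    by_cases hj : j = i
    · subst hj
      rw [hxi, hQi]
      exact ml_apply_hom hb hwi
    · rw [hx ⟨j, hj⟩, hQ ⟨j, hj⟩]
      exact hw _
  have hL : args h i (parIf K W γ) b (w ∘ ρ) =
      fun j => (if j = i then (1 : K) else sgn K (γ && (Q j && decide (j < i)))) • x j := by
    funext j
    by_cases hj : j = i
    · subst hj
      rw [args_self h _ _ _ (fun l => insEquiv h j (.inr l)) fun _ => rfl, if_pos rfl, one_smul,
        hxi]
      rfl
    · rw [if_neg hj]
      have hjv : j.val ≠ i.val := fun h => hj (Fin.ext h)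
      rcases lt_or_gt_of_ne hjv with hji | hji
      · have hji' : j < i := hji
        rw [args_of_lt h _ _ _ hji (insEquiv h i (.inl ⟨j, hj⟩))
          (by simp [insEquiv_inl_val, outer, hji])]
        change parIf K W γ (w (ρ _)) = _
        rw [← hx ⟨j, hj⟩, parIf_hom γ _ (hxQ j)]
        simp [hji']
      · have hji' : ¬ j < i := fun h => absurd h (Nat.lt_asymm hji)
        rw [args_of_gt h _ _ _ hji (insEquiv h i (.inl ⟨j, hj⟩))
          (by simp [insEquiv_inl_val, outer, hji.not_gt]; omega)]
        change w (ρ _) = _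
        rw [← hx ⟨j, hj⟩]
        simp [hji']
  have hR : args h' (e i) (parIf K W γ) (mlPerm e' b) w ∘ e =
      fun j => (if j = i then koszul K e' qi else
        sgn K (γ && (Q j && decide (e j < e i)))) • x j := by
    funext j
    rw [Function.comp_apply]
    by_cases hj : j = i
    · subst hj
      rw [args_self h' _ _ _ (fun l => ρ (insEquiv h j (.inr (e'.symm l)))) fun l => ?_, if_pos rfl,
        hxi]
      · have hw' : IsHom K (qi ∘ e'.symm) fun l => w (ρ (insEquiv h j (.inr (e'.symm l)))) :=
          hwi.comp e'.symm
        have h1 : (qi ∘ e'.symm) ∘ e' = qi := by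
          funext l
          simp
        have h2 : (fun l => w (ρ (insEquiv h j (.inr (e'.symm l))))) ∘ e' = wi := by
          funext l
          simp [wi]
        rw [mlPerm_apply_hom _ _ hw', h1, h2]
      · rw [hi (e'.symm l) _ rfl, Equiv.apply_symm_apply]
    · rw [if_neg hj]
      have hjv : (e j).val ≠ (e i).val := fun h => hj (e.injective (Fin.ext h))
      have hv := ho j (insEquiv h i (.inl ⟨j, hj⟩)) hj rfl
      rcases lt_or_gt_of_ne hjv with hji | hji
      · have hji' : e j < e i := hji
        rw [args_of_lt h' _ _ _ hji (ρ (insEquiv h i (.inl ⟨j, hj⟩)))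
          (by rw [hv]; simp [outer, hji]), ← hx ⟨j, hj⟩, parIf_hom γ _ (hxQ j)]
        simp [hji']
      · have hji' : ¬ e j < e i := fun h => absurd h (Nat.lt_asymm hji)
        rw [args_of_gt h' _ _ _ hji (ρ (insEquiv h i (.inl ⟨j, hj⟩)))
          (by rw [hv]; simp [outer, hji.not_gt]; omega), ← hx ⟨j, hj⟩]
        simp [hji']
  have hRhom : IsHom K (Q ∘ e.symm) (args h' (e i) (parIf K W γ) (mlPerm e' b) w) := by
    intro j
    obtain ⟨j, rfl⟩ := e.surjective j
    have := congrFun hR j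
    rw [Function.comp_apply] at this
    rw [this, map_smul, hxQ j, Function.comp_apply, Equiv.symm_apply_apply, smul_comm]
  rw [mlPerm_apply_hom ρ _ hw, mlComp_apply_hom h i a hb, mlComp_apply_hom h' (e i) _ hb',
    mlPerm_apply_hom e a hRhom, hL, hR, MultilinearMap.map_smul_univ,
    MultilinearMap.map_smul_univ, smul_smul, smul_smul]
  congr 1
  have hcomp : (Q ∘ e.symm) ∘ e = Q := by
    funext j
    simp
  rw [hcomp, Fintype.prod_eq_mul_prod_subtype_ne _ i, Fintype.prod_eq_mul_prod_subtype_ne _ i,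
    if_pos rfl, if_pos rfl, one_mul]
  have := koszul_insert (K := K) h h' e e' ρ i ho hi γ q Q hQ hQi
  convert this using 4 with j _ j _
  · rw [if_neg j.2]
  · rw [if_neg j.2]

end MLEquivariance

end MCTwist

end

noncomputable section

namespace MCTwist

/-! ### The differential of multilinear maps -/

section MLDifferential

variable {K : Type u} [Field K] {W : Type w} [AddCommGroup W] [Module K W] [DGSpace K W]
variable {U : Type v} [AddCommGroup U] [Module K U]

/-- The differential of `W`, as an operation with one input. -/
def dOp (K : Type u) (W : Type w) [Field K] [AddCommGroup W] [Module K W] [DGSpace K W] :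
    ML K W W 1 := MultilinearMap.ofSubsingleton K W W (0 : Fin 1) DGSpace.d

theorem dOp_apply (w : Fin 1 → W) : dOp K W w = DGSpace.d (K := K) (w 0) := rfl

theorem mlPar_dOp : mlPar DGSpace.par 1 (dOp K W) = sgn K true • dOp K W := by
  ext w
  simp [mlPar_apply, dOp_apply, DGSpace.d_par, DGSpace.par_par]

/-- The sum of all insertions of the differential of `W` into a multilinear map. -/
def mlIns (n : ℕ) : ML K W U n →ₗ[K] ML K W U n :=
  ∑ i : Fin n, (mlComp (rfl : n + 1 = n + 1) i).flip (dOp K W)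

theorem mlIns_apply {n : ℕ} (f : ML K W U n) :
    mlIns n f = ∑ i : Fin n, mlComp (rfl : n + 1 = n + 1) i f (dOp K W) := by
  simp [mlIns]

theorem mlComp_dOp_apply [CharZero K] {n : ℕ} (i : Fin n) (f : ML K W U n) (w : Fin n → W) :
    mlComp (rfl : n + 1 = n + 1) i f (dOp K W) w =
      f fun j => (if j < i then DGSpace.par else if j = i then DGSpace.d else LinearMap.id :
        W →ₗ[K] W) (w j) := by
  rw [mlComp_apply_hom _ i f mlPar_dOp]
  congr 1
  funext j
  rcases lt_trichotomy j i with hj | hj | hj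
  · rw [args_of_lt _ _ _ _ hj j rfl, if_pos hj]
    rfl
  · subst hj
    rw [args_self _ _ _ _ (fun _ => j) (fun l => by omega)]
    simp [dOp_apply]
  · rw [args_of_gt _ _ _ _ hj j rfl, if_neg hj.not_gt, if_neg hj.ne']
    rfl

theorem mlD_eq [CharZero K] (εU dU : U →ₗ[K] U) {n : ℕ} (f : ML K W U n) :
    mlD εU dU n f = dU.compMultilinearMap f - mlIns n (mlPar εU n f) := by
  ext w
  simp [mlD, mlIns_apply, mlComp_dOp_apply]

theorem compMultilinearMap_mlComp [CharZero K] (L : U →ₗ[K] U) {m n p : ℕ} (h : p + 1 = m + n)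
    (i : Fin m) (f : ML K W U m) (g : ML K W W n) :
    L.compMultilinearMap (mlComp h i f g) = mlComp h i (L.compMultilinearMap f) g := by
  induction g using ml_hom_induction with
  | hadd g g' hg hg' =>
    rw [map_add, map_add, ← hg, ← hg']
    ext w
    simp
  | hom γ g hg =>
    ext w
    rw [mlComp_apply_hom h i _ hg, LinearMap.compMultilinearMap_apply, mlComp_apply_hom h i _ hg]
    rfl

theorem compMultilinearMap_sub (L : U →ₗ[K] U) {n : ℕ} (f g : ML K W U n) :
    L.compMultilinearMap (f - g) = L.compMultilinearMap f - L.compMultilinearMap g := by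
  ext w
  simp

theorem compMultilinearMap_mlIns [CharZero K] (L : U →ₗ[K] U) {n : ℕ} (f : ML K W U n) :
    L.compMultilinearMap (mlIns n f) = mlIns n (L.compMultilinearMap f) := by
  simp only [mlIns_apply, ← compMultilinearMap_mlComp]
  ext w
  simp

theorem compMultilinearMap_mlPerm (L : U →ₗ[K] U) {m n : ℕ} (e : Fin m ≃ Fin n)
    (f : ML K W U m) :
    L.compMultilinearMap (mlPerm e f) = mlPerm e (L.compMultilinearMap f) := by
  ext w
  simp [mlPerm]

theorem mlComp_dOp_left [CharZero K] {n p : ℕ} (h : p + 1 = 1 + n) (g : ML K W W n)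
    (w : Fin p → W) : mlComp h 0 (dOp K W) g w =
      DGSpace.d (K := K) (g fun l => w ⟨l, by omega⟩) := by
  induction g using ml_hom_induction with
  | hadd g g' hg hg' => simp only [map_add, add_apply, hg, hg']
  | hom γ g hg =>
    rw [mlComp_apply_hom h _ _ hg, dOp_apply,
      args_self h _ _ _ (fun l => ⟨l, by omega⟩) fun l => by simp]

theorem mlComp_comp_d [CharZero K] {m n p : ℕ} (h : p + 1 = m + n) (i : Fin m)
    (f : ML K W U m) (g : ML K W W n) :
    mlComp h i (mlComp (rfl : m + 1 = m + 1) i f (dOp K W)) g =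
      mlComp h i f (DGSpace.d.compMultilinearMap g) := by
  rw [mlComp_mlComp_seq rfl h (add_comm n 1) h i 0 i (by simp)]
  congr 1
  ext w
  exact mlComp_dOp_left _ _ _

theorem mlIns_mlComp [CharZero K] {m n p : ℕ} (h : p + 1 = m + n) (i : Fin m)
    (f : ML K W U m) (g : ML K W W n) :
    mlIns p (mlComp h i f g) = mlComp h i (mlIns m f) (mlPar DGSpace.par n g) -
      mlComp h i f (DGSpace.d.compMultilinearMap (mlPar DGSpace.par n g)) +
      mlComp h i f (mlIns n g) := by
  induction g using ml_hom_induction with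
  | hadd g g' hg hg' =>
    have h : ∀ a b : ML K W W n, (DGSpace.d (K := K) (V := W)).compMultilinearMap (a + b) =
      DGSpace.d.compMultilinearMap a + DGSpace.d.compMultilinearMap b := fun a b => by ext; simp
    simp only [map_add, hg, hg', h]
    abel
  | hom γ g hg =>
    have h1 : ∀ j : {j // j ≠ i}, mlComp (rfl : p + 1 = p + 1) (insEquiv h i (.inl j))
        (mlComp h i f g) (dOp K W) =
        mlComp h i (mlComp (rfl : m + 1 = m + 1) j.1 f (dOp K W)) (mlPar DGSpace.par n g) := by
      rintro ⟨j, hj⟩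
      have hjv : j.val ≠ i.val := fun h => hj (Fin.ext h)
      rw [hg, map_smul]
      rcases lt_or_gt_of_ne hjv with hji | hji
      · rw [mlComp_mlComp_par (rfl : m + 1 = m + 1) h h (rfl : p + 1 = p + 1) j i hji i rfl
          (insEquiv h i (.inl ⟨j, hj⟩)) (by simp [insEquiv_inl_val, outer, hji]) f mlPar_dOp hg,
          smul_smul, Bool.true_and, sgn_mul_self, one_smul]
      · rw [mlComp_mlComp_par h (rfl : p + 1 = p + 1) (rfl : m + 1 = m + 1) h i j hji
          (insEquiv h i (.inl ⟨j, hj⟩)) (by simp [insEquiv_inl_val, outer, hji.not_gt]) i rfl f hg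
          mlPar_dOp, Bool.and_true]
    have h2 : ∀ l : Fin n, mlComp (rfl : p + 1 = p + 1) (insEquiv h i (.inr l))
        (mlComp h i f g) (dOp K W) = mlComp h i f (mlComp (rfl : n + 1 = n + 1) l g (dOp K W)) :=
      fun l => mlComp_mlComp_seq h rfl rfl h i l _ rfl f g _
    rw [mlIns_apply, ← (insEquiv h i).sum_comp, Fintype.sum_sum_type]
    simp only [h1, h2]
    rw [← mlComp_comp_d, mlIns_apply f, mlIns_apply g, map_sum, map_sum, LinearMap.sum_apply,
      Fintype.sum_eq_add_sum_subtype_ne (fun j : Fin m => mlComp h i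
        (mlComp (rfl : m + 1 = m + 1) j f (dOp K W)) (mlPar DGSpace.par n g)) i]
    abel

theorem mlPar_mlIns [CharZero K] (εU : U →ₗ[K] U) {n : ℕ} (f : ML K W U n) :
    mlPar εU n (mlIns n f) = - mlIns n (mlPar εU n f) := by
  rw [mlIns_apply, mlIns_apply, map_sum, ← Finset.sum_neg_distrib]
  refine Finset.sum_congr rfl fun i _ => ?_
  rw [mlPar_mlComp, mlPar_dOp, map_smul, sgn_true, neg_one_smul]

theorem mlIns_mlPerm [CharZero K] {m n : ℕ} (e : Fin m ≃ Fin n) (f : ML K W U m) :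
    mlIns n (mlPerm e f) = mlPerm e (mlIns m f) := by
  rw [mlIns_apply, mlIns_apply, map_sum, ← e.sum_comp]
  refine Finset.sum_congr rfl fun i _ => ?_
  rw [mlPerm_mlComp rfl (rfl : n + 1 = n + 1) e (Equiv.refl _) e i (fun j t _ ht => ?_)
    (fun l t ht => ?_), mlPerm_refl]
  · have : t = j := Fin.ext (by rw [ht, outer]; split_ifs <;> omega)
    rw [this, outer]
    split_ifs <;> omega
  · have : t = i := Fin.ext (by omega)
    rw [this]
    omega

theorem mlIns_mlIns [CharZero K] {n : ℕ} (f : ML K W U n) : mlIns n (mlIns n f) = 0 := by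
  let S : Fin n → Fin n → ML K W U n := fun i j =>
    mlComp (rfl : n + 1 = n + 1) i (mlComp (rfl : n + 1 = n + 1) j f (dOp K W)) (dOp K W)
  have hlt : ∀ i j : Fin n, i < j → S j i = - S i j := fun i j hij => by
    rw [← neg_one_smul K]
    exact mlComp_mlComp_par (rfl : n + 1 = n + 1) (rfl : n + 1 = n + 1) rfl rfl i j hij j rfl i rfl
      f mlPar_dOp mlPar_dOp
  have hS : ∀ i j, S i j = - S j i := by
    intro i j
    rcases lt_trichotomy i j with hij | rfl | hij
    · rw [hlt i j hij, neg_neg]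
    · have : S i i = 0 := by
        simp only [S]
        rw [mlComp_comp_d]
        have : (DGSpace.d.compMultilinearMap (dOp K W) : ML K W W 1) = 0 := by
          ext w
          simp [dOp_apply, DGSpace.d_d]
        rw [this, map_zero]
      rw [this, neg_zero]
    · exact hlt j i hij
  have h1 : mlIns n (mlIns n f) = ∑ i, ∑ j, S i j := by
    simp only [mlIns_apply, S, map_sum, LinearMap.sum_apply]
    exact Finset.sum_comm
  have h2 : ∑ i, ∑ j, S i j = - ∑ i, ∑ j, S i j := by
    conv_lhs => rw [Finset.sum_comm]
    simp only [← Finset.sum_neg_distrib]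
    exact Finset.sum_congr rfl fun i _ => Finset.sum_congr rfl fun j _ => hS j i
  rw [h1]
  have h3 : (2 : K) • ∑ i, ∑ j, S i j = 0 := by
    rw [two_smul]
    exact add_eq_zero_iff_eq_neg.2 h2
  exact (smul_eq_zero.1 h3).resolve_left two_ne_zero

variable [CharZero K] {εU dU : U →ₗ[K] U}

theorem mlPar_compMultilinearMap (hεd : ∀ a, dU (εU a) = - εU (dU a)) {n : ℕ} (f : ML K W U n) :
    mlPar εU n (dU.compMultilinearMap f) = - dU.compMultilinearMap (mlPar εU n f) := by
  ext w
  simp [mlPar_apply, hεd]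

theorem mlD_mlPar (hεd : ∀ a, dU (εU a) = - εU (dU a)) {n : ℕ} (f : ML K W U n) :
    mlD εU dU n (mlPar εU n f) = - mlPar εU n (mlD εU dU n f) := by
  rw [mlD_eq, mlD_eq, map_sub, mlPar_mlIns, mlPar_compMultilinearMap hεd]
  abel

theorem mlD_mlD (hε : ∀ a, εU (εU a) = a) (hd : ∀ a, dU (dU a) = 0)
    (hεd : ∀ a, dU (εU a) = - εU (dU a)) {n : ℕ} (f : ML K W U n) :
    mlD εU dU n (mlD εU dU n f) = 0 := by
  rw [mlD_eq εU dU (mlD εU dU n f), mlD_eq, map_sub, compMultilinearMap_sub, mlPar_mlIns,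
    mlPar_mlPar hε, mlPar_compMultilinearMap hεd, compMultilinearMap_mlIns, map_sub, map_neg,
    map_neg, mlIns_mlIns]
  have : dU.compMultilinearMap (dU.compMultilinearMap f) = 0 := by
    ext w
    simp [hd]
  rw [this]
  abel

theorem mlD_mlPerm {m n : ℕ} (e : Fin m ≃ Fin n) (f : ML K W U m) :
    mlD εU dU n (mlPerm e f) = mlPerm e (mlD εU dU m f) := by
  rw [mlD_eq, mlD_eq, map_sub, mlPar_mlPerm, mlIns_mlPerm, compMultilinearMap_mlPerm]

theorem mlD_mlComp {m n p : ℕ} (h : p + 1 = m + n) (i : Fin m)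
    (f : ML K W U m) (g : ML K W W n) :
    mlD εU dU p (mlComp h i f g) = mlComp h i (mlD εU dU m f) g +
      mlComp h i (mlPar εU m f) (mlD DGSpace.par DGSpace.d n g) := by
  rw [mlD_eq, mlD_eq, mlD_eq, mlPar_mlComp, mlIns_mlComp, mlPar_mlPar DGSpace.par_par,
    compMultilinearMap_mlComp, map_sub, map_sub, LinearMap.sub_apply]
  abel

end MLDifferential

/-! ### The endomorphism operad -/

section EndOperad

variable {K : Type u} [Field K] [CharZero K] {W : Type w} [AddCommGroup W] [Module K W]
  [DGSpace K W]

theorem endOp_isDG : (EndOp K W).IsDG where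
  par_par _ f := mlPar_mlPar DGSpace.par_par f
  d_d _ f := mlD_mlD DGSpace.par_par DGSpace.d_d DGSpace.d_par f
  d_par _ f := mlD_mlPar DGSpace.d_par f
  un_par o f := by cases o; exact mlPar_mlPerm _ _ f
  un_d o f := by cases o; exact mlD_mlPerm _ f
  bin_par o f g := by cases o; exact mlPar_mlComp _ _ _ f g
  bin_d o f g := by cases o; exact mlD_mlComp _ _ f g

theorem endOp_lawful : LawfulOp (EndOp K W) := by
  intro n z hz
  cases hz with
  | perm_refl a => exact sub_eq_zero.2 (mlPerm_refl a)
  | perm_trans e e' a => exact sub_eq_zero.2 (mlPerm_trans e e' a)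
  | equivariance h h' e e' ρ i ho hi a b =>
    exact sub_eq_zero.2 (mlPerm_mlComp h h' e e' ρ i ho hi a b)
  | seq h₁ h₂ h₃ h₄ i j ij hij a b c =>
    exact sub_eq_zero.2 (mlComp_mlComp_seq h₁ h₂ h₃ h₄ i j ij hij a b c)
  | par h₁ h₂ h₃ h₄ i k hik k' hk i' hi β γ a b c hb hc =>
    exact sub_eq_zero.2 (mlComp_mlComp_par h₁ h₂ h₃ h₄ i k hik k' hk i' hi a hb hc)

end EndOperad

end MCTwist

end

noncomputable section

namespace MCTwist

/-! ### Appended lists of arguments -/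

section Append

variable {K : Type u} [Field K] {W : Type w} [AddCommGroup W] [Module K W] [DGSpace K W]
variable {U : Type v} [AddCommGroup U] [Module K U]

theorem append_split {α : Type*} {m k : ℕ} (w : Fin (m + k) → α) :
    ∃ (x : Fin m → α) (y : Fin k → α), w = Fin.append x y :=
  ⟨_, _, Fin.append_castAdd_natAdd.symm⟩

theorem isHom_append {m k : ℕ} {p : Fin m → Bool} {q : Fin k → Bool} {w : Fin m → W}
    {x : Fin k → W} (hw : IsHom K p w) (hx : IsHom K q x) :
    IsHom K (Fin.append p q) (Fin.append w x) := by
  intro j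
  induction j using Fin.addCases with
  | left j => rw [Fin.append_left, Fin.append_left]; exact hw j
  | right j => rw [Fin.append_right, Fin.append_right]; exact hx j

theorem append_comp_par {m k : ℕ} (w : Fin m → W) (x : Fin k → W) (φ : W →ₗ[K] W) :
    (fun j => φ (Fin.append w x j)) = Fin.append (fun j => φ (w j)) fun j => φ (x j) := by
  funext j
  induction j using Fin.addCases <;> simp

/-- `e'` permutes the last `k` positions by `σ` and the positions before by `e`. -/
structure IsAppend {m n k : ℕ} (e' : Fin (m + k) ≃ Fin (n + k)) (e : Fin m ≃ Fin n)
    (σ : Equiv.Perm (Fin k)) : Prop where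
  left : ∀ t, e' (t.castAdd k) = (e t).castAdd k
  right : ∀ t, e' (Fin.natAdd m t) = Fin.natAdd n (σ t)

theorem IsAppend.comp {α : Type*} {m n k : ℕ} {e' : Fin (m + k) ≃ Fin (n + k)} {e : Fin m ≃ Fin n}
    {σ : Equiv.Perm (Fin k)} (h : IsAppend e' e σ) (w : Fin n → α) (x : Fin k → α) :
    Fin.append w x ∘ e' = Fin.append (w ∘ e) (x ∘ σ) := by
  funext j
  induction j using Fin.addCases <;> simp [h.left, h.right]

theorem IsAppend.koszul {m n k : ℕ} {e' : Fin (m + k) ≃ Fin (n + k)} {e : Fin m ≃ Fin n}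
    {σ : Equiv.Perm (Fin k)} (h : IsAppend e' e σ) (p : Fin m → Bool) (q : Fin k → Bool) :
    koszul K e' (Fin.append p q) = koszul K e p * koszul K σ q := by
  rw [koszul_eq_ksign, koszul_eq_ksign, koszul_eq_ksign, ksign_equiv finSumFinEquiv,
    ksign_sum (Fin.val_injective.comp (Equiv.injective _))
      ((val_injective e').comp (Equiv.injective _))]
  have h1 : (Fin.append p q ∘ finSumFinEquiv) ∘ Sum.inl = p := by
    funext j
    simp
  have h2 : (Fin.append p q ∘ finSumFinEquiv) ∘ Sum.inr = q := by
    funext j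
    simp
  have h3 : ∀ i : Fin m, ∀ j : Fin k, crossing K
      (((fun j : Fin (m + k) => j.val) ∘ finSumFinEquiv) (.inl i))
      (((fun j : Fin (m + k) => j.val) ∘ finSumFinEquiv) (.inr j))
      (((fun j => (e' j).val) ∘ finSumFinEquiv) (.inl i))
      (((fun j => (e' j).val) ∘ finSumFinEquiv) (.inr j))
      ((Fin.append p q ∘ finSumFinEquiv) (.inl i)) ((Fin.append p q ∘ finSumFinEquiv) (.inr j)) =
      1 := by
    intro i j
    have a1 : i.val < m + j.val := by omega
    have a2 : (e i).val < n + (σ j).val := by omega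
    simp [crossing, h.left, h.right, a1, a2]
  rw [Finset.prod_congr rfl fun i _ => Finset.prod_congr rfl fun j _ => h3 i j, h1, h2]
  simp only [Finset.prod_const_one, mul_one]
  congr 1
  · refine ksign_congr _ (fun j j' => ?_) fun j j' => ?_
    · simp
    · simp [h.left]
  · refine ksign_congr _ (fun j j' => ?_) fun j j' => ?_
    · simp
    · simp [h.right]

theorem IsAppend.mlPerm_apply [CharZero K] {m n k : ℕ} {e' : Fin (m + k) ≃ Fin (n + k)}
    {e : Fin m ≃ Fin n} {σ : Equiv.Perm (Fin k)} (h : IsAppend e' e σ) (f : ML K W U (m + k))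
    {p : Fin n → Bool} {q : Fin k → Bool} {w : Fin n → W} {x : Fin k → W} (hw : IsHom K p w)
    (hx : IsHom K q x) : mlPerm e' f (Fin.append w x) =
      (MCTwist.koszul K e (p ∘ e) * MCTwist.koszul K σ (q ∘ σ)) •
        f (Fin.append (w ∘ e) (x ∘ σ)) := by
  rw [mlPerm_apply_hom _ _ (isHom_append hw hx), h.comp, h.comp, h.koszul]

theorem isAppend_extendLast {m n : ℕ} (e : Fin m ≃ Fin n) :
    IsAppend (extendLast e) e (Equiv.refl (Fin 1)) where
  left t := extendLast_castSucc e t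
  right t := by
    have h1 : Fin.natAdd m t = Fin.last m := Fin.ext (by simp)
    rw [h1, extendLast_last]
    exact Fin.ext (by simp)

theorem isAppend_swap (n k : ℕ) (a b : Fin k) :
    IsAppend (Equiv.swap (Fin.natAdd n a) (Fin.natAdd n b)) (Equiv.refl (Fin n))
      (Equiv.swap a b) where
  left t := by
    rw [Equiv.swap_apply_of_ne_of_ne] <;> [rfl; skip; skip] <;>
    · intro h
      have := congrArg Fin.val h
      simp at this
      omega
  right t := (Fin.natAdd_injective k n).swap_apply a b t

theorem IsAppend.mul {n k : ℕ} {s t : Equiv.Perm (Fin (n + k))} {σ τ : Equiv.Perm (Fin k)}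
    (hs : IsAppend s (Equiv.refl _) σ) (ht : IsAppend t (Equiv.refl _) τ) :
    IsAppend (s * t) (Equiv.refl _) (σ * τ) where
  left j := by simp [ht.left, hs.left]
  right j := by rw [Equiv.Perm.mul_apply, ht.right, hs.right]; rfl

theorem args_append {m n p k : ℕ} (h : p + 1 = m + n) (h' : (p + k) + 1 = (m + k) + n) (i : Fin m)
    (φ : W →ₗ[K] W) (g : ML K W W n) (w : Fin p → W) (x : Fin k → W) :
    args h' (i.castAdd k) φ g (Fin.append w x) = Fin.append (args h i φ g w) x := by
  funext j
  have hi := i.2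
  induction j using Fin.addCases with
  | left j =>
    have hj := j.2
    rw [Fin.append_left]
    rcases lt_trichotomy j.val i.val with hji | hji | hji
    · rw [args_of_lt h' _ _ _ hji (Fin.castAdd k ⟨j, by omega⟩) rfl,
        args_of_lt h _ _ _ hji ⟨j, by omega⟩ rfl, Fin.append_left]
    · obtain rfl : j = i := Fin.ext hji
      rw [args_self h' _ _ _ (fun l => Fin.castAdd k ⟨j + l, by omega⟩) fun _ => rfl,
        args_self h _ _ _ (fun l => ⟨j + l, by omega⟩) fun _ => rfl]
      congr 1
      funext l
      exact Fin.append_left w x ⟨j + l, by omega⟩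
    · rw [args_of_gt h' _ _ _ hji (Fin.castAdd k ⟨j + n - 1, by omega⟩) (by simp; omega),
        args_of_gt h _ _ _ hji ⟨j + n - 1, by omega⟩ (by simp; omega), Fin.append_left]
  | right j =>
    rw [Fin.append_right, args_of_gt h' _ _ _ (by simp; omega) (Fin.natAdd p j) (by simp; omega),
      Fin.append_right]

theorem append_one {n : ℕ} (w : Fin n → W) (x : W) :
    (Fin.snoc w x : Fin (n + 1) → W) = Fin.append w ![x] := by
  rw [Fin.append_right_eq_snoc]
  rfl

theorem append_two {n : ℕ} (w : Fin n → W) (x y : W) :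
    (Fin.snoc (Fin.snoc w x : Fin (n + 1) → W) y : Fin (n + 2) → W) = Fin.append w ![x, y] := by
  funext j
  refine Fin.addCases (m := n) (n := 2) (fun j => ?_) (fun j => ?_) j
  · rw [Fin.append_left]
    have : j.castAdd 2 = j.castSucc.castSucc := rfl
    rw [this, Fin.snoc_castSucc, Fin.snoc_castSucc]
  · rw [Fin.append_right]
    match j with
    | 0 =>
      have : Fin.natAdd n (0 : Fin 2) = (Fin.last n).castSucc := rfl
      rw [this, Fin.snoc_castSucc, Fin.snoc_last]
      rfl
    | 1 =>
      have : Fin.natAdd n (1 : Fin 2) = Fin.last (n + 1) := rfl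
      rw [this, Fin.snoc_last]
      rfl

end Append

/-! ### Symplectic forms -/

/-- An even symplectic form compatible with the differential. -/
structure IsSymplectic {K : Type u} [Field K] {W : Type w} [AddCommGroup W] [Module K W]
    [DGSpace K W] (ω : LinearMap.BilinForm K W) : Prop where
  nondeg : ω.Nondegenerate
  even : ∀ a b, ω (DGSpace.par (K := K) a) (DGSpace.par (K := K) b) = ω a b
  symm : ∀ (p q : Bool) (a b : W), DGSpace.par (K := K) a = sgn K p • a →
    DGSpace.par (K := K) b = sgn K q • b → ω a b = - (sgn K (p && q) * ω b a)
  d_form : ∀ a b, ω (DGSpace.d (K := K) a) b +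
    ω (DGSpace.par (K := K) a) (DGSpace.d (K := K) b) = 0

theorem ScalarProduct.symplectic {K : Type u} [Field K] {V : Type w} [AddCommGroup V] [Module K V]
    [DGSpace K V] (B : ScalarProduct K V) : IsSymplectic B.omega where
  nondeg := B.omega_nondeg
  even a b := by
    have h := B.even (DGSpace.par (K := K) (V := V) a) b
    change B.form (DGSpace.par (K := K) (V := V) (-(DGSpace.par (K := K) (V := V) a)))
      (-(DGSpace.par (K := K) (V := V) b)) = B.form (DGSpace.par (K := K) (V := V) a) b
    rw [map_neg, map_neg, map_neg, LinearMap.neg_apply, neg_neg, h]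
  symm p q a b ha hb := by
    have key : ∀ (r : Bool) (c : V), -(DGSpace.par (K := K) (V := V) c) = sgn K r • c →
        DGSpace.par (K := K) (V := V) c = sgn K (!r) • c := by
      intro r c hc
      rw [neg_eq_iff_eq_neg] at hc
      rw [hc]
      cases r <;> simp
    have main : ∀ a b : V, DGSpace.par (K := K) (V := V) a = sgn K (!p) • a →
        DGSpace.par (K := K) (V := V) b = sgn K (!q) • b →
        B.form (DGSpace.par (K := K) (V := V) a) b =
          -(sgn K (p && q) * B.form (DGSpace.par (K := K) (V := V) b) a) := by
      intro a b ha hb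
      have h := B.symm _ _ _ _ ha hb
      have he := B.even b a
      rw [ha, hb, map_smul, map_smul, LinearMap.smul_apply] at he
      rw [ha, hb, map_smul, map_smul, LinearMap.smul_apply, LinearMap.smul_apply, h]
      simp only [smul_eq_mul] at he ⊢
      cases p <;> cases q <;> simp at he ⊢
    exact main a b (key p a ha) (key q b hb)
  d_form a b := by
    have main : ∀ a b : V, B.form (DGSpace.par (K := K) (DGSpace.d (K := K) a)) b +
        B.form (DGSpace.par (K := K) (-(DGSpace.par (K := K) a))) (DGSpace.d (K := K) b) = 0 := by
      intro a b
      have h := B.d_form (DGSpace.par (K := K) (V := V) a) b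
      rw [DGSpace.d_par, map_neg, LinearMap.neg_apply] at h
      rw [map_neg, map_neg, LinearMap.neg_apply]
      linear_combination -h
    exact main a b

/-! ### Operations and forms -/

section Forms

variable {K : Type u} [Field K] {W : Type w} [AddCommGroup W] [Module K W] [DGSpace K W]
variable (ω : LinearMap.BilinForm K W)

theorem toForm_apply {n : ℕ} (f : ML K W W n) (w : Fin n → W) (x : Fin 1 → W) :
    toForm ω n f (Fin.append w x) = ω (f w) (x 0) := by
  have h1 : Fin.init (Fin.append w x : Fin (n + 1) → W) = w := by
    funext j
    exact Fin.append_left w x j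
  have h2 : (Fin.append w x : Fin (n + 1) → W) (Fin.last n) = x 0 := Fin.append_right w x 0
  have h3 : toForm ω n f (Fin.append w x) = ω (f (Fin.init (Fin.append w x : Fin (n + 1) → W)))
    ((Fin.append w x : Fin (n + 1) → W) (Fin.last n)) := rfl
  rw [h3, h1, h2]

section Inverse

variable [FiniteDimensional K W] (hω : ω.Nondegenerate)

theorem ofForm_apply {n : ℕ} (G : ML K W K (n + 1)) (w : Fin n → W) (v : W) :
    ω (ofForm ω hω n G w) v = G (Fin.append w ![v]) := by
  rw [← append_one]
  change ω ((ω.toDual hω).symm (G.curryRight w)) v = _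
  rw [LinearMap.BilinForm.apply_toDual_symm_apply, MultilinearMap.curryRight_apply]

theorem toForm_ofForm {n : ℕ} (G : ML K W K (n + 1)) : toForm ω n (ofForm ω hω n G) = G := by
  ext w
  obtain ⟨w, x, rfl⟩ := append_split w
  rw [toForm_apply, ofForm_apply]
  congr 2
  funext j
  rw [Subsingleton.elim j 0]
  rfl

theorem ofForm_toForm {n : ℕ} (f : ML K W W n) : ofForm ω hω n (toForm ω n f) = f := by
  ext w
  rw [← sub_eq_zero]
  refine hω.1 _ fun v => ?_
  rw [map_sub, LinearMap.sub_apply, ofForm_apply, toForm_apply]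
  simp

theorem ofForm_eq_iff {n : ℕ} {G : ML K W K (n + 1)} {f : ML K W W n} :
    ofForm ω hω n G = f ↔ G = toForm ω n f :=
  ⟨fun h => by rw [← h, toForm_ofForm], fun h => by rw [h, ofForm_toForm]⟩

end Inverse

variable {ω}

theorem toForm_mlPar (h : IsSymplectic ω) {n : ℕ} (f : ML K W W n) :
    toForm ω n (mlPar DGSpace.par n f) = mlPar LinearMap.id (n + 1) (toForm ω n f) := by
  ext w
  obtain ⟨w, x, rfl⟩ := append_split w
  rw [toForm_apply, mlPar_apply, mlPar_apply, append_comp_par, toForm_apply, ← h.even,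
    DGSpace.par_par]
  rfl

theorem toForm_mlPerm [CharZero K] (h : IsSymplectic ω) {m n : ℕ} (e : Fin m ≃ Fin n) (f : ML K W W m) :
    toForm ω n (mlPerm e f) = mlPerm (extendLast e) (toForm ω m f) := by
  refine ml_ext_hom fun p w hw => ?_
  obtain ⟨w, x, rfl⟩ := append_split w
  obtain ⟨p, q, rfl⟩ := append_split p
  have h1 : IsHom K p w := fun j => by simpa using hw (j.castAdd 1)
  have h2 : IsHom K q x := fun j => by simpa using hw (Fin.natAdd _ j)
  rw [toForm_apply, (isAppend_extendLast e).mlPerm_apply _ h1 h2, toForm_apply,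
    mlPerm_apply_hom _ _ h1, koszul_refl, mul_one, map_smul, LinearMap.smul_apply]
  rfl

theorem toForm_mlComp [CharZero K] (h : IsSymplectic ω) {m n p : ℕ} (hp : p + 1 = m + n)
    (hp' : (p + 1) + 1 = (m + 1) + n) (i : Fin m) (f : ML K W W m) (g : ML K W W n) :
    toForm ω p (mlComp hp i f g) = mlComp hp' i.castSucc (toForm ω m f) g := by
  induction g using ml_hom_induction with
  | hadd g g' hg hg' => simp only [map_add, hg, hg']
  | hom γ g hg =>
    ext w
    obtain ⟨w, x, rfl⟩ := append_split w
    have : i.castSucc = i.castAdd 1 := rfl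
    rw [toForm_apply, mlComp_apply_hom hp i f hg, mlComp_apply_hom hp' _ _ hg, this, args_append hp,
      toForm_apply]

theorem toForm_mlD [CharZero K] (h : IsSymplectic ω) {n : ℕ} (f : ML K W W n) :
    toForm ω n (mlD DGSpace.par DGSpace.d n f) = mlD LinearMap.id 0 (n + 1) (toForm ω n f) := by
  have h1 : mlComp (rfl : (n + 1) + 1 = (n + 1) + 1) (Fin.last n)
      (toForm ω n (mlPar DGSpace.par n f)) (dOp K W) =
      - toForm ω n (DGSpace.d.compMultilinearMap f) := by
    ext w
    rw [mlComp_dOp_apply]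
    obtain ⟨w, x, rfl⟩ := append_split w
    have : (fun j : Fin (n + 1) => (if j < Fin.last n then DGSpace.par else if j = Fin.last n then
        DGSpace.d else LinearMap.id : W →ₗ[K] W) (Fin.append w x j)) =
        Fin.append (fun j => DGSpace.par (K := K) (w j)) fun j => DGSpace.d (K := K) (x j) := by
      funext j
      induction j using Fin.addCases with
      | left j =>
        have : j.castAdd 1 < Fin.last n := Fin.castSucc_lt_last j
        rw [if_pos this, Fin.append_left, Fin.append_left]
      | right j =>
        have : Fin.natAdd n j = Fin.last n := Fin.ext (by simp)
        rw [Fin.append_right, Fin.append_right, this, if_neg (lt_irrefl _), if_pos rfl]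
    rw [this, toForm_apply, mlPar_apply, neg_apply, toForm_apply]
    simp only [DGSpace.par_par]
    have := h.d_form (f w) (x 0)
    rw [LinearMap.compMultilinearMap_apply]
    linear_combination this
  rw [mlD_eq, mlD_eq, map_sub, ← toForm_mlPar h, mlIns_apply, mlIns_apply,
    Fin.sum_univ_castSucc, h1, map_sum]
  simp only [toForm_mlComp h (rfl : n + 1 = n + 1) rfl]
  have : (0 : K →ₗ[K] K).compMultilinearMap (toForm ω n f) = 0 := by
    ext w
    simp
  rw [this]
  abel

variable [FiniteDimensional K W]

theorem ofForm_mlPar (h : IsSymplectic ω) {n : ℕ} (G : ML K W K (n + 1)) :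
    ofForm ω h.nondeg n (mlPar LinearMap.id (n + 1) G) =
      mlPar DGSpace.par n (ofForm ω h.nondeg n G) := by
  rw [ofForm_eq_iff, toForm_mlPar h, toForm_ofForm]

theorem ofForm_hom (h : IsSymplectic ω) {n : ℕ} {γ : Bool} {G : ML K W K (n + 1)}
    (hG : mlPar LinearMap.id (n + 1) G = sgn K γ • G) :
    mlPar DGSpace.par n (ofForm ω h.nondeg n G) = sgn K γ • ofForm ω h.nondeg n G := by
  rw [← ofForm_mlPar h, hG, map_smul]

theorem ofForm_mlD [CharZero K] (h : IsSymplectic ω) {n : ℕ} (G : ML K W K (n + 1)) :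
    ofForm ω h.nondeg n (mlD LinearMap.id 0 (n + 1) G) =
      mlD DGSpace.par DGSpace.d n (ofForm ω h.nondeg n G) := by
  rw [ofForm_eq_iff, toForm_mlD h, toForm_ofForm]

theorem ofForm_mlPerm [CharZero K] (h : IsSymplectic ω) {m n : ℕ} (e : Fin m ≃ Fin n) (G : ML K W K (m + 1)) :
    ofForm ω h.nondeg n (mlPerm (extendLast e) G) = mlPerm e (ofForm ω h.nondeg m G) := by
  rw [ofForm_eq_iff, toForm_mlPerm h, toForm_ofForm]

theorem ofForm_mlComp [CharZero K] (h : IsSymplectic ω) {m n p : ℕ} (hp : p + 1 = m + n)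
    (hp' : (p + 1) + 1 = (m + 1) + n) (i : Fin m) (G : ML K W K (m + 1)) (g : ML K W W n) :
    ofForm ω h.nondeg p (mlComp hp' i.castSucc G g) = mlComp hp i (ofForm ω h.nondeg m G) g := by
  rw [ofForm_eq_iff, toForm_mlComp h hp hp', toForm_ofForm]

/-- The endomorphism operad maps to the operad underlying the endomorphism modular operad. -/
def formHom [CharZero K] (h : IsSymplectic ω) : Hom (EndOp K W) (opOf (EndMod ω h.nondeg)) where
  map n := toForm ω n
  cont _ := continuous_bot
  map_par _ f := toForm_mlPar h f
  map_d _ f := toForm_mlD h f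
  map_un o f := by cases o; exact toForm_mlPerm h _ f
  map_bin {_ s _} o f g := by
    cases o with
    | comp hp i =>
      have h1 := toForm_mlComp h hp (by omega) i f g
      refine h1.trans ?_
      conv_lhs => rw [← ofForm_toForm ω h.nondeg g]
      rfl

end Forms

end MCTwist

end

noncomputable section

namespace MCTwist

/-! ### Dual bases and contractions -/

section DualBases

variable {K : Type u} [Field K] {W : Type w} [AddCommGroup W] [Module K W] [DGSpace K W]

/-- Homogeneous bases `e` and `f` with `ω(e_a, f_b) = δ_{ab}`. -/
structure DualBases (ω : LinearMap.BilinForm K W) where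
  I : Type
  [fintype : Fintype I]
  [dec : DecidableEq I]
  π : I → Bool
  e : Module.Basis I K W
  f : Module.Basis I K W
  e_hom : IsHom K π e
  f_hom : IsHom K π f
  e_repr : ∀ v a, e.repr v a = ω v (f a)
  f_repr : ∀ v a, f.repr v a = - (sgn K (π a) * ω v (e a))

attribute [instance] DualBases.fintype DualBases.dec

theorem exists_homogeneous_basis [CharZero K] [FiniteDimensional K W] :
    ∃ (r s : ℕ) (b : Module.Basis (Fin r ⊕ Fin s) K W),
      IsHom K (Sum.elim (fun _ => false) fun _ => true) b := by
  let W₀ : Submodule K W := LinearMap.ker (DGSpace.par (K := K) (V := W) - LinearMap.id)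
  let W₁ : Submodule K W := LinearMap.ker (DGSpace.par (K := K) (V := W) + LinearMap.id)
  have h₀ : ∀ v, v ∈ W₀ ↔ DGSpace.par (K := K) v = v := fun v => by
    simp [W₀, sub_eq_zero]
  have h₁ : ∀ v, v ∈ W₁ ↔ DGSpace.par (K := K) v = -v := fun v => by
    simp [W₁, add_eq_zero_iff_eq_neg]
  have hc : IsCompl W₀ W₁ := by
    constructor
    · rw [Submodule.disjoint_def]
      intro v hv hv'
      have h := ((h₀ v).1 hv).symm.trans ((h₁ v).1 hv')
      have : (2 : K) • v = 0 := by
        rw [two_smul]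
        exact add_eq_zero_iff_eq_neg.2 h
      exact (smul_eq_zero.1 this).resolve_left two_ne_zero
    · rw [codisjoint_iff, eq_top_iff]
      intro v _
      rw [← proj_false_add_true (DGSpace.par (K := K) (V := W)) v]
      refine Submodule.add_mem_sup ((h₀ _).2 ?_) ((h₁ _).2 ?_)
      · rw [par_proj DGSpace.par_par, sgn_false, one_smul]
      · rw [par_proj DGSpace.par_par, sgn_true, neg_one_smul]
  refine ⟨_, _, ((Module.finBasis K W₀).prod (Module.finBasis K W₁)).map
    (Submodule.prodEquivOfIsCompl W₀ W₁ hc), fun a => ?_⟩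
  rcases a with a | a
  · have := (h₀ _).1 (Module.finBasis K W₀ a).2
    simpa [Module.Basis.prod_apply] using this
  · have := (h₁ _).1 (Module.finBasis K W₁ a).2
    simpa [Module.Basis.prod_apply] using this

variable [FiniteDimensional K W] {ω : LinearMap.BilinForm K W}

theorem IsSymplectic.nonempty_dualBases [CharZero K] (h : IsSymplectic ω) :
    Nonempty (DualBases ω) := by
  obtain ⟨r, s, f, hf⟩ := exists_homogeneous_basis (K := K) (W := W)
  let π : Fin r ⊕ Fin s → Bool := Sum.elim (fun _ => false) fun _ => true
  let e := ω.dualBasis h.nondeg f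
  have hef : ∀ a b, ω (e a) (f b) = if b = a then 1 else 0 :=
    LinearMap.BilinForm.apply_dualBasis_left h.nondeg f
  have he : IsHom K π e := by
    intro a
    rw [← sub_eq_zero]
    refine h.nondeg.1 _ fun v => ?_
    have : ω (DGSpace.par (K := K) (e a) - sgn K (π a) • e a) = 0 := by
      refine f.ext fun b => ?_
      have h1 := h.even (e a) (DGSpace.par (K := K) (f b))
      rw [DGSpace.par_par] at h1
      rw [map_sub, LinearMap.sub_apply, h1, hf b, map_smul, map_smul, LinearMap.smul_apply, hef]
      by_cases hab : b = a
      · subst hab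
        simp [π]
      · simp [hab]
    rw [this, LinearMap.zero_apply]
  have hfe : ∀ a b, ω (f a) (e b) = if a = b then - sgn K (π a) else 0 := by
    intro a b
    rw [h.symm _ _ _ _ (hf a) (he b), hef]
    by_cases hab : a = b
    · subst hab
      simp [π]
    · simp [hab]
  refine ⟨⟨_, π, e, f, he, hf, fun v a => ?_, fun v a => ?_⟩⟩
  · have : e.coord a = ω.flip (f a) := e.ext fun b => by
      simp [Finsupp.single_apply, hef, eq_comm]
    exact LinearMap.congr_fun this v
  · have : f.coord a = -(sgn K (π a) • ω.flip (e a)) := f.ext fun b => by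
      have hfl : (ω.flip (e a)) (f b) = ω (f b) (e a) := rfl
      rw [LinearMap.neg_apply, LinearMap.smul_apply, hfl, hfe,
        Module.Basis.coord_apply, Module.Basis.repr_self, Finsupp.single_apply]
      by_cases hab : b = a
      · subst hab
        simp [sgn_mul_self]
      · simp [hab]
    exact LinearMap.congr_fun this v

theorem toDual_symm_comp (hω : ω.Nondegenerate) (T : W →ₗ[K] W →ₗ[K] K) (x y : W) :
    ω (((ω.toDual hω).symm.toLinearMap ∘ₗ T) x) y = T x y :=
  LinearMap.BilinForm.apply_toDual_symm_apply (hB := hω) (T x) y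

theorem DualBases.trace_eq (D : DualBases ω) (g : W →ₗ[K] W) :
    LinearMap.trace K W g = ∑ a, ω (g (D.e a)) (D.f a) := by
  rw [LinearMap.trace_eq_matrix_trace K D.e g, Matrix.trace]
  refine Finset.sum_congr rfl fun a _ => ?_
  rw [Matrix.diag_apply, LinearMap.toMatrix_apply, D.e_repr]

theorem DualBases.trace_eq_neg (D : DualBases ω) (g : W →ₗ[K] W) :
    LinearMap.trace K W g = - ∑ a, sgn K (D.π a) * ω (g (D.f a)) (D.e a) := by
  rw [LinearMap.trace_eq_matrix_trace K D.f g, Matrix.trace, ← Finset.sum_neg_distrib]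
  refine Finset.sum_congr rfl fun a _ => ?_
  rw [Matrix.diag_apply, LinearMap.toMatrix_apply, D.f_repr]

theorem DualBases.sum_swap (D : DualBases ω) (hω : ω.Nondegenerate) (T : W →ₗ[K] W →ₗ[K] K) :
    ∑ a, T (D.e a) (D.f a) = - ∑ a, sgn K (D.π a) * T (D.f a) (D.e a) := by
  simp only [← toDual_symm_comp hω T]
  rw [← D.trace_eq, ← D.trace_eq_neg]

theorem DualBases.expand (D : DualBases ω) (v : W) : v = ∑ a, ω v (D.f a) • D.e a := by
  conv_lhs => rw [← D.e.sum_repr v]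
  simp only [D.e_repr]

theorem DualBases.contr_apply (D : DualBases ω) (hω : ω.Nondegenerate) {n : ℕ}
    (H : ML K W K (n + 2)) (w : Fin n → W) :
    mlContr ω hω n H w = ∑ a, sgn K (D.π a) * H (Fin.append w ![D.e a, D.f a]) := by
  have h1 : mlContr ω hω n H w = LinearMap.trace K W ((ω.toDual hω).symm.toLinearMap ∘ₗ
    (H.curryRight.curryRight w : W →ₗ[K] W →ₗ[K] K) ∘ₗ DGSpace.par) := rfl
  rw [h1, D.trace_eq]
  refine Finset.sum_congr rfl fun a _ => ?_
  have h2 := toDual_symm_comp hω (H.curryRight.curryRight w : W →ₗ[K] W →ₗ[K] K)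
    (DGSpace.par (K := K) (D.e a)) (D.f a)
  refine h2.trans ?_
  rw [D.e_hom a, map_smul, LinearMap.smul_apply, smul_eq_mul, ← append_two]
  rfl

/-- The value of a form on the arguments `w` followed by two more. -/
def lastTwo {n : ℕ} (H : ML K W K (n + 2)) (w : Fin n → W) : W →ₗ[K] W →ₗ[K] K :=
  H.curryRight.curryRight w

theorem lastTwo_apply {n : ℕ} (H : ML K W K (n + 2)) (w : Fin n → W) (x y : W) :
    lastTwo H w x y = H (Fin.append w ![x, y]) := by
  rw [← append_two]
  rfl

/-- The value of a form on the arguments `w` followed by one more. -/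
def lastOne {n : ℕ} (H : ML K W K (n + 1)) (w : Fin n → W) : W →ₗ[K] K :=
  H.curryRight w

theorem lastOne_apply {n : ℕ} (H : ML K W K (n + 1)) (w : Fin n → W) (x : W) :
    lastOne H w x = H (Fin.append w ![x]) := by
  rw [← append_one]
  rfl

theorem DualBases.sum_d (D : DualBases ω) (h : IsSymplectic ω) (T : W →ₗ[K] W →ₗ[K] K) :
    ∑ a, sgn K (D.π a) * T (DGSpace.d (K := K) (D.e a)) (D.f a) +
      ∑ a, T (D.e a) (DGSpace.d (K := K) (D.f a)) = 0 := by
  let τ := (ω.toDual h.nondeg).symm.toLinearMap ∘ₗ T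
  have hτ : ∀ x y, T x y = ω (τ x) y := fun x y => (toDual_symm_comp h.nondeg T x y).symm
  let δ : W →ₗ[K] W := DGSpace.d ∘ₗ DGSpace.par
  have h1 : ∀ a, sgn K (D.π a) * T (DGSpace.d (K := K) (D.e a)) (D.f a) =
      ω ((τ * δ) (D.e a)) (D.f a) := fun a => by
    have hδ : δ (D.e a) = sgn K (D.π a) • DGSpace.d (K := K) (D.e a) := by
      rw [← map_smul, ← D.e_hom a]
      rfl
    rw [hτ, Module.End.mul_apply, hδ, map_smul, map_smul, LinearMap.smul_apply, smul_eq_mul]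
  have h2 : ∀ a, T (D.e a) (DGSpace.d (K := K) (D.f a)) = - ω ((δ * τ) (D.e a)) (D.f a) :=
    fun a => by
    have hδ : δ (τ (D.e a)) = DGSpace.d (K := K) (DGSpace.par (K := K) (τ (D.e a))) := rfl
    rw [hτ, Module.End.mul_apply, hδ]
    have := h.d_form (DGSpace.par (K := K) (τ (D.e a))) (D.f a)
    rw [DGSpace.par_par] at this
    linear_combination this
  simp only [h1, h2, Finset.sum_neg_distrib, ← D.trace_eq]
  rw [LinearMap.trace_mul_comm, add_neg_cancel]

theorem mlContr_mlPar [CharZero K] (h : IsSymplectic ω) {n : ℕ} (H : ML K W K (n + 2)) :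
    mlContr ω h.nondeg n (mlPar LinearMap.id (n + 2) H) =
      mlPar LinearMap.id n (mlContr ω h.nondeg n H) := by
  obtain ⟨D⟩ := h.nonempty_dualBases
  ext w
  rw [mlPar_apply, LinearMap.id_apply, D.contr_apply, D.contr_apply]
  refine Finset.sum_congr rfl fun a _ => ?_
  rw [mlPar_apply, LinearMap.id_apply, append_comp_par]
  have : (fun j => DGSpace.par (K := K) ((![D.e a, D.f a] : Fin 2 → W) j)) =
      ![sgn K (D.π a) • D.e a, sgn K (D.π a) • D.f a] := by
    funext j
    match j with
    | 0 => exact D.e_hom a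
    | 1 => exact D.f_hom a
  rw [this, ← lastTwo_apply, ← lastTwo_apply, map_smul, map_smul, LinearMap.smul_apply, smul_smul,
    sgn_mul_self, one_smul]

theorem mlContr_mlIns [CharZero K] (h : IsSymplectic ω) {n : ℕ} (H : ML K W K (n + 2)) :
    mlContr ω h.nondeg n (mlIns (n + 2) H) = mlIns n (mlContr ω h.nondeg n H) := by
  obtain ⟨D⟩ := h.nonempty_dualBases
  ext w
  have key : ∀ (i : Fin n) (x y : W), mlComp (rfl : (n + 2) + 1 = (n + 2) + 1) (i.castAdd 2) H
      (dOp K W) (Fin.append w ![x, y]) = H (Fin.append (args (rfl : n + 1 = n + 1) i DGSpace.par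
        (dOp K W) w) ![x, y]) := by
    intro i x y
    rw [mlComp_apply_hom _ _ _ mlPar_dOp]
    exact congrArg H (args_append rfl rfl i _ _ _ _)
  have h0 : ∀ x y : W, mlComp (rfl : (n + 2) + 1 = (n + 2) + 1) (Fin.natAdd n 0) H
      (dOp K W) (Fin.append w ![x, y]) =
      H (Fin.append (fun j => DGSpace.par (K := K) (w j)) ![DGSpace.d (K := K) x, y]) := by
    intro x y
    rw [mlComp_dOp_apply]
    congr 1
    funext j
    refine Fin.addCases (fun j => ?_) (fun j => ?_) j
    · have : j.castAdd 2 < Fin.natAdd n (0 : Fin 2) := by simp [Fin.lt_def]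
      rw [if_pos this, Fin.append_left, Fin.append_left]
    · rw [Fin.append_right, Fin.append_right]
      match j with
      | 0 => rw [if_neg (lt_irrefl _), if_pos rfl]; rfl
      | 1 =>
        have h1 : ¬ Fin.natAdd n (1 : Fin 2) < Fin.natAdd n (0 : Fin 2) := by simp [Fin.lt_def]
        have h2 : Fin.natAdd n (1 : Fin 2) ≠ Fin.natAdd n (0 : Fin 2) := by simp [Fin.ext_iff]
        rw [if_neg h1, if_neg h2]
        rfl
  have h1 : ∀ x y : W, mlComp (rfl : (n + 2) + 1 = (n + 2) + 1) (Fin.natAdd n 1) H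
      (dOp K W) (Fin.append w ![x, y]) =
      H (Fin.append (fun j => DGSpace.par (K := K) (w j))
        ![DGSpace.par (K := K) x, DGSpace.d (K := K) y]) := by
    intro x y
    rw [mlComp_dOp_apply]
    congr 1
    funext j
    refine Fin.addCases (fun j => ?_) (fun j => ?_) j
    · have : j.castAdd 2 < Fin.natAdd n (1 : Fin 2) := by simp [Fin.lt_def]
      rw [if_pos this, Fin.append_left, Fin.append_left]
    · rw [Fin.append_right, Fin.append_right]
      match j with
      | 0 =>
        have h1 : Fin.natAdd n (0 : Fin 2) < Fin.natAdd n (1 : Fin 2) := by simp [Fin.lt_def]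
        rw [if_pos h1]
        rfl
      | 1 => rw [if_neg (lt_irrefl _), if_pos rfl]; rfl
  rw [D.contr_apply]
  have hs : ∀ a, mlIns (n + 2) H (Fin.append w ![D.e a, D.f a]) =
      ∑ i : Fin n, H (Fin.append (args (rfl : n + 1 = n + 1) i DGSpace.par
        (dOp K W) w) ![D.e a, D.f a]) +
      lastTwo H (fun j => DGSpace.par (K := K) (w j)) (DGSpace.d (K := K) (D.e a)) (D.f a) +
      sgn K (D.π a) * lastTwo H (fun j => DGSpace.par (K := K) (w j)) (D.e a)
        (DGSpace.d (K := K) (D.f a)) := by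
    intro a
    have h2 : sgn K (D.π a) * lastTwo H (fun j => DGSpace.par (K := K) (w j)) (D.e a)
        (DGSpace.d (K := K) (D.f a)) = lastTwo H (fun j => DGSpace.par (K := K) (w j))
        (DGSpace.par (K := K) (D.e a)) (DGSpace.d (K := K) (D.f a)) := by
      rw [D.e_hom a, map_smul]
      rfl
    rw [mlIns_apply, MultilinearMap.sum_apply, ← finSumFinEquiv.sum_comp, Fintype.sum_sum_type,
      Fin.sum_univ_two, ← add_assoc, h2, lastTwo_apply, lastTwo_apply, ← h0, ← h1]
    simp only [finSumFinEquiv_apply_left, finSumFinEquiv_apply_right, key]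
  simp only [hs, mul_add, Finset.sum_add_distrib, ← mul_assoc, sgn_mul_self, one_mul]
  rw [add_assoc, D.sum_d h, add_zero, mlIns_apply, MultilinearMap.sum_apply]
  simp only [Finset.mul_sum]
  rw [Finset.sum_comm]
  refine Finset.sum_congr rfl fun i _ => ?_
  rw [mlComp_apply_hom _ _ _ mlPar_dOp, D.contr_apply]
  rfl

theorem mlContr_mlD [CharZero K] (h : IsSymplectic ω) {n : ℕ} (H : ML K W K (n + 2)) :
    mlContr ω h.nondeg n (mlD LinearMap.id 0 (n + 2) H) =
      mlD LinearMap.id 0 n (mlContr ω h.nondeg n H) := by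
  have h0 : ∀ {k : ℕ} (G : ML K W K k), (0 : K →ₗ[K] K).compMultilinearMap G = 0 := fun G => by
    ext w
    simp
  rw [mlD_eq, mlD_eq, h0, h0, zero_sub, zero_sub, map_neg, mlContr_mlIns h, mlContr_mlPar h]

end DualBases

section EndModDG

variable {K : Type u} [Field K] [CharZero K] {W : Type w} [AddCommGroup W] [Module K W]
  [DGSpace K W] [FiniteDimensional K W] {ω : LinearMap.BilinForm K W}

theorem endMod_isDG (h : IsSymplectic ω) : (EndMod ω h.nondeg).IsDG where
  par_par _ f := mlPar_mlPar (εU := LinearMap.id) (fun _ => rfl) f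
  d_d _ f := mlD_mlD (εU := LinearMap.id) (dU := 0) (fun _ => rfl) (fun _ => rfl)
    (fun _ => by simp) f
  d_par _ f := mlD_mlPar (εU := LinearMap.id) (dU := 0) (fun _ => by simp) f
  un_par o f := by
    cases o with
    | perm g e => exact mlPar_mlPerm _ _ f
    | contr hg n => exact (mlContr_mlPar h f).symm
  un_d o f := by
    cases o with
    | perm g e => exact mlD_mlPerm _ f
    | contr hg n => exact (mlContr_mlD h f).symm
  bin_par o f g := by
    cases o with
    | comp hg hp i =>
      refine (mlPar_mlComp LinearMap.id hp i f (ofForm ω h.nondeg _ g)).trans ?_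
      exact congrArg (mlComp hp i (mlPar LinearMap.id _ f)) (ofForm_mlPar h g).symm
  bin_d o f g := by
    cases o with
    | comp hg hp i =>
      refine (mlD_mlComp (εU := LinearMap.id) (dU := 0) hp i f (ofForm ω h.nondeg _ g)).trans ?_
      exact congrArg (fun x => mlComp hp i (mlD LinearMap.id 0 _ f) (ofForm ω h.nondeg _ g) +
        mlComp hp i (mlPar LinearMap.id _ f) x) (ofForm_mlD h g).symm

end EndModDG

end MCTwist

end

noncomputable section

namespace MCTwist

/-! ### Signs of short permutations -/

section ShortSigns

variable {K : Type u} [Field K]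

theorem sgn_injective [CharZero K] {p q : Bool} (h : sgn K p = sgn K q) : p = q := by
  have h1 : (-1 : K) ≠ 1 := by norm_num
  cases p <;> cases q <;> simp_all [eq_comm]

theorem parityOf_append {m k : ℕ} (p : Fin m → Bool) (q : Fin k → Bool) :
    parityOf (Fin.append p q) = xor (parityOf p) (parityOf q) := by
  apply sgn_injective (K := ℚ)
  rw [sgn_xor, sgn_parityOf, sgn_parityOf, sgn_parityOf, Fin.prod_univ_add]
  simp

theorem parityOf_one (a : Bool) : parityOf ![a] = a := by
  apply sgn_injective (K := ℚ)
  rw [sgn_parityOf]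
  simp

theorem parityOf_two (a b : Bool) : parityOf ![a, b] = xor a b := by
  apply sgn_injective (K := ℚ)
  rw [sgn_parityOf, sgn_xor, Fin.prod_univ_two]
  rfl

theorem koszul_swap (a b : Bool) :
    koszul K (Equiv.swap (0 : Fin 2) 1) ![a, b] = sgn K (a && b) := by
  cases a <;> cases b <;> simp [koszul, Fin.prod_univ_two]

theorem koszul_swap_swap (a b : Bool) :
    koszul K (Equiv.swap (0 : Fin 4) 2 * Equiv.swap 1 3) ![a, a, b, b] = 1 := by
  have h0 : (Equiv.swap (0 : Fin 4) 2 * Equiv.swap 1 3 : Equiv.Perm (Fin 4)) 0 = 2 := by decide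
  have h1 : (Equiv.swap (0 : Fin 4) 2 * Equiv.swap 1 3 : Equiv.Perm (Fin 4)) 1 = 3 := by decide
  have h2 : (Equiv.swap (0 : Fin 4) 2 * Equiv.swap 1 3 : Equiv.Perm (Fin 4)) 2 = 0 := by decide
  have h3 : (Equiv.swap (0 : Fin 4) 2 * Equiv.swap 1 3 : Equiv.Perm (Fin 4)) 3 = 1 := by decide
  simp only [koszul, Fin.prod_univ_four, h0, h1, h2, h3]
  cases a <;> cases b <;> simp

theorem koszul_blockSwap {m n p : ℕ} (hp : p = m + n) (τ : Fin p ≃ Fin p)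
    (h₁ : ∀ l : Fin n, (τ ⟨l, by omega⟩).val = m + l)
    (h₂ : ∀ j : Fin m, (τ ⟨n + j, by omega⟩).val = j) (q : Fin p → Bool) :
    koszul K τ (q ∘ τ) = sgn K (parityOf (fun j : Fin m => q ⟨j, by omega⟩) &&
      parityOf fun l : Fin n => q ⟨m + l, by omega⟩) := by
  let s : Fin n ⊕ Fin m ≃ Fin p := finSumFinEquiv.trans (finCongr (by omega))
  have sl : ∀ l : Fin n, s (.inl l) = ⟨l, by omega⟩ := fun l => rfl
  have sr : ∀ j : Fin m, s (.inr j) = ⟨n + j, by omega⟩ := fun j => rfl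
  rw [koszul_eq_ksign, ksign_equiv s, ksign_sum (Fin.val_injective.comp (Equiv.injective _))
    ((val_injective τ).comp (Equiv.injective _)), ksign_eq_one, ksign_eq_one, one_mul, one_mul,
    sgn_and_parityOf]
  · refine Finset.prod_congr rfl fun l _ => ?_
    rw [Bool.and_comm, sgn_and_parityOf]
    refine Finset.prod_congr rfl fun j _ => ?_
    have a1 : l.val < n + j.val := by omega
    have a2 : ¬ m + l.val < j.val := by omega
    have b1 : τ ⟨l, by omega⟩ = ⟨m + l, by omega⟩ := Fin.ext (h₁ l)
    have b2 : τ ⟨n + j, by omega⟩ = ⟨j, by omega⟩ := Fin.ext (h₂ j)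
    simp [crossing, sl, sr, a1, a2, b1, b2]
  · intro j j' _ _
    simp only [Function.comp_apply, sr, h₂]
    omega
  · intro j j' _ _
    simp only [Function.comp_apply, sl, h₁]
    omega

theorem koszul_shift {m n : ℕ} (ρ : Fin (m + n + 2) ≃ Fin (m + n + 2))
    (h₁ : ∀ t : Fin (m + n + 2), t.val < m → (ρ t).val = t)
    (h₂ : ∀ t : Fin (m + n + 2), t.val = m → (ρ t).val = m + n)
    (h₃ : ∀ t : Fin (m + n + 2), m < t.val → t.val ≤ m + n → (ρ t).val = t - 1)
    (h₄ : ∀ t : Fin (m + n + 2), t.val = m + n + 1 → (ρ t).val = m + n + 1)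
    (p : Fin m → Bool) (q : Fin n → Bool) (x y : Bool) :
    koszul K ρ (Fin.append (Fin.append p q) ![x, y] ∘ ρ) = sgn K (x && parityOf q) := by
  let s : (Fin m ⊕ Fin n) ⊕ Fin 2 ≃ Fin (m + n + 2) :=
    (finSumFinEquiv.sumCongr (Equiv.refl (Fin 2))).trans finSumFinEquiv
  have s1 : ∀ j, s (.inl (.inl j)) = (j.castAdd n).castAdd 2 := fun j => rfl
  have s2 : ∀ l, s (.inl (.inr l)) = (Fin.natAdd m l).castAdd 2 := fun l => rfl
  have s3 : ∀ k, s (.inr k) = Fin.natAdd (m + n) k := fun k => rfl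
  have key : ∀ (t t' : Fin (m + n + 2)), (ρ t).val = t'.val → ρ.symm t' = t := fun t t' h => by
    rw [Equiv.symm_apply_eq]
    exact (Fin.ext h).symm
  have r1 : ∀ j, (ρ.symm (s (.inl (.inl j)))).val = j := fun j => by
    rw [key ⟨j, by omega⟩ (s (.inl (.inl j))) (h₁ _ j.2)]
  have r2 : ∀ l, (ρ.symm (s (.inl (.inr l)))).val = m + l + 1 := fun l => by
    have hl := l.2
    rw [key ⟨m + l + 1, by omega⟩ (s (.inl (.inr l)))
      ((h₃ _ (by simp only; omega) (by simp only; omega)).trans (by simp [s2]))]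
  have r3 : (ρ.symm (s (.inr 0))).val = m := by
    rw [key ⟨m, by omega⟩ (s (.inr 0)) ((h₂ _ rfl).trans (by simp [s3]))]
  have r4 : (ρ.symm (s (.inr 1))).val = m + n + 1 := by
    rw [key ⟨m + n + 1, by omega⟩ (s (.inr 1)) ((h₄ _ rfl).trans (by simp [s3]))]
  have g1 : ∀ j, (s (.inl (.inl j))).val = j := fun j => rfl
  have g2 : ∀ l, (s (.inl (.inr l))).val = m + l := fun l => rfl
  have g3 : (s (.inr 0)).val = m + n := rfl
  have g4 : (s (.inr 1)).val = m + n + 1 := rfl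
  rw [koszul_eq_ksign, ksign_equiv (s.trans ρ.symm),
    ksign_sum (Fin.val_injective.comp (Equiv.injective _))
      ((val_injective ρ).comp (Equiv.injective _)), ksign_eq_one, ksign_eq_one, one_mul, one_mul,
    Fintype.prod_sum_type, Finset.prod_eq_one, one_mul, sgn_and_parityOf]
  · refine Finset.prod_congr rfl fun l _ => ?_
    have a1 : ¬ m + l.val + 1 < m := by omega
    have a2 : m + l.val + 1 < m + n + 1 := by omega
    have a3 : m + l.val < m + n := by omega
    have a4 : m + l.val < m + n + 1 := by omega
    simp only [Fin.prod_univ_two, crossing, Function.comp_apply, Equiv.trans_apply,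
      Equiv.apply_symm_apply, r2, r3, r4, g2, g3, g4, a1, a2, a3, a4]
    simp [s2, s3, Bool.and_comm]
  · intro j _
    have a1 : j.val < m := j.2
    have a2 : j.val < m + n + 1 := by omega
    have a3 : j.val < m + n := by omega
    simp only [Fin.prod_univ_two, crossing, Function.comp_apply, Equiv.trans_apply,
      Equiv.apply_symm_apply, r1, r3, r4, g1, g3, g4, a1, a2, a3]
    simp
  · intro k k' _ _
    simp only [Function.comp_apply, Equiv.trans_apply, Equiv.apply_symm_apply]
    match k, k' with
    | 0, 0 => omega
    | 1, 1 => omega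
    | 0, 1 => rw [g3, g4]; omega
    | 1, 0 => rw [r3, r4]; omega
  · rintro (j | l) (j' | l') _ _
    · simp only [Function.comp_apply, Equiv.trans_apply, Equiv.apply_symm_apply, r1, g1]
      omega
    · simp only [Function.comp_apply, Equiv.trans_apply, Equiv.apply_symm_apply, r1, r2, g1, g2]
      omega
    · simp only [Function.comp_apply, Equiv.trans_apply, Equiv.apply_symm_apply, r1, r2, g1, g2]
      omega
    · simp only [Function.comp_apply, Equiv.trans_apply, Equiv.apply_symm_apply, r2, g2]
      omega

end ShortSigns

/-! ### The endomorphism modular operad -/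

section EndModular

variable {K : Type u} [Field K] [CharZero K] {W : Type w} [AddCommGroup W] [Module K W]
  [DGSpace K W]

theorem isHom_one {a : Bool} {x : W} (hx : DGSpace.par (K := K) x = sgn K a • x) :
    IsHom K ![a] ![x] := fun j => by
  rw [Subsingleton.elim j 0]
  exact hx

theorem isHom_two {a b : Bool} {x y : W} (hx : DGSpace.par (K := K) x = sgn K a • x)
    (hy : DGSpace.par (K := K) y = sgn K b • y) : IsHom K ![a, b] ![x, y] := fun j => by
  match j with
  | 0 => exact hx
  | 1 => exact hy

theorem append_append_two {α : Type*} {n : ℕ} (w : Fin n → α) (a b c d : α) :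
    Fin.append (m := n + 2) (n := 2) (Fin.append w ![a, b]) ![c, d] =
      (Fin.append w ![a, b, c, d] : Fin (n + 4) → α) := by
  funext j
  refine Fin.addCases (m := n) (n := 4) (fun j => ?_) (fun j => ?_) j
  · rw [Fin.append_left]
    exact (Fin.append_left (m := n + 2) _ _ (j.castAdd 2)).trans (Fin.append_left _ _ j)
  · rw [Fin.append_right]
    match j with
    | 0 => exact (Fin.append_left (m := n + 2) _ _ (Fin.natAdd n 0)).trans (Fin.append_right _ _ 0)
    | 1 => exact (Fin.append_left (m := n + 2) _ _ (Fin.natAdd n 1)).trans (Fin.append_right _ _ 1)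
    | 2 => exact Fin.append_right (m := n + 2) _ _ 0
    | 3 => exact Fin.append_right (m := n + 2) _ _ 1

theorem form_hom_induction {n : ℕ} {P : ML K W K n → Prop} (hadd : ∀ f g, P f → P g → P (f + g))
    (hom : ∀ γ f, mlPar LinearMap.id n f = sgn K γ • f → P f) (f : ML K W K n) : P f := by
  rw [← proj_false_add_true (mlPar LinearMap.id n) f]
  exact hadd _ _ (hom _ _ (par_proj (mlPar_mlPar fun _ => rfl) _ _))
    (hom _ _ (par_proj (mlPar_mlPar fun _ => rfl) _ _))

theorem form_eq_zero_or {n : ℕ} {G : ML K W K n} {γ : Bool}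
    (hG : mlPar LinearMap.id n G = sgn K γ • G) {q : Fin n → Bool} {x : Fin n → W}
    (hx : IsHom K q x) : G x = 0 ∨ γ = parityOf q := by
  have h1 : (G fun j => DGSpace.par (K := K) (x j)) = sgn K γ * G x :=
    congrArg (fun F : ML K W K n => F x) hG
  have h2 : (G fun j => DGSpace.par (K := K) (x j)) = sgn K (parityOf q) * G x := by
    rw [sgn_parityOf, ← smul_eq_mul, ← MultilinearMap.map_smul_univ]
    congr 1
    funext j
    exact hx j
  by_cases h0 : G x = 0
  · exact Or.inl h0
  · exact Or.inr (sgn_injective (mul_right_cancel₀ h0 (h1.symm.trans h2)))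

theorem form_append_parIf {m k : ℕ} (G : ML K W K (m + k)) (γ : Bool) {p : Fin m → Bool}
    {w : Fin m → W} (hw : IsHom K p w) (x : Fin k → W) :
    G (Fin.append (fun j => parIf K W γ (w j)) x) =
      sgn K (γ && parityOf p) * G (Fin.append w x) := by
  have : Fin.append (fun j => parIf K W γ (w j)) x =
      fun j => (Fin.append (fun j => sgn K (γ && p j)) fun _ => (1 : K)) j • Fin.append w x j := by
    funext j
    induction j using Fin.addCases with
    | left j => simp [parIf_hom γ _ (hw j)]
    | right j => simp
  rw [this, MultilinearMap.map_smul_univ, Fin.prod_univ_add, sgn_and_parityOf]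
  simp

theorem args_last {m n p : ℕ} (hp : p + 1 = (m + 1) + n) (φ : W →ₗ[K] W) (g : ML K W W n)
    (v : Fin p → W) : args hp (Fin.last m) φ g v =
      Fin.append (fun j : Fin m => φ (v ⟨j, by omega⟩)) ![g fun l => v ⟨m + l, by omega⟩] := by
  funext j
  refine Fin.addCases (m := m) (n := 1) (fun j => ?_) (fun j => ?_) j
  · rw [Fin.append_left, args_of_lt hp _ _ _ (by simp) ⟨j, by omega⟩ rfl]
  · have : Fin.natAdd m j = Fin.last m := Fin.ext (by simp)
    rw [Fin.append_right, this, args_self hp _ _ _ (fun l => ⟨m + l, by omega⟩) fun _ => rfl]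
    simp

variable [FiniteDimensional K W] {ω : LinearMap.BilinForm K W}

theorem exists_extendLast {n n' : ℕ} (e : Fin (n + 1) ≃ Fin (n' + 1))
    (he : e (Fin.last n) = Fin.last n') : ∃ e' : Fin n ≃ Fin n', e = extendLast e' := by
  let E : Option (Fin n) ≃ Option (Fin n') :=
    finSuccEquivLast.symm.trans (e.trans finSuccEquivLast)
  have hE : E none = none := by simp [E, he]
  refine ⟨E.removeNone, Equiv.ext fun j => ?_⟩
  induction j using Fin.lastCases with
  | last => rw [extendLast_last, he]
  | cast j =>
    have hne : E (some j) ≠ none := fun h => by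
      have := E.injective (h.trans hE.symm)
      simp at this
    obtain ⟨x, hx⟩ := Option.ne_none_iff_exists'.1 hne
    have h1 := E.removeNone_some ⟨x, hx⟩
    rw [extendLast_castSucc]
    have h2 : finSuccEquivLast (e j.castSucc) = E (some j) := by simp [E]
    apply finSuccEquivLast.injective
    rw [h2, ← h1, finSuccEquivLast_castSucc]

/-- The gluing of two forms along the last leg of the first, by means of dual bases. -/
theorem DualBases.comp_last_apply (D : DualBases ω) (h : IsSymplectic ω) {m n p : ℕ}
    (hp : p + 1 = (m + 1) + n) (a : ML K W K (m + 1)) {b : ML K W K (n + 1)} {β : Bool}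
    (hb : mlPar LinearMap.id (n + 1) b = sgn K β • b) {q : Fin m → Bool} (v : Fin p → W)
    (hv : IsHom K q fun j : Fin m => v ⟨j, by omega⟩) :
    mlComp hp (Fin.last m) a (ofForm ω h.nondeg n b) v = sgn K (β && parityOf q) *
      ∑ c, lastOne a (fun j : Fin m => v ⟨j, by omega⟩) (D.e c) *
        lastOne b (fun l : Fin n => v ⟨m + l, by omega⟩) (D.f c) := by
  rw [mlComp_apply_hom hp _ _ (ofForm_hom h hb), args_last, form_append_parIf a β hv,
    ← lastOne_apply, D.expand (ofForm ω h.nondeg n b _), map_sum]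
  congr 1
  refine Finset.sum_congr rfl fun c _ => ?_
  rw [ofForm_apply, map_smul, lastOne_apply b, smul_eq_mul, mul_comm]

theorem mlComp_anti_last (h : IsSymplectic ω) {m n p : ℕ} (hp : p + 1 = (m + 1) + n)
    (hp' : p + 1 = (n + 1) + m) (τ : Fin p ≃ Fin p)
    (h₁ : ∀ l : Fin n, (τ ⟨l, by omega⟩).val = m + l)
    (h₂ : ∀ j : Fin m, (τ ⟨n + j, by omega⟩).val = j) {α β : Bool}
    {a : ML K W K (m + 1)} {b : ML K W K (n + 1)}
    (ha : mlPar LinearMap.id (m + 1) a = sgn K α • a)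
    (hb : mlPar LinearMap.id (n + 1) b = sgn K β • b) :
    mlComp hp (Fin.last m) a (ofForm ω h.nondeg n b) = - (sgn K (α && β) •
      mlPerm τ (mlComp hp' (Fin.last n) b (ofForm ω h.nondeg m a))) := by
  obtain ⟨D⟩ := h.nonempty_dualBases
  refine ml_ext_hom fun p v hv => ?_
  let w : Fin m → W := fun j => v ⟨j, by omega⟩
  let z : Fin n → W := fun l => v ⟨m + l, by omega⟩
  let pw : Fin m → Bool := fun j => p ⟨j, by omega⟩
  let pz : Fin n → Bool := fun l => p ⟨m + l, by omega⟩
  have hw : IsHom K pw w := fun j => hv _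
  have hz : IsHom K pz z := fun j => hv _
  have e1 : (fun l : Fin n => (v ∘ τ) ⟨l, by omega⟩) = z := by
    funext l
    exact congrArg v (Fin.ext (h₁ l))
  have e2 : (fun j : Fin m => (v ∘ τ) ⟨n + j, by omega⟩) = w := by
    funext j
    exact congrArg v (Fin.ext (h₂ j))
  have hz' : IsHom K pz fun l : Fin n => (v ∘ τ) ⟨l, by omega⟩ := by rw [e1]; exact hz
  rw [D.comp_last_apply h hp a hb v hw, neg_apply, smul_apply, mlPerm_apply_hom _ _ hv,
    D.comp_last_apply h hp' b ha (v ∘ τ) hz', e1, e2,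
    koszul_blockSwap (by omega) τ h₁ h₂]
  let T : W →ₗ[K] W →ₗ[K] K := (LinearMap.mul K K).compl₁₂ (lastOne a w) (lastOne b z)
  have hT : ∀ x y, lastOne a w x * lastOne b z y = T x y := fun x y => rfl
  change _ * ∑ c, lastOne a w (D.e c) * lastOne b z (D.f c) = _
  simp only [hT]
  rw [D.sum_swap h.nondeg, smul_eq_mul, smul_eq_mul, mul_neg, neg_inj, Finset.mul_sum,
    Finset.mul_sum, Finset.mul_sum, Finset.mul_sum]
  refine Finset.sum_congr rfl fun c _ => ?_
  rw [← hT, lastOne_apply, lastOne_apply]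
  rcases form_eq_zero_or ha (isHom_append hw (isHom_one (D.f_hom c))) with h0 | hα
  · simp [h0]
  rcases form_eq_zero_or hb (isHom_append hz (isHom_one (D.e_hom c))) with h0 | hβ
  · simp [h0]
  rw [parityOf_append, parityOf_one] at hα hβ
  change _ = sgn K (α && β) * (sgn K (parityOf pw && parityOf pz) * _)
  rw [hα, hβ]
  cases parityOf pw <;> cases parityOf pz <;> cases D.π c <;> simp <;> ring

end EndModular

end MCTwist

end

noncomputable section

namespace MCTwist

section EndModularLaws

variable {K : Type u} [Field K] [CharZero K] {W : Type w} [AddCommGroup W] [Module K W]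
  [DGSpace K W] [FiniteDimensional K W] {ω : LinearMap.BilinForm K W}

theorem mlComp_anti (h : IsSymplectic ω) {m n p : ℕ} (hp : p + 1 = (m + 1) + n)
    (hp' : p + 1 = (n + 1) + m) (i : Fin (m + 1)) (e : Fin (m + 1) ≃ Fin (m + 1))
    (he : e i = Fin.last m) (ρ : Fin p ≃ Fin p)
    (hb : ∀ (l : Fin n) (t : Fin p), t.val = l → (ρ t).val = i + l)
    (ha : ∀ (j : Fin (m + 1)) (t : Fin p), j ≠ i → t.val = n + e j →
      (ρ t).val = outer n i j)
    {α β : Bool} {a : ML K W K (m + 1)} {b : ML K W K (n + 1)}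
    (hpa : mlPar LinearMap.id (m + 1) a = sgn K α • a)
    (hpb : mlPar LinearMap.id (n + 1) b = sgn K β • b) :
    mlComp hp i a (ofForm ω h.nondeg n b) + sgn K (α && β) •
      mlPerm ρ (mlComp hp' (Fin.last n) b (ofForm ω h.nondeg m (mlPerm e a))) = 0 := by
  let τ : Fin p ≃ Fin p := (finCongr (by omega : p = n + m)).trans
    (finAddFlip.trans (finCongr (by omega : m + n = p)))
  have h₁ : ∀ l : Fin n, (τ ⟨l, by omega⟩).val = m + l := fun l => by
    have : finCongr (by omega : p = n + m) ⟨l, by omega⟩ = Fin.castAdd m l := rfl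
    simp only [τ, Equiv.trans_apply, this, finAddFlip_apply_castAdd]
    rfl
  have h₂ : ∀ j : Fin m, (τ ⟨n + j, by omega⟩).val = j := fun j => by
    have : finCongr (by omega : p = n + m) ⟨n + j, by omega⟩ = Fin.natAdd n j := rfl
    simp only [τ, Equiv.trans_apply, this, finAddFlip_apply_natAdd]
    rfl
  let ρ' : Fin p ≃ Fin p := ρ.symm.trans τ
  have hi2 := i.2
  have hsymm : ∀ s t : Fin p, (ρ s).val = t.val → ρ.symm t = s := fun s t hst => by
    rw [Equiv.symm_apply_eq]
    exact (Fin.ext hst).symm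
  have heq : mlPerm ρ' (mlComp hp i a (ofForm ω h.nondeg n b)) =
      mlComp hp (Fin.last m) (mlPerm e a) (ofForm ω h.nondeg n b) := by
    rw [mlPerm_mlComp hp hp e (Equiv.refl _) ρ' i, he, mlPerm_refl]
    · intro j t hj ht
      have hej : (e j).val < m := by
        have h1 := (e j).2
        have h2 : e j ≠ Fin.last m := fun h => hj (e.injective (h.trans he.symm))
        have h3 : (e j).val ≠ m := fun h => h2 (Fin.ext h)
        omega
      have h1 : ρ.symm t = ⟨n + e j, by omega⟩ := hsymm _ _ (by rw [ha j _ hj rfl, ht])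
      rw [Equiv.trans_apply, h1, he, outer, if_pos (by simpa using hej)]
      exact h₂ ⟨e j, hej⟩
    · intro l t ht
      have h1 : ρ.symm t = ⟨l, by omega⟩ := hsymm _ _ (by rw [hb l _ rfl, ht])
      rw [Equiv.trans_apply, h1, he, h₁]
      rfl
  have hae : mlPar LinearMap.id (m + 1) (mlPerm e a) = sgn K α • mlPerm e a := by
    rw [mlPar_mlPerm, hpa, map_smul]
  have hlast := heq.trans (mlComp_anti_last h hp hp' τ h₁ h₂ hae hpb)
  have h3 := congrArg (mlPerm ρ'.symm) hlast
  rw [mlPerm_trans, Equiv.self_trans_symm, mlPerm_refl, map_neg, map_smul, mlPerm_trans] at h3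
  have h4 : τ.trans ρ'.symm = ρ := by
    ext t
    simp [ρ']
  rw [h4] at h3
  rw [h3, neg_add_cancel]

theorem mlContr_equivariance (h : IsSymplectic ω) {m n : ℕ} {e : Fin m ≃ Fin n}
    {e' : Fin (m + 2) ≃ Fin (n + 2)} (he : IsAppend e' e (Equiv.refl _)) (a : ML K W K (m + 2)) :
    mlPerm e (mlContr ω h.nondeg m a) = mlContr ω h.nondeg n (mlPerm e' a) := by
  obtain ⟨D⟩ := h.nonempty_dualBases
  refine ml_ext_hom fun p w hw => ?_
  rw [mlPerm_apply_hom _ _ hw, D.contr_apply, D.contr_apply, Finset.smul_sum]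
  refine Finset.sum_congr rfl fun c _ => ?_
  rw [he.mlPerm_apply a hw (isHom_two (D.e_hom c) (D.f_hom c)), koszul_refl, mul_one,
    smul_eq_mul, smul_eq_mul, mul_left_comm]
  rfl

theorem swap_two_comp {α : Type*} (x y : α) :
    (![x, y] : Fin 2 → α) ∘ Equiv.swap (0 : Fin 2) 1 = ![y, x] := by
  funext j
  match j with
  | 0 => rfl
  | 1 => rfl

theorem mlContr_anti (h : IsSymplectic ω) {n : ℕ} (a : ML K W K (n + 2)) :
    mlContr ω h.nondeg n (mlPerm
      (Equiv.swap (Fin.natAdd n (0 : Fin 2)) (Fin.natAdd n (1 : Fin 2))) a) +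
      mlContr ω h.nondeg n a = 0 := by
  obtain ⟨D⟩ := h.nonempty_dualBases
  refine ml_ext_hom fun p w hw => ?_
  have h1 : ∀ c, sgn K (D.π c) * mlPerm
      (Equiv.swap (Fin.natAdd n (0 : Fin 2)) (Fin.natAdd n (1 : Fin 2))) a
      (Fin.append w ![D.e c, D.f c]) = lastTwo a w (D.f c) (D.e c) := by
    intro c
    rw [(isAppend_swap n 2 0 1).mlPerm_apply a hw (isHom_two (D.e_hom c) (D.f_hom c)),
      swap_two_comp, swap_two_comp,
      koszul_refl, koszul_swap, one_mul, Bool.and_self, smul_eq_mul, ← mul_assoc, sgn_mul_self,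
      one_mul, lastTwo_apply]
    rfl
  have h2 : ∀ c, sgn K (D.π c) * a (Fin.append w ![D.e c, D.f c]) =
      (lastTwo a w ∘ₗ DGSpace.par) (D.e c) (D.f c) := by
    intro c
    rw [LinearMap.comp_apply, D.e_hom c, map_smul, LinearMap.smul_apply, lastTwo_apply, smul_eq_mul]
  have h3 : ∀ c, sgn K (D.π c) * (lastTwo a w ∘ₗ DGSpace.par) (D.f c) (D.e c) =
      lastTwo a w (D.f c) (D.e c) := by
    intro c
    rw [LinearMap.comp_apply, D.f_hom c, map_smul, LinearMap.smul_apply, smul_eq_mul, ← mul_assoc,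
      sgn_mul_self, one_mul]
  rw [add_apply, D.contr_apply, D.contr_apply]
  simp only [h1, h2]
  rw [D.sum_swap h.nondeg]
  simp only [h3, add_neg_cancel]
  rfl

theorem mlContr_contr (h : IsSymplectic ω) {n : ℕ} (a : ML K W K (n + 4)) :
    mlContr ω h.nondeg n (mlContr ω h.nondeg (n + 2) (mlPerm
      (Equiv.swap (Fin.natAdd n (0 : Fin 4)) (Fin.natAdd n (2 : Fin 4)) *
        Equiv.swap (Fin.natAdd n (1 : Fin 4)) (Fin.natAdd n (3 : Fin 4))) a)) =
      mlContr ω h.nondeg n (mlContr ω h.nondeg (n + 2) a) := by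
  obtain ⟨D⟩ := h.nonempty_dualBases
  refine ml_ext_hom fun p w hw => ?_
  simp only [D.contr_apply, Finset.mul_sum, append_append_two]
  rw [Finset.sum_comm]
  refine Finset.sum_congr rfl fun c _ => Finset.sum_congr rfl fun d _ => ?_
  let σ : Equiv.Perm (Fin 4) := Equiv.swap 0 2 * Equiv.swap 1 3
  have hs : IsAppend (Equiv.swap (Fin.natAdd n (0 : Fin 4)) (Fin.natAdd n (2 : Fin 4)) *
      Equiv.swap (Fin.natAdd n (1 : Fin 4)) (Fin.natAdd n (3 : Fin 4))) (Equiv.refl _) σ :=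
    (isAppend_swap n 4 0 2).mul (isAppend_swap n 4 1 3)
  have h4 : IsHom K ![D.π d, D.π d, D.π c, D.π c] ![D.e d, D.f d, D.e c, D.f c] := fun j => by
    match j with
    | 0 => exact D.e_hom d
    | 1 => exact D.f_hom d
    | 2 => exact D.e_hom c
    | 3 => exact D.f_hom c
  have hx : (![D.e d, D.f d, D.e c, D.f c] : Fin 4 → W) ∘ σ = ![D.e c, D.f c, D.e d, D.f d] := by
    funext j
    match j with
    | 0 => rfl
    | 1 => rfl
    | 2 => rfl
    | 3 => rfl
  have hq : (![D.π d, D.π d, D.π c, D.π c] : Fin 4 → Bool) ∘ σ =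
      ![D.π c, D.π c, D.π d, D.π d] := by
    funext j
    match j with
    | 0 => rfl
    | 1 => rfl
    | 2 => rfl
    | 3 => rfl
  rw [hs.mlPerm_apply a hw h4, hx, hq, koszul_refl, koszul_swap_swap, one_mul, one_smul,
    mul_left_comm]
  rfl

theorem mlContr_mlComp (h : IsSymplectic ω) {m n p : ℕ} (hp : p + 1 = m + n)
    (hp' : (p + 2) + 1 = (m + 2) + n) (i : Fin m) (a : ML K W K (m + 2)) (b : ML K W W n) :
    mlComp hp i (mlContr ω h.nondeg m a) b =
      mlContr ω h.nondeg p (mlComp hp' (i.castAdd 2) a b) := by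
  obtain ⟨D⟩ := h.nonempty_dualBases
  induction b using ml_hom_induction with
  | hadd g g' hg hg' => simp only [map_add, hg, hg']
  | hom γ b hb =>
    ext w
    rw [mlComp_apply_hom hp i _ hb, D.contr_apply, D.contr_apply]
    refine Finset.sum_congr rfl fun c _ => ?_
    rw [mlComp_apply_hom hp' _ _ hb, args_append hp]

theorem append_append_one {α : Type*} {n : ℕ} (z : Fin n → α) (x y : α) :
    Fin.append (m := n + 1) (n := 1) (Fin.append z ![x]) ![y] =
      (Fin.append z ![x, y] : Fin (n + 2) → α) := by
  funext j
  refine Fin.addCases (m := n) (n := 2) (fun j => ?_) (fun j => ?_) j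
  · rw [Fin.append_left]
    exact (Fin.append_left (m := n + 1) _ _ (j.castAdd 1)).trans (Fin.append_left _ _ j)
  · rw [Fin.append_right]
    match j with
    | 0 => exact (Fin.append_left (m := n + 1) _ _ (Fin.natAdd n 0)).trans (Fin.append_right _ _ 0)
    | 1 => exact Fin.append_right (m := n + 1) _ _ 0

theorem append_three_apply {α : Type*} {m n : ℕ} (w : Fin m → α) (z : Fin n → α) (x y : α)
    (t : Fin (m + n + 2)) :
    (∀ j : Fin m, t.val = j → Fin.append (Fin.append w z) ![x, y] t = w j) ∧
    (∀ l : Fin n, t.val = m + l → Fin.append (Fin.append w z) ![x, y] t = z l) ∧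
    (t.val = m + n → Fin.append (Fin.append w z) ![x, y] t = x) ∧
    (t.val = m + n + 1 → Fin.append (Fin.append w z) ![x, y] t = y) := by
  refine ⟨fun j ht => ?_, fun l ht => ?_, fun ht => ?_, fun ht => ?_⟩
  · have : t = (j.castAdd n).castAdd 2 := Fin.ext ht
    rw [this, Fin.append_left, Fin.append_left]
  · have : t = (Fin.natAdd m l).castAdd 2 := Fin.ext ht
    rw [this, Fin.append_left, Fin.append_right]
  · have : t = Fin.natAdd (m + n) (0 : Fin 2) := Fin.ext ht
    rw [this, Fin.append_right]
    rfl
  · have : t = Fin.natAdd (m + n) (1 : Fin 2) := Fin.ext ht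
    rw [this, Fin.append_right]
    rfl

theorem args_natAdd_one {m n : ℕ} (hp : (m + n + 2) + 1 = (m + 2) + (n + 1)) (φ : W →ₗ[K] W)
    (g : ML K W W (n + 1)) (w : Fin m → W) (z : Fin n → W) (x y : W) (u : Fin (m + n + 2) → W)
    (h₁ : ∀ (j : Fin m) (t : Fin (m + n + 2)), t.val = j → u t = w j)
    (h₂ : ∀ t : Fin (m + n + 2), t.val = m → u t = x)
    (h₃ : ∀ (l : Fin n) (t : Fin (m + n + 2)), t.val = m + 1 + l → u t = z l)
    (h₄ : ∀ t : Fin (m + n + 2), t.val = m + n + 1 → u t = y) :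
    args hp (Fin.natAdd m 1) φ g u =
      Fin.append (fun j => φ (w j)) ![φ x, g (Fin.append z ![y])] := by
  funext j
  refine Fin.addCases (fun j => ?_) (fun j => ?_) j
  · rw [Fin.append_left, args_of_lt hp _ _ _ (by simp) ⟨j, by omega⟩ rfl, h₁ j _ rfl]
  · rw [Fin.append_right]
    match j with
    | 0 =>
      rw [args_of_lt hp _ _ _ (by simp) ⟨m, by omega⟩ rfl, h₂ _ rfl]
      rfl
    | 1 =>
      rw [args_self hp _ _ _ (fun l => ⟨m + 1 + l, by omega⟩) fun _ => rfl]
      have : (fun l : Fin (n + 1) => u ⟨m + 1 + l, by omega⟩) = Fin.append z ![y] := by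
        funext l
        refine Fin.addCases (m := n) (n := 1) (fun l => ?_) (fun l => ?_) l
        · rw [Fin.append_left, h₃ l _ rfl]
        · rw [Fin.append_right, h₄ _ (by simp; omega)]
          simp
      rw [this]
      rfl

theorem args_natAdd_zero {m n : ℕ} (hp : (m + n + 2) + 1 = (m + 2) + (n + 1)) (φ : W →ₗ[K] W)
    (g : ML K W W (n + 1)) (w : Fin m → W) (z : Fin n → W) (x y : W) :
    args hp (Fin.natAdd m 0) φ g (Fin.append (Fin.append w z) ![y, x]) =
      Fin.append (fun j => φ (w j)) ![g (Fin.append z ![y]), x] := by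
  have hu := append_three_apply w z y x
  funext j
  refine Fin.addCases (fun j => ?_) (fun j => ?_) j
  · rw [Fin.append_left, args_of_lt hp _ _ _ (by simp) ⟨j, by omega⟩ rfl, (hu _).1 j rfl]
  · rw [Fin.append_right]
    match j with
    | 0 =>
      rw [args_self hp _ _ _ (fun l => ⟨m + l, by omega⟩) fun _ => rfl]
      have : (fun l : Fin (n + 1) => Fin.append (Fin.append w z) ![y, x] ⟨m + l, by omega⟩) =
          Fin.append z ![y] := by
        funext l
        refine Fin.addCases (m := n) (n := 1) (fun l => ?_) (fun l => ?_) l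
        · rw [Fin.append_left, (hu _).2.1 l rfl]
        · rw [Fin.append_right, (hu _).2.2.1 (by simp)]
          simp
      rw [this]
      rfl
    | 1 =>
      rw [args_of_gt hp _ _ _ (by simp) ⟨m + n + 1, by omega⟩ (by simp; omega),
        (hu _).2.2.2 rfl]
      rfl

theorem mlContr_comp_comp (h : IsSymplectic ω) {m n : ℕ}
    (hp : (m + n + 2) + 1 = (m + 2) + (n + 1)) (ρ : Fin (m + n + 2) ≃ Fin (m + n + 2))
    (h₁ : ∀ t : Fin (m + n + 2), t.val < m → (ρ t).val = t)
    (h₂ : ∀ t : Fin (m + n + 2), t.val = m → (ρ t).val = m + n)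
    (h₃ : ∀ t : Fin (m + n + 2), m < t.val → t.val ≤ m + n → (ρ t).val = t - 1)
    (h₄ : ∀ t : Fin (m + n + 2), t.val = m + n + 1 → (ρ t).val = m + n + 1)
    (a : ML K W K (m + 2)) (b : ML K W K (n + 2)) :
    mlContr ω h.nondeg (m + n) (mlPerm ρ (mlComp hp (Fin.natAdd m 1) a
        (ofForm ω h.nondeg (n + 1) b))) =
      mlContr ω h.nondeg (m + n) (mlPerm
        (Equiv.swap (Fin.natAdd (m + n) (0 : Fin 2)) (Fin.natAdd (m + n) (1 : Fin 2)))
        (mlComp hp (Fin.natAdd m 0) a (ofForm ω h.nondeg (n + 1) (mlPerm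
          (Equiv.swap (Fin.natAdd n (0 : Fin 2)) (Fin.natAdd n (1 : Fin 2))) b)))) := by
  obtain ⟨D⟩ := h.nonempty_dualBases
  induction b using form_hom_induction with
  | hadd g g' hg hg' => simp only [map_add, hg, hg']
  | hom β b hb =>
  have hb' : mlPar LinearMap.id (n + 2) (mlPerm
      (Equiv.swap (Fin.natAdd n (0 : Fin 2)) (Fin.natAdd n (1 : Fin 2))) b) = sgn K β • mlPerm
      (Equiv.swap (Fin.natAdd n (0 : Fin 2)) (Fin.natAdd n (1 : Fin 2))) b := by
    rw [mlPar_mlPerm, hb, map_smul]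
  refine ml_ext_hom fun p v hv => ?_
  obtain ⟨w, z, rfl⟩ := append_split v
  obtain ⟨pw, pz, rfl⟩ := append_split p
  have hw : IsHom K pw w := fun j => by simpa using hv (j.castAdd n)
  have hz : IsHom K pz z := fun j => by simpa using hv (Fin.natAdd m j)
  have hL : ∀ d, mlPerm ρ (mlComp hp (Fin.natAdd m 1) a (ofForm ω h.nondeg (n + 1) b))
      (Fin.append (Fin.append w z) ![D.e d, D.f d]) =
      sgn K (D.π d && parityOf pz) * (sgn K (β && parityOf pw) * (sgn K (β && D.π d) *
        ∑ c, lastTwo a w (D.e d) (D.e c) * lastTwo b z (D.f d) (D.f c))) := by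
    intro d
    have hu := append_three_apply w z (D.e d) (D.f d)
    rw [mlPerm_apply_hom _ _ (isHom_append hv (isHom_two (D.e_hom d) (D.f_hom d))),
      koszul_shift ρ h₁ h₂ h₃ h₄, mlComp_apply_hom hp _ _ (ofForm_hom h hb),
      args_natAdd_one hp _ _ w z (D.e d) (D.f d), form_append_parIf a β hw, ← lastTwo_apply,
      parIf_hom β _ (D.e_hom d), map_smul, LinearMap.smul_apply, smul_eq_mul, smul_eq_mul,
      D.expand (ofForm ω h.nondeg (n + 1) b _), map_sum]
    · congr 3
      refine Finset.sum_congr rfl fun c _ => ?_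
      rw [map_smul, ofForm_apply, smul_eq_mul, mul_comm, lastTwo_apply b, append_append_one]
    · intro j t ht
      exact (hu _).1 j ((h₁ t (by omega)).trans ht)
    · intro t ht
      exact (hu _).2.2.1 (h₂ t ht)
    · intro l t ht
      exact (hu _).2.1 l ((h₃ t (by omega) (by omega)).trans (by omega))
    · intro t ht
      exact (hu _).2.2.2 (h₄ t ht)
  have hR : ∀ d, mlPerm (Equiv.swap (Fin.natAdd (m + n) (0 : Fin 2)) (Fin.natAdd (m + n) (1 : Fin 2)))
        (mlComp hp (Fin.natAdd m 0) a (ofForm ω h.nondeg (n + 1) (mlPerm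
          (Equiv.swap (Fin.natAdd n (0 : Fin 2)) (Fin.natAdd n (1 : Fin 2))) b)))
      (Fin.append (Fin.append w z) ![D.e d, D.f d]) =
      sgn K (D.π d) * (sgn K (β && parityOf pw) *
        ∑ c, sgn K (D.π d && D.π c) *
          (lastTwo a w (D.e c) (D.e d) * lastTwo b z (D.f c) (D.f d))) := by
    intro d
    rw [(isAppend_swap (m + n) 2 0 1).mlPerm_apply _ hv (isHom_two (D.e_hom d) (D.f_hom d)),
      swap_two_comp, swap_two_comp, koszul_refl, koszul_swap, Bool.and_self, one_mul,
      mlComp_apply_hom hp _ _ (ofForm_hom h hb')]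
    have h5 := args_natAdd_zero hp (parIf K W β) (ofForm ω h.nondeg (n + 1) (mlPerm
          (Equiv.swap (Fin.natAdd n (0 : Fin 2)) (Fin.natAdd n (1 : Fin 2))) b)) w z (D.e d) (D.f d)
    refine (congrArg (fun x => sgn K (D.π d) • a x) h5).trans ?_
    rw [form_append_parIf a β hw, ← lastTwo_apply, smul_eq_mul,
      D.expand (ofForm ω h.nondeg (n + 1) _ _), map_sum, LinearMap.sum_apply]
    congr 2
    refine Finset.sum_congr rfl fun c _ => ?_
    rw [map_smul, LinearMap.smul_apply, ofForm_apply, append_append_one,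
      (isAppend_swap n 2 0 1).mlPerm_apply _ hz (isHom_two (D.f_hom d) (D.f_hom c)), swap_two_comp, swap_two_comp,
      koszul_refl, koszul_swap, one_mul, Bool.and_comm, smul_eq_mul, smul_eq_mul, lastTwo_apply b]
    change _ * b (Fin.append z _) * _ = _
    ring
  rw [D.contr_apply, D.contr_apply]
  simp only [hL, hR, Finset.mul_sum]
  rw [Finset.sum_comm]
  refine Finset.sum_congr rfl fun c _ => Finset.sum_congr rfl fun d _ => ?_
  rw [lastTwo_apply b]
  rcases form_eq_zero_or hb (isHom_append hz (isHom_two (D.f_hom d) (D.f_hom c))) with h0 | hβ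
  · simp [h0]
  rw [parityOf_append, parityOf_two] at hβ
  rw [hβ]
  cases parityOf pw <;> cases parityOf pz <;> cases D.π c <;> cases D.π d <;> simp

theorem endMod_lawful (h : IsSymplectic ω) : LawfulMod (EndMod ω h.nondeg) := by
  intro s z hz
  cases hz with
  | perm_refl a => exact sub_eq_zero.2 (mlPerm_refl a)
  | perm_trans e e' a => exact sub_eq_zero.2 (mlPerm_trans e e' a)
  | equivariance hg hp hp' e e' he' ρ i ho hi a b =>
    obtain ⟨e', rfl⟩ := exists_extendLast e' he'
    refine sub_eq_zero.2 ((mlPerm_mlComp hp hp' e e' ρ i ho (fun l t ht => ?_) a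
      (ofForm ω h.nondeg _ b)).trans ?_)
    · rw [hi l t ht, extendLast_castSucc]
      rfl
    · exact congrArg (mlComp hp' (e i) (mlPerm e a)) (ofForm_mlPerm h e' b).symm
  | seq g₁ g₂ g₃ g₄ h₁ h₂ h₃ h₄ i j ij hij a b c =>
    refine sub_eq_zero.2 ((mlComp_mlComp_seq h₁ h₂ (by omega) h₄ i j ij hij a
      (ofForm ω h.nondeg _ b) (ofForm ω h.nondeg _ c)).trans ?_)
    exact congrArg (mlComp h₄ i a) (ofForm_mlComp h (by omega) h₃ j b _).symm
  | par g₁ g₂ g₃ g₄ h₁ h₂ h₃ h₄ i k₀ hik k' hk i' hi β γ a b c hb hc =>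
    exact sub_eq_zero.2 (mlComp_mlComp_par h₁ h₂ h₃ h₄ i k₀ hik k' hk i' hi a (ofForm_hom h hb)
      (ofForm_hom h hc))
  | anti hg hg' hp hp' i e he ρ hb ha α β a b hpa hpb =>
    exact mlComp_anti h hp hp' i e he ρ hb ha hpa hpb
  | contr_equivariance hg e e' he he₀ he₁ a =>
    refine sub_eq_zero.2 (mlContr_equivariance h ⟨fun t => Fin.ext (he t), fun t => ?_⟩ a)
    match t with
    | 0 => exact Fin.ext he₀
    | 1 => exact Fin.ext he₁
  | contr_anti hg a => exact mlContr_anti h a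
  | contr_contr hg hg' a => exact sub_eq_zero.2 (mlContr_contr h a)
  | contr_comp hr hs ht hst hp hp' i a b =>
    exact sub_eq_zero.2 (mlContr_mlComp h hp hp' i a (ofForm ω h.nondeg _ b))
  | comp_comp hr hs hp ρ h₁ h₂ h₃ h₄ a b =>
    exact sub_eq_zero.2 (mlContr_comp_comp h hp ρ h₁ h₂ h₃ h₄ a b)

end EndModularLaws

end MCTwist

end

theorem theorem4p5 (K : Type u) [Field K] [CharZero K] (kind : Kind) :
    -- the operad of `L∞` or `A∞` algebras with a Maurer-Cartan element
    (∃ tw : Hom (Curly K kind) (Curly K kind), tw.IsAut ∧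
      tw.map (0 : ℕ) (curlyX K kind) = - curlyX K kind ∧
      (∀ n : ℕ, 1 ≤ n →
        HasSum (fun i : ℕ => twTerm kind (Curly K kind) (curlyM K kind) (curlyX K kind) n i)
          (tw.map n (curlyM K kind n))) ∧
      ∀ (A : FormalCDGA.{u, v} K) (V : Type w) [AddCommGroup V] [Module K V] [DGSpace K V]
        (φ : Hom (Inf K kind) (A.coeff (EndOp K (PiRev V))))
        (ξ : (A.coeff (EndOp K (PiRev V))).obj (0 : ℕ)),
        IsMC kind (A.coeff (EndOp K (PiRev V))) (ops φ) ξ →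
        ∃ (f : Hom (Curly K kind) (A.coeff (EndOp K (PiRev V))))
          (φ' : Hom (Inf K kind) (A.coeff (EndOp K (PiRev V)))),
          Determines f φ ξ ∧ (∀ f', Determines f' φ ξ → f' = f) ∧
          IsTwist kind (A.coeff (EndOp K (PiRev V))) (ops φ) ξ (ops φ') ∧
          IsMC kind (A.coeff (EndOp K (PiRev V))) (ops φ') (-ξ) ∧
          Determines (tw.trans f) φ' (-ξ)) ∧
    -- its modular closure
    (∃ tw : Hom (CurlyMod K kind) (CurlyMod K kind), tw.IsAut ∧
      tw.map ((0, 1) : ℕ × ℕ) (curlyModX K kind) = - curlyModX K kind ∧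
      (∀ n : ℕ, 1 ≤ n →
        HasSum (fun i : ℕ =>
            twTerm kind (opOf (CurlyMod K kind)) (curlyModM K kind) (curlyModX K kind) n i)
          (tw.map ((0, n + 1) : ℕ × ℕ) (curlyModM K kind n))) ∧
      ∀ (A : FormalCDGA.{u, v} K) (V : Type w) [AddCommGroup V] [Module K V] [DGSpace K V]
        [FiniteDimensional K V] (B : ScalarProduct K V)
        (φ : Hom (Inf K kind) (A.coeff (EndOp K (PiRev V))))
        (ξ : (A.coeff (EndOp K (PiRev V))).obj (0 : ℕ)),
        IsCyclicStr A B φ → IsMC kind (A.coeff (EndOp K (PiRev V))) (ops φ) ξ →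
        ∃ (F : Hom (CurlyMod K kind) (A.coeff (EndMod B.omega B.omega_nondeg)))
          (φ' : Hom (Inf K kind) (A.coeff (EndOp K (PiRev V)))),
          DeterminesMod F φ ξ ∧ (∀ F' : Hom (CurlyMod K kind) _, DeterminesMod F' φ ξ → F' = F) ∧
          IsTwist kind (A.coeff (EndOp K (PiRev V))) (ops φ) ξ (ops φ') ∧ IsCyclicStr A B φ' ∧
          IsMC kind (A.coeff (EndOp K (PiRev V))) (ops φ') (-ξ) ∧
          DeterminesMod (tw.trans F) φ' (-ξ)) := by
  refine ⟨⟨curlyTw K kind, curlyTw_isAut K kind, curlyTw_X K kind,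
    fun n hn => curlyTw_hasSum K kind hn, ?_⟩,
    ⟨curlyModTw K kind, curlyModTw_isAut K kind, curlyModTw_X K kind,
    fun n hn => curlyModTw_hasSum K kind hn, ?_⟩⟩
  · intro A V _ _ _ φ ξ hξ
    exact exists_twisted_algebra K kind endOp_isDG endOp_lawful φ ξ hξ
  · intro A V _ _ _ _ B φ ξ hcyc hξ
    exact exists_twisted_modular_algebra K kind endOp_isDG endOp_lawful
      (endMod_isDG B.symplectic) (endMod_lawful B.symplectic) (formHom B.symplectic)
      (fun n => A.toForm B.omega B.omega_nondeg n) (fun _ _ _ => rfl) φ ξ hcyc hξ
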